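/- **Setting.** Let $\mathbb S^3=\{y\in\mathbb R^4:|y|=3\}$ with its round metric $\mathring g$ and volume measure $d\mathring\varpi$. With $R_{kl}=\tfrac13(y^k\partial_l-y^l\partial_k)$, let $Z_1=R_{12}+R_{34}$, $Z_2=R_{23}+R_{14}$, $Z_3=R_{13}-R_{24}$; these are $\mathring g$-orthonormal Killing fields with $[Z_A,Z_B]=\tfrac23\epsilon_{ABC}Z_C$. For a multi-index $I=(i_1,\dots,i_N)$ with entries in $\{1,2,3\}$, $|I|=N$, write $Z^I=Z_{i_1}\cdots Z_{i_N}$ on functions and $\mathcal L^I=\mathcal L_{Z_{i_1}}\cdots\mathcal L_{Z_{i_N}}$ on tensor fields (Lie derivatives). A sum over $I_1+\cdots+I_r=I$ runs over all ways of distributing the positions of $I$ over $r$ ordered parts, with the order of the entries kept inside each part (the Leibniz rule). Indices below are spatial, and repeated indices are summed. Let $a$ be the scale factor: $a''=-\tfrac23a^{1/3}$, $a(0)=1$, $a'(0)=0$, $a>0$ on $(-T_c,T_c)$ and $a(t)\to0$ as $t\uparrow T_c$. Put $H=a'/a$. A *solution on* $[0,T)\times\mathbb S^3$ consists of a Riemannian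 metric $g(t)$ and a function $\phi(t)$ on $\mathbb S^3$, a lapse $n(t)>0$ and a tensor field $k^i{}_j(t)$ ($g,n,\phi$ of class $C^{18}$ and $k$ of class $C^{17}$ on $[0,T)\times\mathbb S^3$) that solve the Einstein-scalar field equations in constant-mean-curvature-transported spatial coordinates gauge: with $\nabla$, $\Delta$, $\mathrm{Ric}$, $R$ the connection, Laplacian, Ricci and scalar curvature of $g$, $\hat k^i{}_j=k^i{}_j-\tfrac13(\mathrm{tr}\,k)\delta^i_j$ and $\phi_n=n^{-1}\partial_t\phi$, $$\mathrm{tr}\,k=-H,\qquad R-k^i{}_jk^j{}_i+H^2=\phi_n^2+g^{ij}\nabla_i\phi\nabla_j\phi,\qquad \nabla_a\hat k^a{}_i=-\phi_n\nabla_i\phi,$$ $$\partial_tg_{ij}=-2n\,g_{ic}k^c{}_j,\qquad \partial_tk^i{}_j=-g^{ic}\nabla_c\nabla_jn+n\big(g^{ic}\mathrm{Ric}_{cj}+(\mathrm{tr}\,k)k^i{}_j-g^{ic}\nabla_c\phi\nabla_j\phi\big),$$ $$-n^{-1}\partial_t\phi_n+\Delta\phi=H\phi_n-n^{-1}g^{ij}\nabla_in\nabla_j\phi,\qquad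 \Delta n=H'+n\big(\hat k^i{}_j\hat k^j{}_i+\tfrac13H^2+\phi_n^2\big).$$ **Rescaled variables.** $G=a^{-2/3}g$, $K=a\hat k$, $N=a^{-4/3}(n-1)$, $\Phi=a\,n^{-1}\partial_t\phi-\sqrt{2/3}$, $\Psi=\nabla\phi$ (a one-form). From now on $\nabla$, $\Delta$, $\mathrm{Ric}$, $|\cdot|$, $d\varpi$, $\sharp$ and the trace refer to $G$, and $\|\cdot\|$ is the $L^2$ norm defined by $G$ on the time slice. Here $\mathrm{Ric}^\sharp$ has components $G^{ic}\mathrm{Ric}_{cj}$. **Norm.** With $\|\xi\|_{\dot H^q}^2=\sum_{|I|=q}\|\mathcal L^I\xi\|^2_{L^2(\mathring g)}$, $\|\xi\|_{H^q}^2=\sum_{|I|\le q}\|\mathcal L^I\xi\|^2_{L^2(\mathring g)}$ and $\|\xi\|_{C^q}^2=\sum_{|I|\le q}\sup|\mathcal L^I\xi|^2_{\mathring g}$, set $$\begin{aligned}\mathcal H(t)={}&\|K\|_{H^{16}}+a^{2/3}\|G\|_{\dot H^{17}}+\|G-\mathring g\|_{H^{16}}+\|G^{-1}-\mathring g^{-1}\|_{H^{16}}+\sum_{L=1}^4a^{2L/3}\|N\|_{\dot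 H^{14+L}}+\|N\|_{H^{14}}\\&+\|\Phi\|_{H^{16}}+a^{2/3}\|\Psi\|_{H^{16}}+\|\Psi\|_{H^{15}}+\|K\|_{C^{14}}+\|G-\mathring g\|_{C^{14}}+\|G^{-1}-\mathring g^{-1}\|_{C^{14}}\\&+\|N\|_{C^{12}}+\|\Phi\|_{C^{14}}+\|\Psi\|_{C^{13}}.\end{aligned}$$ **Energies.** For $\kappa>0$ let $\mathcal E_{M;\kappa}=\kappa\,\mathcal E^{\mathrm{metric}}_M+\mathcal E^{\mathrm{sf}}_M$ with $$\mathcal E^{\mathrm{metric}}_M=\sum_{1\le|I|\le M}\int\Big(|\mathcal L^IK|^2+\tfrac14a^{4/3}|\nabla\mathcal L^IG|^2\Big)d\varpi,\qquad \mathcal E^{\mathrm{sf}}_M=\sum_{1\le|I|\le M}\int\Big((Z^I\Phi)^2+a^{4/3}|\mathcal L^I\Psi|^2\Big)d\varpi .$$ **Error terms** (those of the $\mathcal L^I$-commuted equations). A condition on $|I_j|$ below restricts only the term it is attached to. * Momentum constraints, with $(\mathrm{div}\,K)_j=\nabla_aK^a{}_j$ and $(\mathrm{div}^\sharp K)^i=G^{ab}\nabla_aK^i{}_b$: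 $$\mathfrak M^{I}_{\downarrow}=-[\mathcal L^I,\mathrm{div}]K-\sum_{I_1+I_2=I}(Z^{I_1}\Phi)\mathcal L^{I_2}\Psi,$$ $$(\mathfrak M^I_\uparrow)^i=-([\mathcal L^I,\mathrm{div}^\sharp]K)^i-\sqrt{\tfrac23}\sum_{I_1+I_2=I,\ |I_2|<|I|}(\mathcal L^{I_1}G^{-1})^{ic}(\mathcal L^{I_2}\Psi)_c-\sum_{I_1+I_2+I_3=I}(Z^{I_1}\Phi)(\mathcal L^{I_2}G^{-1})^{ic}(\mathcal L^{I_3}\Psi)_c.$$ * Gradient of the metric. Let $h=\partial_tG$, $\dot\Gamma_{c}{}^{d}{}_{i}=\tfrac12G^{de}(\nabla_ch_{ie}+\nabla_ih_{ce}-\nabla_eh_{ci})$ and $([\mathcal L_{\partial_t},\nabla]\xi)_{cij}=-\dot\Gamma_c{}^d{}_i\xi_{dj}-\dot\Gamma_c{}^d{}_j\xi_{id}$. Then $$\begin{aligned}(\mathfrak B^I_{\nabla G})_{cij}={}&-2a^{4/3}(\nabla_cZ^IN)G_{id}K^d{}_j-2\sum_{I_1+I_2=I}(\nabla_c\mathcal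 L^{I_1}G_{id})\mathcal L^{I_2}K^d{}_j\\&-2\sum_{I_1+I_2=I,\ |I_2|<|I|}(\mathcal L^{I_1}G_{id})\nabla_c\mathcal L^{I_2}K^d{}_j+a([\mathcal L_{\partial_t},\nabla]\mathcal L^IG)_{cij},\end{aligned}$$ $$\begin{aligned}(\mathfrak J^I_{\nabla G})_{cij}={}&\tfrac23a'\Big\{\sum_{I_1+I_2=I,\ |I_1|<|I|}(\nabla_cZ^{I_1}N)\mathcal L^{I_2}G_{ij}+\sum_{I_1+I_2=I}(Z^{I_1}N)\nabla_c\mathcal L^{I_2}G_{ij}\Big\}\\&-2\sum_{I_1+I_2+I_3=I,\ |I_1|<|I|}(\nabla_cZ^{I_1}N)(\mathcal L^{I_2}G_{id})\mathcal L^{I_3}K^d{}_j-2\sum_{I_1+I_2+I_3=I}(Z^{I_1}N)(\nabla_c\mathcal L^{I_2}G_{id})\mathcal L^{I_3}K^d{}_j\\&-2\sum_{I_1+I_2+I_3=I,\ |I_3|<|I|}(Z^{I_1}N)(\mathcal L^{I_2}G_{id})\nabla_c\mathcal L^{I_3}K^d{}_j.\end{aligned}$$ * Curvature, with $(\mathrm{div}\,\xi)_j=G^{ab}\nabla_a\xi_{bj}$: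 $$\mathfrak R^I=\mathcal L^I(\mathrm{Ric}^\sharp)+\tfrac12(\Delta\mathcal L^IG)^\sharp+\tfrac12\nabla^\sharp\nabla\,\mathrm{tr}\,\mathcal L^IG-\tfrac12\nabla^\sharp\mathrm{div}\,\mathcal L^IG-\tfrac12\nabla(\mathrm{div}\,\mathcal L^IG)^\sharp,$$ i.e. in components the last four terms are $+\tfrac12G^{ic}\Delta\mathcal L^IG_{cj}$, $+\tfrac12G^{ic}\nabla_c\nabla_j\mathrm{tr}\,\mathcal L^IG$, $-\tfrac12G^{ic}\nabla_c(\mathrm{div}\,\mathcal L^IG)_j$, $-\tfrac12\nabla_j(\mathrm{div}\,\mathcal L^IG)^i$. * Second fundamental form: $\mathfrak B^I_K=-a'(Z^IN)K$ and $$\begin{aligned}\mathfrak J^I_K={}&-a'\sum_{I_1+I_2=I,\ |I_1|<|I|}(Z^{I_1}N)\mathcal L^{I_2}K+a^{4/3}G^{-1}[\nabla^2,\mathcal L^I]N+a^{4/3}[G^{-1},\mathcal L^I]\nabla^2N+a^{4/3}[\mathcal L^I,N]\mathrm{Ric}^\sharp\\&-\sum_{I_1+I_2+I_3=I}(\mathcal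 L^{I_1}G^{-1}\cdot\mathcal L^{I_2}\Psi)\otimes\mathcal L^{I_3}\Psi-a^{4/3}\sum_{I_1+\cdots+I_4=I}(Z^{I_2}N)(\mathcal L^{I_1}G^{-1}\cdot\mathcal L^{I_3}\Psi)\otimes\mathcal L^{I_4}\Psi .\end{aligned}$$ Here $G^{-1}\xi$ raises the first index of $\xi$ and $(P\cdot\psi)^i=P^{ic}\psi_c$. * Scalar field: $\mathfrak B^I_\Phi=-a'(Z^IN)\Phi$, $\mathfrak B^I_\Psi=\Phi\nabla Z^IN$, $\mathfrak J^I_\Psi=[\mathcal L^I,N]\nabla\Phi+[\mathcal L^I,\Phi]\nabla N$ and, with $\mathrm{div}\,\Psi=G^{ab}\nabla_a\Psi_b$, $$\begin{aligned}\mathfrak J^I_\Phi={}&-a'\sum_{I_1+I_2=I,\ |I_1|<|I|}(Z^{I_1}N)Z^{I_2}\Phi+[\mathcal L^I,\mathrm{div}]\Psi+a^{4/3}[\mathcal L^I,N\,\mathrm{div}]\Psi\\&+a^{4/3}\sum_{I_1+I_2+I_3=I}(\nabla_cZ^{I_1}N)(\mathcal L^{I_2}G^{-1})^{cd}(\mathcal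 L^{I_3}\Psi)_d .\end{aligned}$$ * Lapse: $$\begin{aligned}\mathfrak B^I_N&=\sum_{I_1+I_2=I}(\mathcal L^{I_1}K)^c{}_d(\mathcal L^{I_2}K)^d{}_c+\sum_{I_1+I_2=I}(Z^{I_1}\Phi)Z^{I_2}\Phi,\\ \mathfrak J^I_N&=a^{4/3}[\Delta,Z^I]N+[Z^I,|K|^2]N+2\sqrt{\tfrac23}\,[Z^I,\Phi]N+[Z^I,\Phi^2]N .\end{aligned}$$ Finally, with all quantities at time $s$, set $$\mathcal B_I=a^{1/3}\big(\|\mathfrak M^I_\downarrow\|^2+\|\mathfrak M^I_\uparrow\|^2+\|\mathfrak B^I_{\nabla G}\|^2\big)+a^3\|\mathfrak B^I_\Psi\|^2+a^{-1}\|\mathfrak B^I_N\|^2+\tfrac1\varepsilon a^{5/3}\big(\|\mathfrak B^I_K\|^2+\|\mathfrak B^I_\Phi\|^2\big),$$ $$\mathcal J_I=a^{7/3}\big(\|\mathfrak J^I_{\nabla G}\|^2+\|\mathfrak J^I_\Psi\|^2\big)+a\big(\|\mathfrak J^I_N\|^2+\|\mathfrak R^I\|^2+\|\mathfrak J^I_K\|^2+\|\mathfrak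 J^I_\Phi\|^2\big)+a^4\|\nabla Z^IN\|^2+a^{7/3}\|Z^IN\|^2.$$ **Proposition.** Let $1\le M\le16$. For every $\delta>0$ there are a small constant $\kappa_*\in(0,\delta]$, a constant $C>0$ and thresholds $\varepsilon_0,\sigma_0>0$ such that the following holds for all $\varepsilon,\sigma,T_{boot}$ with $0<\varepsilon\le\varepsilon_0$, $\sqrt\varepsilon\le\sigma\le\sigma_0$, $\sigma<1$, $0<T_{boot}\le T_c$. For every solution on $[0,T_{boot})\times\mathbb S^3$ with $\mathcal H(0)\le\varepsilon^2$ and $\mathcal H(t)\le\varepsilon\,a(t)^{-\sigma}$ for all $t\in[0,T_{boot})$, and for every $t\in[0,T_{boot})$, $$\begin{aligned}\mathcal E_{M;\kappa_*}(t)&+\sum_{1\le|I|\le M}\int_0^t|a'|a^{1/3}\|\nabla\mathcal L^IG\|^2ds+\sum_{1\le|I|\le M}\int_0^t|a'|a^{1/3}\|\mathcal L^I\Psi\|^2ds\\&+\sum_{1\le|I|\le M}\int_0^t|a'|a^{3}\|\nabla Z^IN\|^2ds+\sum_{1\le|I|\le M}\int_0^t|a'|^3a^{5/3}\|Z^IN\|^2ds\\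 \le{}&C\,\mathcal E_{M;\kappa_*}(0)+C\varepsilon\int_0^ta^{-1}\mathcal E_{M;\kappa_*}ds+C\int_0^ta^{-1/3}\mathcal E_{M;\kappa_*}ds+C\sum_{1\le|I|\le M}\int_0^t\mathcal B_I\,ds+C\sum_{1\le|I|\le M}\int_0^t\mathcal J_I\,ds .\end{aligned}$$ -/

import Mathlib

open scoped Manifold ContDiff ENNReal
open MeasureTheory

noncomputable section

namespace BigCrunch

/-! ## The three-sphere, its round metric and the frame of Killing fields

The round three-sphere of radius `3` is modelled on the unit sphere `S3` through `y = 3 u`. -/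

/-- Euclidean four-space. -/
abbrev R4 : Type := EuclideanSpace ℝ (Fin 4)

/-- The manifold underlying the three-sphere. -/
abbrev S3 : Type := Metric.sphere (0 : R4) 1

/-- The rotation field `(1/3) (y^k ∂_l - y^l ∂_k)` of `R4`; it has the same expression in the
variable `y` and in the variable `u = y / 3`. -/
def rot (k l : Fin 4) (y : R4) : R4 :=
  (1 / 3 : ℝ) • (y k • EuclideanSpace.single l (1 : ℝ) - y l • EuclideanSpace.single k (1 : ℝ))

/-- The frame fields `Z₁ = R₁₂ + R₃₄`, `Z₂ = R₂₃ + R₁₄`, `Z₃ = R₁₃ - R₂₄` (the indices are shifted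
by one, as `Fin` starts at `0`). -/
def frameVec (A : Fin 3) (y : R4) : R4 :=
  match A with
  | 0 => rot 0 1 y + rot 2 3 y
  | 1 => rot 1 2 y + rot 0 3 y
  | 2 => rot 0 2 y - rot 1 3 y

/-- The great circle that starts at `y` with velocity `frameVec A y`, when `y` is a unit vector. -/
def frameCurve (A : Fin 3) (s : ℝ) (y : R4) : R4 :=
  Real.cos (s / 3) • y + (3 * Real.sin (s / 3)) • frameVec A y

theorem frameCurve_mem (A : Fin 3) (s : ℝ) (y : S3) :
    frameCurve A s (y : R4) ∈ Metric.sphere (0 : R4) 1 := by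
  have hy : ‖(y : R4)‖ = 1 := by simp
  have h2 : (y : R4) 0 ^ 2 + (y : R4) 1 ^ 2 + (y : R4) 2 ^ 2 + (y : R4) 3 ^ 2 = 1 := by
    have h := EuclideanSpace.real_norm_sq_eq (y : R4)
    rw [hy, Fin.sum_univ_four] at h
    linarith
  have hcs := Real.sin_sq_add_cos_sq (s / 3)
  rw [mem_sphere_zero_iff_norm]
  have h3 : ‖frameCurve A s (y : R4)‖ ^ 2 = 1 := by
    rw [EuclideanSpace.real_norm_sq_eq, Fin.sum_univ_four]
    fin_cases A <;>
      simp [frameCurve, frameVec, rot] <;>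
      linear_combination (Real.sin (s / 3) ^ 2 + Real.cos (s / 3) ^ 2) * h2 + hcs
  nlinarith [norm_nonneg (frameCurve A s (y : R4))]

/-- The flow of the vector field `Z_A` on the sphere. -/
def frameFlow (A : Fin 3) (s : ℝ) (y : S3) : S3 := ⟨frameCurve A s y, frameCurve_mem A s y⟩

/-- `frameFlow A` is indeed the flow of `frameVec A`. -/
theorem hasDerivAt_frameFlow (A : Fin 3) (s : ℝ) (y : S3) :
    HasDerivAt (fun r => (frameFlow A r y : R4)) (frameVec A (frameFlow A s y)) s := by
  have hd : HasDerivAt (fun r : ℝ => r / 3) (1 / 3) s := (hasDerivAt_id s).div_const 3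
  have h1 := (hd.cos.smul_const (y : R4)).add ((hd.sin.const_mul 3).smul_const (frameVec A (y : R4)))
  refine h1.congr_deriv ?_
  ext i
  fin_cases A <;> fin_cases i <;>
    simp [frameFlow, frameCurve, frameVec, rot] <;> ring

/-- The derivative `Z_A f` of a function along the frame field `Z_A`. -/
def Z (A : Fin 3) (f : S3 → ℝ) (y : S3) : ℝ := deriv (fun s => f (frameFlow A s y)) 0

/-- The totally antisymmetric symbol with `eps 0 1 2 = 1`. -/
def eps (A B C : Fin 3) : ℝ :=
  (((B : ℕ) : ℝ) - ((A : ℕ) : ℝ)) * (((C : ℕ) : ℝ) - ((A : ℕ) : ℝ)) *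
    (((C : ℕ) : ℝ) - ((B : ℕ) : ℝ)) / 2

/-- The volume measure of the round metric (radius `3`): `27` times the surface measure of the unit
sphere. -/
def roundVol : Measure S3 := (27 : ℝ≥0∞) • (volume : Measure R4).toSphere

/-! ## Tensor fields in frame components

The frame `Z` is global and orthonormal for the round metric, and `[Z_A, Z_B] = (2/3) ε_{ABC} Z_C`.
A tensor field on a time slice is given by its components in `Z` and in the dual coframe. -/

/-- Tensor fields with `l` upper and `m` lower indices: `ξ y a b` is the component with upper
indices `a` and lower indices `b`. -/
abbrev Tensor (l m : ℕ) : Type := S3 → (Fin l → Fin 3) → (Fin m → Fin 3) → ℝ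

/-- The matrix of frame components of a symmetric two-tensor such as a metric. -/
abbrev Metric3 : Type := S3 → Matrix (Fin 3) (Fin 3) ℝ

/-- A function as a tensor field. -/
def ofScalar (f : S3 → ℝ) : Tensor 0 0 := fun y _ _ => f y

/-- A metric as a tensor field with two lower indices. -/
def lowT (G : Metric3) : Tensor 0 2 := fun y _ b => G y (b 0) (b 1)

/-- The inverse metric as a tensor field with two upper indices. -/
def invT (G : Metric3) : Tensor 2 0 := fun y a _ => (G y)⁻¹ (a 0) (a 1)

/-- The round metric: the frame is orthonormal. -/
def roundMet : Metric3 := fun _ => 1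

/-- The Lie derivative along `Z_A` in frame components. -/
def lie (A : Fin 3) {l m : ℕ} (ξ : Tensor l m) : Tensor l m := fun y a b =>
  Z A (fun x => ξ x a b) y
    + ∑ i, ∑ D, (2 / 3) * eps A D (a i) * ξ y (Function.update a i D) b
    - ∑ j, ∑ D, (2 / 3) * eps A (b j) D * ξ y a (Function.update b j D)

/-- The iterated Lie derivative `L_{Z_{i₁}} L_{Z_{i₂}} ⋯` for the multi-index `I = [i₁, i₂, …]`. -/
def lieI (I : List (Fin 3)) {l m : ℕ} (ξ : Tensor l m) : Tensor l m :=
  I.foldr (fun A η => lie A η) ξ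

/-- The iterated derivative `Z^I f` of a function. -/
def ZI (I : List (Fin 3)) (f : S3 → ℝ) : S3 → ℝ := I.foldr (fun A h => Z A h) f

/-- All multi-indices of order between `p` and `q`. -/
def multiIdx (p q : ℕ) : Finset (List (Fin 3)) :=
  (Finset.Icc p q).biUnion fun N =>
    (Finset.univ : Finset (Fin N → Fin 3)).image fun I => List.ofFn I

/-- The splittings `I₁ + I₂ = I` of the Leibniz rule: each position of `I` goes to one of the two
parts, the order being kept; a splitting is listed once for every such distribution. -/
def split2 : List (Fin 3) → List (List (Fin 3) × List (Fin 3))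
  | [] => [([], [])]
  | i :: I => (split2 I).flatMap fun p => [(i :: p.1, p.2), (p.1, i :: p.2)]

/-- The sum over `I₁ + I₂ = I`. -/
def sum2 (I : List (Fin 3)) (F : List (Fin 3) → List (Fin 3) → ℝ) : ℝ :=
  ((split2 I).map fun p => F p.1 p.2).sum

/-- The sum over `I₁ + I₂ + I₃ = I`. -/
def sum3 (I : List (Fin 3)) (F : List (Fin 3) → List (Fin 3) → List (Fin 3) → ℝ) : ℝ :=
  sum2 I fun I₁ J => sum2 J fun I₂ I₃ => F I₁ I₂ I₃

/-- The sum over `I₁ + I₂ + I₃ + I₄ = I`. -/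
def sum4 (I : List (Fin 3))
    (F : List (Fin 3) → List (Fin 3) → List (Fin 3) → List (Fin 3) → ℝ) : ℝ :=
  sum2 I fun I₁ J => sum3 J fun I₂ I₃ I₄ => F I₁ I₂ I₃ I₄

/-! ## Levi-Civita connection and curvature -/

/-- `Γ_{ACB} = G(∇_{Z_A} Z_B, Z_C)`, by the Koszul formula. -/
def chrLow (G : Metric3) (y : S3) (A C B : Fin 3) : ℝ :=
  (1 / 2) * (Z A (fun x => G x B C) y + Z B (fun x => G x A C) y - Z C (fun x => G x A B) y)
    + (1 / 3) * ∑ D, (eps A B D * G y C D - eps B C D * G y A D - eps A C D * G y B D)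

/-- The connection coefficients: `∇_{Z_A} Z_B = ∑ D, chr G y A D B • Z_D`. -/
def chr (G : Metric3) (y : S3) (A D B : Fin 3) : ℝ := ∑ C, (G y)⁻¹ C D * chrLow G y A C B

/-- The covariant derivative `∇ξ`; the new lower index (the direction) comes first. -/
def cov (G : Metric3) {l m : ℕ} (ξ : Tensor l m) : Tensor l (m + 1) := fun y a b =>
  Z (b 0) (fun x => ξ x a (Fin.tail b)) y
    + ∑ i, ∑ D, chr G y (b 0) (a i) D * ξ y (Function.update a i D) (Fin.tail b)
    - ∑ j, ∑ D, chr G y (b 0) D (Fin.tail b j) * ξ y a (Function.update (Fin.tail b) j D)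

/-- The differential `∇f` of a function. -/
def grad (f : S3 → ℝ) : Tensor 0 1 := fun y _ b => Z (b 0) f y

/-- The Hessian `∇²f`. -/
def hess (G : Metric3) (f : S3 → ℝ) : Tensor 0 2 := cov G (grad f)

/-- The Laplacian `G^{ab} ∇_a ∇_b ξ` of a tensor field. -/
def lap (G : Metric3) {l m : ℕ} (ξ : Tensor l m) : Tensor l m := fun y a b =>
  ∑ c, ∑ d, (G y)⁻¹ c d * cov G (cov G ξ) y a (Fin.cons c (Fin.cons d b))

/-- The Laplacian of a function. -/
def lapS (G : Metric3) (f : S3 → ℝ) (y : S3) : ℝ :=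
  ∑ c, ∑ d, (G y)⁻¹ c d * hess G f y ![] ![c, d]

/-- The coframe field `θ^M`. -/
def coframe (M : Fin 3) : Tensor 0 1 := fun _ _ b => if b 0 = M then 1 else 0

/-- The curvature `Riem_{ijkl}`, determined by
`∇_i ∇_j X_k - ∇_j ∇_i X_k = G^{lm} Riem_{ijkl} X_m` for all one-forms `X`. -/
def riem (G : Metric3) (y : S3) (i j k l : Fin 3) : ℝ :=
  ∑ m, G y l m * (cov G (cov G (coframe m)) y ![] ![i, j, k]
    - cov G (cov G (coframe m)) y ![] ![j, i, k])

/-- The Ricci curvature `Ric_{ij} = G^{ab} Riem_{iajb}`. -/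
def ric (G : Metric3) (y : S3) (i j : Fin 3) : ℝ :=
  ∑ a, ∑ b, (G y)⁻¹ a b * riem G y i a j b

/-- The scalar curvature. -/
def scalCurv (G : Metric3) (y : S3) : ℝ := ∑ a, ∑ b, (G y)⁻¹ a b * ric G y a b

/-- `Ric^#`, the Ricci curvature with its first index raised. -/
def ricSharp (G : Metric3) : Tensor 1 1 := fun y a b => ∑ c, (G y)⁻¹ (a 0) c * ric G y c (b 0)

/-- Raising the index of a one-form. -/
def sharp1 (G : Metric3) (η : Tensor 0 1) : Tensor 1 0 := fun y a _ =>
  ∑ c, (G y)⁻¹ (a 0) c * η y ![] ![c]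

/-- Raising the first index of a tensor with two lower indices. -/
def sharp2 (G : Metric3) (ξ : Tensor 0 2) : Tensor 1 1 := fun y a b =>
  ∑ c, (G y)⁻¹ (a 0) c * ξ y ![] ![c, b 0]

/-- The trace `G^{ab} ξ_{ab}`. -/
def trG (G : Metric3) (ξ : Tensor 0 2) (y : S3) : ℝ := ∑ c, ∑ d, (G y)⁻¹ c d * ξ y ![] ![c, d]

/-- The divergence `G^{ab} ∇_a η_b` of a one-form. -/
def div01 (G : Metric3) (η : Tensor 0 1) (y : S3) : ℝ :=
  ∑ c, ∑ d, (G y)⁻¹ c d * cov G η y ![] ![c, d]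

/-- The divergence `∇_a ξ^a_j`. -/
def div11 (G : Metric3) (ξ : Tensor 1 1) : Tensor 0 1 := fun y _ b =>
  ∑ c, cov G ξ y ![c] ![c, b 0]

/-- The divergence `G^{ab} ∇_a ξ^i_b`. -/
def div11Sharp (G : Metric3) (ξ : Tensor 1 1) : Tensor 1 0 := fun y a _ =>
  ∑ c, ∑ d, (G y)⁻¹ c d * cov G ξ y ![a 0] ![c, d]

/-- The divergence `G^{ab} ∇_a ξ_{bj}`. -/
def div02 (G : Metric3) (ξ : Tensor 0 2) : Tensor 0 1 := fun y _ b =>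
  ∑ c, ∑ d, (G y)⁻¹ c d * cov G ξ y ![] ![c, d, b 0]

/-! ## Norms -/

/-- The squared pointwise norm `|ξ|²_G`. -/
def normSq (G : Metric3) {l m : ℕ} (ξ : Tensor l m) (y : S3) : ℝ :=
  ∑ a : Fin l → Fin 3, ∑ a' : Fin l → Fin 3, ∑ b : Fin m → Fin 3, ∑ b' : Fin m → Fin 3,
    (∏ i, G y (a i) (a' i)) * (∏ j, (G y)⁻¹ (b j) (b' j)) * ξ y a b * ξ y a' b'

/-- The integral of `f` against the volume form of `G`. -/
def integralVol (G : Metric3) (f : S3 → ℝ) : ℝ := ∫ y, f y * Real.sqrt (G y).det ∂roundVol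

/-- The squared norm `‖ξ‖²` in `L²_G`. -/
def l2Sq (G : Metric3) {l m : ℕ} (ξ : Tensor l m) : ℝ := integralVol G (normSq G ξ)

/-- For the round metric: `sobolev p q ξ` is the square root of the sum of `‖L_Z^I ξ‖²` over
`p ≤ |I| ≤ q`. So `sobolev 0 q` is the `H^q` norm and `sobolev q q` the homogeneous one. -/
def sobolev (p q : ℕ) {l m : ℕ} (ξ : Tensor l m) : ℝ :=
  Real.sqrt (∑ I ∈ multiIdx p q, l2Sq roundMet (lieI I ξ))

/-- The `C^q` norm relative to the round metric. -/
def supNorm (q : ℕ) {l m : ℕ} (ξ : Tensor l m) : ℝ :=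
  Real.sqrt (∑ I ∈ multiIdx 0 q, ⨆ y, normSq roundMet (lieI I ξ) y)

/-! ## The scale factor and the Einstein-scalar field system -/

/-- `a` is the scale factor of the background solution and `Tc` its crunch time: `a` solves
`a'' = -(2/3) a^{1/3}`, `a(0) = 1`, `a'(0) = 0`, is positive on `(-Tc, Tc)` and vanishes at `Tc`. -/
structure IsScaleFactor (a : ℝ → ℝ) (Tc : ℝ) : Prop where
  crunch_pos : 0 < Tc
  init : a 0 = 1
  init_deriv : deriv a 0 = 0
  pos : ∀ t ∈ Set.Ioo (-Tc) Tc, 0 < a t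
  differentiable : ∀ t ∈ Set.Ioo (-Tc) Tc, DifferentiableAt ℝ a t
  ode : ∀ t ∈ Set.Ioo (-Tc) Tc, HasDerivAt (deriv a) (-(2 / 3) * a t ^ (1 / 3 : ℝ)) t
  crunch : Filter.Tendsto a (nhdsWithin Tc (Set.Iio Tc)) (nhds 0)

/-- The Hubble factor. -/
def hubble (a : ℝ → ℝ) (t : ℝ) : ℝ := deriv a t / a t

/-- The unknowns in transported spatial coordinates: the spatial metric `g`, the second fundamental
form `k` (row index up, column index down) in frame components, the lapse `n` and the scalar
field `φ`. The frame does not depend on time. -/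
structure Fields where
  g : ℝ → Metric3
  k : ℝ → S3 → Matrix (Fin 3) (Fin 3) ℝ
  n : ℝ → S3 → ℝ
  φ : ℝ → S3 → ℝ

/-- The time derivative on `[0, ∞)`, one-sided at `0`. -/
def dt (f : ℝ → S3 → ℝ) (t : ℝ) (y : S3) : ℝ := derivWithin (fun s => f s y) (Set.Ici 0) t

/-- `f` is of class `C^r` on `[0, T) × S3`. -/
def IsCk (r : ℕ) (T : ℝ) (f : ℝ → S3 → ℝ) : Prop :=
  ContMDiffOn (𝓘(ℝ, ℝ).prod (𝓡 3)) 𝓘(ℝ, ℝ) ((r : ℕ∞) : ℕ∞ω)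
    (fun p : ℝ × S3 => f p.1 p.2) (Set.Ico 0 T ×ˢ Set.univ)

namespace Fields

/-- The derivative `n⁻¹ ∂_t φ` of the scalar field in the unit normal direction. -/
def nφ (S : Fields) (t : ℝ) (y : S3) : ℝ := (S.n t y)⁻¹ * dt S.φ t y

/-- The trace-free part of the second fundamental form. -/
def kHat (S : Fields) (t : ℝ) : Tensor 1 1 := fun y a b =>
  S.k t y (a 0) (b 0) - (1 / 3) * (S.k t y).trace * (1 : Matrix (Fin 3) (Fin 3) ℝ) (a 0) (b 0)

end Fields

/-- `S` is a classical solution on `[0, T) × S3` of the Einstein-scalar field equations in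
CMC-transported spatial coordinates gauge. -/
structure IsSolution (a : ℝ → ℝ) (T : ℝ) (S : Fields) : Prop where
  g_reg : ∀ i j, IsCk 18 T fun t y => S.g t y i j
  k_reg : ∀ i j, IsCk 17 T fun t y => S.k t y i j
  n_reg : IsCk 18 T S.n
  φ_reg : IsCk 18 T S.φ
  g_posDef : ∀ t ∈ Set.Ico 0 T, ∀ y, (S.g t y).PosDef
  n_pos : ∀ t ∈ Set.Ico 0 T, ∀ y, 0 < S.n t y
  cmc : ∀ t ∈ Set.Ico 0 T, ∀ y, (S.k t y).trace = -hubble a t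
  hamiltonian : ∀ t ∈ Set.Ico 0 T, ∀ y,
    scalCurv (S.g t) y - ∑ i, ∑ j, S.k t y i j * S.k t y j i + hubble a t ^ 2
      = S.nφ t y ^ 2 + ∑ i, ∑ j, (S.g t y)⁻¹ i j * Z i (S.φ t) y * Z j (S.φ t) y
  momentum : ∀ t ∈ Set.Ico 0 T, ∀ y i,
    div11 (S.g t) (S.kHat t) y ![] ![i] = -S.nφ t y * Z i (S.φ t) y
  evol_g : ∀ t ∈ Set.Ico 0 T, ∀ y i j,
    dt (fun s x => S.g s x i j) t y = -2 * S.n t y * ∑ c, S.g t y i c * S.k t y c j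
  evol_k : ∀ t ∈ Set.Ico 0 T, ∀ y i j,
    dt (fun s x => S.k s x i j) t y
      = -(∑ c, (S.g t y)⁻¹ i c * hess (S.g t) (S.n t) y ![] ![c, j])
        + S.n t y * (∑ c, (S.g t y)⁻¹ i c * ric (S.g t) y c j
            + (S.k t y).trace * S.k t y i j
            - ∑ c, (S.g t y)⁻¹ i c * Z c (S.φ t) y * Z j (S.φ t) y)
  wave : ∀ t ∈ Set.Ico 0 T, ∀ y,
    -(S.n t y)⁻¹ * dt S.nφ t y + lapS (S.g t) (S.φ t) y
      = hubble a t * S.nφ t y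
        - (S.n t y)⁻¹ * ∑ i, ∑ j, (S.g t y)⁻¹ i j * Z i (S.n t) y * Z j (S.φ t) y
  lapse : ∀ t ∈ Set.Ico 0 T, ∀ y,
    lapS (S.g t) (S.n t) y
      = deriv (hubble a) t
        + S.n t y * (∑ i, ∑ j, S.kHat t y ![i] ![j] * S.kHat t y ![j] ![i]
            + (1 / 3) * hubble a t ^ 2 + S.nφ t y ^ 2)

/-! ## The time-rescaled variables -/

/-- The values at one time of the scale factor `α`, of its derivative `α'` and of the rescaled
variables: metric `G`, trace-free second fundamental form `K`, lapse `N`, scalar field derivatives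
`Φ` (normal) and `Ψ` (spatial), together with the time derivative `Gt` of `G`. -/
structure Rescaled where
  α : ℝ
  α' : ℝ
  G : Metric3
  K : Tensor 1 1
  N : S3 → ℝ
  Φ : S3 → ℝ
  Ψ : Tensor 0 1
  Gt : Tensor 0 2

/-- The rescaled metric `a^{-2/3} g`. -/
def rescaledMetric (a : ℝ → ℝ) (S : Fields) (t : ℝ) : Metric3 := fun y =>
  a t ^ (-2 / 3 : ℝ) • S.g t y

/-- The rescaled variables of `S` at time `t`. -/
def rescale (a : ℝ → ℝ) (S : Fields) (t : ℝ) : Rescaled where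
  α := a t
  α' := deriv a t
  G := rescaledMetric a S t
  K := fun y i j => a t * S.kHat t y i j
  N := fun y => a t ^ (-4 / 3 : ℝ) * (S.n t y - 1)
  Φ := fun y => a t * S.nφ t y - Real.sqrt (2 / 3)
  Ψ := grad (S.φ t)
  Gt := fun y _ b => dt (fun s x => rescaledMetric a S s x (b 0) (b 1)) t y

namespace Rescaled

variable (X : Rescaled)

/-- The high norm of the solution. -/
def highNorm : ℝ :=
  sobolev 0 16 X.K
  + X.α ^ (2 / 3 : ℝ) * sobolev 17 17 (lowT X.G)
  + sobolev 0 16 (lowT X.G - lowT roundMet)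
  + sobolev 0 16 (invT X.G - invT roundMet)
  + ∑ L ∈ Finset.Icc (1 : ℕ) 4,
      X.α ^ ((2 / 3 : ℝ) * (L : ℝ)) * sobolev (14 + L) (14 + L) (ofScalar X.N)
  + sobolev 0 14 (ofScalar X.N)
  + sobolev 0 16 (ofScalar X.Φ)
  + X.α ^ (2 / 3 : ℝ) * sobolev 0 16 X.Ψ
  + sobolev 0 15 X.Ψ
  + supNorm 14 X.K
  + supNorm 14 (lowT X.G - lowT roundMet)
  + supNorm 14 (invT X.G - invT roundMet)
  + supNorm 12 (ofScalar X.N)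
  + supNorm 14 (ofScalar X.Φ)
  + supNorm 13 X.Ψ

/-- The metric energy. -/
def metricEnergy (M : ℕ) : ℝ :=
  ∑ I ∈ multiIdx 1 M, integralVol X.G fun y =>
    normSq X.G (lieI I X.K) y
      + (1 / 4) * X.α ^ (4 / 3 : ℝ) * normSq X.G (cov X.G (lieI I (lowT X.G))) y

/-- The scalar field energy. -/
def sfEnergy (M : ℕ) : ℝ :=
  ∑ I ∈ multiIdx 1 M, integralVol X.G fun y =>
    ZI I X.Φ y ^ 2 + X.α ^ (4 / 3 : ℝ) * normSq X.G (lieI I X.Ψ) y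

/-- The total energy with parameter `κ`. -/
def totalEnergy (M : ℕ) (κ : ℝ) : ℝ := κ * X.metricEnergy M + X.sfEnergy M

/-! ### Error terms of the commuted equations -/

/-- Borderline term of the commuted momentum constraint (index down):
`-[L^I, div] K - ∑ (Z^{I₁} Φ) L^{I₂} Ψ`. -/
def momBorderDown (I : List (Fin 3)) : Tensor 0 1 := fun y a b =>
  -(lieI I (div11 X.G X.K) y a b - div11 X.G (lieI I X.K) y a b)
  - sum2 I fun I₁ I₂ => ZI I₁ X.Φ y * lieI I₂ X.Ψ y a b

/-- Borderline term of the commuted momentum constraint (index up). -/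
def momBorderUp (I : List (Fin 3)) : Tensor 1 0 := fun y a b =>
  -(lieI I (div11Sharp X.G X.K) y a b - div11Sharp X.G (lieI I X.K) y a b)
  - Real.sqrt (2 / 3) * (sum2 I fun I₁ I₂ =>
      if I₂.length < I.length then
        ∑ c, lieI I₁ (invT X.G) y ![a 0, c] ![] * lieI I₂ X.Ψ y ![] ![c] else 0)
  - sum3 I fun I₁ I₂ I₃ =>
      ZI I₁ X.Φ y * ∑ c, lieI I₂ (invT X.G) y ![a 0, c] ![] * lieI I₃ X.Ψ y ![] ![c]

/-- The derivative of the connection coefficients in time: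
`(1/2) G^{de} (∇_c h_{ie} + ∇_i h_{ce} - ∇_e h_{ci})` with `h = ∂_t G`. -/
def chrDt (y : S3) (c d i : Fin 3) : ℝ :=
  (1 / 2) * ∑ e, (X.G y)⁻¹ d e * (cov X.G X.Gt y ![] ![c, i, e] + cov X.G X.Gt y ![] ![i, c, e]
    - cov X.G X.Gt y ![] ![e, c, i])

/-- The commutator `[L_{∂_t}, ∇] ξ` for `ξ` with two lower indices. -/
def commDt (ξ : Tensor 0 2) : Tensor 0 3 := fun y _ b =>
  -(∑ d, (X.chrDt y (b 0) d (b 1) * ξ y ![] ![d, b 2] + X.chrDt y (b 0) d (b 2) * ξ y ![] ![b 1, d]))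

/-- Borderline term of the commuted evolution equation of `∇G`; slots `(c, i, j)`. -/
def gradMetBorder (I : List (Fin 3)) : Tensor 0 3 := fun y a b =>
  -2 * X.α ^ (4 / 3 : ℝ) * Z (b 0) (ZI I X.N) y * (∑ d, X.G y (b 1) d * X.K y ![d] ![b 2])
  - 2 * (sum2 I fun I₁ I₂ =>
      (∑ d, cov X.G (lieI I₁ (lowT X.G)) y ![] ![b 0, b 1, d] * lieI I₂ X.K y ![d] ![b 2])
      + (if I₂.length < I.length then
          ∑ d, lieI I₁ (lowT X.G) y ![] ![b 1, d] * cov X.G (lieI I₂ X.K) y ![d] ![b 0, b 2]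
        else 0))
  + X.α * X.commDt (lieI I (lowT X.G)) y a b

/-- Junk term of the commuted evolution equation of `∇G`; slots `(c, i, j)`. -/
def gradMetJunk (I : List (Fin 3)) : Tensor 0 3 := fun y _ b =>
  (2 / 3) * X.α' * (sum2 I fun I₁ I₂ =>
      (if I₁.length < I.length then
          Z (b 0) (ZI I₁ X.N) y * lieI I₂ (lowT X.G) y ![] ![b 1, b 2] else 0)
      + ZI I₁ X.N y * cov X.G (lieI I₂ (lowT X.G)) y ![] ![b 0, b 1, b 2])
  - 2 * sum3 I fun I₁ I₂ I₃ =>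
      (if I₁.length < I.length then
          Z (b 0) (ZI I₁ X.N) y
            * ∑ d, lieI I₂ (lowT X.G) y ![] ![b 1, d] * lieI I₃ X.K y ![d] ![b 2] else 0)
      + ZI I₁ X.N y * (∑ d,
          cov X.G (lieI I₂ (lowT X.G)) y ![] ![b 0, b 1, d] * lieI I₃ X.K y ![d] ![b 2])
      + (if I₃.length < I.length then
          ZI I₁ X.N y * ∑ d,
            lieI I₂ (lowT X.G) y ![] ![b 1, d] * cov X.G (lieI I₃ X.K) y ![d] ![b 0, b 2] else 0)

/-- The curvature error term: what remains of `L^I (Ric^#)` after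
`-(1/2) (Δ L^I G)^# - (1/2) ∇^# ∇ tr L^I G + (1/2) ∇^# div L^I G + (1/2) ∇ (div L^I G)^#`. -/
def ricError (I : List (Fin 3)) : Tensor 1 1 := fun y a b =>
  lieI I (ricSharp X.G) y a b
  + (1 / 2) * sharp2 X.G (lap X.G (lieI I (lowT X.G))) y a b
  + (1 / 2) * sharp2 X.G (hess X.G (trG X.G (lieI I (lowT X.G)))) y a b
  - (1 / 2) * sharp2 X.G (cov X.G (div02 X.G (lieI I (lowT X.G)))) y a b
  - (1 / 2) * cov X.G (sharp1 X.G (div02 X.G (lieI I (lowT X.G)))) y a b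

/-- Borderline term of the commuted evolution equation of `K`. -/
def secBorder (I : List (Fin 3)) : Tensor 1 1 := fun y a b => -X.α' * ZI I X.N y * X.K y a b

/-- Junk term of the commuted evolution equation of `K`. The two commutators
`G⁻¹ [∇², L^I] N` and `[G⁻¹, L^I] ∇² N` are on the second and third line. -/
def secJunk (I : List (Fin 3)) : Tensor 1 1 := fun y a b =>
  -X.α' * (sum2 I fun I₁ I₂ =>
      if I₁.length < I.length then ZI I₁ X.N y * lieI I₂ X.K y a b else 0)
  + X.α ^ (4 / 3 : ℝ) * sharp2 X.G (hess X.G (ZI I X.N) - lieI I (hess X.G X.N)) y a b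
  + X.α ^ (4 / 3 : ℝ) * (sharp2 X.G (lieI I (hess X.G X.N)) y a b
      - lieI I (sharp2 X.G (hess X.G X.N)) y a b)
  + X.α ^ (4 / 3 : ℝ) * (lieI I (fun x i j => X.N x * ricSharp X.G x i j) y a b
      - X.N y * lieI I (ricSharp X.G) y a b)
  - (sum3 I fun I₁ I₂ I₃ =>
      (∑ c, lieI I₁ (invT X.G) y ![a 0, c] ![] * lieI I₂ X.Ψ y ![] ![c]) * lieI I₃ X.Ψ y ![] b)
  - X.α ^ (4 / 3 : ℝ) * sum4 I fun I₁ I₂ I₃ I₄ =>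
      (∑ c, lieI I₁ (invT X.G) y ![a 0, c] ![] * lieI I₃ X.Ψ y ![] ![c])
        * ZI I₂ X.N y * lieI I₄ X.Ψ y ![] b

/-- Borderline term of the commuted evolution equation of `Φ`. -/
def timeBorder (I : List (Fin 3)) : S3 → ℝ := fun y => -X.α' * ZI I X.N y * X.Φ y

/-- Junk term of the commuted evolution equation of `Φ`. -/
def timeJunk (I : List (Fin 3)) : S3 → ℝ := fun y =>
  -X.α' * (sum2 I fun I₁ I₂ =>
      if I₁.length < I.length then ZI I₁ X.N y * ZI I₂ X.Φ y else 0)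
  + (ZI I (div01 X.G X.Ψ) y - div01 X.G (lieI I X.Ψ) y)
  + X.α ^ (4 / 3 : ℝ) * (ZI I (fun x => X.N x * div01 X.G X.Ψ x) y
      - X.N y * div01 X.G (lieI I X.Ψ) y)
  + X.α ^ (4 / 3 : ℝ) * sum3 I fun I₁ I₂ I₃ =>
      ∑ c, ∑ d, Z c (ZI I₁ X.N) y * lieI I₂ (invT X.G) y ![c, d] ![] * lieI I₃ X.Ψ y ![] ![d]

/-- Borderline term of the commuted evolution equation of `Ψ`. -/
def spaceBorder (I : List (Fin 3)) : Tensor 0 1 := fun y a b => X.Φ y * grad (ZI I X.N) y a b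

/-- Junk term of the commuted evolution equation of `Ψ`: `[L^I, N] ∇Φ + [L^I, Φ] ∇N`. -/
def spaceJunk (I : List (Fin 3)) : Tensor 0 1 := fun y a b =>
  (lieI I (fun x i j => X.N x * grad X.Φ x i j) y a b - X.N y * lieI I (grad X.Φ) y a b)
  + (lieI I (fun x i j => X.Φ x * grad X.N x i j) y a b - X.Φ y * lieI I (grad X.N) y a b)

/-- Borderline term of the commuted elliptic lapse equation. -/
def lapseBorder (I : List (Fin 3)) : S3 → ℝ := fun y =>
  (sum2 I fun I₁ I₂ => ∑ c, ∑ d, lieI I₁ X.K y ![c] ![d] * lieI I₂ X.K y ![d] ![c])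
  + sum2 I fun I₁ I₂ => ZI I₁ X.Φ y * ZI I₂ X.Φ y

/-- Junk term of the commuted elliptic lapse equation. -/
def lapseJunk (I : List (Fin 3)) : S3 → ℝ := fun y =>
  X.α ^ (4 / 3 : ℝ) * (lapS X.G (ZI I X.N) y - ZI I (lapS X.G X.N) y)
  + (ZI I (fun x => normSq X.G X.K x * X.N x) y - normSq X.G X.K y * ZI I X.N y)
  + 2 * Real.sqrt (2 / 3) * (ZI I (fun x => X.Φ x * X.N x) y - X.Φ y * ZI I X.N y)
  + (ZI I (fun x => X.Φ x ^ 2 * X.N x) y - X.Φ y ^ 2 * ZI I X.N y)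

/-- The borderline part of the right-hand side of the energy inequality. -/
def energyBorder (ε : ℝ) (I : List (Fin 3)) : ℝ :=
  X.α ^ (1 / 3 : ℝ) * l2Sq X.G (X.momBorderDown I)
  + X.α ^ (1 / 3 : ℝ) * l2Sq X.G (X.momBorderUp I)
  + X.α ^ (1 / 3 : ℝ) * l2Sq X.G (X.gradMetBorder I)
  + X.α ^ 3 * l2Sq X.G (X.spaceBorder I)
  + X.α⁻¹ * l2Sq X.G (ofScalar (X.lapseBorder I))
  + (1 / ε) * X.α ^ (5 / 3 : ℝ) * l2Sq X.G (X.secBorder I)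
  + (1 / ε) * X.α ^ (5 / 3 : ℝ) * l2Sq X.G (ofScalar (X.timeBorder I))

/-- The junk part of the right-hand side of the energy inequality. -/
def energyJunk (I : List (Fin 3)) : ℝ :=
  X.α ^ (7 / 3 : ℝ) * l2Sq X.G (X.gradMetJunk I)
  + X.α ^ (7 / 3 : ℝ) * l2Sq X.G (X.spaceJunk I)
  + X.α * l2Sq X.G (ofScalar (X.lapseJunk I))
  + X.α * l2Sq X.G (X.ricError I)
  + X.α * l2Sq X.G (X.secJunk I)
  + X.α * l2Sq X.G (ofScalar (X.timeJunk I))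
  + X.α ^ 4 * l2Sq X.G (grad (ZI I X.N))
  + X.α ^ (7 / 3 : ℝ) * l2Sq X.G (ofScalar (ZI I X.N))

end Rescaled

end BigCrunch

end

/-! The estimate is an energy inequality in which the contraction of the background provides the
damping. With b = a^{1/3} one has a'² = 1 − b⁴ (`friedmann`) and a' ≤ 0. In the rescaled variables
the pure background terms cancel, and the field equations become `SliceEqs`, with integer powers of
b only. Lie derivatives along the frame and covariant derivatives are both instances of `der`, so
one Leibniz rule per bilinear operation (`IsNatural`) yields all the commuted equations (`div_lie`,
`space_lie`, `time_lie`, `lapse_lie`, `metric_lie`, `sec_lie`).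

The time derivative of the energy density consists of three kinds of terms.

First, products of top order. In the metric energy, the Laplacian part of the curvature pairs with
L^I K and cancels, up to a divergence, the pairing of ∇L^I G with ∇L^I K; the weight 1/4 in the
energy is chosen for this. The other second order parts of the curvature and the Hessian of the
lapse are integrated by parts onto L^I K, whose divergence is of the order of L^I Ψ by the momentum
constraint (`metric_identity`). In the scalar field energy, Φ and Ψ form a wave pair with the same
cancellation (`sf_identity`).

Second, derivatives of the weight a^{4/3}. As a' ≤ 0, they give the negative terms −(1/3)|a'| b
|∇L^I G|² and −(4/3)|a'| b |L^I Ψ|². Adding the commuted lapse equation, multiplied by a' b⁵ Z^I N,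
produces in addition −|a'| b⁹ |∇Z^I N|² and a negative multiple of (Z^I N)², and it removes exactly
the linear coupling between Z^I N and Z^I Φ.

Third, the time derivative of G inside the pointwise norms and the volume form. Its size is a⁻¹|K|
plus a^{-1/3}, which leads to the two Gronwall terms.

The scalar field part closes by itself: the cross term between L^I Ψ and ∇Z^I N is absorbed because
√(2/3)² = 2/3 is small enough (`sf_density_le`). The metric part leaves large multiples of the
dissipated scalar quantities (`metric_density_le`). Multiplication by a small κ makes them
absorbable (`combine_densities`, `densDeriv_le`). Errors of borderline size in the equations for K
and Φ are split by Young's inequality with a weight proportional to ε, which explains the factor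
1/ε.

The coefficient ε a⁻¹ requires |K| ≤ C₁ ε pointwise, without the loss a^{-σ} of the bootstrap
assumption. This is `exists_lowBounds`: the time derivatives of K and Φ carry a factor b and vanish
on the background, where Ric = (2/9) g cancels a''/3; for small σ the factor b absorbs every power
of a^{-σ} that occurs, and integration in time from the small data gives the bound. The calculus
`Near` keeps the constants uniform over all solutions.

Finally the density inequality is integrated over the sphere, where divergences vanish
(`integralVol_divV`), and over time (`energyI_le`), then summed over the multi-indices
(`energy_le`). -/

noncomputable section
namespace BigCrunch

/-! ## Regularity on the slab `[0, T) × S3`, read off from homogeneous extensions -/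

/-- The radial projection of `R4` onto the unit sphere (with a dummy value at the origin). -/
def nrm (y : R4) : S3 :=
  if h : y = 0 then ⟨EuclideanSpace.single 0 1, by simp⟩
  else ⟨‖y‖⁻¹ • y, by simp [norm_smul, h]⟩

theorem nrm_val {y : R4} (h : y ≠ 0) : (nrm y : R4) = ‖y‖⁻¹ • y := by simp [nrm, h]

theorem S3.ne_zero (y : S3) : (y : R4) ≠ 0 := by
  intro h
  have : ‖(y : R4)‖ = 1 := by simp
  simp [h] at this

@[simp] theorem nrm_coe (y : S3) : nrm (y : R4) = y := by
  ext1
  rw [nrm_val y.ne_zero]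
  simp

theorem nrm_smul {c : ℝ} (hc : 0 < c) (y : R4) (h : y ≠ 0) : nrm (c • y) = nrm y := by
  ext1
  rw [nrm_val h, nrm_val (smul_ne_zero hc.ne' h), norm_smul, smul_smul, Real.norm_of_nonneg hc.le,
    mul_inv]
  congr 1
  field_simp

theorem frameVec_smul (A : Fin 3) (c : ℝ) (y : R4) : frameVec A (c • y) = c • frameVec A y := by
  ext i
  fin_cases A <;> fin_cases i <;> simp [frameVec, rot] <;> ring

theorem frameVec_add (A : Fin 3) (x y : R4) : frameVec A (x + y) = frameVec A x + frameVec A y := by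
  ext i
  fin_cases A <;> fin_cases i <;> simp [frameVec, rot] <;> ring

/-- `frameVec A` as a continuous linear map. -/
def frameL (A : Fin 3) : R4 →L[ℝ] R4 :=
  LinearMap.toContinuousLinearMap
    { toFun := frameVec A
      map_add' := frameVec_add A
      map_smul' := frameVec_smul A }

@[simp] theorem frameL_apply (A : Fin 3) (y : R4) : frameL A y = frameVec A y := rfl

theorem frameCurve_smul (A : Fin 3) (s c : ℝ) (y : R4) :
    frameCurve A s (c • y) = c • frameCurve A s y := by
  simp only [frameCurve, frameVec_smul, smul_add, smul_comm c]

theorem eq_norm_smul_nrm {y : R4} (h : y ≠ 0) : y = ‖y‖ • (nrm y : R4) := by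
  rw [nrm_val h, smul_smul, mul_inv_cancel₀ (norm_ne_zero_iff.2 h), one_smul]

theorem frameCurve_eq {y : R4} (h : y ≠ 0) (A : Fin 3) (s : ℝ) :
    frameCurve A s y = ‖y‖ • (frameFlow A s (nrm y) : R4) := by
  conv_lhs => rw [eq_norm_smul_nrm h, frameCurve_smul]
  rfl

theorem frameCurve_ne_zero {y : R4} (h : y ≠ 0) (A : Fin 3) (s : ℝ) : frameCurve A s y ≠ 0 := by
  rw [frameCurve_eq h]
  exact smul_ne_zero (norm_ne_zero_iff.2 h) (S3.ne_zero _)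

/-- Because the flow on R4 is linear and preserves rays, a homogeneous extension of degree zero
intertwines it with the flow on the sphere. Hence `Z A` becomes the directional derivative along
`frameVec A`, computed in a vector space. -/
theorem frameFlow_nrm {y : R4} (h : y ≠ 0) (A : Fin 3) (s : ℝ) :
    frameFlow A s (nrm y) = nrm (frameCurve A s y) := by
  rw [frameCurve_eq h, nrm_smul (norm_pos_iff.2 h) _ (S3.ne_zero _), nrm_coe]

theorem frameCurve_zero (A : Fin 3) (y : R4) : frameCurve A 0 y = y := by simp [frameCurve]

theorem frameFlow_zero (A : Fin 3) (y : S3) : frameFlow A 0 y = y := by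
  ext1; simp [frameFlow, frameCurve_zero]

theorem hasDerivAt_frameCurve (A : Fin 3) (y : R4) :
    HasDerivAt (fun s => frameCurve A s y) (frameVec A y) 0 := by
  have hd : HasDerivAt (fun r : ℝ => r / 3) (1 / 3) 0 := (hasDerivAt_id (0 : ℝ)).div_const 3
  have h1 := (hd.cos.smul_const y).add ((hd.sin.const_mul 3).smul_const (frameVec A y))
  refine h1.congr_deriv ?_
  simp

/-- Applying `frameVec A` twice is multiplication by −1/9, so the flow is exp(sJ/3) for a complex
structure J, and the group law is the addition theorem for sine and cosine. -/
theorem frameFlow_add (A : Fin 3) (r s : ℝ) (y : S3) :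
    frameFlow A (r + s) y = frameFlow A s (frameFlow A r y) := by
  ext1
  simp only [frameFlow, frameCurve, add_div, Real.cos_add, Real.sin_add]
  ext i
  fin_cases A <;> fin_cases i <;> simp [frameVec, rot] <;> ring

/-- The space-time region `[0, T) × (R4 ∖ 0)`. -/
def slab (T : ℝ) : Set (ℝ × R4) := Set.Ico 0 T ×ˢ {0}ᶜ

/-- The homogeneous extension of a function on `ℝ × S3`. -/
def hext (f : ℝ → S3 → ℝ) (p : ℝ × R4) : ℝ := f p.1 (nrm p.2)

/-- `f` is of class `C^r` on `[0, T) × S3`, in terms of its homogeneous extension. -/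
def Ck (r : ℕ) (T : ℝ) (f : ℝ → S3 → ℝ) : Prop := ContDiffOn ℝ r (hext f) (slab T)

theorem uniqueDiffOn_slab (T : ℝ) : UniqueDiffOn ℝ (slab T) :=
  (uniqueDiffOn_Ico 0 T).prod isOpen_compl_singleton.uniqueDiffOn

/-- Symmetry of second derivatives taken within the slab holds at points of the closure of its
interior; this covers the initial slice t = 0. -/
theorem slab_subset (T : ℝ) : slab T ⊆ closure (interior (slab T)) := by
  intro p hp
  have h0 : (0 : ℝ) < T := lt_of_le_of_lt hp.1.1 hp.1.2
  rw [slab, interior_prod_eq, closure_prod_eq, interior_Ico, closure_Ioo h0.ne,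
    isOpen_compl_singleton.interior_eq]
  exact ⟨⟨hp.1.1, hp.1.2.le⟩, subset_closure hp.2⟩

theorem mem_slab {T t : ℝ} (ht : t ∈ Set.Ico 0 T) {y : R4} (hy : y ≠ 0) : (t, y) ∈ slab T := ⟨ht, hy⟩

/-- Restricting the codomain to the sphere requires a map whose values all have norm one, hence the
detour through the open submanifold of nonzero vectors. -/
theorem contMDiffAt_nrm {y : R4} (hy : y ≠ 0) : ContMDiffAt 𝓘(ℝ, R4) (𝓡 3) ∞ nrm y := by
  let U : TopologicalSpace.Opens R4 := ⟨{0}ᶜ, isOpen_compl_singleton⟩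
  have key : ContMDiffAt 𝓘(ℝ, R4) (𝓡 3) ∞ (fun x : U => nrm (x : R4)) ⟨y, hy⟩ := by
    have hf : ContMDiff 𝓘(ℝ, R4) 𝓘(ℝ, R4) ∞ (fun x : U => ‖(x : R4)‖⁻¹ • (x : R4)) := by
      intro x
      have : ContMDiffAt 𝓘(ℝ, R4) 𝓘(ℝ, R4) ∞ (fun x : R4 => ‖x‖⁻¹ • x) (x : R4) := by
        apply ContDiffAt.contMDiffAt
        have hx : (x : R4) ≠ 0 := x.2
        exact ((contDiffAt_norm ℝ hx).inv (norm_ne_zero_iff.2 hx)).smul contDiffAt_id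
      exact (contMDiffAt_subtype_iff (U := U)
        (f := fun x : R4 => ‖x‖⁻¹ • x)).2 this
    have hm : ∀ x : U, ‖(x : R4)‖⁻¹ • (x : R4) ∈ Metric.sphere (0 : R4) 1 := fun x => by
      have hx : (x : R4) ≠ 0 := x.2
      simp [norm_smul, hx]
    have : Fact (Module.finrank ℝ R4 = 3 + 1) := ⟨finrank_euclideanSpace_fin⟩
    have := (hf.codRestrict_sphere (n := 3) hm) ⟨y, hy⟩
    refine this.congr_of_eventuallyEq (Filter.Eventually.of_forall fun x => ?_)
    ext1
    rw [nrm_val x.2]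
    rfl
  exact (contMDiffAt_subtype_iff (U := U)).1 key

/-- Composition with the smooth radial projection. From here on regularity is ordinary calculus on a
subset of ℝ × R4. -/
theorem IsCk.ck {r : ℕ} {T : ℝ} {f : ℝ → S3 → ℝ} (hf : IsCk r T f) : Ck r T f := by
  have h1 : ContMDiffOn (𝓘(ℝ, ℝ).prod 𝓘(ℝ, R4)) (𝓘(ℝ, ℝ).prod (𝓡 3)) (r : ℕ∞ω)
      (fun p : ℝ × R4 => (p.1, nrm p.2)) (slab T) := by
    intro p hp
    apply ContMDiffAt.contMDiffWithinAt
    refine contMDiffAt_fst.prodMk ?_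
    have := (contMDiffAt_nrm hp.2).of_le (n := (∞ : ℕ∞ω)) (m := (r : ℕ∞ω))
      (by exact_mod_cast le_top)
    exact this.comp p contMDiffAt_snd
  have h2 := ContMDiffOn.comp hf h1 (fun p hp => ⟨hp.1, Set.mem_univ _⟩)
  rw [← modelWithCornersSelf_prod, chartedSpaceSelf_prod, contMDiffOn_iff_contDiffOn] at h2
  exact h2

namespace Ck

variable {r : ℕ} {T : ℝ} {f g : ℝ → S3 → ℝ}

theorem of_le (hf : Ck r T f) {q : ℕ} (h : q ≤ r) : Ck q T f :=
  ContDiffOn.of_le hf (by exact_mod_cast h)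

theorem const (c : ℝ) : Ck r T fun _ _ => c := contDiffOn_const

theorem ofTime {h : ℝ → ℝ} (hh : ContDiffOn ℝ r h (Set.Ico 0 T)) : Ck r T fun t _ => h t :=
  ContDiffOn.comp hh contDiffOn_fst (fun _ hp => hp.1)

theorem add (hf : Ck r T f) (hg : Ck r T g) : Ck r T fun t y => f t y + g t y := ContDiffOn.add hf hg

theorem sub (hf : Ck r T f) (hg : Ck r T g) : Ck r T fun t y => f t y - g t y := ContDiffOn.sub hf hg

theorem mul (hf : Ck r T f) (hg : Ck r T g) : Ck r T fun t y => f t y * g t y := ContDiffOn.mul hf hg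

theorem neg (hf : Ck r T f) : Ck r T fun t y => -f t y := ContDiffOn.neg hf

theorem pow (hf : Ck r T f) (n : ℕ) : Ck r T fun t y => f t y ^ n := ContDiffOn.pow hf n

theorem sum {ι : Type*} {s : Finset ι} {F : ι → ℝ → S3 → ℝ} (h : ∀ i ∈ s, Ck r T (F i)) :
    Ck r T fun t y => ∑ i ∈ s, F i t y := ContDiffOn.sum h

theorem prod {ι : Type*} {s : Finset ι} {F : ι → ℝ → S3 → ℝ} (h : ∀ i ∈ s, Ck r T (F i)) :
    Ck r T fun t y => ∏ i ∈ s, F i t y := contDiffOn_prod h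

theorem inv (hf : Ck r T f) (h : ∀ t ∈ Set.Ico 0 T, ∀ y, f t y ≠ 0) :
    Ck r T fun t y => (f t y)⁻¹ := ContDiffOn.inv hf fun p hp => h p.1 hp.1 _

theorem sqrt (hf : Ck r T f) (h : ∀ t ∈ Set.Ico 0 T, ∀ y, f t y ≠ 0) :
    Ck r T fun t y => Real.sqrt (f t y) := ContDiffOn.sqrt hf fun p hp => h p.1 hp.1 _

/-- A time slice, regarded as a function that does not depend on time. -/
theorem slice (hf : Ck r T f) {t : ℝ} (ht : t ∈ Set.Ico 0 T) : Ck r 1 fun _ => f t :=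
  ContDiffOn.comp (g := hext f) (t := slab T) (f := fun p : ℝ × R4 => (t, p.2)) hf
    (contDiffOn_const.prodMk contDiffOn_snd) (fun _ hp => ⟨ht, hp.2⟩)

theorem continuousOn (hf : Ck r T f) :
    ContinuousOn (fun p : ℝ × S3 => f p.1 p.2) (Set.Ico 0 T ×ˢ Set.univ) := by
  have h1 : ContinuousOn (fun p : ℝ × S3 => ((p.1, (p.2 : R4)) : ℝ × R4))
      (Set.Ico 0 T ×ˢ Set.univ) := by fun_prop
  have := ContinuousOn.comp (ContDiffOn.continuousOn hf) h1 (fun p hp => ⟨hp.1, p.2.ne_zero⟩)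
  refine this.congr fun p _ => ?_
  simp [hext]

theorem differentiableWithinAt (hf : Ck (r + 1) T f) {p : ℝ × R4} (hp : p ∈ slab T) :
    DifferentiableWithinAt ℝ (hext f) (slab T) p :=
  ContDiffOn.differentiableOn hf (by simp) p hp

/-- The orbit `frameCurve A s y` at a fixed time stays in the slab for all s, so the derivative
within the slab suffices for a two-sided chain rule, also at t = 0. -/
theorem hasDerivAt_flow_hext (hf : Ck (r + 1) T f) {t : ℝ} (ht : t ∈ Set.Ico 0 T) {y : R4}
    (hy : y ≠ 0) (A : Fin 3) :
    HasDerivAt (fun s => f t (frameFlow A s (nrm y)))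
      (fderivWithin ℝ (hext f) (slab T) (t, y) (0, frameVec A y)) 0 := by
  have h1 := (hf.differentiableWithinAt (mem_slab ht hy)).hasFDerivWithinAt
  have h2 : HasDerivAt (fun s : ℝ => ((t, frameCurve A s y) : ℝ × R4)) (0, frameVec A y) 0 :=
    (hasDerivAt_const _ _).prodMk (hasDerivAt_frameCurve A y)
  have h3 := h1.comp_hasDerivWithinAt_of_eq (s := Set.univ) (x := 0) h2.hasDerivWithinAt
    (fun s _ => mem_slab ht (frameCurve_ne_zero hy A s)) (by simp [frameCurve_zero])
  rw [hasDerivWithinAt_univ] at h3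
  refine h3.congr_of_eventuallyEq (Filter.Eventually.of_forall fun s => ?_)
  simp [hext, frameFlow_nrm hy]

theorem hext_Z (hf : Ck (r + 1) T f) (A : Fin 3) {p : ℝ × R4} (hp : p ∈ slab T) :
    hext (fun t => BigCrunch.Z A (f t)) p
      = fderivWithin ℝ (hext f) (slab T) p (0, frameVec A p.2) :=
  (hf.hasDerivAt_flow_hext hp.1 hp.2 A).deriv

theorem Z (hf : Ck (r + 1) T f) (A : Fin 3) : Ck r T fun t => BigCrunch.Z A (f t) := by
  have h1 : ContDiffOn ℝ r (fderivWithin ℝ (hext f) (slab T)) (slab T) :=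
    ContDiffOn.fderivWithin hf (uniqueDiffOn_slab T) (by simp)
  have h2 : ContDiffOn ℝ r (fun p : ℝ × R4 => ((0, frameL A p.2) : ℝ × R4)) (slab T) :=
    contDiffOn_const.prodMk ((frameL A).contDiff.comp_contDiffOn contDiffOn_snd)
  exact (h1.clm_apply h2).congr fun p hp => hf.hext_Z A hp

theorem hasDerivAt_flow (hf : Ck (r + 1) T f) {t : ℝ} (ht : t ∈ Set.Ico 0 T) (A : Fin 3) (y : S3) :
    HasDerivAt (fun s => f t (frameFlow A s y)) (BigCrunch.Z A (f t) y) 0 := by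
  have h := hf.hasDerivAt_flow_hext ht y.ne_zero A
  rw [nrm_coe] at h
  exact h.differentiableAt.hasDerivAt

theorem hasDerivWithinAt_hext (hf : Ck (r + 1) T f) {p : ℝ × R4} (hp : p ∈ slab T) :
    HasDerivWithinAt (fun s => f s (nrm p.2))
      (fderivWithin ℝ (hext f) (slab T) p (1, 0)) (Set.Ici 0) p.1 := by
  have h1 := (hf.differentiableWithinAt hp).hasFDerivWithinAt
  have h2 : HasDerivAt (fun s : ℝ => ((s, p.2) : ℝ × R4)) (1, 0) p.1 :=
    (hasDerivAt_id _).prodMk (hasDerivAt_const _ _)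
  have h3 := h1.comp_hasDerivWithinAt_of_eq (s := Set.Ico 0 T) (x := p.1) h2.hasDerivWithinAt
    (fun s hs => mem_slab hs hp.2) rfl
  refine h3.mono_of_mem_nhdsWithin ?_
  exact mem_nhdsWithin.2 ⟨Set.Iio T, isOpen_Iio, hp.1.2, fun s hs => ⟨hs.2, hs.1⟩⟩

theorem hext_dt (hf : Ck (r + 1) T f) {p : ℝ × R4} (hp : p ∈ slab T) :
    hext (BigCrunch.dt f) p = fderivWithin ℝ (hext f) (slab T) p (1, 0) :=
  (hf.hasDerivWithinAt_hext hp).derivWithin ((uniqueDiffOn_Ici 0) _ hp.1.1)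

theorem dt (hf : Ck (r + 1) T f) : Ck r T (BigCrunch.dt f) := by
  have h1 : ContDiffOn ℝ r (fderivWithin ℝ (hext f) (slab T)) (slab T) :=
    ContDiffOn.fderivWithin hf (uniqueDiffOn_slab T) (by simp)
  exact (h1.clm_apply contDiffOn_const).congr fun p hp => hf.hext_dt hp

theorem hasDerivAt (hf : Ck (r + 1) T f) {t : ℝ} (ht : t ∈ Set.Ioo 0 T) (y : S3) :
    HasDerivAt (fun s => f s y) (BigCrunch.dt f t y) t := by
  have h := hf.hasDerivWithinAt_hext (mem_slab ⟨ht.1.le, ht.2⟩ y.ne_zero)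
  rw [nrm_coe] at h
  have h' := h.hasDerivAt (Ici_mem_nhds ht.1)
  have h2 := hf.hext_dt (mem_slab ⟨ht.1.le, ht.2⟩ y.ne_zero)
  simp only [hext, nrm_coe] at h2
  rwa [h2]

end Ck

theorem dt_eq {f : ℝ → S3 → ℝ} {t c : ℝ} {y : S3} (ht : 0 < t)
    (h : HasDerivAt (fun s => f s y) c t) : dt f t y = c :=
  h.hasDerivWithinAt.derivWithin ((uniqueDiffOn_Ici 0) _ ht.le)

/-- The commutator of two derivations `V`, `W` on a twice differentiable function. -/
theorem fderivWithin_comm {F : ℝ × R4 → ℝ} {T : ℝ} (hF : ContDiffOn ℝ 2 F (slab T))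
    {p : ℝ × R4} (hp : p ∈ slab T) {V W : ℝ × R4 → ℝ × R4} {V' W' : ℝ × R4 →L[ℝ] ℝ × R4}
    (hV : HasFDerivAt V V' p) (hW : HasFDerivAt W W' p) :
    fderivWithin ℝ (fun q => fderivWithin ℝ F (slab T) q (W q)) (slab T) p (V p)
      - fderivWithin ℝ (fun q => fderivWithin ℝ F (slab T) q (V q)) (slab T) p (W p)
      = fderivWithin ℝ F (slab T) p (W' (V p)) - fderivWithin ℝ F (slab T) p (V' (W p)) := by
  have hu := uniqueDiffOn_slab T p hp
  have h1 : ContDiffOn ℝ 1 (fderivWithin ℝ F (slab T)) (slab T) :=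
    ContDiffOn.fderivWithin hF (uniqueDiffOn_slab T) (by norm_num)
  have h2 := ((h1.differentiableOn (by simp)) p hp).hasFDerivWithinAt
  have hsymm := (hF p hp).isSymmSndFDerivWithinAt (by simp) (uniqueDiffOn_slab T)
    (slab_subset T hp) hp
  rw [(h2.clm_apply hW.hasFDerivWithinAt).fderivWithin hu,
    (h2.clm_apply hV.hasFDerivWithinAt).fderivWithin hu]
  have := hsymm (V p) (W p)
  simp only [add_apply, ContinuousLinearMap.comp_apply,
    ContinuousLinearMap.flip_apply]
  rw [this]
  ring

/-- The vector fields are linear, so their Lie bracket is the commutator of the matrices in reversed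
order; this fixes the sign of the structure constants. -/
theorem frameVec_bracket (A B : Fin 3) (y : R4) :
    frameVec B (frameVec A y) - frameVec A (frameVec B y)
      = ∑ C, ((2 / 3) * eps A B C) • frameVec C y := by
  ext i
  fin_cases A <;> fin_cases B <;> fin_cases i <;>
    simp [frameVec, rot, eps, Fin.sum_univ_three] <;> ring

theorem fderivWithin_congr_slab {F F' : ℝ × R4 → ℝ} {T : ℝ} {p : ℝ × R4} (hp : p ∈ slab T)
    (h : ∀ q ∈ slab T, F q = F' q) : fderivWithin ℝ F (slab T) p = fderivWithin ℝ F' (slab T) p :=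
  fderivWithin_congr h (h p hp)

/-- `[Z_A, Z_B] = (2/3) ε_{ABC} Z_C`. -/
theorem Z_comm {f : ℝ → S3 → ℝ} {T : ℝ} (hf : Ck 2 T f) {t : ℝ} (ht : t ∈ Set.Ico 0 T) (A B : Fin 3)
    (y : S3) :
    Z A (Z B (f t)) y - Z B (Z A (f t)) y = ∑ C, (2 / 3) * eps A B C * Z C (f t) y := by
  have hp := mem_slab ht y.ne_zero
  have hA := (hf.Z A).hext_Z (r := 0) B hp
  have hB := (hf.Z B).hext_Z (r := 0) A hp
  rw [fderivWithin_congr_slab hp fun q hq => hf.hext_Z A hq] at hA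
  rw [fderivWithin_congr_slab hp fun q hq => hf.hext_Z B hq] at hB
  have hL : ∀ C, HasFDerivAt (fun q : ℝ × R4 => ((0, frameVec C q.2) : ℝ × R4))
      ((0 : ℝ × R4 →L[ℝ] ℝ).prod ((frameL C).comp (ContinuousLinearMap.snd ℝ ℝ R4))) (t, (y : R4)) :=
    fun C => (hasFDerivAt_const _ _).prodMk ((frameL C).hasFDerivAt.comp _ hasFDerivAt_snd)
  have key := fderivWithin_comm hf hp (hL A) (hL B)
  simp only [hext, nrm_coe] at hA hB
  rw [hA, hB]
  refine key.trans ?_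
  have hC : ∀ C, Z C (f t) y = fderivWithin ℝ (hext f) (slab T) (t, (y : R4)) (0, frameVec C y) :=
    fun C => by
      have := hf.hext_Z C hp
      simpa only [hext, nrm_coe] using this
  simp only [hC, ContinuousLinearMap.prod_apply, ContinuousLinearMap.comp_apply, frameL_apply,
    ContinuousLinearMap.coe_snd', zero_apply]
  rw [← map_sub]
  simp only [← smul_eq_mul, ← map_smul, ← map_sum]
  congr 1
  ext1
  · simp [Prod.fst_sum]
  · simp only [Prod.snd_sub, Prod.snd_sum, Prod.smul_snd, frameVec_bracket, smul_eq_mul]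

/-- The fields ∂_t and Z_A commute, since the frame does not depend on time: both bracket terms of
`fderivWithin_comm` vanish. -/
theorem dt_Z {f : ℝ → S3 → ℝ} {T : ℝ} (hf : Ck 2 T f) {t : ℝ} (ht : t ∈ Set.Ico 0 T) (A : Fin 3)
    (y : S3) : dt (fun s => Z A (f s)) t y = Z A (dt f t) y := by
  have hp := mem_slab ht y.ne_zero
  have hA := (hf.Z A).hext_dt (r := 0) hp
  have hB := (hf.dt).hext_Z (r := 0) A hp
  rw [fderivWithin_congr_slab hp fun q hq => hf.hext_Z A hq] at hA
  rw [fderivWithin_congr_slab hp fun q hq => hf.hext_dt hq] at hB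
  have hL : HasFDerivAt (fun q : ℝ × R4 => ((0, frameVec A q.2) : ℝ × R4))
      ((0 : ℝ × R4 →L[ℝ] ℝ).prod ((frameL A).comp (ContinuousLinearMap.snd ℝ ℝ R4))) (t, (y : R4)) :=
    (hasFDerivAt_const _ _).prodMk ((frameL A).hasFDerivAt.comp _ hasFDerivAt_snd)
  have hM : HasFDerivAt (fun _ : ℝ × R4 => ((1, 0) : ℝ × R4)) (0 : ℝ × R4 →L[ℝ] ℝ × R4)
      (t, (y : R4)) := hasFDerivAt_const _ _
  have key := fderivWithin_comm hf hp hL hM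
  simp only [hext, nrm_coe] at hA hB
  rw [hA, hB]
  simp only [zero_apply, map_zero, ContinuousLinearMap.prod_apply,
    ContinuousLinearMap.comp_apply, ContinuousLinearMap.coe_snd'] at key
  have h00 : ((0, 0) : ℝ × R4) = 0 := rfl
  rw [h00, map_zero, sub_zero] at key
  linarith

/-! ## Functions on a time slice -/

/-- `f` is of class `C^r` on the sphere. -/
def Sm (r : ℕ) (f : S3 → ℝ) : Prop := Ck r 1 fun _ => f

namespace Sm

variable {r : ℕ} {f g : S3 → ℝ}

theorem of_le (hf : Sm r f) {q : ℕ} (h : q ≤ r) : Sm q f := Ck.of_le hf h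

theorem const (c : ℝ) : Sm r fun _ => c := Ck.const c

theorem add (hf : Sm r f) (hg : Sm r g) : Sm r fun y => f y + g y := Ck.add hf hg

theorem sub (hf : Sm r f) (hg : Sm r g) : Sm r fun y => f y - g y := Ck.sub hf hg

theorem mul (hf : Sm r f) (hg : Sm r g) : Sm r fun y => f y * g y := Ck.mul hf hg

theorem sum {ι : Type*} {s : Finset ι} {F : ι → S3 → ℝ} (h : ∀ i ∈ s, Sm r (F i)) :
    Sm r fun y => ∑ i ∈ s, F i y := Ck.sum (F := fun i _ => F i) h

theorem Z (hf : Sm (r + 1) f) (A : Fin 3) : Sm r (Z A f) := Ck.Z hf A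

theorem continuous (hf : Sm r f) : Continuous f := by
  have h1 : Continuous fun y : S3 => ((0 : ℝ), y) := by fun_prop
  have := ContinuousOn.comp_continuous (Ck.continuousOn hf) h1
    (fun y => ⟨⟨le_rfl, one_pos⟩, Set.mem_univ _⟩)
  exact this

theorem hasDerivAt (hf : Sm (r + 1) f) (A : Fin 3) (y : S3) :
    HasDerivAt (fun s => f (frameFlow A s y)) (BigCrunch.Z A f y) 0 :=
  Ck.hasDerivAt_flow hf ⟨le_rfl, one_pos⟩ A y

theorem Z_comm (hf : Sm 2 f) (A B : Fin 3) (y : S3) :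
    BigCrunch.Z A (BigCrunch.Z B f) y - BigCrunch.Z B (BigCrunch.Z A f) y
      = ∑ C, (2 / 3) * eps A B C * BigCrunch.Z C f y :=
  BigCrunch.Z_comm (f := fun _ => f) hf ⟨le_rfl, one_pos⟩ A B y

end Sm

theorem Ck.sm {r : ℕ} {T : ℝ} {f : ℝ → S3 → ℝ} (hf : Ck r T f) {t : ℝ} (ht : t ∈ Set.Ico 0 T) :
    Sm r (f t) := hf.slice ht

theorem Z_eq {A : Fin 3} {f : S3 → ℝ} {y : S3} {c : ℝ}
    (h : HasDerivAt (fun s => f (frameFlow A s y)) c 0) : Z A f y = c := h.deriv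

section rules

variable {f g : S3 → ℝ} (A : Fin 3) (y : S3)

@[simp] theorem Z_const (c : ℝ) : Z A (fun _ => c) y = 0 := by simp [Z]

theorem Z_add (hf : Sm 1 f) (hg : Sm 1 g) : Z A (fun x => f x + g x) y = Z A f y + Z A g y :=
  Z_eq ((hf.hasDerivAt (r := 0) A y).add (hg.hasDerivAt (r := 0) A y))

theorem Z_mul (hf : Sm 1 f) (hg : Sm 1 g) :
    Z A (fun x => f x * g x) y = Z A f y * g y + f y * Z A g y := by
  have := (hf.hasDerivAt (r := 0) A y).mul (hg.hasDerivAt (r := 0) A y)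
  simp only [frameFlow_zero] at this
  exact Z_eq this

theorem Z_const_mul (c : ℝ) (hf : Sm 1 f) : Z A (fun x => c * f x) y = c * Z A f y :=
  Z_eq ((hf.hasDerivAt (r := 0) A y).const_mul c)

theorem Z_sum {ι : Type*} {s : Finset ι} {F : ι → S3 → ℝ} (h : ∀ i ∈ s, Sm 1 (F i)) :
    Z A (fun x => ∑ i ∈ s, F i x) y = ∑ i ∈ s, Z A (F i) y :=
  Z_eq (HasDerivAt.fun_sum fun i hi => (h i hi).hasDerivAt (r := 0) A y)

end rules

/-! ## Integration on the sphere -/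

instance : IsFiniteMeasure roundVol := by
  unfold roundVol
  exact MeasureTheory.Measure.smul_finite _ (by norm_num)

theorem frameCurve_add (A : Fin 3) (s : ℝ) (x y : R4) :
    frameCurve A s (x + y) = frameCurve A s x + frameCurve A s y := by
  simp only [frameCurve, frameVec_add, smul_add]
  abel

theorem norm_frameCurve (A : Fin 3) (s : ℝ) (y : R4) : ‖frameCurve A s y‖ = ‖y‖ := by
  by_cases h : y = 0
  · subst h
    have h0 : frameVec A 0 = 0 := (frameL A).map_zero
    simp [frameCurve, h0]
  · rw [frameCurve_eq h, norm_smul]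
    simp

/-- The flow of a frame field as a rotation of `R4`. -/
def frameRot (A : Fin 3) (s : ℝ) : R4 ≃ₗᵢ[ℝ] R4 :=
  LinearIsometry.toLinearIsometryEquiv
    { toFun := frameCurve A s
      map_add' := frameCurve_add A s
      map_smul' := fun c y => frameCurve_smul A s c y
      norm_map' := norm_frameCurve A s } rfl

theorem frameRot_apply (A : Fin 3) (s : ℝ) (y : R4) : frameRot A s y = frameCurve A s y := rfl

theorem continuous_frameFlow (A : Fin 3) (s : ℝ) : Continuous (frameFlow A s) := by
  refine Continuous.subtype_mk ?_ _
  exact (frameRot A s).continuous.comp continuous_subtype_val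

/-- The surface measure is defined through the volume of cones, and the cone over a preimage is the
preimage of the cone under the linear rotation `frameRot`, which preserves Lebesgue measure. -/
theorem measurePreserving_frameFlow (A : Fin 3) (s : ℝ) :
    MeasurePreserving (frameFlow A s) roundVol roundVol := by
  refine MeasurePreserving.smul_measure (μa := (volume : Measure R4).toSphere)
    (μb := (volume : Measure R4).toSphere) ?_ _
  refine ⟨(continuous_frameFlow A s).measurable, ?_⟩
  ext U hU
  have hU' := (continuous_frameFlow A s).measurable hU
  rw [Measure.map_apply (continuous_frameFlow A s).measurable hU, Measure.toSphere_apply' _ hU,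
    Measure.toSphere_apply' _ hU']
  congr 1
  conv_rhs => rw [← (frameRot A s).measurePreserving.measure_preimage_emb
    (frameRot A s).toHomeomorph.measurableEmbedding]
  congr 1
  ext y
  simp only [Set.mem_smul, Set.mem_image, Set.mem_preimage]
  constructor
  · rintro ⟨c, hc, _, ⟨u, hu, rfl⟩, rfl⟩
    refine ⟨c, hc, _, ⟨_, hu, rfl⟩, ?_⟩
    rw [frameRot_apply, frameCurve_smul]
    rfl
  · rintro ⟨c, hc, _, ⟨u, hu, rfl⟩, h⟩
    have hy : y = c • (frameRot A s).symm u := by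
      rw [← map_smul, h, LinearIsometryEquiv.symm_apply_apply]
    have hm : (frameRot A s).symm u ∈ Metric.sphere (0 : R4) 1 := by simp
    refine ⟨c, hc, _, ⟨⟨_, hm⟩, ?_, rfl⟩, hy.symm⟩
    have : frameFlow A s ⟨_, hm⟩ = u := by
      ext1
      exact (frameRot A s).apply_symm_apply u
    rwa [this]

theorem integral_frameFlow (A : Fin 3) (s : ℝ) {f : S3 → ℝ} (hf : Continuous f) :
    ∫ y, f (frameFlow A s y) ∂roundVol = ∫ y, f y ∂roundVol := by
  have h := measurePreserving_frameFlow A s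
  conv_rhs => rw [← h.map_eq]
  rw [integral_map h.measurable.aemeasurable hf.aestronglyMeasurable]

theorem integrable_of_continuous {f : S3 → ℝ} (hf : Continuous f) : Integrable f roundVol :=
  hf.integrable_of_hasCompactSupport (HasCompactSupport.of_compactSpace f)

theorem exists_bound {f : S3 → ℝ} (hf : Continuous f) : ∃ C, ∀ y, |f y| ≤ C := by
  obtain ⟨C, hC⟩ := isCompact_univ.exists_bound_of_continuousOn hf.continuousOn
  exact ⟨C, fun y => hC y (Set.mem_univ y)⟩

/-- The frame fields are divergence free for the round volume. -/
theorem integral_Z (A : Fin 3) {f : S3 → ℝ} (hf : Sm 1 f) : ∫ y, Z A f y ∂roundVol = 0 := by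
  have hZ : Continuous (Z A f) := (hf.Z (r := 0) A).continuous
  obtain ⟨C, hC⟩ := exists_bound hZ
  -- By invariance of the measure the integral of f along the flow is constant in s; its derivative
  -- at s = 0 is the integral of `Z A f`.
  have key := hasDerivAt_integral_of_dominated_loc_of_deriv_le (μ := roundVol) (x₀ := (0 : ℝ))
    (s := Set.univ) (F := fun s y => f (frameFlow A s y)) (F' := fun s y => Z A f (frameFlow A s y))
    (bound := fun _ => C) Filter.univ_mem
    (Filter.Eventually.of_forall fun s =>
      (hf.continuous.comp (continuous_frameFlow A s)).aestronglyMeasurable)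
    (integrable_of_continuous (hf.continuous.comp (continuous_frameFlow A 0)))
    (hZ.comp (continuous_frameFlow A 0)).aestronglyMeasurable
    (Filter.Eventually.of_forall fun y s _ => hC _) (integrable_const C)
    (Filter.Eventually.of_forall fun y s _ => by
      have h1 := hf.hasDerivAt (r := 0) A (frameFlow A s y)
      have h2 := HasDerivAt.comp_sub_const (f := fun r => f (frameFlow A r (frameFlow A s y)))
        s s (by rwa [sub_self])
      refine h2.congr_of_eventuallyEq (Filter.Eventually.of_forall fun r => ?_)
      simp only [← frameFlow_add, add_sub_cancel])
  have h2 := key.2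
  simp only [integral_frameFlow A _ hf.continuous, frameFlow_zero] at h2
  exact h2.unique (hasDerivAt_const _ _)

theorem Ck.continuousOn_integral {T τ : ℝ} {f : ℝ → S3 → ℝ} (hf : Ck 0 T f) (hτ0 : 0 ≤ τ)
    (hτ : τ < T) : ContinuousOn (fun t => ∫ y, f t y ∂roundVol) (Set.Icc 0 τ) := by
  -- Freezing the time outside [0, τ] by projection makes the integrand continuous on all of ℝ × S3.
  have hc : Continuous (Function.uncurry fun (s : ℝ) (y : S3) => f (Set.projIcc 0 τ hτ0 s) y) := by
    have h1 : Continuous fun p : ℝ × S3 => (((Set.projIcc 0 τ hτ0 p.1 : ℝ), p.2) : ℝ × S3) := by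
      fun_prop
    exact hf.continuousOn.comp_continuous h1 fun p =>
      ⟨⟨(Set.projIcc 0 τ hτ0 p.1).2.1, lt_of_le_of_lt (Set.projIcc 0 τ hτ0 p.1).2.2 hτ⟩,
        Set.mem_univ _⟩
  have h2 := continuous_parametric_integral_of_continuous (μ := roundVol) hc isCompact_univ
  simp only [Measure.restrict_univ] at h2
  refine h2.continuousOn.congr fun t ht => ?_
  simp only [Set.projIcc_of_mem hτ0 ht]

theorem Ck.hasDerivAt_integral {T t : ℝ} {f : ℝ → S3 → ℝ} (hf : Ck 1 T f) (ht : t ∈ Set.Ioo 0 T) :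
    HasDerivAt (fun t => ∫ y, f t y ∂roundVol) (∫ y, BigCrunch.dt f t y ∂roundVol) t := by
  have hd : Ck 0 T (BigCrunch.dt f) := Ck.dt hf
  obtain ⟨l, hl0, hlt⟩ := exists_between ht.1
  obtain ⟨u, hut, huT⟩ := exists_between ht.2
  have hsub : Set.Icc l u ×ˢ (Set.univ : Set S3) ⊆ Set.Ico 0 T ×ˢ Set.univ :=
    Set.prod_mono (fun s hs => ⟨hl0.le.trans hs.1, hs.2.trans_lt huT⟩) le_rfl
  obtain ⟨C, hC⟩ := (isCompact_Icc.prod isCompact_univ).exists_bound_of_continuousOn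
    (hd.continuousOn.mono hsub)
  have hI : ∀ s ∈ Set.Icc l u, s ∈ Set.Ico 0 T := fun s hs => ⟨hl0.le.trans hs.1, hs.2.trans_lt huT⟩
  exact (hasDerivAt_integral_of_dominated_loc_of_deriv_le (μ := roundVol)
    (s := Set.Icc l u) (bound := fun _ => C) (Icc_mem_nhds hlt hut)
    (Filter.eventually_of_mem (Icc_mem_nhds hlt hut) fun s hs =>
      (hf.sm (hI s hs)).continuous.aestronglyMeasurable)
    (integrable_of_continuous (hf.sm (hI t ⟨hlt.le, hut.le⟩)).continuous)
    (hd.sm (hI t ⟨hlt.le, hut.le⟩)).continuous.aestronglyMeasurable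
    (Filter.Eventually.of_forall fun y s hs => hC (s, y) ⟨hs, Set.mem_univ _⟩) (integrable_const C)
    (Filter.Eventually.of_forall fun y s hs =>
      hf.hasDerivAt (r := 0) ⟨hl0.trans_le hs.1, hs.2.trans_lt huT⟩ y)).2

/-! ## Sums over splittings of a multi-index -/

section sum2

variable {I : List (Fin 3)} {F F' : List (Fin 3) → List (Fin 3) → ℝ}

@[simp] theorem sum2_nil : sum2 [] F = F [] [] := by simp [sum2, split2]

theorem sum2_cons (i : Fin 3) :
    sum2 (i :: I) F = sum2 I fun I₁ I₂ => F (i :: I₁) I₂ + F I₁ (i :: I₂) := by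
  simp only [sum2, split2]
  induction split2 I with
  | nil => simp
  | cons p L ih =>
    simp only [List.flatMap_cons, List.map_append, List.sum_append, ih, List.map_cons,
      List.sum_cons, List.map_nil, List.sum_nil]
    ring

/-- The length identity is the information about the parts that the later arguments need: it bounds
the order of every factor by the order of I, and so supplies the regularity hypotheses. -/
theorem sum2_congr (h : ∀ I₁ I₂, I₁.length + I₂.length = I.length → F I₁ I₂ = F' I₁ I₂) :
    sum2 I F = sum2 I F' := by
  induction I generalizing F F' with
  | nil => simpa using h [] [] rfl
  | cons i I ih =>
    rw [sum2_cons, sum2_cons]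
    refine ih fun I₁ I₂ hl => ?_
    rw [h (i :: I₁) I₂ (by simp; omega), h I₁ (i :: I₂) (by simp; omega)]

theorem sum2_add : sum2 I (fun I₁ I₂ => F I₁ I₂ + F' I₁ I₂) = sum2 I F + sum2 I F' :=
  List.sum_map_add

theorem sum2_mul_left (c : ℝ) : sum2 I (fun I₁ I₂ => c * F I₁ I₂) = c * sum2 I F :=
  List.sum_map_mul_left _ _ _

@[simp] theorem sum2_zero : sum2 I (fun _ _ => 0) = 0 := by simp [sum2]

theorem sum2_finset_sum {ι : Type*} {s : Finset ι} {H : ι → List (Fin 3) → List (Fin 3) → ℝ} :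
    sum2 I (fun I₁ I₂ => ∑ i ∈ s, H i I₁ I₂) = ∑ i ∈ s, sum2 I (H i) := by
  classical
  induction s using Finset.induction_on with
  | empty => simp
  | insert i s hi ih => simp only [Finset.sum_insert hi, sum2_add, ih]

/-- Exactly one distribution of the positions gives the first part full length, namely all of I, so
only the term (I, []) survives. -/
theorem sum2_full_left : sum2 I (fun I₁ I₂ => if I₁.length < I.length then 0 else F I₁ I₂)
    = F I [] := by
  induction I generalizing F with
  | nil => simp
  | cons i I ih =>
    rw [sum2_cons, ← ih (F := fun I₁ I₂ => F (i :: I₁) I₂)]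
    refine sum2_congr fun I₁ I₂ hl => ?_
    have h1 : I₁.length < I.length + 1 := by omega
    simp only [List.length_cons, h1, if_true, add_zero, Nat.add_lt_add_iff_right]

theorem sum2_full_right : sum2 I (fun I₁ I₂ => if I₂.length < I.length then 0 else F I₁ I₂)
    = F [] I := by
  induction I generalizing F with
  | nil => simp
  | cons i I ih =>
    rw [sum2_cons, ← ih (F := fun I₁ I₂ => F I₁ (i :: I₂))]
    refine sum2_congr fun I₁ I₂ hl => ?_
    have h1 : I₂.length < I.length + 1 := by omega
    simp only [List.length_cons, h1, if_true, zero_add, Nat.add_lt_add_iff_right]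

/-- Isolating the splitting that gives everything to the first part. -/
theorem sum2_eq_left :
    sum2 I F = F I [] + sum2 I fun I₁ I₂ => if I₁.length < I.length then F I₁ I₂ else 0 := by
  rw [← sum2_full_left (F := F), ← sum2_add]
  refine sum2_congr fun I₁ I₂ _ => ?_
  split_ifs <;> simp

/-- Isolating the splitting that gives everything to the second part. -/
theorem sum2_eq_right :
    sum2 I F = F [] I + sum2 I fun I₁ I₂ => if I₂.length < I.length then F I₁ I₂ else 0 := by
  rw [← sum2_full_right (F := F), ← sum2_add]
  refine sum2_congr fun I₁ I₂ _ => ?_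
  split_ifs <;> simp

theorem Ck.sum2 {r : ℕ} {T : ℝ} {H : List (Fin 3) → List (Fin 3) → ℝ → S3 → ℝ}
    (h : ∀ I₁ I₂, I₁.length + I₂.length = I.length → Ck r T (H I₁ I₂)) :
    Ck r T fun t y => BigCrunch.sum2 I fun I₁ I₂ => H I₁ I₂ t y := by
  induction I generalizing H with
  | nil => simpa using h [] [] rfl
  | cons i I ih =>
    simp only [sum2_cons]
    exact ih (H := fun I₁ I₂ t y => H (i :: I₁) I₂ t y + H I₁ (i :: I₂) t y) fun I₁ I₂ hl =>
      (h (i :: I₁) I₂ (by simp; omega)).add (h I₁ (i :: I₂) (by simp; omega))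

theorem Z_sum2 (A : Fin 3) (y : S3) {H : List (Fin 3) → List (Fin 3) → S3 → ℝ}
    (h : ∀ I₁ I₂, I₁.length + I₂.length = I.length → Sm 1 (H I₁ I₂)) :
    Z A (fun x => sum2 I fun I₁ I₂ => H I₁ I₂ x) y = sum2 I fun I₁ I₂ => Z A (H I₁ I₂) y := by
  induction I generalizing H with
  | nil => simp
  | cons i I ih =>
    have h1 : ∀ I₁ I₂, I₁.length + I₂.length = I.length → Sm 1 (H (i :: I₁) I₂) := fun I₁ I₂ hl =>
      h (i :: I₁) I₂ (by simp; omega)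
    have h2 : ∀ I₁ I₂, I₁.length + I₂.length = I.length → Sm 1 (H I₁ (i :: I₂)) := fun I₁ I₂ hl =>
      h I₁ (i :: I₂) (by simp; omega)
    simp only [sum2_cons]
    rw [ih (H := fun I₁ I₂ x => H (i :: I₁) I₂ x + H I₁ (i :: I₂) x) fun I₁ I₂ hl =>
      (h1 I₁ I₂ hl).add (h2 I₁ I₂ hl)]
    exact sum2_congr fun I₁ I₂ hl => Z_add A y (h1 I₁ I₂ hl) (h2 I₁ I₂ hl)

end sum2

/-! ## Derivations of the tensor algebra -/

section der

variable {l m : ℕ}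

/-- A time-dependent tensor field with components of class `C^r`. -/
def TCk (r : ℕ) (T : ℝ) (ξ : ℝ → Tensor l m) : Prop := ∀ a b, Ck r T fun t y => ξ t y a b

/-- A tensor field on the sphere with components of class `C^r`. -/
def TSm (r : ℕ) (ξ : Tensor l m) : Prop := ∀ a b, Sm r fun y => ξ y a b

theorem TCk.sm {r : ℕ} {T : ℝ} {ξ : ℝ → Tensor l m} (h : TCk r T ξ) {t : ℝ}
    (ht : t ∈ Set.Ico 0 T) : TSm r (ξ t) := fun a b => (h a b).sm ht

theorem TCk.of_le {r : ℕ} {T : ℝ} {ξ : ℝ → Tensor l m} (h : TCk r T ξ) {q : ℕ} (hq : q ≤ r) :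
    TCk q T ξ := fun a b => (h a b).of_le hq

theorem TSm.of_le {r : ℕ} {ξ : Tensor l m} (h : TSm r ξ) {q : ℕ} (hq : q ≤ r) :
    TSm q ξ := fun a b => (h a b).of_le hq

/-- The derivation of the tensor algebra that is `Z_A` on functions and is given by the connection
matrix `Γ` on the frame. -/
def der (A : Fin 3) (Γ : S3 → Matrix (Fin 3) (Fin 3) ℝ) (ξ : Tensor l m) : Tensor l m := fun y a b =>
  Z A (fun x => ξ x a b) y
    + ∑ i, ∑ D, Γ y (a i) D * ξ y (Function.update a i D) b
    - ∑ j, ∑ D, Γ y D (b j) * ξ y a (Function.update b j D)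

/-- The matrix of the Lie derivative along `Z_A` in the frame. -/
def lieMat (A : Fin 3) : Matrix (Fin 3) (Fin 3) ℝ := fun i D => (2 / 3) * eps A D i

/-- The matrix of the covariant derivative in the direction `Z_c`. -/
def chrMat (G : Metric3) (c : Fin 3) (y : S3) : Matrix (Fin 3) (Fin 3) ℝ := fun i D => chr G y c i D

/-- Lie and covariant derivatives differ only in the connection matrix. Each Leibniz rule is
therefore proved once, for an arbitrary matrix Γ, and used for both. -/
theorem lie_eq_der (A : Fin 3) (ξ : Tensor l m) : lie A ξ = der A (fun _ => lieMat A) ξ := rfl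

theorem cov_eq_der (G : Metric3) (ξ : Tensor l m) (y : S3) (a : Fin l → Fin 3)
    (b : Fin (m + 1) → Fin 3) :
    cov G ξ y a b = der (b 0) (chrMat G (b 0)) ξ y a (Fin.tail b) := rfl

theorem TCk.der {r : ℕ} {T : ℝ} {ξ : ℝ → Tensor l m} (h : TCk (r + 1) T ξ) (A : Fin 3)
    {Γ : ℝ → S3 → Matrix (Fin 3) (Fin 3) ℝ} (hΓ : ∀ i j, Ck r T fun t y => Γ t y i j) :
    TCk r T fun t => der A (Γ t) (ξ t) := fun a b =>
  (((h a b).Z A).add (Ck.sum fun i _ => Ck.sum fun D _ =>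
    (hΓ _ _).mul ((h _ _).of_le (Nat.le_succ r)))).sub
    (Ck.sum fun i _ => Ck.sum fun D _ => (hΓ _ _).mul ((h _ _).of_le (Nat.le_succ r)))

theorem TCk.lie {r : ℕ} {T : ℝ} {ξ : ℝ → Tensor l m} (h : TCk (r + 1) T ξ) (A : Fin 3) :
    TCk r T fun t => lie A (ξ t) :=
  h.der A (Γ := fun _ _ => lieMat A) fun _ _ => Ck.const _

theorem TCk.lieI {r : ℕ} {T : ℝ} {ξ : ℝ → Tensor l m} {I : List (Fin 3)}
    (h : TCk (r + I.length) T ξ) : TCk r T fun t => lieI I (ξ t) := by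
  induction I generalizing r with
  | nil => exact h
  | cons A I ih => exact TCk.lie (ih (r := r + 1) (h.of_le (by simp; omega))) A

theorem TSm.lieI {r : ℕ} {ξ : Tensor l m} {I : List (Fin 3)} (h : TSm (r + I.length) ξ) :
    TSm r (lieI I ξ) :=
  TCk.lieI (ξ := fun _ => ξ) h

theorem lieI_cons (A : Fin 3) (I : List (Fin 3)) (ξ : Tensor l m) :
    lieI (A :: I) ξ = lie A (lieI I ξ) := rfl

@[simp] theorem lieI_nil (ξ : Tensor l m) : lieI [] ξ = ξ := rfl

theorem ZI_cons (A : Fin 3) (I : List (Fin 3)) (f : S3 → ℝ) : ZI (A :: I) f = Z A (ZI I f) := rfl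

theorem Ck.ZI {r : ℕ} {T : ℝ} {f : ℝ → S3 → ℝ} {I : List (Fin 3)} (h : Ck (r + I.length) T f) :
    Ck r T fun t => ZI I (f t) := by
  induction I generalizing r with
  | nil => exact h
  | cons A I ih => exact Ck.Z (ih (r := r + 1) (h.of_le (by simp; omega))) A

theorem Sm.ZI {r : ℕ} {f : S3 → ℝ} {I : List (Fin 3)} (h : Sm (r + I.length) f) :
    Sm r (ZI I f) := Ck.ZI (f := fun _ => f) h

theorem lie_ofScalar (A : Fin 3) (f : S3 → ℝ) : lie A (ofScalar f) = ofScalar (Z A f) := by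
  funext y a b
  simp [lie, ofScalar]

theorem lieI_ofScalar (I : List (Fin 3)) (f : S3 → ℝ) : lieI I (ofScalar f) = ofScalar (ZI I f) := by
  induction I with
  | nil => rfl
  | cons A I ih => rw [lieI_cons, ih, lie_ofScalar, ZI_cons]

theorem der_add (A : Fin 3) (Γ : S3 → Matrix (Fin 3) (Fin 3) ℝ) {ξ η : Tensor l m} (hξ : TSm 1 ξ)
    (hη : TSm 1 η) : der A Γ (ξ + η) = der A Γ ξ + der A Γ η := by
  funext y a b
  have := Z_add A y (hξ a b) (hη a b)
  simp only [der, Pi.add_apply, mul_add, Finset.sum_add_distrib]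
  rw [this]
  ring

theorem der_smul (A : Fin 3) (Γ : S3 → Matrix (Fin 3) (Fin 3) ℝ) (c : ℝ) {ξ : Tensor l m}
    (hξ : TSm 1 ξ) : der A Γ (c • ξ) = c • der A Γ ξ := by
  funext y a b
  have := Z_const_mul A y c (hξ a b)
  simp only [der, Pi.smul_apply, smul_eq_mul, this, mul_left_comm _ c, ← Finset.mul_sum]
  ring

theorem TSm.add {r : ℕ} {ξ η : Tensor l m} (hξ : TSm r ξ) (hη : TSm r η) : TSm r (ξ + η) :=
  fun a b => (hξ a b).add (hη a b)

theorem TSm.smul {r : ℕ} {ξ : Tensor l m} (hξ : TSm r ξ) (c : ℝ) : TSm r (c • ξ) :=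
  fun a b => (Sm.const c).mul (hξ a b)

theorem lieI_add {I : List (Fin 3)} {ξ η : Tensor l m} (hξ : TSm I.length ξ)
    (hη : TSm I.length η) : lieI I (ξ + η) = lieI I ξ + lieI I η := by
  induction I with
  | nil => rfl
  | cons A I ih =>
    rw [lieI_cons, ih (hξ.of_le (by simp)) (hη.of_le (by simp)), lie_eq_der, der_add]
    · rfl
    · exact TSm.lieI (hξ.of_le (by simp; omega))
    · exact TSm.lieI (hη.of_le (by simp; omega))

theorem lieI_smul {I : List (Fin 3)} (c : ℝ) {ξ : Tensor l m} (hξ : TSm I.length ξ) :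
    lieI I (c • ξ) = c • lieI I ξ := by
  induction I with
  | nil => rfl
  | cons A I ih =>
    rw [lieI_cons, ih (hξ.of_le (by simp)), lie_eq_der, der_smul]
    · rfl
    · exact TSm.lieI (hξ.of_le (by simp; omega))

theorem ZI_eq_lieI (I : List (Fin 3)) (f : S3 → ℝ) (y : S3) :
    ZI I f y = lieI I (ofScalar f) y ![] ![] := by rw [lieI_ofScalar]; rfl

theorem TSm.ofScalar {r : ℕ} {f : S3 → ℝ} (h : Sm r f) : TSm r (ofScalar f) := fun _ _ => h

/-! ### Components -/

section components

variable (A : Fin 3) (Γ : S3 → Matrix (Fin 3) (Fin 3) ℝ) (y : S3)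

theorem update_vec1 (i D : Fin 3) : Function.update ![i] 0 D = ![D] := by
  funext k; fin_cases k; rfl

theorem update_vec2_zero (i j D : Fin 3) : Function.update ![i, j] 0 D = ![D, j] := by
  funext k; fin_cases k <;> rfl

theorem update_vec2_one (i j D : Fin 3) : Function.update ![i, j] 1 D = ![i, D] := by
  funext k; fin_cases k <;> rfl

theorem vec1_eta (b : Fin 1 → Fin 3) : ![b 0] = b := by funext k; fin_cases k; rfl

theorem vec2_eta (b : Fin 2 → Fin 3) : ![b 0, b 1] = b := by funext k; fin_cases k <;> rfl

theorem vec3_eta (b : Fin 3 → Fin 3) : ![b 0, b 1, b 2] = b := by funext k; fin_cases k <;> rfl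

theorem vec0_eq (a : Fin 0 → Fin 3) : a = ![] := Subsingleton.elim _ _

theorem der_00 (f : Tensor 0 0) : der A Γ f y ![] ![] = Z A (fun x => f x ![] ![]) y := by
  simp [der]

theorem der_01 (ψ : Tensor 0 1) (j : Fin 3) :
    der A Γ ψ y ![] ![j] = Z A (fun x => ψ x ![] ![j]) y - ∑ D, Γ y D j * ψ y ![] ![D] := by
  simp [der, update_vec1]

theorem der_10 (v : Tensor 1 0) (i : Fin 3) :
    der A Γ v y ![i] ![] = Z A (fun x => v x ![i] ![]) y + ∑ D, Γ y i D * v y ![D] ![] := by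
  simp [der, update_vec1]

theorem der_11 (x : Tensor 1 1) (i j : Fin 3) :
    der A Γ x y ![i] ![j] = Z A (fun z => x z ![i] ![j]) y + ∑ D, Γ y i D * x y ![D] ![j]
      - ∑ D, Γ y D j * x y ![i] ![D] := by
  simp [der, update_vec1]

theorem der_02 (h : Tensor 0 2) (i j : Fin 3) :
    der A Γ h y ![] ![i, j] = Z A (fun z => h z ![] ![i, j]) y - ∑ D, Γ y D i * h y ![] ![D, j]
      - ∑ D, Γ y D j * h y ![] ![i, D] := by
  simp [der, Fin.sum_univ_two, update_vec2_zero, update_vec2_one, sub_sub]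

theorem der_20 (h : Tensor 2 0) (i j : Fin 3) :
    der A Γ h y ![i, j] ![] = Z A (fun z => h z ![i, j] ![]) y + ∑ D, Γ y i D * h y ![D, j] ![]
      + ∑ D, Γ y j D * h y ![i, D] ![] := by
  simp [der, Fin.sum_univ_two, update_vec2_zero, update_vec2_one, add_assoc]

end components

/-! ### Leibniz rules -/

/-- A pointwise bilinear operation on tensor fields that obeys the Leibniz rule for all derivations
of the tensor algebra. -/
structure IsNatural {l₁ m₁ l₂ m₂ l₃ m₃ : ℕ}
    (op : Tensor l₁ m₁ → Tensor l₂ m₂ → Tensor l₃ m₃) : Prop where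
  leibniz : ∀ (A : Fin 3) (Γ : S3 → Matrix (Fin 3) (Fin 3) ℝ) {ξ η}, TSm 1 ξ → TSm 1 η →
    der A Γ (op ξ η) = op (der A Γ ξ) η + op ξ (der A Γ η)
  smooth : ∀ {r : ℕ} {T : ℝ} {ξ : ℝ → Tensor l₁ m₁} {η : ℝ → Tensor l₂ m₂}, TCk r T ξ → TCk r T η →
    TCk r T fun t => op (ξ t) (η t)

theorem IsNatural.sm {l₁ m₁ l₂ m₂ l₃ m₃ : ℕ} {op : Tensor l₁ m₁ → Tensor l₂ m₂ → Tensor l₃ m₃}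
    (h : IsNatural op) {r : ℕ} {ξ : Tensor l₁ m₁} {η : Tensor l₂ m₂} (hξ : TSm r ξ)
    (hη : TSm r η) : TSm r (op ξ η) :=
  h.smooth (ξ := fun _ => ξ) (η := fun _ => η) hξ hη

theorem der_sum2 (A : Fin 3) (Γ : S3 → Matrix (Fin 3) (Fin 3) ℝ) {I : List (Fin 3)}
    {H : List (Fin 3) → List (Fin 3) → Tensor l m}
    (h : ∀ I₁ I₂, I₁.length + I₂.length = I.length → TSm 1 (H I₁ I₂)) (y : S3) (a : Fin l → Fin 3)
    (b : Fin m → Fin 3) :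
    der A Γ (fun x a b => sum2 I fun I₁ I₂ => H I₁ I₂ x a b) y a b
      = sum2 I fun I₁ I₂ => der A Γ (H I₁ I₂) y a b := by
  have hZ := Z_sum2 A y (H := fun I₁ I₂ x => H I₁ I₂ x a b) fun I₁ I₂ hl => h I₁ I₂ hl a b
  have e : (sum2 I fun I₁ I₂ => der A Γ (H I₁ I₂) y a b)
      = sum2 I fun I₁ I₂ => Z A (fun x => H I₁ I₂ x a b) y
        + (∑ i, ∑ D, Γ y (a i) D * H I₁ I₂ y (Function.update a i D) b
        + (-1) * ∑ j, ∑ D, Γ y D (b j) * H I₁ I₂ y a (Function.update b j D)) :=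
    sum2_congr fun I₁ I₂ _ => by simp only [der]; ring
  rw [e]
  simp only [sum2_add, sum2_mul_left, sum2_finset_sum]
  simp only [der, hZ]
  ring

/-- The iterated Leibniz rule. -/
theorem IsNatural.lieI {l₁ m₁ l₂ m₂ l₃ m₃ : ℕ} {op : Tensor l₁ m₁ → Tensor l₂ m₂ → Tensor l₃ m₃}
    (h : IsNatural op) {I : List (Fin 3)} {ξ : Tensor l₁ m₁} {η : Tensor l₂ m₂}
    (hξ : TSm I.length ξ) (hη : TSm I.length η) :
    lieI I (op ξ η) = fun y a b => sum2 I fun I₁ I₂ =>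
      op (BigCrunch.lieI I₁ ξ) (BigCrunch.lieI I₂ η) y a b := by
  induction I with
  | nil => simp
  | cons A I ih =>
    rw [lieI_cons, ih (hξ.of_le (by simp)) (hη.of_le (by simp)), lie_eq_der]
    funext y a b
    have h1 : ∀ I₁ : List (Fin 3), I₁.length ≤ I.length → TSm 1 (BigCrunch.lieI I₁ ξ) :=
      fun I₁ hl => TSm.lieI (hξ.of_le (by simp; omega))
    have h2 : ∀ I₁ : List (Fin 3), I₁.length ≤ I.length → TSm 1 (BigCrunch.lieI I₁ η) :=
      fun I₁ hl => TSm.lieI (hη.of_le (by simp; omega))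
    rw [der_sum2 A _ (H := fun I₁ I₂ => op (BigCrunch.lieI I₁ ξ) (BigCrunch.lieI I₂ η))
      fun I₁ I₂ hl => h.sm (h1 I₁ (by omega)) (h2 I₂ (by omega)), sum2_cons]
    refine sum2_congr fun I₁ I₂ hl => ?_
    rw [h.leibniz A _ (h1 I₁ (by omega)) (h2 I₂ (by omega))]
    rfl

/-- The product of a function and a tensor field. -/
def smulT (f : Tensor 0 0) (ξ : Tensor l m) : Tensor l m := fun y a b => f y ![] ![] * ξ y a b

theorem isNatural_smulT : IsNatural (smulT (l := l) (m := m)) where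
  smooth hf hξ a b := (hf _ _).mul (hξ a b)
  leibniz A Γ f ξ hf hξ := by
    funext y a b
    have := Z_mul A y (hf ![] ![]) (hξ a b)
    simp only [smulT, Pi.add_apply]
    rw [der_00]
    simp only [der, smulT, mul_left_comm _ (f y ![] ![]), ← Finset.mul_sum]
    rw [this]
    ring

/-- `ξ_{id} η^d_j`. -/
def lowMul (ξ : Tensor 0 2) (η : Tensor 1 1) : Tensor 0 2 := fun y _ b =>
  ∑ d, ξ y ![] ![b 0, d] * η y ![d] ![b 1]

/-- `P^{ic} ψ_c`. -/
def upVec (P : Tensor 2 0) (ψ : Tensor 0 1) : Tensor 1 0 := fun y a _ =>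
  ∑ c, P y ![a 0, c] ![] * ψ y ![] ![c]

/-- `P^{ic} h_{cj}`. -/
def upMul (P : Tensor 2 0) (h : Tensor 0 2) : Tensor 1 1 := fun y a b =>
  ∑ c, P y ![a 0, c] ![] * h y ![] ![c, b 0]

/-- `ψ_i χ_j`. -/
def tens (ψ χ : Tensor 0 1) : Tensor 0 2 := fun y _ b => ψ y ![] ![b 0] * χ y ![] ![b 1]

/-- `ψ_c v^c`. -/
def pairing (ψ : Tensor 0 1) (v : Tensor 1 0) : Tensor 0 0 := fun y _ _ =>
  ∑ c, ψ y ![] ![c] * v y ![c] ![]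

/-- `x^c_d z^d_c`. -/
def trMul (x z : Tensor 1 1) : Tensor 0 0 := fun y _ _ => ∑ c, ∑ d, x y ![c] ![d] * z y ![d] ![c]

theorem Z_sum_mul (A : Fin 3) (y : S3) {f g : Fin 3 → S3 → ℝ} (hf : ∀ i, Sm 1 (f i))
    (hg : ∀ i, Sm 1 (g i)) :
    Z A (fun x => ∑ c, f c x * g c x) y = ∑ c, (Z A (f c) y * g c y + f c y * Z A (g c) y) := by
  rw [Z_sum A y fun c _ => (hf c).mul (hg c)]
  exact Finset.sum_congr rfl fun c _ => Z_mul A y (hf c) (hg c)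

/-- In a contracted slot the connection acts with opposite signs on the upper and the lower index,
so these terms cancel in the sum; the same mechanism gives all the rules of this kind. -/
theorem isNatural_lowMul : IsNatural lowMul where
  smooth hξ hη _ _ := Ck.sum fun _ _ => (hξ _ _).mul (hη _ _)
  leibniz A Γ ξ η hξ hη := by
    funext y a b
    rw [vec0_eq a, ← vec2_eta b]
    generalize b 0 = i
    generalize b 1 = j
    simp only [Pi.add_apply, der_02]
    simp only [lowMul, Matrix.cons_val_zero, Matrix.cons_val_one]
    rw [Z_sum_mul A y (fun c => hξ _ _) fun c => hη _ _]
    simp only [der_02, der_11, Fin.sum_univ_three]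
    ring

theorem isNatural_upVec : IsNatural upVec where
  smooth hξ hη _ _ := Ck.sum fun _ _ => (hξ _ _).mul (hη _ _)
  leibniz A Γ ξ η hξ hη := by
    funext y a b
    rw [vec0_eq b, ← vec1_eta a]
    generalize a 0 = i
    simp only [Pi.add_apply, der_10]
    simp only [upVec, Matrix.cons_val_zero]
    rw [Z_sum_mul A y (fun c => hξ _ _) fun c => hη _ _]
    simp only [der_20, der_01, Fin.sum_univ_three]
    ring

theorem isNatural_upMul : IsNatural upMul where
  smooth hξ hη _ _ := Ck.sum fun _ _ => (hξ _ _).mul (hη _ _)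
  leibniz A Γ ξ η hξ hη := by
    funext y a b
    rw [← vec1_eta a, ← vec1_eta b]
    generalize a 0 = i
    generalize b 0 = j
    simp only [Pi.add_apply, der_11]
    simp only [upMul, Matrix.cons_val_zero]
    rw [Z_sum_mul A y (fun c => hξ _ _) fun c => hη _ _]
    simp only [der_20, der_02, Fin.sum_univ_three]
    ring

theorem isNatural_tens : IsNatural tens where
  smooth hξ hη _ _ := (hξ _ _).mul (hη _ _)
  leibniz A Γ ξ η hξ hη := by
    funext y a b
    rw [vec0_eq a, ← vec2_eta b]
    generalize b 0 = i
    generalize b 1 = j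
    simp only [Pi.add_apply, der_02]
    simp only [tens, Matrix.cons_val_zero, Matrix.cons_val_one]
    rw [Z_mul A y (hξ _ _) (hη _ _)]
    simp only [der_01, Fin.sum_univ_three]
    ring

theorem isNatural_pairing : IsNatural pairing where
  smooth hξ hη _ _ := Ck.sum fun _ _ => (hξ _ _).mul (hη _ _)
  leibniz A Γ ξ η hξ hη := by
    funext y a b
    rw [vec0_eq a, vec0_eq b]
    simp only [Pi.add_apply, der_00]
    simp only [pairing]
    rw [Z_sum_mul A y (fun c => hξ _ _) fun c => hη _ _]
    simp only [der_01, der_10, Fin.sum_univ_three]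
    ring

theorem isNatural_trMul : IsNatural trMul where
  smooth hξ hη _ _ := Ck.sum fun _ _ => Ck.sum fun _ _ => (hξ _ _).mul (hη _ _)
  leibniz A Γ ξ η hξ hη := by
    funext y a b
    rw [vec0_eq a, vec0_eq b]
    simp only [Pi.add_apply, der_00]
    simp only [trMul]
    rw [Z_sum A y fun c _ => Sm.sum fun d _ => (hξ _ _).mul (hη _ _)]
    simp only [Z_sum_mul A y (fun c => hξ _ _) fun c => hη _ _]
    simp only [der_11, Fin.sum_univ_three]
    ring

/-- The trace `x^c_c`. -/
def tr11 (x : Tensor 1 1) : S3 → ℝ := fun y => ∑ c, x y ![c] ![c]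

/-- A mixed trace is a natural contraction: the two connection terms of each derivation cancel after
summation, and no metric is involved. -/
theorem lieI_tr11 {I : List (Fin 3)} {x : Tensor 1 1} (hx : TSm I.length x) :
    tr11 (lieI I x) = ZI I (tr11 x) := by
  induction I with
  | nil => rfl
  | cons A I ih =>
    rw [ZI_cons, ← ih (hx.of_le (by simp))]
    have h1 : TSm 1 (lieI I x) := TSm.lieI (hx.of_le (by simp; omega))
    funext y
    have hZ : Z A (tr11 (lieI I x)) y = ∑ c, Z A (fun z => lieI I x z ![c] ![c]) y :=
      Z_sum A y fun c _ => h1 _ _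
    rw [hZ]
    simp only [tr11, lieI_cons, lie_eq_der, der_11]
    simp only [Fin.sum_univ_three]
    ring

theorem TCk.grad {r : ℕ} {T : ℝ} {f : ℝ → S3 → ℝ} (h : Ck (r + 1) T f) :
    TCk r T fun t => grad (f t) := fun _ b => h.Z (b 0)

theorem TSm.grad {r : ℕ} {f : S3 → ℝ} (h : Sm (r + 1) f) : TSm r (grad f) :=
  TCk.grad (f := fun _ => f) h

/-- The structure constants inside `lie` are those of the frame, so they compensate the commutator
of Z_A with Z_j. -/
theorem lie_grad (A : Fin 3) {f : S3 → ℝ} (hf : Sm 2 f) : lie A (grad f) = grad (Z A f) := by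
  funext y a b
  rw [vec0_eq a, ← vec1_eta b]
  generalize b 0 = j
  have h1 : Z A (fun x => Z j f x) y = Z A (Z j f) y := rfl
  simp only [lie_eq_der, der_01]
  simp only [grad, Matrix.cons_val_zero, h1, lieMat]
  linarith [hf.Z_comm A j y]

theorem lieI_grad {I : List (Fin 3)} {f : S3 → ℝ} (hf : Sm (I.length + 1) f) :
    lieI I (grad f) = grad (ZI I f) := by
  induction I with
  | nil => rfl
  | cons A I ih =>
    rw [lieI_cons, ih (hf.of_le (by simp)), lie_grad A, ZI_cons]
    exact Sm.ZI (hf.of_le (by simp; omega))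

/-! ### Time derivatives -/

/-- The time derivative of the components of a tensor field. -/
def dtT (ξ : ℝ → Tensor l m) (t : ℝ) : Tensor l m := fun y a b => dt (fun s x => ξ s x a b) t y

theorem TCk.dtT {r : ℕ} {T : ℝ} {ξ : ℝ → Tensor l m} (h : TCk (r + 1) T ξ) : TCk r T (dtT ξ) :=
  fun a b => (h a b).dt

theorem dtT_lie {T : ℝ} {ξ : ℝ → Tensor l m} (h : TCk 2 T ξ) {t : ℝ} (ht : t ∈ Set.Ioo 0 T)
    (A : Fin 3) : dtT (fun s => lie A (ξ s)) t = lie A (dtT ξ t) := by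
  funext y a b
  have ht' : t ∈ Set.Ico 0 T := ⟨ht.1.le, ht.2⟩
  have h1 : ∀ a b, HasDerivAt (fun s => ξ s y a b) (dtT ξ t y a b) t := fun a b =>
    ((h a b).of_le one_le_two).hasDerivAt (r := 0) ht y
  refine dt_eq ht.1 (HasDerivAt.sub (HasDerivAt.add ?_ ?_) ?_)
  · have h2 : Ck 1 T fun s => Z A fun x => ξ s x a b := (h a b).Z A
    have h3 := h2.hasDerivAt (r := 0) ht y
    rwa [dt_Z (h a b) ht' A y] at h3
  · exact HasDerivAt.fun_sum fun i _ => HasDerivAt.fun_sum fun D _ => (h1 _ _).const_mul _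
  · exact HasDerivAt.fun_sum fun i _ => HasDerivAt.fun_sum fun D _ => (h1 _ _).const_mul _

theorem dtT_lieI {T : ℝ} {ξ : ℝ → Tensor l m} {I : List (Fin 3)} (h : TCk (I.length + 1) T ξ) {t : ℝ}
    (ht : t ∈ Set.Ioo 0 T) : dtT (fun s => lieI I (ξ s)) t = lieI I (dtT ξ t) := by
  induction I with
  | nil => rfl
  | cons A I ih =>
    rw [lieI_cons, ← ih (h.of_le (by simp))]
    exact dtT_lie (TCk.lieI (r := 2) (h.of_le (by simp; omega))) ht A

theorem hasDerivAt_lieI {T : ℝ} {ξ : ℝ → Tensor l m} {I : List (Fin 3)}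
    (h : TCk (I.length + 1) T ξ) {t : ℝ} (ht : t ∈ Set.Ioo 0 T) (y : S3) (a : Fin l → Fin 3)
    (b : Fin m → Fin 3) :
    HasDerivAt (fun s => lieI I (ξ s) y a b) (lieI I (dtT ξ t) y a b) t := by
  rw [← dtT_lieI h ht]
  exact (TCk.lieI (r := 1) (h.of_le (by omega)) a b).hasDerivAt (r := 0) ht y

end der

/-! ## Positive kernels and the norms of tensors -/

/-- Components of a tensor at one point. -/
abbrev Comp (l m : ℕ) : Type := (Fin l → Fin 3) → (Fin m → Fin 3) → ℝ

section kernel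

variable {l m : ℕ}

/-- The form on tensors with the bilinear form `P i` in the `i`-th upper and `Q j` in the `j`-th
lower slot. -/
def ker (P : Fin l → Matrix (Fin 3) (Fin 3) ℝ) (Q : Fin m → Matrix (Fin 3) (Fin 3) ℝ)
    (ξ η : Comp l m) : ℝ :=
  ∑ a : Fin l → Fin 3, ∑ a' : Fin l → Fin 3, ∑ b : Fin m → Fin 3, ∑ b' : Fin m → Fin 3,
    (∏ i, P i (a i) (a' i)) * (∏ j, Q j (b j) (b' j)) * ξ a b * η a' b'

/-- The tensor product of a family of matrices. -/
def piKron (P : Fin l → Matrix (Fin 3) (Fin 3) ℝ) : Matrix (Fin l → Fin 3) (Fin l → Fin 3) ℝ :=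
  fun a a' => ∏ i, P i (a i) (a' i)

open scoped MatrixOrder in
theorem exists_factor {n : Type*} [Fintype n] [DecidableEq n] {P : Matrix n n ℝ}
    (h : P.PosSemidef) : ∃ R : Matrix n n ℝ, P = R.conjTranspose * R :=
  CStarAlgebra.nonneg_iff_eq_star_mul_self.mp h.nonneg

/-- A Gram factorisation RᵀR of every factor yields one of the tensor product, with the tensor
product of the factors R. -/
theorem piKron_posSemidef {P : Fin l → Matrix (Fin 3) (Fin 3) ℝ} (h : ∀ i, (P i).PosSemidef) :
    (piKron P).PosSemidef := by
  choose R hR using fun i => exists_factor (h i)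
  have : piKron P = (piKron R).conjTranspose * piKron R := by
    ext a a'
    rw [Matrix.mul_apply]
    simp only [piKron, Matrix.conjTranspose_apply, star_trivial, ← Finset.prod_mul_distrib]
    rw [← Fintype.piFinset_univ, ← Finset.prod_univ_sum (fun _ => Finset.univ)
      fun i k => R i k (a i) * R i k (a' i)]
    refine Finset.prod_congr rfl fun i _ => ?_
    rw [hR i, Matrix.mul_apply]
    simp
  rw [this]
  exact Matrix.posSemidef_conjTranspose_mul_self _

theorem ker_eq (P : Fin l → Matrix (Fin 3) (Fin 3) ℝ) (Q : Fin m → Matrix (Fin 3) (Fin 3) ℝ)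
    (ξ η : Comp l m) :
    ker P Q ξ η = (fun p : (Fin l → Fin 3) × (Fin m → Fin 3) => ξ p.1 p.2) ⬝ᵥ
      (Matrix.kroneckerMap (· * ·) (piKron P) (piKron Q)).mulVec fun p => η p.1 p.2 := by
  simp only [ker, dotProduct, Matrix.mulVec, Fintype.sum_prod_type, Matrix.kroneckerMap_apply,
    piKron, Finset.mul_sum]
  refine Finset.sum_congr rfl fun a _ => ?_
  rw [Finset.sum_comm]
  refine Finset.sum_congr rfl fun b _ => Finset.sum_congr rfl fun a' _ =>
    Finset.sum_congr rfl fun b' _ => ?_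
  ring

theorem ker_nonneg {P : Fin l → Matrix (Fin 3) (Fin 3) ℝ} {Q : Fin m → Matrix (Fin 3) (Fin 3) ℝ}
    (hP : ∀ i, (P i).PosSemidef) (hQ : ∀ j, (Q j).PosSemidef) (ξ : Comp l m) : 0 ≤ ker P Q ξ ξ := by
  rw [ker_eq]
  have := ((piKron_posSemidef hP).kronecker (piKron_posSemidef hQ)).dotProduct_mulVec_nonneg
    fun p : (Fin l → Fin 3) × (Fin m → Fin 3) => ξ p.1 p.2
  simpa using this

theorem ker_symm {P : Fin l → Matrix (Fin 3) (Fin 3) ℝ} {Q : Fin m → Matrix (Fin 3) (Fin 3) ℝ}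
    (hP : ∀ i, (P i).IsSymm) (hQ : ∀ j, (Q j).IsSymm) (ξ η : Comp l m) :
    ker P Q ξ η = ker P Q η ξ := by
  simp only [ker]
  rw [Finset.sum_comm]
  refine Finset.sum_congr rfl fun a _ => Finset.sum_congr rfl fun a' _ => ?_
  rw [Finset.sum_comm]
  refine Finset.sum_congr rfl fun b _ => Finset.sum_congr rfl fun b' _ => ?_
  simp only [fun i => (hP i).apply, fun j => (hQ j).apply]
  ring

theorem ker_add_left (P : Fin l → Matrix (Fin 3) (Fin 3) ℝ) (Q : Fin m → Matrix (Fin 3) (Fin 3) ℝ)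
    (ξ ξ' η : Comp l m) : ker P Q (ξ + ξ') η = ker P Q ξ η + ker P Q ξ' η := by
  simp only [ker, Pi.add_apply, mul_add, add_mul, Finset.sum_add_distrib]

theorem ker_add_right (P : Fin l → Matrix (Fin 3) (Fin 3) ℝ) (Q : Fin m → Matrix (Fin 3) (Fin 3) ℝ)
    (ξ η η' : Comp l m) : ker P Q ξ (η + η') = ker P Q ξ η + ker P Q ξ η' := by
  simp only [ker, Pi.add_apply, mul_add, Finset.sum_add_distrib]

theorem ker_smul_left (P : Fin l → Matrix (Fin 3) (Fin 3) ℝ) (Q : Fin m → Matrix (Fin 3) (Fin 3) ℝ)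
    (c : ℝ) (ξ η : Comp l m) : ker P Q (c • ξ) η = c * ker P Q ξ η := by
  simp only [ker, Pi.smul_apply, smul_eq_mul, Finset.mul_sum]
  refine Finset.sum_congr rfl fun a _ => Finset.sum_congr rfl fun a' _ =>
    Finset.sum_congr rfl fun b _ => Finset.sum_congr rfl fun b' _ => ?_
  ring

theorem ker_smul_right (P : Fin l → Matrix (Fin 3) (Fin 3) ℝ) (Q : Fin m → Matrix (Fin 3) (Fin 3) ℝ)
    (c : ℝ) (ξ η : Comp l m) : ker P Q ξ (c • η) = c * ker P Q ξ η := by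
  simp only [ker, Pi.smul_apply, smul_eq_mul, Finset.mul_sum]
  refine Finset.sum_congr rfl fun a _ => Finset.sum_congr rfl fun a' _ =>
    Finset.sum_congr rfl fun b _ => Finset.sum_congr rfl fun b' _ => ?_
  ring

theorem ker_update_left (P : Fin l → Matrix (Fin 3) (Fin 3) ℝ)
    (Q : Fin m → Matrix (Fin 3) (Fin 3) ℝ) (i : Fin l) (c d : ℝ) (X Y : Matrix (Fin 3) (Fin 3) ℝ)
    (ξ η : Comp l m) :
    ker (Function.update P i (c • X + d • Y)) Q ξ η
      = c * ker (Function.update P i X) Q ξ η + d * ker (Function.update P i Y) Q ξ η := by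
  have key : ∀ (W : Matrix (Fin 3) (Fin 3) ℝ) (a a' : Fin l → Fin 3),
      ∏ k, Function.update P i W k (a k) (a' k)
        = W (a i) (a' i) * ∏ k ∈ Finset.univ.erase i, P k (a k) (a' k) := fun W a a' => by
    rw [← Finset.mul_prod_erase _ _ (Finset.mem_univ i), Function.update_self]
    congr 1
    exact Finset.prod_congr rfl fun k hk => by rw [Function.update_of_ne (Finset.ne_of_mem_erase hk)]
  simp only [ker, key, Finset.mul_sum, ← Finset.sum_add_distrib]
  refine Finset.sum_congr rfl fun a _ => Finset.sum_congr rfl fun a' _ =>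
    Finset.sum_congr rfl fun b _ => Finset.sum_congr rfl fun b' _ => ?_
  simp only [Matrix.add_apply, Matrix.smul_apply, smul_eq_mul]
  ring

theorem ker_update_right (P : Fin l → Matrix (Fin 3) (Fin 3) ℝ)
    (Q : Fin m → Matrix (Fin 3) (Fin 3) ℝ) (i : Fin m) (c d : ℝ) (X Y : Matrix (Fin 3) (Fin 3) ℝ)
    (ξ η : Comp l m) :
    ker P (Function.update Q i (c • X + d • Y)) ξ η
      = c * ker P (Function.update Q i X) ξ η + d * ker P (Function.update Q i Y) ξ η := by
  have key : ∀ (W : Matrix (Fin 3) (Fin 3) ℝ) (a a' : Fin m → Fin 3),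
      ∏ k, Function.update Q i W k (a k) (a' k)
        = W (a i) (a' i) * ∏ k ∈ Finset.univ.erase i, Q k (a k) (a' k) := fun W a a' => by
    rw [← Finset.mul_prod_erase _ _ (Finset.mem_univ i), Function.update_self]
    congr 1
    exact Finset.prod_congr rfl fun k hk => by rw [Function.update_of_ne (Finset.ne_of_mem_erase hk)]
  simp only [ker, key, Finset.mul_sum, ← Finset.sum_add_distrib]
  refine Finset.sum_congr rfl fun a _ => Finset.sum_congr rfl fun a' _ =>
    Finset.sum_congr rfl fun b _ => Finset.sum_congr rfl fun b' _ => ?_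
  simp only [Matrix.add_apply, Matrix.smul_apply, smul_eq_mul]
  ring

/-- The inner product of tensors defined by the metric with matrix `g` and inverse `h`. -/
abbrev ipm (g h : Matrix (Fin 3) (Fin 3) ℝ) (ξ η : Comp l m) : ℝ := ker (fun _ => g) (fun _ => h) ξ η

theorem update_posSemidef {k : ℕ} {g X : Matrix (Fin 3) (Fin 3) ℝ} (hg : g.PosSemidef)
    (hX : X.PosSemidef) (i j : Fin k) :
    (Function.update (fun _ => g) i X j : Matrix (Fin 3) (Fin 3) ℝ).PosSemidef := by
  by_cases hj : j = i
  · subst hj; simpa using hX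
  · rw [Function.update_of_ne hj]; exact hg

/-- The two hypotheses say −c g ≤ X ≤ c g as quadratic forms. The kernel is linear in each single
slot and nonnegative for nonnegative slots, so the bound passes to the kernel with X in slot i. -/
theorem abs_ker_update_left_le {g h X : Matrix (Fin 3) (Fin 3) ℝ} (hg : g.PosSemidef)
    (hh : h.PosSemidef) {c : ℝ} (h1 : (c • g + (1 : ℝ) • X).PosSemidef)
    (h2 : (c • g + (-1 : ℝ) • X).PosSemidef) (i : Fin l) (ξ : Comp l m) :
    |ker (Function.update (fun _ => g) i X) (fun _ => h) ξ ξ| ≤ c * ipm g h ξ ξ := by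
  have k1 := ker_nonneg (update_posSemidef hg h1 i) (fun _ : Fin m => hh) ξ
  have k2 := ker_nonneg (update_posSemidef hg h2 i) (fun _ : Fin m => hh) ξ
  rw [ker_update_left] at k1 k2
  have e : Function.update (fun _ : Fin l => g) i g = fun _ => g := Function.update_eq_self i _
  rw [e] at k1 k2
  rw [abs_le]
  constructor <;> simp only [ipm] <;> linarith

theorem abs_ker_update_right_le {g h X : Matrix (Fin 3) (Fin 3) ℝ} (hg : g.PosSemidef)
    (hh : h.PosSemidef) {c : ℝ} (h1 : (c • h + (1 : ℝ) • X).PosSemidef)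
    (h2 : (c • h + (-1 : ℝ) • X).PosSemidef) (i : Fin m) (ξ : Comp l m) :
    |ker (fun _ => g) (Function.update (fun _ => h) i X) ξ ξ| ≤ c * ipm g h ξ ξ := by
  have k1 := ker_nonneg (fun _ : Fin l => hg) (update_posSemidef hh h1 i) ξ
  have k2 := ker_nonneg (fun _ : Fin l => hg) (update_posSemidef hh h2 i) ξ
  rw [ker_update_right] at k1 k2
  have e : Function.update (fun _ : Fin m => h) i h = fun _ => h := Function.update_eq_self i _
  rw [e] at k1 k2
  rw [abs_le]
  constructor <;> simp only [ipm] <;> linarith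

theorem _root_.Matrix.PosSemidef.isSymm {n : Type*} {P : Matrix n n ℝ} (h : P.PosSemidef) :
    P.IsSymm := by
  have := h.1
  rwa [Matrix.IsHermitian, Matrix.conjTranspose_eq_transpose_of_trivial] at this

/-- Young's inequality for the inner product of tensors. -/
theorem ipm_young {g h : Matrix (Fin 3) (Fin 3) ℝ} (hg : g.PosSemidef) (hh : h.PosSemidef)
    (ξ η : Comp l m) {c : ℝ} (hc : 0 < c) :
    2 * |ipm g h ξ η| ≤ c * ipm g h ξ ξ + c⁻¹ * ipm g h η η := by
  have hs : ker (fun _ => g) (fun _ => h) ξ η = ker (fun _ => g) (fun _ => h) η ξ :=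
    ker_symm (fun _ => hg.isSymm) (fun _ => hh.isSymm) ξ η
  have key : ∀ s : ℝ, s ^ 2 = 1 → 0 ≤ c ^ 2 * ipm g h ξ ξ + 2 * s * c * ipm g h ξ η + ipm g h η η := by
    intro s hs2
    have := ker_nonneg (fun _ : Fin l => hg) (fun _ : Fin m => hh) (c • ξ + s • η)
    simp only [ker_add_left, ker_add_right, ker_smul_left, ker_smul_right] at this
    rw [← hs] at this
    simp only [ipm]
    linear_combination this + (ker (fun _ => g) (fun _ => h) η η) * hs2
  have h1 := key 1 (by norm_num)
  have h2 := key (-1) (by norm_num)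
  have e : c * ipm g h ξ ξ + c⁻¹ * ipm g h η η = c⁻¹ * (c ^ 2 * ipm g h ξ ξ + ipm g h η η) := by
    field_simp
  have h3 : 2 * c * |ipm g h ξ η| ≤ c ^ 2 * ipm g h ξ ξ + ipm g h η η := by
    rcases abs_cases (ipm g h ξ η) with ⟨ha, _⟩ | ⟨ha, _⟩ <;> rw [ha] <;> linarith
  rw [e, inv_mul_eq_div, le_div_iff₀ hc]
  linarith

theorem ipm_self_nonneg {g h : Matrix (Fin 3) (Fin 3) ℝ} (hg : g.PosSemidef) (hh : h.PosSemidef)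
    (ξ : Comp l m) : 0 ≤ ipm g h ξ ξ := ker_nonneg (fun _ => hg) (fun _ => hh) ξ

/-- The Cauchy–Schwarz inequality. -/
theorem ipm_sq_le {g h : Matrix (Fin 3) (Fin 3) ℝ} (hg : g.PosSemidef) (hh : h.PosSemidef)
    (ξ η : Comp l m) : ipm g h ξ η ^ 2 ≤ ipm g h ξ ξ * ipm g h η η := by
  have hs : ker (fun _ => g) (fun _ => h) ξ η = ker (fun _ => g) (fun _ => h) η ξ :=
    ker_symm (fun _ => hg.isSymm) (fun _ => hh.isSymm) ξ η
  have key : ∀ s : ℝ, 0 ≤ ipm g h ξ ξ * (s * s) + 2 * ipm g h ξ η * s + ipm g h η η := by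
    intro s
    have := ker_nonneg (fun _ : Fin l => hg) (fun _ : Fin m => hh) (s • ξ + η)
    simp only [ker_add_left, ker_add_right, ker_smul_left, ker_smul_right] at this
    rw [← hs] at this
    simp only [ipm]
    linear_combination this
  have := discrim_le_zero key
  rw [discrim] at this
  linarith

theorem prod_update_eq {k : ℕ} {P : Fin k → Matrix (Fin 3) (Fin 3) ℝ} (i : Fin k)
    (W : Matrix (Fin 3) (Fin 3) ℝ) (a a' : Fin k → Fin 3) :
    ∏ j, Function.update P i W j (a j) (a' j)
      = (∏ j ∈ Finset.univ.erase i, P j (a j) (a' j)) * W (a i) (a' i) := by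
  rw [← Finset.mul_prod_erase _ _ (Finset.mem_univ i), Function.update_self, mul_comm]
  congr 1
  exact Finset.prod_congr rfl fun j hj => by rw [Function.update_of_ne (Finset.ne_of_mem_erase hj)]

/-- The derivative of the squared norm of a tensor along a curve of metrics and tensors. -/
theorem hasDerivAt_ipm {g h : ℝ → Matrix (Fin 3) (Fin 3) ℝ} {g' h' : Matrix (Fin 3) (Fin 3) ℝ}
    {ξ : ℝ → Comp l m} {ξ' : Comp l m} {t : ℝ}
    (hg : ∀ i j, HasDerivAt (fun s => g s i j) (g' i j) t)
    (hh : ∀ i j, HasDerivAt (fun s => h s i j) (h' i j) t)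
    (hξ : ∀ a b, HasDerivAt (fun s => ξ s a b) (ξ' a b) t)
    (sg : (g t).IsSymm) (sh : (h t).IsSymm) :
    HasDerivAt (fun s => ipm (g s) (h s) (ξ s) (ξ s))
      (2 * ipm (g t) (h t) (ξ t) ξ'
        + ∑ i, ker (Function.update (fun _ => g t) i g') (fun _ => h t) (ξ t) (ξ t)
        + ∑ j, ker (fun _ => g t) (Function.update (fun _ => h t) j h') (ξ t) (ξ t)) t := by
  have hs := ker_symm (fun _ : Fin l => sg) (fun _ : Fin m => sh) (ξ t) ξ'
  have h1 : HasDerivAt (fun s => ipm (g s) (h s) (ξ s) (ξ s))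
      (∑ a : Fin l → Fin 3, ∑ a' : Fin l → Fin 3, ∑ b : Fin m → Fin 3, ∑ b' : Fin m → Fin 3,
        ((((∑ i, ∏ k, Function.update (fun _ => g t) i g' k (a k) (a' k))
            * (∏ j, h t (b j) (b' j))
          + (∏ i, g t (a i) (a' i))
            * (∑ j, ∏ k, Function.update (fun _ => h t) j h' k (b k) (b' k))) * ξ t a b
          + ((∏ i, g t (a i) (a' i)) * ∏ j, h t (b j) (b' j)) * ξ' a b) * ξ t a' b'
          + (((∏ i, g t (a i) (a' i)) * ∏ j, h t (b j) (b' j)) * ξ t a b) * ξ' a' b')) t := by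
    refine HasDerivAt.fun_sum fun a _ => HasDerivAt.fun_sum fun a' _ =>
      HasDerivAt.fun_sum fun b _ => HasDerivAt.fun_sum fun b' _ => ?_
    refine HasDerivAt.fun_mul (HasDerivAt.fun_mul (HasDerivAt.fun_mul ?_ ?_) (hξ _ _)) (hξ _ _)
    · have := HasDerivAt.fun_finset_prod (u := Finset.univ)
        (f := fun (i : Fin l) s => g s (a i) (a' i)) (x := t) fun i _ => hg (a i) (a' i)
      simpa only [prod_update_eq, smul_eq_mul] using this
    · have := HasDerivAt.fun_finset_prod (u := Finset.univ)
        (f := fun (i : Fin m) s => h s (b i) (b' i)) (x := t) fun i _ => hh (b i) (b' i)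
      simpa only [prod_update_eq, smul_eq_mul] using this
  refine h1.congr_deriv ?_
  have e1 : ∑ i, ker (Function.update (fun _ => g t) i g') (fun _ => h t) (ξ t) (ξ t)
      = ∑ a : Fin l → Fin 3, ∑ a' : Fin l → Fin 3, ∑ b : Fin m → Fin 3, ∑ b' : Fin m → Fin 3,
        (∑ i, ∏ k, Function.update (fun _ => g t) i g' k (a k) (a' k)) * (∏ j, h t (b j) (b' j))
          * ξ t a b * ξ t a' b' := by
    simp only [ker, Finset.sum_mul]
    iterate 3
      rw [Finset.sum_comm]
      refine Finset.sum_congr rfl fun _ _ => ?_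
    rw [Finset.sum_comm]
  have e2 : ∑ j, ker (fun _ => g t) (Function.update (fun _ => h t) j h') (ξ t) (ξ t)
      = ∑ a : Fin l → Fin 3, ∑ a' : Fin l → Fin 3, ∑ b : Fin m → Fin 3, ∑ b' : Fin m → Fin 3,
        (∏ i, g t (a i) (a' i)) * (∑ j, ∏ k, Function.update (fun _ => h t) j h' k (b k) (b' k))
          * ξ t a b * ξ t a' b' := by
    simp only [ker, Finset.sum_mul, Finset.mul_sum]
    iterate 3
      rw [Finset.sum_comm]
      refine Finset.sum_congr rfl fun _ _ => ?_
    rw [Finset.sum_comm]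
  have e3 : 2 * ipm (g t) (h t) (ξ t) ξ' = ipm (g t) (h t) ξ' (ξ t) + ipm (g t) (h t) (ξ t) ξ' := by
    simp only [ipm]
    rw [hs]
    ring
  rw [e1, e2, e3]
  simp only [ipm, ker, ← Finset.sum_add_distrib]
  refine Finset.sum_congr rfl fun a _ => Finset.sum_congr rfl fun a' _ =>
    Finset.sum_congr rfl fun b _ => Finset.sum_congr rfl fun b' _ => ?_
  ring

end kernel

/-! ## Curves of matrices -/

section curves

variable {M : ℝ → Matrix (Fin 3) (Fin 3) ℝ} {M' : Matrix (Fin 3) (Fin 3) ℝ} {t : ℝ}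

theorem inv_apply_eq (P : Matrix (Fin 3) (Fin 3) ℝ) (i j : Fin 3) :
    P⁻¹ i j = P.det⁻¹ * P.adjugate i j := by
  rw [Matrix.inv_def, Matrix.smul_apply, Ring.inverse_eq_inv', smul_eq_mul]

/-- Jacobi's formula, read off from the explicit 3 × 3 determinant and adjugate. -/
theorem hasDerivAt_det (h : ∀ i j, HasDerivAt (fun s => M s i j) (M' i j) t) (h0 : (M t).det ≠ 0) :
    HasDerivAt (fun s => (M s).det) ((M t).det * ((M t)⁻¹ * M').trace) t := by
  simp only [Matrix.det_fin_three]
  refine ((((((((h 0 0).fun_mul (h 1 1)).fun_mul (h 2 2)).fun_sub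
    (((h 0 0).fun_mul (h 1 2)).fun_mul (h 2 1))).fun_sub
    (((h 0 1).fun_mul (h 1 0)).fun_mul (h 2 2))).fun_add
    (((h 0 1).fun_mul (h 1 2)).fun_mul (h 2 0))).fun_add
    (((h 0 2).fun_mul (h 1 0)).fun_mul (h 2 1))).fun_sub
    (((h 0 2).fun_mul (h 1 1)).fun_mul (h 2 0))).congr_deriv ?_
  have e : (M t).det * ((M t)⁻¹ * M').trace = ((M t).adjugate * M').trace := by
    rw [Matrix.inv_def, Ring.inverse_eq_inv', Matrix.smul_mul, Matrix.trace_smul, smul_eq_mul,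
      mul_inv_cancel_left₀ h0]
  rw [← Matrix.det_fin_three, e, Matrix.adjugate_fin_three]
  simp only [Matrix.trace, Matrix.diag_apply, Matrix.mul_apply, Fin.sum_univ_three]
  simp
  ring

/-- The cofactor formula only serves to show differentiability. The value of the derivative then
follows by differentiating M⁻¹ M = 1. -/
theorem hasDerivAt_matrix_inv (h : ∀ i j, HasDerivAt (fun s => M s i j) (M' i j) t)
    (h0 : ∀ᶠ s in nhds t, (M s).det ≠ 0) (i j : Fin 3) :
    HasDerivAt (fun s => (M s)⁻¹ i j) ((-((M t)⁻¹ * M' * (M t)⁻¹)) i j) t := by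
  have ht := h0.self_of_nhds
  have hdiff : ∀ i j, DifferentiableAt ℝ (fun s => (M s)⁻¹ i j) t := by
    intro i j
    have hd := fun i j => (h i j).differentiableAt
    have hdet := (hasDerivAt_det h ht).differentiableAt
    simp only [inv_apply_eq]
    refine (hdet.fun_inv ht).fun_mul ?_
    fin_cases i <;> fin_cases j <;> simp only [Matrix.adjugate_fin_three] <;>
      simp <;> fun_prop
  have hI := fun i j => (hdiff i j).hasDerivAt
  set W : Matrix (Fin 3) (Fin 3) ℝ := fun i j => deriv (fun s => (M s)⁻¹ i j) t with hW
  have key : W * M t + (M t)⁻¹ * M' = 0 := by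
    ext i j
    have h1 : HasDerivAt (fun s => ∑ k, (M s)⁻¹ i k * M s k j)
        (∑ k, (W i k * M t k j + (M t)⁻¹ i k * M' k j)) t :=
      HasDerivAt.fun_sum fun k _ => (hI i k).fun_mul (h k j)
    have h2 : HasDerivAt (fun s => ∑ k, (M s)⁻¹ i k * M s k j) 0 t := by
      refine (hasDerivAt_const t ((1 : Matrix (Fin 3) (Fin 3) ℝ) i j)).congr_of_eventuallyEq ?_
      filter_upwards [h0] with s hs
      rw [← Matrix.mul_apply, Matrix.nonsing_inv_mul _ (isUnit_iff_ne_zero.2 hs)]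
    have h3 := h1.unique h2
    simpa [Matrix.mul_apply, Finset.sum_add_distrib] using h3
  have hWe : W = -((M t)⁻¹ * M' * (M t)⁻¹) := by
    have h4 : W * M t * (M t)⁻¹ = -((M t)⁻¹ * M') * (M t)⁻¹ := by
      rw [eq_neg_of_add_eq_zero_left key]
    rwa [Matrix.mul_assoc, Matrix.mul_nonsing_inv _ (isUnit_iff_ne_zero.2 ht), Matrix.mul_one,
      Matrix.neg_mul] at h4
  rw [← hWe]
  exact hI i j

end curves

/-! ## Metrics on the sphere -/

/-- A time-dependent Riemannian metric with components of class `C^r`. -/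
structure MetricCk (r : ℕ) (T : ℝ) (G : ℝ → Metric3) : Prop where
  smooth : ∀ i j, Ck r T fun t y => G t y i j
  pos : ∀ t ∈ Set.Ico 0 T, ∀ y, (G t y).PosDef

/-- A Riemannian metric on the sphere with components of class `C^r`. -/
structure MetricSm (r : ℕ) (G : Metric3) : Prop where
  smooth : ∀ i j, Sm r fun y => G y i j
  pos : ∀ y, (G y).PosDef

namespace MetricCk

variable {r : ℕ} {T : ℝ} {G : ℝ → Metric3}

theorem sm (h : MetricCk r T G) {t : ℝ} (ht : t ∈ Set.Ico 0 T) : MetricSm r (G t) :=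
  ⟨fun i j => (h.smooth i j).sm ht, h.pos t ht⟩

theorem of_le (h : MetricCk r T G) {q : ℕ} (hq : q ≤ r) : MetricCk q T G :=
  ⟨fun i j => (h.smooth i j).of_le hq, h.pos⟩

theorem det (h : MetricCk r T G) : Ck r T fun t y => (G t y).det := by
  have hs := h.smooth
  simp only [Matrix.det_fin_three]
  exact (((((((hs 0 0).mul (hs 1 1)).mul (hs 2 2)).sub (((hs 0 0).mul (hs 1 2)).mul (hs 2 1))).sub
    (((hs 0 1).mul (hs 1 0)).mul (hs 2 2))).add (((hs 0 1).mul (hs 1 2)).mul (hs 2 0))).add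
    (((hs 0 2).mul (hs 1 0)).mul (hs 2 1))).sub (((hs 0 2).mul (hs 1 1)).mul (hs 2 0))

theorem sqrt_det (h : MetricCk r T G) : Ck r T fun t y => Real.sqrt (G t y).det :=
  h.det.sqrt fun t ht y => (h.pos t ht y).det_pos.ne'

theorem inv (h : MetricCk r T G) (i j : Fin 3) : Ck r T fun t y => (G t y)⁻¹ i j := by
  have hs := h.smooth
  have hm : ∀ a b c d e f g k : Fin 3,
      Ck r T fun t y => G t y a b * G t y c d - G t y e f * G t y g k := fun a b c d e f g k =>
    ((hs a b).mul (hs c d)).sub ((hs e f).mul (hs g k))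
  have hm' : ∀ a b c d e f g k : Fin 3,
      Ck r T fun t y => -(G t y a b * G t y c d) + G t y e f * G t y g k := fun a b c d e f g k =>
    ((hs a b).mul (hs c d)).neg.add ((hs e f).mul (hs g k))
  simp only [inv_apply_eq]
  refine (h.det.inv fun t ht y => (h.pos t ht y).det_pos.ne').mul ?_
  simp only [Matrix.adjugate_fin_three]
  fin_cases i <;> fin_cases j <;> first | exact hm _ _ _ _ _ _ _ _ | exact hm' _ _ _ _ _ _ _ _

theorem chrLow (h : MetricCk (r + 1) T G) (A C B : Fin 3) :
    Ck r T fun t y => chrLow (G t) y A C B := by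
  have hs := fun i j => (h.smooth i j).of_le (Nat.le_succ r)
  exact ((Ck.const _).mul ((((h.smooth _ _).Z _).add ((h.smooth _ _).Z _)).sub
    ((h.smooth _ _).Z _))).add ((Ck.const _).mul (Ck.sum fun D _ =>
    (((Ck.const _).mul (hs _ _)).sub ((Ck.const _).mul (hs _ _))).sub
      ((Ck.const _).mul (hs _ _))))

theorem chr (h : MetricCk (r + 1) T G) (A D B : Fin 3) : Ck r T fun t y => chr (G t) y A D B :=
  Ck.sum fun _ _ => ((h.of_le (Nat.le_succ r)).inv _ _).mul (h.chrLow _ _ _)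

theorem cov (h : MetricCk (r + 1) T G) {l m : ℕ} {ξ : ℝ → Tensor l m} (hξ : TCk (r + 1) T ξ) :
    TCk r T fun t => cov (G t) (ξ t) := fun a b =>
  (hξ.der (b 0) (Γ := fun t => chrMat (G t) (b 0)) fun _ _ => h.chr _ _ _) a (Fin.tail b)

theorem lowT (h : MetricCk r T G) : TCk r T fun t => lowT (G t) := fun _ _ => h.smooth _ _

theorem invT (h : MetricCk r T G) : TCk r T fun t => invT (G t) := fun _ _ => h.inv _ _

end MetricCk

namespace MetricSm

variable {r : ℕ} {G : Metric3}

theorem ck (h : MetricSm r G) : MetricCk r 1 fun _ => G := ⟨h.smooth, fun _ _ => h.pos⟩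

theorem of_le (h : MetricSm r G) {q : ℕ} (hq : q ≤ r) : MetricSm q G :=
  ⟨fun i j => (h.smooth i j).of_le hq, h.pos⟩

theorem cov (h : MetricSm (r + 1) G) {l m : ℕ} {ξ : Tensor l m} (hξ : TSm (r + 1) ξ) :
    TSm r (cov G ξ) := h.ck.cov (ξ := fun _ => ξ) hξ

theorem invT (h : MetricSm r G) : TSm r (invT G) := h.ck.invT

theorem lowT (h : MetricSm r G) : TSm r (lowT G) := h.ck.lowT

variable (h : MetricSm r G) (y : S3)
include h

theorem det_ne : (G y).det ≠ 0 := (h.pos y).det_pos.ne'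

theorem isUnit : IsUnit (G y).det := isUnit_iff_ne_zero.2 (h.det_ne y)

theorem symm : (G y).IsSymm := (h.pos y).posSemidef.isSymm

theorem symm_apply (i j : Fin 3) : G y i j = G y j i := ((h.symm y).apply i j).symm

theorem inv_mul : (G y)⁻¹ * G y = 1 := Matrix.nonsing_inv_mul _ (h.isUnit y)

theorem mul_inv : G y * (G y)⁻¹ = 1 := Matrix.mul_nonsing_inv _ (h.isUnit y)

theorem inv_symm : ((G y)⁻¹).IsSymm := by
  rw [Matrix.IsSymm, Matrix.transpose_nonsing_inv, h.symm y]

theorem inv_symm_apply (i j : Fin 3) : (G y)⁻¹ i j = (G y)⁻¹ j i := ((h.inv_symm y).apply i j).symm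

end MetricSm

theorem chr_eq (G : Metric3) (y : S3) (A D B : Fin 3) :
    chr G y A D B = ∑ C, (G y)⁻¹ C D * chrLow G y A C B := rfl

/-- The matrix of the frame derivatives of a matrix of functions. -/
def ZMat (A : Fin 3) (G : Metric3) (y : S3) : Matrix (Fin 3) (Fin 3) ℝ :=
  fun i j => Z A (fun x => G x i j) y

/-! ### The Koszul connection: compatibility, torsion, inverse metric and volume -/

section connection

variable {r : ℕ} {G : Metric3} (h : MetricSm (r + 1) G) (A B C D : Fin 3) (y : S3)
include h

/-- Metric compatibility: the bracket part of the Koszul formula is antisymmetric in B and C, and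
the derivative part symmetrises to a single frame derivative. -/
theorem chrLow_compat : chrLow G y A C B + chrLow G y A B C = Z A (fun x => G x B C) y := by
  have e : ∀ i j, (fun x => G x i j) = fun x => G x j i := fun i j =>
    funext fun x => h.symm_apply x i j
  simp only [chrLow, e C B, e A B, e A C, Fin.sum_univ_three, h.symm_apply y 1 0,
    h.symm_apply y 2 0, h.symm_apply y 2 1]
  fin_cases A <;> fin_cases B <;> fin_cases C <;> simp [eps, h.symm_apply y 1 0,
    h.symm_apply y 2 0, h.symm_apply y 2 1] <;> ring

/-- Antisymmetrising the Koszul formula in A and B removes the derivatives of the metric and leaves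
the bracket of the frame fields, lowered with G: the torsion vanishes. -/
theorem chrLow_torsion : chrLow G y A C B - chrLow G y B C A
    = ∑ D, (2 / 3) * eps A B D * G y C D := by
  have e : ∀ i j, (fun x => G x i j) = fun x => G x j i := fun i j =>
    funext fun x => h.symm_apply x i j
  simp only [chrLow, e B A, Fin.sum_univ_three]
  fin_cases A <;> fin_cases B <;> simp [eps] <;> ring

theorem sum_inv_mul (i j : Fin 3) : ∑ C, (G y)⁻¹ C i * G y C j = (1 : Matrix (Fin 3) (Fin 3) ℝ) i j := by
  rw [← h.inv_mul y, Matrix.mul_apply]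
  exact Finset.sum_congr rfl fun C _ => by rw [h.inv_symm_apply]

theorem chr_torsion : chr G y A D B - chr G y B D A = (2 / 3) * eps A B D := by
  rw [chr_eq, chr_eq, ← Finset.sum_sub_distrib]
  have e : ∀ C, (G y)⁻¹ C D * chrLow G y A C B - (G y)⁻¹ C D * chrLow G y B C A
      = ∑ E, (2 / 3) * eps A B E * ((G y)⁻¹ C D * G y C E) := fun C => by
    rw [← mul_sub, chrLow_torsion h, Finset.mul_sum]
    exact Finset.sum_congr rfl fun E _ => by ring
  simp only [e]
  rw [Finset.sum_comm]
  simp only [← Finset.mul_sum, sum_inv_mul h, Matrix.one_apply]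
  simp

theorem sum_mul_chr : ∑ D, G y C D * chr G y A D B = chrLow G y A C B := by
  simp only [chr_eq, Finset.mul_sum]
  rw [Finset.sum_comm]
  have e : ∀ E, ∑ D, G y C D * ((G y)⁻¹ E D * chrLow G y A E B)
      = (1 : Matrix (Fin 3) (Fin 3) ℝ) C E * chrLow G y A E B := fun E => by
    rw [← h.mul_inv y, Matrix.mul_apply, Finset.sum_mul]
    exact Finset.sum_congr rfl fun D _ => by rw [h.inv_symm_apply y E D]; ring
  simp only [e, Matrix.one_apply]
  simp

/-- The derivative of the metric components in terms of the connection matrix. -/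
theorem Z_metric : ZMat A G y
    = (chrMat G A y).transpose * G y + G y * chrMat G A y := by
  ext i j
  rw [Matrix.add_apply, Matrix.mul_apply, Matrix.mul_apply]
  have h1 := sum_mul_chr h A i j y
  have h2 := sum_mul_chr h A j i y
  simp only [Matrix.transpose_apply, chrMat, h2, ZMat]
  rw [show ∑ x, chr G y A x i * G y x j = chrLow G y A j i by
      rw [← sum_mul_chr h A i j y]
      exact Finset.sum_congr rfl fun D _ => by rw [h.symm_apply y D j]; ring]
  rw [← chrLow_compat h A i j y, add_comm]

theorem hasDerivAt_metric_flow (i j : Fin 3) : HasDerivAt (fun s => G (frameFlow A s y) i j)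
    (Z A (fun x => G x i j) y) 0 :=
  (h.smooth i j).hasDerivAt A y

theorem Z_inv : ZMat A (fun x => (G x)⁻¹) y
    = -(chrMat G A y * (G y)⁻¹ + (G y)⁻¹ * (chrMat G A y).transpose) := by
  have h1 := hasDerivAt_matrix_inv (t := 0) (M := fun s => G (frameFlow A s y))
    (M' := ZMat A G y) (fun i j => hasDerivAt_metric_flow h A y i j)
    (Filter.Eventually.of_forall fun s => h.det_ne _)
  ext i j
  have h2 := (h1 i j).deriv
  simp only [frameFlow_zero] at h2
  refine h2.trans ?_
  rw [Z_metric h A y]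
  congr 1
  congr 1
  rw [Matrix.mul_add, Matrix.add_mul, ← Matrix.mul_assoc (G y)⁻¹ (G y), h.inv_mul, Matrix.one_mul,
    ← Matrix.mul_assoc, Matrix.mul_assoc _ (G y), h.mul_inv, Matrix.mul_one, add_comm]

theorem Z_inv_apply (i j : Fin 3) : Z A (fun x => (G x)⁻¹ i j) y
    = -(∑ D, chr G y A i D * (G y)⁻¹ D j + ∑ D, (G y)⁻¹ i D * chr G y A j D) := by
  have := congrFun (congrFun (Z_inv h A y) i) j
  simpa [Matrix.add_apply, Matrix.mul_apply, chrMat, ZMat] using this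

/-- The inverse metric is parallel. -/
theorem der_invT (a : Fin 2 → Fin 3) (b : Fin 0 → Fin 3) :
    der A (chrMat G A) (invT G) y a b = 0 := by
  rw [vec0_eq b, ← vec2_eta a, der_20]
  simp only [invT, Matrix.cons_val_zero, Matrix.cons_val_one, chrMat]
  rw [Z_inv_apply h]
  simp only [mul_comm ((G y)⁻¹ _ _)]
  ring

/-- Jacobi's formula along the flow; by metric compatibility the trace of G⁻¹ Z_A G is twice the
trace of the connection matrix. -/
theorem Z_sqrt_det : Z A (fun x => Real.sqrt (G x).det) y
    = Real.sqrt (G y).det * ∑ D, chr G y A D D := by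
  have h1 := hasDerivAt_det (t := 0) (M := fun s => G (frameFlow A s y))
    (M' := ZMat A G y) (fun i j => hasDerivAt_metric_flow h A y i j)
    (h.det_ne _)
  have h2 := (h1.sqrt (h.det_ne _)).deriv
  refine h2.trans ?_
  simp only [frameFlow_zero]
  have ht : ((G y)⁻¹ * ZMat A G y).trace
      = 2 * ∑ D, chr G y A D D := by
    rw [Z_metric h A y, Matrix.mul_add, Matrix.trace_add, ← Matrix.mul_assoc, ← Matrix.mul_assoc,
      h.inv_mul, Matrix.one_mul, Matrix.trace_mul_comm, ← Matrix.mul_assoc, h.mul_inv,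
      Matrix.one_mul, Matrix.trace_transpose]
    simp [Matrix.trace, chrMat, two_mul]
  rw [ht]
  have hp := (h.pos y).det_pos
  have hq := Real.sqrt_pos.2 hp
  rw [div_eq_iff (by positivity)]
  nth_rewrite 1 [← Real.mul_self_sqrt hp.le]
  ring

end connection

theorem cov_cons (G : Metric3) {l m : ℕ} (ξ : Tensor l m) (y : S3) (a : Fin l → Fin 3) (c : Fin 3)
    (b : Fin m → Fin 3) : cov G ξ y a (Matrix.vecCons c b) = der c (chrMat G c) ξ y a b := rfl

/-- The divergence of a vector field. -/
def divV (G : Metric3) (X : Tensor 1 0) (y : S3) : ℝ := ∑ c, der c (chrMat G c) X y ![c] ![]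

theorem TSm.der {l m r : ℕ} {ξ : Tensor l m} (h : TSm (r + 1) ξ) (A : Fin 3)
    {Γ : S3 → Matrix (Fin 3) (Fin 3) ℝ} (hΓ : ∀ i j, Sm r fun y => Γ y i j) : TSm r (der A Γ ξ) :=
  TCk.der (ξ := fun _ => ξ) h A (Γ := fun _ => Γ) hΓ

theorem MetricSm.chr {r : ℕ} {G : Metric3} (h : MetricSm (r + 1) G) (A D B : Fin 3) :
    Sm r fun y => BigCrunch.chr G y A D B := h.ck.chr A D B

/-- The divergence theorem. -/
theorem integralVol_divV {G : Metric3} (h : MetricSm 1 G) {X : Tensor 1 0} (hX : TSm 1 X) :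
    integralVol G (divV G X) = 0 := by
  have hs : Sm 1 fun y => Real.sqrt (G y).det := h.ck.sqrt_det
  have e : ∀ y, divV G X y * Real.sqrt (G y).det
      = ∑ c, Z c (fun x => X x ![c] ![] * Real.sqrt (G x).det) y := by
    intro y
    have h1 : ∀ c, Z c (fun x => X x ![c] ![] * Real.sqrt (G x).det) y
        = Z c (fun x => X x ![c] ![]) y * Real.sqrt (G y).det
          + X y ![c] ![] * (Real.sqrt (G y).det * ∑ D, BigCrunch.chr G y c D D) := fun c => by
      rw [Z_mul c y (hX _ _) hs, Z_sqrt_det (r := 0) h]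
    -- The volume factor contributes one trace of the connection and the divergence the other; they
    -- agree, since their difference is the structure constant ε_{cDD} = 0. Thus the divergence
    -- times the volume density is a sum of frame derivatives.
    have h2 : ∀ c D, BigCrunch.chr G y c D D = BigCrunch.chr G y D D c + (2 / 3) * eps c D D :=
      fun c D => by linarith [chr_torsion (r := 0) h c D D y]
    have h3 : ∀ c D, eps c D D = 0 := fun c D => by simp [eps]
    simp only [h3, mul_zero, add_zero] at h2
    simp only [h1, divV, der_10, chrMat]
    simp only [Fin.sum_univ_three]
    rw [h2 0 1, h2 0 2, h2 1 0, h2 1 2, h2 2 0, h2 2 1]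
    ring
  unfold integralVol
  simp only [e]
  rw [integral_finset_sum]
  · exact Finset.sum_eq_zero fun c _ => integral_Z c ((hX _ _).mul hs)
  · exact fun c _ => integrable_of_continuous (((hX _ _).mul hs).Z (r := 0) c).continuous

/-! ## Inner products of tensors of low rank -/

theorem sum_vec0 (F : (Fin 0 → Fin 3) → ℝ) : ∑ b, F b = F ![] := by
  rw [Fintype.sum_unique]
  congr 1

theorem sum_vec_succ {m : ℕ} (F : (Fin (m + 1) → Fin 3) → ℝ) :
    ∑ b, F b = ∑ i, ∑ b : Fin m → Fin 3, F (Matrix.vecCons i b) := by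
  rw [← (Fin.consEquiv fun _ : Fin (m + 1) => Fin 3).sum_comp, Fintype.sum_prod_type]
  rfl

/-- The Frobenius product of matrices. -/
def fro (A B : Matrix (Fin 3) (Fin 3) ℝ) : ℝ := (A.transpose * B).trace

theorem fro_eq_sum (A B : Matrix (Fin 3) (Fin 3) ℝ) : fro A B = ∑ i, ∑ j, A i j * B i j := by
  simp only [fro, Matrix.trace, Matrix.diag_apply, Matrix.mul_apply, Matrix.transpose_apply]
  exact Finset.sum_comm

theorem fro_comm (A B : Matrix (Fin 3) (Fin 3) ℝ) : fro A B = fro B A := by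
  simp only [fro_eq_sum, mul_comm]

theorem fro_mul_left (A B P : Matrix (Fin 3) (Fin 3) ℝ) :
    fro A (P * B) = fro (P.transpose * A) B := by
  simp only [fro, Matrix.transpose_mul, Matrix.transpose_transpose, Matrix.mul_assoc]

theorem fro_smul_right (c : ℝ) (A B : Matrix (Fin 3) (Fin 3) ℝ) : fro A (c • B) = c * fro A B := by
  simp [fro, Matrix.trace_smul]

/-- The matrix of a tensor with one upper and one lower index. -/
def m11 (x : Comp 1 1) : Matrix (Fin 3) (Fin 3) ℝ := Matrix.of fun i j => x ![i] ![j]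

/-- The matrix in the last two indices of a tensor with three lower indices. -/
def m03 (h : Comp 0 3) (c : Fin 3) : Matrix (Fin 3) (Fin 3) ℝ := Matrix.of fun i j => h ![] ![c, i, j]

section ipm

variable {g k : Matrix (Fin 3) (Fin 3) ℝ}

theorem ipm_00 (f f' : Comp 0 0) : ipm g k f f' = f ![] ![] * f' ![] ![] := by
  simp only [ipm, ker, sum_vec0, Finset.univ_eq_empty, Finset.prod_empty, one_mul]

theorem ipm_01 (ψ χ : Comp 0 1) :
    ipm g k ψ χ = ∑ c, ∑ d, k c d * ψ ![] ![c] * χ ![] ![d] := by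
  simp only [ipm, ker, sum_vec0, sum_vec_succ, Finset.univ_eq_empty, Finset.prod_empty, one_mul,
    Fin.prod_univ_one, Matrix.cons_val_zero]

theorem ipm_10 (v w : Comp 1 0) :
    ipm g k v w = ∑ c, ∑ d, g c d * v ![c] ![] * w ![d] ![] := by
  simp only [ipm, ker, sum_vec0, sum_vec_succ, Finset.univ_eq_empty, Finset.prod_empty, mul_one,
    Fin.prod_univ_one, Matrix.cons_val_zero]

theorem ipm_11 (x z : Comp 1 1) : ipm g k x z = fro (m11 x) (g * m11 z * k.transpose) := by
  simp only [ipm, ker, sum_vec0, sum_vec_succ, fro_eq_sum, Matrix.mul_apply, Matrix.transpose_apply,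
    m11, Matrix.of_apply, Finset.mul_sum, Finset.sum_mul]
  refine Finset.sum_congr rfl fun a _ => ?_
  rw [Finset.sum_comm]
  refine Finset.sum_congr rfl fun b _ => ?_
  rw [Finset.sum_comm]
  refine Finset.sum_congr rfl fun a' _ => Finset.sum_congr rfl fun b' _ => ?_
  simp
  ring

theorem ipm_03 (h η : Comp 0 3) :
    ipm g k h η = ∑ c, ∑ d, k c d * fro (m03 h c) (k * m03 η d * k.transpose) := by
  have e : ipm g k h η = ∑ c, ∑ i, ∑ j, ∑ d, ∑ i', ∑ j',
      k c d * (k i i' * k j j' * h ![] ![c, i, j] * η ![] ![d, i', j']) := by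
    simp only [ipm, ker, sum_vec0, sum_vec_succ]
    refine Finset.sum_congr rfl fun c _ => Finset.sum_congr rfl fun i _ =>
      Finset.sum_congr rfl fun j _ => Finset.sum_congr rfl fun d _ =>
      Finset.sum_congr rfl fun i' _ => Finset.sum_congr rfl fun j' _ => ?_
    simp [Fin.prod_univ_three]
    ring
  rw [e]
  refine Finset.sum_congr rfl fun c _ => ?_
  have e2 : ∀ i, ∑ j, ∑ d, ∑ i', ∑ j',
      k c d * (k i i' * k j j' * h ![] ![c, i, j] * η ![] ![d, i', j'])
      = ∑ d, ∑ j, ∑ i', ∑ j', k c d * (k i i' * k j j' * h ![] ![c, i, j] * η ![] ![d, i', j']) :=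
    fun i => Finset.sum_comm
  simp only [e2]
  rw [Finset.sum_comm]
  refine Finset.sum_congr rfl fun d _ => ?_
  simp only [fro_eq_sum, Matrix.mul_apply, Matrix.transpose_apply, m03, Matrix.of_apply,
    Finset.mul_sum, Finset.sum_mul]
  refine Finset.sum_congr rfl fun i _ => Finset.sum_congr rfl fun j _ => ?_
  rw [Finset.sum_comm]
  refine Finset.sum_congr rfl fun j' _ => Finset.sum_congr rfl fun i' _ => ?_
  ring

/-- Lowering the first index: `ν_c g_{ie} x^e_j`. -/
def lowTens (g : Matrix (Fin 3) (Fin 3) ℝ) (z : Comp 1 2) : Comp 0 3 := fun _ b =>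
  ∑ e, g (b 1) e * z ![e] ![b 0, b 2]

/-- `h_{cij} ↦ g^{ij} h_{cij}`. -/
def trace23 (k : Matrix (Fin 3) (Fin 3) ℝ) (h : Comp 0 3) : Comp 0 1 := fun _ b =>
  ∑ i, ∑ j, k i j * h ![] ![b 0, i, j]

/-- `h_{cij} ↦ g^{ci} h_{cij}`. -/
def trace12 (k : Matrix (Fin 3) (Fin 3) ℝ) (h : Comp 0 3) : Comp 0 1 := fun _ b =>
  ∑ c, ∑ i, k c i * h ![] ![c, i, b 0]

/-- `ν_c g_{ij}`. -/
def vecMet (g : Matrix (Fin 3) (Fin 3) ℝ) (ν : Comp 0 1) : Comp 0 3 := fun _ b =>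
  ν ![] ![b 0] * g (b 1) (b 2)

/-- `g_{ci} χ_j`. -/
def metVec (g : Matrix (Fin 3) (Fin 3) ℝ) (χ : Comp 0 1) : Comp 0 3 := fun _ b =>
  g (b 0) (b 1) * χ ![] ![b 2]

/-- `g^{ic} ξ_{cj}`. -/
def raise2 (k : Matrix (Fin 3) (Fin 3) ℝ) (ξ : Comp 0 2) : Comp 1 1 := fun a b =>
  ∑ c, k (a 0) c * ξ ![] ![c, b 0]

/-- `g^{ic} ν_c w_j`. -/
def raiseTens (k : Matrix (Fin 3) (Fin 3) ℝ) (ν w : Comp 0 1) : Comp 1 1 := fun a b =>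
  ∑ c, k (a 0) c * (ν ![] ![c] * w ![] ![b 0])

variable (hgk : g * k = 1) (hg : g.IsSymm) (hk : k.IsSymm)

theorem m11_raise2 (ξ : Comp 0 2) :
    m11 (raise2 k ξ) = k * Matrix.of fun c j => ξ ![] ![c, j] := by
  ext i j
  simp [m11, raise2, Matrix.mul_apply]

include hgk in
theorem ipm_raise2 (x : Comp 1 1) (ξ : Comp 0 2) :
    ipm g k x (raise2 k ξ) = ∑ c, ∑ j, ∑ l, x ![c] ![j] * k j l * ξ ![] ![c, l] := by
  rw [ipm_11, m11_raise2, ← Matrix.mul_assoc, hgk, Matrix.one_mul, fro_eq_sum]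
  simp only [Matrix.mul_apply, Finset.mul_sum, m11, Matrix.of_apply, Matrix.transpose_apply]
  refine Finset.sum_congr rfl fun c _ => Finset.sum_congr rfl fun j _ =>
    Finset.sum_congr rfl fun l _ => ?_
  ring

include hgk in
theorem ipm_raiseTens (x : Comp 1 1) (ν w : Comp 0 1) :
    ipm g k x (raiseTens k ν w) = ∑ c, ∑ j, ∑ l, x ![c] ![j] * k j l * (ν ![] ![c] * w ![] ![l]) :=
  ipm_raise2 hgk x fun _ b => ν ![] ![b 0] * w ![] ![b 1]

include hgk hk in
theorem ipm_raiseTens_self (ν w : Comp 0 1) :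
    ipm g k (raiseTens k ν w) (raiseTens k ν w) = ipm g k ν ν * ipm g k w w := by
  rw [ipm_raiseTens hgk, ipm_01, ipm_01]
  simp only [raiseTens, Fin.sum_univ_three, Matrix.cons_val_zero]
  rw [hk.apply 1 0, hk.apply 2 0, hk.apply 2 1]
  ring

include hgk in
theorem ipm_lowTens (h : Comp 0 3) (z : Comp 1 2) :
    ipm g k h (lowTens g z)
      = ∑ c, ∑ d, k c d * ∑ e, ∑ j, ∑ l, h ![] ![c, e, j] * k j l * z ![e] ![d, l] := by
  rw [ipm_03]
  refine Finset.sum_congr rfl fun c _ => Finset.sum_congr rfl fun d _ => ?_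
  have e : m03 (lowTens g z) d = g * Matrix.of fun e j => z ![e] ![d, j] := by
    ext i j
    simp [m03, lowTens, Matrix.mul_apply]
  rw [e, ← Matrix.mul_assoc, mul_eq_one_comm.1 hgk, Matrix.one_mul, fro_eq_sum]
  simp only [Matrix.mul_apply, Finset.mul_sum, m03, Matrix.of_apply, Matrix.transpose_apply]
  refine Finset.sum_congr rfl fun c _ => Finset.sum_congr rfl fun j _ =>
    Finset.sum_congr rfl fun l _ => ?_
  ring

/-- `ν_c x^i_j`. -/
def vecTens (ν : Comp 0 1) (x : Comp 1 1) : Comp 1 2 := fun a b => ν ![] ![b 0] * x a ![b 1]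

include hgk hg hk in
theorem ipm_lowTens_vecTens_self (ν : Comp 0 1) (x : Comp 1 1) :
    ipm g k (lowTens g (vecTens ν x)) (lowTens g (vecTens ν x)) = ipm g k ν ν * ipm g k x x := by
  have e : ipm g k x x = ∑ e, ∑ j, ∑ l, (∑ i, g e i * x ![i] ![j]) * k j l * x ![e] ![l] := by
    rw [ipm_11, Matrix.mul_assoc, fro_mul_left, hg.eq, fro_eq_sum]
    simp only [Matrix.mul_apply, Finset.mul_sum, m11, Matrix.of_apply, Matrix.transpose_apply]
    refine Finset.sum_congr rfl fun c _ => Finset.sum_congr rfl fun j _ =>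
      Finset.sum_congr rfl fun l _ => ?_
    rw [hk.apply]
    ring
  rw [ipm_lowTens hgk, e, ipm_01, Finset.sum_mul]
  refine Finset.sum_congr rfl fun c _ => ?_
  rw [Finset.sum_mul]
  refine Finset.sum_congr rfl fun d _ => ?_
  simp only [Finset.mul_sum]
  refine Finset.sum_congr rfl fun e _ => Finset.sum_congr rfl fun j _ =>
    Finset.sum_congr rfl fun l _ => ?_
  simp only [lowTens, vecTens]
  simp only [Fin.sum_univ_three]
  simp
  ring

-- Multiplication by the metric is the adjoint of `trace23`. This evaluates the ∇N part of the
-- evolution of ∇G in the energy, and by duality bounds the norm of the trace.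
include hgk hk in
theorem ipm_vecMet (h : Comp 0 3) (ν : Comp 0 1) :
    ipm g k h (vecMet g ν) = ipm g k (trace23 k h) ν := by
  rw [ipm_03, ipm_01]
  refine Finset.sum_congr rfl fun c _ => Finset.sum_congr rfl fun d _ => ?_
  have e : m03 (vecMet g ν) d = ν ![] ![d] • g := by
    ext i j
    simp [m03, vecMet]
  rw [e, Matrix.mul_smul, mul_eq_one_comm.1 hgk, Matrix.smul_mul, Matrix.one_mul,
    fro_smul_right, fro_eq_sum, hk.eq]
  simp only [trace23, Matrix.cons_val_zero, m03, Matrix.of_apply]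
  simp only [mul_comm (k _ _) (h _ _)]
  ring

-- The corresponding adjointness for `trace12`, the contraction that produces the divergence of a
-- two-tensor from its gradient.
include hgk hk in
theorem ipm_metVec (h : Comp 0 3) (χ : Comp 0 1) :
    ipm g k h (metVec g χ) = ipm g k (trace12 k h) χ := by
  have e1 : ∀ d, k * m03 (metVec g χ) d
      = Matrix.of fun i j => (∑ p, k i p * g d p) * χ ![] ![j] := fun d => by
    ext i j
    simp only [Matrix.mul_apply, m03, metVec, Matrix.of_apply, Finset.sum_mul]
    refine Finset.sum_congr rfl fun p _ => ?_
    simp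
    ring
  have e2 : ∀ c i, ∑ d, k c d * ∑ p, k i p * g d p = k i c := fun c i => by
    have : (k * g) * k.transpose = k.transpose := by
      rw [mul_eq_one_comm.1 hgk, Matrix.one_mul]
    have h2 := congrFun (congrFun this c) i
    rw [Matrix.transpose_apply] at h2
    rw [← h2, Matrix.mul_assoc, Matrix.mul_apply]
    refine Finset.sum_congr rfl fun d _ => ?_
    rw [Matrix.mul_apply]
    congr 1
    exact Finset.sum_congr rfl fun p _ => by rw [Matrix.transpose_apply]; ring
  have e3 : ∀ c d, fro (m03 h c) (k * m03 (metVec g χ) d * k.transpose)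
      = ∑ i, ∑ j, ∑ l, (∑ p, k i p * g d p) * (h ![] ![c, i, j] * k j l * χ ![] ![l]) := fun c d => by
    rw [e1, fro_eq_sum]
    simp only [Matrix.mul_apply, Matrix.of_apply, Matrix.transpose_apply, m03, Finset.mul_sum]
    refine Finset.sum_congr rfl fun i _ => Finset.sum_congr rfl fun j _ =>
      Finset.sum_congr rfl fun l _ => ?_
    simp only [Finset.sum_mul, Finset.mul_sum]
    exact Finset.sum_congr rfl fun p _ => by ring
  have e4 : ∀ c, ∑ d, k c d * fro (m03 h c) (k * m03 (metVec g χ) d * k.transpose)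
      = ∑ i, ∑ j, ∑ l, k i c * (h ![] ![c, i, j] * k j l * χ ![] ![l]) := fun c => by
    simp only [e3]
    -- The inner contraction is frozen as an opaque array u, so that the sum over d can be moved
    -- inside before `e2` collapses it.
    have e5 := e2 c
    generalize hu : (fun d i => ∑ p, k i p * g d p) = u at e5
    simp only [fun d i => (congrFun (congrFun hu d) i : ∑ p, k i p * g d p = u d i)] at e5 ⊢
    simp only [Finset.mul_sum]
    rw [Finset.sum_comm]
    refine Finset.sum_congr rfl fun i _ => ?_
    rw [Finset.sum_comm]
    refine Finset.sum_congr rfl fun j _ => ?_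
    rw [Finset.sum_comm]
    refine Finset.sum_congr rfl fun l _ => ?_
    rw [← e5 i, Finset.sum_mul]
    exact Finset.sum_congr rfl fun d _ => by ring
  rw [ipm_03, ipm_01]
  simp only [e4, trace12, Matrix.cons_val_zero]
  simp only [Fin.sum_univ_three]
  rw [hk.apply 0 1, hk.apply 0 2, hk.apply 1 2]
  ring

/-- Duality: if `h ↦ L h` is adjoint to an embedding `J` with `|J ν|² ≤ 3 |ν|²`, then
`|L h|² ≤ 3 |h|²`. -/
theorem sq_le_of_adjoint {p q r : ℝ} (hr : 0 ≤ r) (h : p ^ 2 ≤ r * q) (hq : q ≤ 3 * p) :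
    p ≤ 3 * r := by
  by_contra hc
  push Not at hc
  nlinarith

section norms

variable (pg : g.PosSemidef) (pk : k.PosSemidef)

include hgk pg pk in
theorem ipm_vecMet_self (ν : Comp 0 1) :
    ipm g k (vecMet g ν) (vecMet g ν) = 3 * ipm g k ν ν := by
  rw [ipm_vecMet hgk pk.isSymm]
  have e : trace23 k (vecMet g ν) = (3 : ℝ) • ν := by
    funext a b
    have h1 : ∑ i, ∑ j, k i j * g i j = 3 := by
      have : (g * k).trace = 3 := by rw [hgk]; simp
      rw [← this]
      simp only [Matrix.trace, Matrix.diag_apply, Matrix.mul_apply]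
      refine Finset.sum_congr rfl fun i _ => Finset.sum_congr rfl fun j _ => ?_
      rw [pk.isSymm.apply i j]
      ring
    rw [vec0_eq a, ← vec1_eta b]
    have h2 : trace23 k (vecMet g ν) ![] ![b 0] = ν ![] ![b 0] * ∑ i, ∑ j, k i j * g i j := by
      simp only [trace23, vecMet, Finset.mul_sum]
      refine Finset.sum_congr rfl fun i _ => Finset.sum_congr rfl fun j _ => ?_
      simp
      ring
    rw [h2, h1]
    simp [mul_comm]
  rw [e, ipm, ker_smul_left]

include hgk pg pk in
theorem trace12_metVec (χ : Comp 0 1) : trace12 k (metVec g χ) = (3 : ℝ) • χ := by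
  funext a b
  have h1 : ∑ i, ∑ j, k i j * g i j = 3 := by
    have : (g * k).trace = 3 := by rw [hgk]; simp
    rw [← this]
    simp only [Matrix.trace, Matrix.diag_apply, Matrix.mul_apply]
    refine Finset.sum_congr rfl fun i _ => Finset.sum_congr rfl fun j _ => ?_
    rw [pk.isSymm.apply i j]
    ring
  rw [vec0_eq a, ← vec1_eta b]
  have h2 : trace12 k (metVec g χ) ![] ![b 0] = χ ![] ![b 0] * ∑ i, ∑ j, k i j * g i j := by
    simp only [trace12, metVec, Finset.mul_sum]
    refine Finset.sum_congr rfl fun i _ => Finset.sum_congr rfl fun j _ => ?_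
    simp
    ring
  rw [h2, h1]
  simp [mul_comm]

include hgk pg pk in
theorem ipm_metVec_self (χ : Comp 0 1) :
    ipm g k (metVec g χ) (metVec g χ) = 3 * ipm g k χ χ := by
  rw [ipm_metVec hgk pk.isSymm, trace12_metVec hgk pg pk, ipm, ker_smul_left]

include hgk pg pk in
theorem ipm_trace23_le (h : Comp 0 3) :
    ipm g k (trace23 k h) (trace23 k h) ≤ 3 * ipm g k h h := by
  refine sq_le_of_adjoint (ipm_self_nonneg pg pk h) ?_ (ipm_vecMet_self hgk pg pk _).le
  rw [← ipm_vecMet hgk pk.isSymm]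
  exact ipm_sq_le pg pk _ _

include hgk pg pk in
theorem ipm_trace12_le (h : Comp 0 3) :
    ipm g k (trace12 k h) (trace12 k h) ≤ 3 * ipm g k h h := by
  refine sq_le_of_adjoint (ipm_self_nonneg pg pk h) ?_ (ipm_metVec_self hgk pg pk _).le
  rw [← ipm_metVec hgk pk.isSymm]
  exact ipm_sq_le pg pk _ _

/-- The identity tensor. -/
def idT : Comp 1 1 := fun a b => (1 : Matrix (Fin 3) (Fin 3) ℝ) (a 0) (b 0)

include hgk pk in
theorem ipm_idT (x : Comp 1 1) : ipm g k x idT = ∑ c, x ![c] ![c] := by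
  have e : m11 idT = 1 := by ext i j; rfl
  rw [ipm_11, e, Matrix.mul_one, pk.isSymm.eq, hgk, fro_eq_sum]
  simp [Matrix.one_apply, m11]

/-- Lowering the index of a vector. -/
def lower1 (g : Matrix (Fin 3) (Fin 3) ℝ) (v : Comp 1 0) : Comp 0 1 := fun _ b =>
  ∑ c, g (b 0) c * v ![c] ![]

include hgk pg pk in
theorem ipm_lower1 (v : Comp 1 0) (w : Comp 0 1) :
    ipm g k (lower1 g v) w = ∑ i, v ![i] ![] * w ![] ![i] := by
  rw [ipm_01]
  have e : ∀ d, ∑ c, k c d * lower1 g v ![] ![c] = v ![d] ![] := fun d => by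
    have h1 : (k * g).mulVec (fun c => v ![c] ![]) d = v ![d] ![] := by
      rw [mul_eq_one_comm.1 hgk, Matrix.one_mulVec]
    rw [← h1, ← Matrix.mulVec_mulVec]
    simp only [Matrix.mulVec, dotProduct, lower1]
    exact Finset.sum_congr rfl fun c _ => by rw [pk.isSymm.apply d c]; rfl
  rw [Finset.sum_comm]
  simp only [← Finset.sum_mul, e]

include hgk pg pk in
theorem ipm_lower1_self (v : Comp 1 0) : ipm g k (lower1 g v) (lower1 g v) = ipm g k v v := by
  rw [ipm_lower1 hgk pg pk, ipm_10]
  refine Finset.sum_congr rfl fun i _ => ?_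
  simp only [lower1, Finset.mul_sum, Matrix.cons_val_zero]
  exact Finset.sum_congr rfl fun j _ => by ring

/-- The norm of a self-adjoint endomorphism. -/
theorem ipm_self_of_symm (hgk : g * k = 1) {x : Comp 1 1} (hk : k.IsSymm)
    (hx : (g * m11 x).IsSymm) : ipm g k x x = ∑ i, ∑ j, x ![i] ![j] * x ![j] ![i] := by
  have h1 : ipm g k x x = (m11 x * m11 x).trace := by
    have h2 : (m11 x).transpose * g.transpose = g * m11 x := by
      rw [← Matrix.transpose_mul]; exact hx
    rw [ipm_11, fro_comm, fro, hk.eq, Matrix.transpose_mul, Matrix.transpose_mul, hk.eq, h2,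
      ← Matrix.mul_assoc, mul_eq_one_comm.1 hgk, Matrix.one_mul]
  rw [h1]
  simp [Matrix.trace, Matrix.mul_apply, m11]

include hgk pg pk in
/-- An endomorphism is bounded by its norm, as a quadratic form. -/
theorem sq_form_le (x : Comp 1 1) (ξ : Fin 3 → ℝ) :
    (ξ ⬝ᵥ (g * m11 x).mulVec ξ) ^ 2 ≤ ipm g k x x * (ξ ⬝ᵥ g.mulVec ξ) ^ 2 := by
  -- The rank one endomorphism ξ ⊗ gξ: pairing with it evaluates the quadratic form at ξ, and its
  -- squared norm is g(ξ, ξ)², so the claim is Cauchy–Schwarz.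
  let z : Comp 1 1 := fun a b => ξ (a 0) * g.mulVec ξ (b 0)
  have hz : m11 z = Matrix.vecMulVec ξ (g.mulVec ξ) := by ext i j; rfl
  have hgξ : k.mulVec (g.mulVec ξ) = ξ := by
    rw [Matrix.mulVec_mulVec, mul_eq_one_comm.1 hgk, Matrix.one_mulVec]
  have h1 : g * m11 z * k.transpose = Matrix.vecMulVec (g.mulVec ξ) ξ := by
    rw [hz, Matrix.mul_vecMulVec, Matrix.vecMulVec_mul, Matrix.vecMul_transpose, hgξ]
  have key : ∀ w : Comp 1 1, ipm g k w z = ξ ⬝ᵥ (g * m11 w).mulVec ξ := fun w => by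
    rw [ipm_11, h1, fro_eq_sum, ← Matrix.mulVec_mulVec, Matrix.dotProduct_mulVec]
    have hs : Matrix.vecMul ξ g = g.mulVec ξ := by
      rw [← Matrix.mulVec_transpose, pg.isSymm.eq]
    rw [hs]
    simp only [dotProduct, Matrix.mulVec, Matrix.vecMulVec_apply, Finset.mul_sum]
    refine Finset.sum_congr rfl fun i _ => Finset.sum_congr rfl fun j _ => ?_
    simp only [Finset.sum_mul, Finset.mul_sum]
    exact Finset.sum_congr rfl fun l _ => by ring
  have h2 : ipm g k z z = (ξ ⬝ᵥ g.mulVec ξ) ^ 2 := by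
    rw [key, hz, Matrix.mul_vecMulVec, Matrix.vecMulVec_mulVec]
    simp [dotProduct_comm, sq]
  rw [← key, ← h2]
  exact ipm_sq_le pg pk x z

include hgk pg pk in
/-- A multiple of the metric dominates `u g x + v g`. -/
theorem posSemidef_add_smul {x : Comp 1 1} (hx : (g * m11 x).IsSymm) {u v c b : ℝ} (hb : 0 ≤ b)
    (hxb : ipm g k x x ≤ b ^ 2) (hc : |u| * b + |v| ≤ c) {s : ℝ} (hs : |s| = 1) :
    (c • g + s • (u • (g * m11 x) + v • g)).PosSemidef := by
  refine Matrix.PosSemidef.of_dotProduct_mulVec_nonneg ?_ fun ξ => ?_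
  · have : (c • g + s • (u • (g * m11 x) + v • g)).IsSymm := by
      unfold Matrix.IsSymm
      simp only [Matrix.transpose_add, Matrix.transpose_smul, hx.eq, pg.isSymm.eq]
    rwa [Matrix.IsHermitian, Matrix.conjTranspose_eq_transpose_of_trivial]
  · simp only [star_trivial, Matrix.add_mulVec, Matrix.smul_mulVec, dotProduct_add,
      dotProduct_smul, smul_eq_mul]
    have h0 : 0 ≤ ξ ⬝ᵥ g.mulVec ξ := by simpa using pg.dotProduct_mulVec_nonneg ξ
    have h1 : |ξ ⬝ᵥ (g * m11 x).mulVec ξ| ≤ b * (ξ ⬝ᵥ g.mulVec ξ) := by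
      refine abs_le_of_sq_le_sq ?_ (by positivity)
      refine (sq_form_le hgk pg pk x ξ).trans ?_
      rw [mul_pow]
      gcongr
    set q := ξ ⬝ᵥ g.mulVec ξ
    set r := ξ ⬝ᵥ (g * m11 x).mulVec ξ
    have h2 : |s * (u * r + v * q)| ≤ (|u| * b + |v|) * q := by
      rw [abs_mul, hs, one_mul]
      refine (abs_add_le _ _).trans ?_
      rw [abs_mul, abs_mul, abs_of_nonneg h0, add_mul, mul_assoc]
      gcongr
    have h3 : (|u| * b + |v|) * q ≤ c * q := by gcongr
    linarith [neg_abs_le (s * (u * r + v * q))]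

-- Congruence with k = g⁻¹ transports a bound for the derivative of the metric to the derivative of
-- its inverse, which is −kXk.
include hgk pk in
theorem posSemidef_inv {X : Matrix (Fin 3) (Fin 3) ℝ} {c s : ℝ}
    (h : (c • g + s • X).PosSemidef) : (c • k + s • (k * X * k)).PosSemidef := by
  have := h.conjTranspose_mul_mul_same k
  have e : k.conjTranspose * (c • g + s • X) * k = c • k + s • (k * X * k) := by
    rw [Matrix.conjTranspose_eq_transpose_of_trivial, pk.isSymm.eq, Matrix.mul_add, Matrix.add_mul,
      Matrix.mul_smul, Matrix.mul_smul, Matrix.smul_mul, Matrix.smul_mul,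
      mul_eq_one_comm.1 hgk, Matrix.one_mul]
  rwa [e] at this

end norms

end ipm

/-! ## Divergence identities -/

theorem update_vec3_zero (i j k D : Fin 3) : Function.update ![i, j, k] 0 D = ![D, j, k] := by
  funext p; fin_cases p <;> rfl

theorem update_vec3_one (i j k D : Fin 3) : Function.update ![i, j, k] 1 D = ![i, D, k] := by
  funext p; fin_cases p <;> rfl

theorem update_vec3_two (i j k D : Fin 3) : Function.update ![i, j, k] 2 D = ![i, j, D] := by
  funext p; fin_cases p <;> rfl

theorem der_03 (A : Fin 3) (Γ : S3 → Matrix (Fin 3) (Fin 3) ℝ) (y : S3) (h : Tensor 0 3)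
    (i j k : Fin 3) :
    der A Γ h y ![] ![i, j, k] = Z A (fun z => h z ![] ![i, j, k]) y
      - ∑ D, Γ y D i * h y ![] ![D, j, k] - ∑ D, Γ y D j * h y ![] ![i, D, k]
      - ∑ D, Γ y D k * h y ![] ![i, j, D] := by
  have e : ∑ p : Fin 3, ∑ D, Γ y D (![i, j, k] p) * h y ![] (Function.update ![i, j, k] p D)
      = ∑ D, Γ y D i * h y ![] ![D, j, k] + ∑ D, Γ y D j * h y ![] ![i, D, k]
        + ∑ D, Γ y D k * h y ![] ![i, j, D] := by
    rw [Fin.sum_univ_three]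
    simp only [update_vec3_zero, update_vec3_one, update_vec3_two]
    rfl
  simp only [der, e, Finset.univ_eq_empty, Finset.sum_empty]
  ring

/-- `x^i_d P^{dj}`. -/
def mulUp (x : Tensor 1 1) (P : Tensor 2 0) : Tensor 2 0 := fun y a _ =>
  ∑ d, x y ![a 0] ![d] * P y ![d, a 1] ![]

/-- `P^{ij} h_{cij}`. -/
def contr (P : Tensor 2 0) (h : Tensor 0 3) : Tensor 0 1 := fun y _ b =>
  ∑ i, ∑ j, P y ![i, j] ![] * h y ![] ![b 0, i, j]

/-- `x^i_d v^d`. -/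
def mulVec (x : Tensor 1 1) (v : Tensor 1 0) : Tensor 1 0 := fun y a _ =>
  ∑ d, x y ![a 0] ![d] * v y ![d] ![]

/-- `w_d x^d_j`. -/
def vecMul (w : Tensor 0 1) (x : Tensor 1 1) : Tensor 0 1 := fun y _ b =>
  ∑ d, w y ![] ![d] * x y ![d] ![b 0]

theorem isNatural_mulUp : IsNatural mulUp where
  smooth hξ hη _ _ := Ck.sum fun _ _ => (hξ _ _).mul (hη _ _)
  leibniz A Γ ξ η hξ hη := by
    funext y a b
    rw [vec0_eq b, ← vec2_eta a]
    generalize a 0 = i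
    generalize a 1 = j
    simp only [Pi.add_apply, der_20]
    simp only [mulUp, Matrix.cons_val_zero, Matrix.cons_val_one]
    rw [Z_sum_mul A y (fun c => hξ _ _) fun c => hη _ _]
    simp only [der_20, der_11, Fin.sum_univ_three]
    ring

theorem isNatural_contr : IsNatural contr where
  smooth hξ hη _ _ := Ck.sum fun _ _ => Ck.sum fun _ _ => (hξ _ _).mul (hη _ _)
  leibniz A Γ ξ η hξ hη := by
    funext y a b
    rw [vec0_eq a, ← vec1_eta b]
    generalize b 0 = i
    simp only [Pi.add_apply, der_01]
    simp only [contr, Matrix.cons_val_zero]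
    rw [Z_sum A y fun c _ => Sm.sum fun d _ => (hξ _ _).mul (hη _ _)]
    simp only [Z_sum_mul A y (fun c => hξ _ _) fun c => hη _ _]
    simp only [der_20, der_03, Fin.sum_univ_three]
    ring

theorem isNatural_mulVec : IsNatural mulVec where
  smooth hξ hη _ _ := Ck.sum fun _ _ => (hξ _ _).mul (hη _ _)
  leibniz A Γ ξ η hξ hη := by
    funext y a b
    rw [vec0_eq b, ← vec1_eta a]
    generalize a 0 = i
    simp only [Pi.add_apply, der_10]
    simp only [mulVec, Matrix.cons_val_zero]
    rw [Z_sum_mul A y (fun c => hξ _ _) fun c => hη _ _]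
    simp only [der_10, der_11, Fin.sum_univ_three]
    ring

theorem isNatural_vecMul : IsNatural vecMul where
  smooth hξ hη _ _ := Ck.sum fun _ _ => (hξ _ _).mul (hη _ _)
  leibniz A Γ ξ η hξ hη := by
    funext y a b
    rw [vec0_eq a, ← vec1_eta b]
    generalize b 0 = i
    simp only [Pi.add_apply, der_01]
    simp only [vecMul, Matrix.cons_val_zero]
    rw [Z_sum_mul A y (fun c => hξ _ _) fun c => hη _ _]
    simp only [der_01, der_11, Fin.sum_univ_three]
    ring

section divergence

variable {G : Metric3} (h : MetricSm 1 G)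
include h

/-- The inverse metric is parallel, so raising an index commutes with the covariant derivative. -/
theorem der_upVec {η : Tensor 0 1} (hη : TSm 1 η) (A : Fin 3) (y : S3) (i : Fin 3) :
    der A (chrMat G A) (upVec (invT G) η) y ![i] ![]
      = ∑ d, (G y)⁻¹ i d * der A (chrMat G A) η y ![] ![d] := by
  rw [isNatural_upVec.leibniz A _ h.invT hη]
  simp only [Pi.add_apply, upVec, der_invT (r := 0) h, zero_mul, Finset.sum_const_zero, zero_add]
  rfl

theorem divV_smul {n : S3 → ℝ} (hn : Sm 1 n) {X : Tensor 1 0} (hX : TSm 1 X) (y : S3) :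
    divV G (smulT (ofScalar n) X) y = ∑ c, Z c n y * X y ![c] ![] + n y * divV G X y := by
  simp only [divV, isNatural_smulT.leibniz _ _ (TSm.ofScalar hn) hX, Pi.add_apply, Finset.mul_sum,
    ← Finset.sum_add_distrib]
  refine Finset.sum_congr rfl fun c _ => ?_
  simp only [smulT, der_00]
  rfl

theorem divV_upVec {η : Tensor 0 1} (hη : TSm 1 η) (y : S3) :
    divV G (upVec (invT G) η) y = ∑ c, ∑ d, (G y)⁻¹ c d * der c (chrMat G c) η y ![] ![d] := by
  simp only [divV, der_upVec h hη]

theorem divV_smul_upVec {f : S3 → ℝ} (hf : Sm 1 f) {ψ : Tensor 0 1} (hψ : TSm 1 ψ) (y : S3) :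
    divV G (smulT (ofScalar f) (upVec (invT G) ψ)) y
      = ipm (G y) (G y)⁻¹ (grad f y) (ψ y) + f y * div01 G ψ y := by
  rw [divV_smul h hf (isNatural_upVec.sm h.invT hψ), divV_upVec h hψ, ipm_01]
  congr 1
  simp only [upVec, Finset.mul_sum]
  refine Finset.sum_congr rfl fun c _ => Finset.sum_congr rfl fun d _ => ?_
  simp only [invT, grad, Matrix.cons_val_zero, Matrix.cons_val_one]
  ring

/-- The product rule for n x^c_d ξ^d splits into three pairings: with the gradient of the weight n,
with the divergence of x, and with ∇ξ. For x = L^I K the second is governed by the momentum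
constraint. -/
theorem divV_mulVec {n : S3 → ℝ} (hn : Sm 1 n) {x : Tensor 1 1} (hx : TSm 1 x) {ξ : Tensor 0 1}
    (hξ : TSm 1 ξ) (y : S3) :
    divV G (smulT (ofScalar n) (mulVec x (upVec (invT G) ξ))) y
      = ipm (G y) (G y)⁻¹ (x y) (raiseTens (G y)⁻¹ (grad n y) (ξ y))
        + n y * ipm (G y) (G y)⁻¹ (div11 G x y) (ξ y)
        + n y * ipm (G y) (G y)⁻¹ (x y) (sharp2 G (cov G ξ) y) := by
  have hv : TSm 1 (upVec (invT G) ξ) := isNatural_upVec.sm h.invT hξ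
  have e : ipm (G y) (G y)⁻¹ (x y) (sharp2 G (cov G ξ) y)
      = ∑ c, ∑ j, ∑ l, x y ![c] ![j] * (G y)⁻¹ j l * cov G ξ y ![] ![c, l] :=
    ipm_raise2 (h.mul_inv y) (x y) (cov G ξ y)
  rw [divV_smul h hn (isNatural_mulVec.sm hx hv), ipm_raiseTens (h.mul_inv y), e, add_assoc,
    ← mul_add]
  congr 1
  · simp only [mulVec, upVec, Finset.mul_sum]
    refine Finset.sum_congr rfl fun c _ => Finset.sum_congr rfl fun d _ =>
      Finset.sum_congr rfl fun l _ => ?_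
    simp only [invT, grad, Matrix.cons_val_zero, Matrix.cons_val_one]
    ring
  · congr 1
    simp only [divV, isNatural_mulVec.leibniz _ _ hx hv, Pi.add_apply, Finset.sum_add_distrib]
    congr 1
    · rw [ipm_01]
      simp only [mulVec, upVec, div11, cov_cons, Finset.mul_sum, Finset.sum_mul,
        Matrix.cons_val_zero, invT, Matrix.cons_val_one]
      rw [Finset.sum_comm]
      refine Finset.sum_congr rfl fun c _ => ?_
      rw [Finset.sum_comm]
      refine Finset.sum_congr rfl fun d _ => Finset.sum_congr rfl fun l _ => ?_
      ring
    · simp only [mulVec, Matrix.cons_val_zero, der_upVec h hξ, Finset.mul_sum, cov_cons]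
      refine Finset.sum_congr rfl fun c _ => Finset.sum_congr rfl fun d _ =>
        Finset.sum_congr rfl fun l _ => ?_
      ring

/-- Counterpart of `divV_mulVec` for the curvature term with the free index raised. Since L^I K need
not be symmetric with respect to G, the other divergence `div11Sharp` appears. -/
theorem divV_vecMul {n : S3 → ℝ} (hn : Sm 1 n) {x : Tensor 1 1} (hx : TSm 1 x) {w : Tensor 0 1}
    (hw : TSm 1 w) (y : S3) :
    divV G (smulT (ofScalar n) (upVec (invT G) (vecMul w x))) y
      = ipm (G y) (G y)⁻¹ (x y) (raiseTens (G y)⁻¹ (w y) (grad n y))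
        + n y * ∑ i, div11Sharp G x y ![i] ![] * w y ![] ![i]
        + n y * ipm (G y) (G y)⁻¹ (x y) (cov G (sharp1 G w) y) := by
  have hv : TSm 1 (vecMul w x) := isNatural_vecMul.sm hw hx
  have e1 : cov G (sharp1 G w) y = raise2 (G y)⁻¹ fun _ b => cov G w y ![] ![b 1, b 0] := by
    funext a b
    rw [← vec1_eta a, ← vec1_eta b]
    exact der_upVec h hw _ y _
  rw [divV_smul h hn (isNatural_upVec.sm h.invT hv), ipm_raiseTens (h.mul_inv y), e1,
    ipm_raise2 (h.mul_inv y), divV_upVec h hv, add_assoc, ← mul_add]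
  have hs := h.inv_symm_apply y
  congr 1
  · simp only [vecMul, upVec, Finset.mul_sum, invT, grad, Matrix.cons_val_zero, Matrix.cons_val_one]
    rw [Finset.sum_comm' (t' := Finset.univ) (s' := fun _ => Finset.univ) (by simp)]
    simp only [Fin.sum_univ_three]
    rw [hs 1 0, hs 2 0, hs 2 1]
    ring
  · congr 1
    simp only [isNatural_vecMul.leibniz _ _ hw hx, Pi.add_apply, mul_add, Finset.sum_add_distrib]
    rw [add_comm]
    congr 1
    · simp only [vecMul, div11Sharp, cov_cons, Finset.mul_sum, Finset.sum_mul, Matrix.cons_val_zero]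
      simp only [Fin.sum_univ_three]
      ring
    · simp only [vecMul, Finset.mul_sum, Matrix.cons_val_zero, Matrix.cons_val_one, cov_cons]
      simp only [Fin.sum_univ_three]
      rw [hs 1 0, hs 2 0, hs 2 1]
      ring

/-- The integration by parts of the hyperbolic pair: it trades the pairing of x with the Laplacian
of ξ for that of ∇x with ∇ξ, at the cost of the gradient of n. -/
theorem divV_contr {n : S3 → ℝ} (hn : Sm 1 n) {x : Tensor 1 1} (hx : TSm 1 x) {ξ : Tensor 0 2}
    (hξ : TSm 1 (cov G ξ)) (y : S3) :
    divV G (smulT (ofScalar n) (upVec (invT G) (contr (mulUp x (invT G)) (cov G ξ)))) y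
      = ipm (G y) (G y)⁻¹ (cov G ξ y) (lowTens (G y) (vecTens (grad n y) (x y)))
        + n y * ipm (G y) (G y)⁻¹ (cov G ξ y) (lowTens (G y) (cov G x y))
        + n y * ipm (G y) (G y)⁻¹ (x y) (sharp2 G (lap G ξ) y) := by
  have hp : TSm 1 (mulUp x (invT G)) := isNatural_mulUp.sm hx h.invT
  have hv : TSm 1 (contr (mulUp x (invT G)) (cov G ξ)) := isNatural_contr.sm hp hξ
  have hs := h.inv_symm_apply y
  have e : ipm (G y) (G y)⁻¹ (x y) (sharp2 G (lap G ξ) y)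
      = ∑ c, ∑ j, ∑ l, x y ![c] ![j] * (G y)⁻¹ j l * lap G ξ y ![] ![c, l] :=
    ipm_raise2 (h.mul_inv y) (x y) (lap G ξ y)
  rw [divV_smul h hn (isNatural_upVec.sm h.invT hv), e, divV_upVec h hv, add_assoc, ← mul_add,
    ipm_lowTens (h.mul_inv y), ipm_lowTens (h.mul_inv y)]
  have key : ∀ (z : Comp 1 1) d, ∑ i, ∑ j, (∑ l, z ![i] ![l] * (G y)⁻¹ l j)
      * cov G ξ y ![] ![d, i, j]
      = ∑ e, ∑ j, ∑ l, cov G ξ y ![] ![d, e, j] * (G y)⁻¹ j l * z ![e] ![l] := fun z d => by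
    refine Finset.sum_congr rfl fun i _ => Finset.sum_congr rfl fun j _ => ?_
    rw [Finset.sum_mul]
    refine Finset.sum_congr rfl fun l _ => ?_
    rw [hs l j]
    ring
  have kc : ∀ (z : Tensor 1 1) d, contr (mulUp z (invT G)) (cov G ξ) y ![] ![d]
      = ∑ e, ∑ j, ∑ l, cov G ξ y ![] ![d, e, j] * (G y)⁻¹ j l * z y ![e] ![l] := fun z d => key (z y) d
  congr 1
  · simp only [upVec, kc, invT, grad, vecTens, Matrix.cons_val_zero, Matrix.cons_val_one]
    simp only [Finset.mul_sum]
    rw [Finset.sum_comm]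
    refine Finset.sum_congr rfl fun c _ => Finset.sum_congr rfl fun d _ =>
      Finset.sum_congr rfl fun e _ => Finset.sum_congr rfl fun j _ => Finset.sum_congr rfl fun l _ => ?_
    rw [hs d c]
    ring
  · congr 1
    have hd : ∀ c d, der c (chrMat G c) (contr (mulUp x (invT G)) (cov G ξ)) y ![] ![d]
        = contr (mulUp (der c (chrMat G c) x) (invT G)) (cov G ξ) y ![] ![d]
          + ∑ i, ∑ j, (∑ l, x y ![i] ![l] * (G y)⁻¹ l j)
            * cov G (cov G ξ) y ![] ![c, d, i, j] := fun c d => by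
      rw [isNatural_contr.leibniz _ _ hp hξ, isNatural_mulUp.leibniz _ _ hx h.invT]
      simp only [Pi.add_apply, contr, mulUp, der_invT (r := 0) h, mul_zero, Finset.sum_const_zero,
        add_zero]
      rfl
    simp only [hd, kc, mul_add, Finset.sum_add_distrib]
    congr 1
    · rw [Finset.sum_comm]
      refine Finset.sum_congr rfl fun c _ => Finset.sum_congr rfl fun d _ => ?_
      rw [hs d c]
      rfl
    · have el : ∀ i j, lap G ξ y ![] ![i, j]
          = ∑ c, ∑ d, (G y)⁻¹ c d * cov G (cov G ξ) y ![] ![c, d, i, j] := fun i j => rfl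
      simp only [el, Fin.sum_univ_three]
      ring

end divergence

/-! ## The scale factor -/

namespace IsScaleFactor

variable {a : ℝ → ℝ} {Tc : ℝ} (h : IsScaleFactor a Tc)
include h

theorem zero_mem : (0 : ℝ) ∈ Set.Ioo (-Tc) Tc := ⟨neg_lt_zero.2 h.crunch_pos, h.crunch_pos⟩

theorem hasDerivAt {t : ℝ} (ht : t ∈ Set.Ioo (-Tc) Tc) : HasDerivAt a (deriv a t) t :=
  (h.differentiable t ht).hasDerivAt

/-- The equation expresses a'' through a, which is positive, so a and a' gain one derivative at a
time, together. -/
theorem contDiffOn_pair (n : ℕ) : ContDiffOn ℝ n a (Set.Ioo (-Tc) Tc) ∧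
    ContDiffOn ℝ n (deriv a) (Set.Ioo (-Tc) Tc) := by
  induction n with
  | zero =>
    simp only [CharP.cast_eq_zero, contDiffOn_zero]
    exact ⟨fun t ht => (h.hasDerivAt ht).continuousAt.continuousWithinAt,
      fun t ht => (h.ode t ht).continuousAt.continuousWithinAt⟩
  | succ n ih =>
    have ho := isOpen_Ioo (a := -Tc) (b := Tc)
    push_cast
    rw [contDiffOn_succ_iff_deriv_of_isOpen ho, contDiffOn_succ_iff_deriv_of_isOpen ho]
    refine ⟨⟨fun t ht => (h.hasDerivAt ht).differentiableAt.differentiableWithinAt, by simp, ih.2⟩,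
      fun t ht => (h.ode t ht).differentiableAt.differentiableWithinAt, by simp, ?_⟩
    have h1 : ContDiffOn ℝ n (fun t => -(2 / 3) * a t ^ (1 / 3 : ℝ)) (Set.Ioo (-Tc) Tc) :=
      contDiffOn_const.mul (ih.1.rpow_const_of_ne fun t ht => (h.pos t ht).ne')
    exact h1.congr fun t ht => (h.ode t ht).deriv

theorem contDiffOn (n : ℕ) : ContDiffOn ℝ n a (Set.Ioo (-Tc) Tc) := (h.contDiffOn_pair n).1

theorem contDiffOn_deriv (n : ℕ) : ContDiffOn ℝ n (deriv a) (Set.Ioo (-Tc) Tc) :=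
  (h.contDiffOn_pair n).2

theorem contDiffOn_rpow (n : ℕ) (p : ℝ) : ContDiffOn ℝ n (fun t => a t ^ p) (Set.Ioo (-Tc) Tc) :=
  (h.contDiffOn n).rpow_const_of_ne fun t ht => (h.pos t ht).ne'

/-- The quantity a'² + a^{4/3} is conserved by the equation for a'', and equals 1 at time zero. -/
theorem friedmann {t : ℝ} (ht : t ∈ Set.Ioo (-Tc) Tc) :
    deriv a t ^ 2 = 1 - a t ^ (4 / 3 : ℝ) := by
  have hd : ∀ s ∈ Set.Ioo (-Tc) Tc,
      HasDerivAt (fun s => deriv a s ^ 2 + a s ^ (4 / 3 : ℝ)) 0 s := fun s hs => by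
    have h1 := ((h.ode s hs).pow 2).add ((h.hasDerivAt hs).rpow_const (p := 4 / 3)
      (Or.inl (h.pos s hs).ne'))
    refine h1.congr_deriv ?_
    norm_num
    ring
  have hc := isOpen_Ioo.is_const_of_deriv_eq_zero isPreconnected_Ioo
    (fun s hs => (hd s hs).differentiableAt.differentiableWithinAt)
    (fun s hs => (hd s hs).deriv) ht h.zero_mem
  simp only [h.init, h.init_deriv] at hc
  norm_num at hc
  linarith

/-- The scale factor is concave with a'(0) = 0. This sign is the source of all the damping in the
energy estimate. -/
theorem deriv_nonpos {t : ℝ} (ht : t ∈ Set.Ico 0 Tc) : deriv a t ≤ 0 := by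
  have hsub : Set.Ico 0 Tc ⊆ Set.Ioo (-Tc) Tc := fun s hs =>
    ⟨lt_of_lt_of_le (neg_lt_zero.2 h.crunch_pos) hs.1, hs.2⟩
  have : AntitoneOn (deriv a) (Set.Ico 0 Tc) := by
    refine antitoneOn_of_deriv_nonpos (convex_Ico 0 Tc)
      (fun s hs => (h.ode s (hsub hs)).continuousAt.continuousWithinAt)
      (fun s hs => (h.ode s (hsub (interior_subset hs))).differentiableAt.differentiableWithinAt)
      fun s hs => ?_
    rw [(h.ode s (hsub (interior_subset hs))).deriv]
    have := Real.rpow_nonneg (h.pos s (hsub (interior_subset hs))).le (1 / 3)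
    linarith
  have := this ⟨le_rfl, h.crunch_pos⟩ ht ht.1
  rwa [h.init_deriv] at this

theorem le_one {t : ℝ} (ht : t ∈ Set.Ico 0 Tc) : a t ≤ 1 := by
  have h0 := h.pos t ⟨by linarith [ht.1, h.crunch_pos], ht.2⟩
  have h1 := h.friedmann ⟨by linarith [ht.1, h.crunch_pos], ht.2⟩
  by_contra hc
  push Not at hc
  have := Real.one_lt_rpow hc (show (0 : ℝ) < 4 / 3 by norm_num)
  nlinarith [sq_nonneg (deriv a t)]

theorem ck {r : ℕ} {T : ℝ} (hT : T ≤ Tc) : Ck r T fun t _ => a t :=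
  Ck.ofTime ((h.contDiffOn r).mono fun s hs =>
    ⟨lt_of_lt_of_le (neg_lt_zero.2 h.crunch_pos) hs.1, hs.2.trans_le hT⟩)

theorem ck_deriv {r : ℕ} {T : ℝ} (hT : T ≤ Tc) : Ck r T fun t _ => deriv a t :=
  Ck.ofTime ((h.contDiffOn_deriv r).mono fun s hs =>
    ⟨lt_of_lt_of_le (neg_lt_zero.2 h.crunch_pos) hs.1, hs.2.trans_le hT⟩)

theorem ck_rpow {r : ℕ} {T : ℝ} (hT : T ≤ Tc) (p : ℝ) : Ck r T fun t _ => a t ^ p :=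
  Ck.ofTime ((h.contDiffOn_rpow r p).mono fun s hs =>
    ⟨lt_of_lt_of_le (neg_lt_zero.2 h.crunch_pos) hs.1, hs.2.trans_le hT⟩)

end IsScaleFactor

/-! ## Scaling of the metric by a constant -/

section scaling

variable {g : Metric3} (hg : MetricSm 1 g) {c : ℝ} (hc : 0 < c)
include hg hc

theorem inv_smul_metric (y : S3) : (c • g y)⁻¹ = c⁻¹ • (g y)⁻¹ := by
  haveI := invertibleOfNonzero hc.ne'
  rw [Matrix.inv_smul (A := g y) c (hg.isUnit y), invOf_eq_inv]

/-- The factor c of the Koszul formula cancels the factor c⁻¹ of the inverse metric. Hence covariant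
derivatives and the Ricci tensor do not see the rescaling by a power of a. -/
theorem chr_smul_metric (y : S3) (A D B : Fin 3) : chr (fun x => c • g x) y A D B = chr g y A D B := by
  have hl : ∀ C, chrLow (fun x => c • g x) y A C B = c * chrLow g y A C B := fun C => by
    simp only [chrLow, Matrix.smul_apply, smul_eq_mul, Z_const_mul _ y c (hg.smooth _ _),
      Fin.sum_univ_three]
    ring
  simp only [chr_eq, hl, inv_smul_metric hg hc, Matrix.smul_apply, smul_eq_mul]
  refine Finset.sum_congr rfl fun C _ => ?_
  field_simp

theorem cov_smul_metric {l m : ℕ} (ξ : Tensor l m) : cov (fun x => c • g x) ξ = cov g ξ := by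
  funext y a b
  simp only [cov, chr_smul_metric hg hc]

theorem ric_smul_metric (y : S3) (i j : Fin 3) : ric (fun x => c • g x) y i j = ric g y i j := by
  simp only [ric, riem, cov_smul_metric hg hc, inv_smul_metric hg hc, Matrix.smul_apply, smul_eq_mul,
    Finset.mul_sum]
  refine Finset.sum_congr rfl fun a _ => Finset.sum_congr rfl fun b _ =>
    Finset.sum_congr rfl fun m _ => ?_
  field_simp

end scaling

/-! ## The rescaled system -/

/-! ### Powers of the scale factor in terms of its cube root -/

section cube

variable {b : ℝ} (hb : 0 < b)
include hb

/-- Writing a = b³ turns the fractional weights of the problem into integer powers of b, within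
reach of polynomial arithmetic. -/
theorem cube_rpow (x : ℝ) : (b ^ 3) ^ x = b ^ (3 * x) := by
  rw [← Real.rpow_natCast, ← Real.rpow_mul hb.le]
  norm_num

theorem cube_rpow_one_third : (b ^ 3) ^ (1 / 3 : ℝ) = b := by
  rw [cube_rpow hb]; norm_num

theorem cube_rpow_neg_one_third : (b ^ 3) ^ (-1 / 3 : ℝ) = b⁻¹ := by
  rw [cube_rpow hb, show (3 : ℝ) * (-1 / 3) = -1 by norm_num, Real.rpow_neg_one]

theorem cube_rpow_four_thirds : (b ^ 3) ^ (4 / 3 : ℝ) = b ^ 4 := by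
  rw [cube_rpow hb, show (3 : ℝ) * (4 / 3) = (4 : ℕ) by norm_num, Real.rpow_natCast]

theorem cube_rpow_five_thirds : (b ^ 3) ^ (5 / 3 : ℝ) = b ^ 5 := by
  rw [cube_rpow hb, show (3 : ℝ) * (5 / 3) = (5 : ℕ) by norm_num, Real.rpow_natCast]

theorem cube_rpow_seven_thirds : (b ^ 3) ^ (7 / 3 : ℝ) = b ^ 7 := by
  rw [cube_rpow hb, show (3 : ℝ) * (7 / 3) = (7 : ℕ) by norm_num, Real.rpow_natCast]

theorem cube_rpow_neg_two_thirds : (b ^ 3) ^ (-2 / 3 : ℝ) = (b ^ 2)⁻¹ := by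
  rw [cube_rpow hb, show (3 : ℝ) * (-2 / 3) = -((2 : ℕ) : ℝ) by norm_num, Real.rpow_neg hb.le,
    Real.rpow_natCast]

theorem cube_rpow_neg_four_thirds : (b ^ 3) ^ (-4 / 3 : ℝ) = (b ^ 4)⁻¹ := by
  rw [cube_rpow hb, show (3 : ℝ) * (-4 / 3) = -((4 : ℕ) : ℝ) by norm_num, Real.rpow_neg hb.le,
    Real.rpow_natCast]

theorem cube_rpow_neg_five_thirds : (b ^ 3) ^ (-2 / 3 - 1 : ℝ) = (b ^ 5)⁻¹ := by
  rw [cube_rpow hb, show (3 : ℝ) * (-2 / 3 - 1) = -((5 : ℕ) : ℝ) by norm_num, Real.rpow_neg hb.le,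
    Real.rpow_natCast]

end cube

/-- The identity as a tensor field. -/
def idTen : Tensor 1 1 := fun _ => idT

/-- The number `√(2/3)`. -/
def sqt : ℝ := Real.sqrt (2 / 3)

theorem sqt_sq : sqt ^ 2 = 2 / 3 := Real.sq_sqrt (by norm_num)

theorem sqt_nonneg : 0 ≤ sqt := Real.sqrt_nonneg _

/-- The rescaled equations on a time slice; `b` is the cube root of the scale factor and
`Kt`, `Φt`, `Ψt` are the time derivatives of the rescaled variables. -/
structure SliceEqs (b : ℝ) (X : Rescaled) (Kt : Tensor 1 1) (Φt : S3 → ℝ) (Ψt : Tensor 0 1) :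
    Prop where
  b_pos : 0 < b
  b_le : b ≤ 1
  α_eq : X.α = b ^ 3
  friedmann : X.α' ^ 2 = 1 - b ^ 4
  α'_nonpos : X.α' ≤ 0
  met : MetricSm 18 X.G
  K_sm : TSm 17 X.K
  N_sm : Sm 18 X.N
  Φ_sm : Sm 17 X.Φ
  Ψ_sm : TSm 17 X.Ψ
  tr : ∀ y, ∑ c, X.K y ![c] ![c] = 0
  symm : ∀ y, (X.G y * m11 (X.K y)).IsSymm
  metric_eq : X.Gt = (-2 * (b ^ 3)⁻¹) • lowMul (lowT X.G) X.K
    + (-2 * b) • smulT (ofScalar X.N) (lowMul (lowT X.G) X.K)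
    + (2 / 3 * b * X.α') • smulT (ofScalar X.N) (lowT X.G)
  sec_eq : Kt = (-(X.α' * b)) • smulT (ofScalar X.N) X.K + (-b ^ 5) • sharp2 X.G (hess X.G X.N)
    + b • ricSharp X.G + b ^ 5 • smulT (ofScalar X.N) (ricSharp X.G)
    + (-b) • upMul (invT X.G) (tens X.Ψ X.Ψ)
    + (-b ^ 5) • upMul (invT X.G) (smulT (ofScalar X.N) (tens X.Ψ X.Ψ))
    + smulT (ofScalar fun y => (1 / 3) * (b * X.α' ^ 2) * X.N y + -(2 / 9) * b) idTen
  time_eq : ofScalar Φt = b • ofScalar (div01 X.G X.Ψ)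
    + b ^ 5 • smulT (ofScalar X.N) (ofScalar (div01 X.G X.Ψ))
    + (-(sqt * X.α' * b)) • ofScalar X.N + (-(X.α' * b)) • smulT (ofScalar X.N) (ofScalar X.Φ)
    + b ^ 5 • pairing (grad X.N) (upVec (invT X.G) X.Ψ)
  space_eq : Ψt = (b ^ 3)⁻¹ • grad X.Φ + b • smulT (ofScalar X.N) (grad X.Φ)
    + b • smulT (ofScalar X.Φ) (grad X.N) + (sqt * b) • grad X.N
  mom_down : div11 X.G X.K = (-sqt) • X.Ψ + (-1 : ℝ) • smulT (ofScalar X.Φ) X.Ψ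
  mom_up : div11Sharp X.G X.K = (-sqt) • upVec (invT X.G) X.Ψ
    + (-1 : ℝ) • smulT (ofScalar X.Φ) (upVec (invT X.G) X.Ψ)
  lapse_eq : b ^ 4 • ofScalar (lapS X.G X.N) = (X.α' ^ 2 / 3 + 2 / 3) • ofScalar X.N
    + (2 * sqt * (b ^ 4)⁻¹) • ofScalar X.Φ + (b ^ 4)⁻¹ • trMul X.K X.K
    + (b ^ 4)⁻¹ • smulT (ofScalar X.Φ) (ofScalar X.Φ)
    + smulT (ofScalar (normSq X.G X.K)) (ofScalar X.N)
    + (2 * sqt) • smulT (ofScalar X.Φ) (ofScalar X.N)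
    + smulT (ofScalar fun y => X.Φ y ^ 2) (ofScalar X.N)

/-! ### Regularity of the rescaled variables -/

section regularity

variable {a : ℝ → ℝ} {Tc T : ℝ} (ha : IsScaleFactor a Tc) (hT : T ≤ Tc) {S : Fields}
  (hS : IsSolution a T S)
include ha hT

theorem IsScaleFactor.mem {t : ℝ} (ht : t ∈ Set.Ico 0 T) : t ∈ Set.Ioo (-Tc) Tc :=
  ⟨by linarith [ht.1, ha.crunch_pos], ht.2.trans_le hT⟩

include hS

theorem ck_nφ : Ck 17 T S.nφ :=
  ((hS.n_reg.ck.inv fun t ht y => (hS.n_pos t ht y).ne').of_le (by norm_num)).mul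
    (Ck.dt (r := 17) hS.φ_reg.ck)

theorem tck_kHat : TCk 17 T S.kHat := fun a b =>
  (hS.k_reg _ _).ck.sub (((Ck.const (1 / 3)).mul
    (Ck.sum (F := fun i t y => S.k t y i i) fun i _ => (hS.k_reg i i).ck)).mul (Ck.const _))

theorem metricCk_rescale : MetricCk 18 T fun t => (rescale a S t).G where
  smooth i j := (ha.ck_rpow hT _).mul (hS.g_reg i j).ck
  pos t ht y := (hS.g_posDef t ht y).smul (Real.rpow_pos_of_pos (ha.pos t (ha.mem hT ht)) _)

theorem tck_K : TCk 17 T fun t => (rescale a S t).K := fun i j =>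
  (ha.ck hT).mul (tck_kHat ha hT hS i j)

theorem ck_N : Ck 18 T fun t => (rescale a S t).N :=
  (ha.ck_rpow hT _).mul (hS.n_reg.ck.sub (Ck.const 1))

theorem ck_Φ : Ck 17 T fun t => (rescale a S t).Φ :=
  ((ha.ck hT).mul (ck_nφ ha hT hS)).sub (Ck.const _)

theorem tck_Ψ : TCk 17 T fun t => (rescale a S t).Ψ := TCk.grad hS.φ_reg.ck

theorem tck_Gt : TCk 17 T fun t => (rescale a S t).Gt :=
  TCk.dtT (metricCk_rescale ha hT hS).lowT

end regularity

/-! ### Derivation of the rescaled equations on a time slice -/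

section slice

variable {a : ℝ → ℝ} {Tc T : ℝ} (ha : IsScaleFactor a Tc) (hT : T ≤ Tc) {S : Fields}
  (hS : IsSolution a T S) {t : ℝ} (ht : t ∈ Set.Ioo 0 T)
include ha hT

theorem IsScaleFactor.root_pos (ht : t ∈ Set.Ico 0 T) : 0 < a t ^ (1 / 3 : ℝ) :=
  Real.rpow_pos_of_pos (ha.pos t (ha.mem hT ht)) _

theorem IsScaleFactor.root_le (ht : t ∈ Set.Ico 0 T) : a t ^ (1 / 3 : ℝ) ≤ 1 :=
  Real.rpow_le_one (ha.pos t (ha.mem hT ht)).le (ha.le_one ⟨ht.1, ht.2.trans_le hT⟩) (by norm_num)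

theorem IsScaleFactor.root_cube (ht : t ∈ Set.Ico 0 T) : a t = (a t ^ (1 / 3 : ℝ)) ^ 3 := by
  rw [← Real.rpow_natCast, ← Real.rpow_mul (ha.pos t (ha.mem hT ht)).le]
  norm_num

include hS

/-- Symmetry of the second fundamental form need not be postulated: it is read off from the
evolution of the symmetric metric g, because n > 0. -/
theorem gk_symm (ht : t ∈ Set.Ico 0 T) (y : S3) (i j : Fin 3) :
    ∑ c, S.g t y i c * S.k t y c j = ∑ c, S.g t y j c * S.k t y c i := by
  have h1 := hS.evol_g t ht y i j
  have h2 := hS.evol_g t ht y j i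
  have hn := hS.n_pos t ht y
  have e : dt (fun s x => S.g s x i j) t y = dt (fun s x => S.g s x j i) t y := by
    refine Filter.EventuallyEq.derivWithin_eq ?_ ?_
    · filter_upwards [self_mem_nhdsWithin, mem_nhdsWithin_of_mem_nhds (Iio_mem_nhds ht.2)] with s h1 h2
      exact (hS.g_posDef s ⟨h1, h2⟩ y).posSemidef.isSymm.apply j i
    · exact (hS.g_posDef t ht y).posSemidef.isSymm.apply j i
  rw [h1, h2] at e
  have h3 : -2 * S.n t y ≠ 0 := mul_ne_zero (by norm_num) hn.ne'
  exact mul_left_cancel₀ h3 (by simpa using e)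

theorem metricSm_g (ht : t ∈ Set.Ico 0 T) : MetricSm 18 (S.g t) :=
  ⟨fun i j => (hS.g_reg i j).ck.sm ht, hS.g_posDef t ht⟩

theorem rescale_K_eq (ht : t ∈ Set.Ico 0 T) (y : S3) (i j : Fin 3) :
    (rescale a S t).K y ![i] ![j]
      = a t * S.k t y i j + deriv a t / 3 * (1 : Matrix (Fin 3) (Fin 3) ℝ) i j := by
  have h1 : (rescale a S t).K y ![i] ![j] = a t * (S.k t y i j - (1 / 3) * (S.k t y).trace
    * (1 : Matrix (Fin 3) (Fin 3) ℝ) i j) := rfl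
  have h2 := (ha.pos t (ha.mem hT ht)).ne'
  rw [h1, hS.cmc t ht y, hubble]
  field_simp
  ring

theorem rescale_tr (ht : t ∈ Set.Ico 0 T) (y : S3) :
    ∑ c, (rescale a S t).K y ![c] ![c] = 0 := by
  have h2 := (ha.pos t (ha.mem hT ht)).ne'
  have h3 := hS.cmc t ht y
  rw [Matrix.trace] at h3
  simp only [Matrix.diag_apply] at h3
  simp only [rescale_K_eq ha hT hS ht, Finset.sum_add_distrib, ← Finset.mul_sum, h3, hubble]
  simp [Matrix.one_apply]
  field_simp
  ring

theorem rescale_symm (ht : t ∈ Set.Ico 0 T) (y : S3) :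
    ((rescale a S t).G y * m11 ((rescale a S t).K y)).IsSymm := by
  have key : ∀ i j, ((rescale a S t).G y * m11 ((rescale a S t).K y)) i j
      = a t ^ (-2 / 3 : ℝ) * (a t * ∑ c, S.g t y i c * S.k t y c j + deriv a t / 3 * S.g t y i j) := by
    intro i j
    have e : ∀ c, (rescale a S t).G y i c = a t ^ (-2 / 3 : ℝ) * S.g t y i c := fun c => rfl
    simp only [Matrix.mul_apply, m11, Matrix.of_apply, rescale_K_eq ha hT hS ht, e, mul_add,
      Finset.sum_add_distrib]
    congr 1
    · simp only [Finset.mul_sum]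
      exact Finset.sum_congr rfl fun c _ => by ring
    · simp [Matrix.one_apply]
      ring
  refine Matrix.IsSymm.ext fun i j => ?_
  rw [key, key, gk_symm ha hT hS ht, (hS.g_posDef t ht y).posSemidef.isSymm.apply]

theorem cov_rescale (ht : t ∈ Set.Ico 0 T) {l m : ℕ} (ξ : Tensor l m) :
    cov (rescale a S t).G ξ = cov (S.g t) ξ :=
  cov_smul_metric ((metricSm_g ha hT hS ht).of_le (by norm_num))
    (Real.rpow_pos_of_pos (ha.pos t (ha.mem hT ht)) _) ξ

theorem ric_rescale (ht : t ∈ Set.Ico 0 T) (y : S3) (i j : Fin 3) :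
    ric (rescale a S t).G y i j = ric (S.g t) y i j :=
  ric_smul_metric ((metricSm_g ha hT hS ht).of_le (by norm_num))
    (Real.rpow_pos_of_pos (ha.pos t (ha.mem hT ht)) _) y i j

theorem inv_rescale (ht : t ∈ Set.Ico 0 T) {b : ℝ} (hb : 0 < b) (hab : a t = b ^ 3) (y : S3)
    (i j : Fin 3) : (S.g t y)⁻¹ i j = (b ^ 2)⁻¹ * ((rescale a S t).G y)⁻¹ i j := by
  have h1 : (rescale a S t).G y = (b ^ 2)⁻¹ • S.g t y := by
    show a t ^ (-2 / 3 : ℝ) • S.g t y = _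
    rw [hab, cube_rpow_neg_two_thirds hb]
  rw [h1, inv_smul_metric ((metricSm_g ha hT hS ht).of_le (by norm_num)) (by positivity),
    Matrix.smul_apply, smul_eq_mul, inv_inv, inv_mul_cancel_left₀ (by positivity)]

theorem n_eq (ht : t ∈ Set.Ico 0 T) {b : ℝ} (hb : 0 < b) (hab : a t = b ^ 3) (y : S3) :
    S.n t y = 1 + b ^ 4 * (rescale a S t).N y := by
  show _ = 1 + b ^ 4 * (a t ^ (-4 / 3 : ℝ) * (S.n t y - 1))
  rw [hab, cube_rpow_neg_four_thirds hb, mul_inv_cancel_left₀ (by positivity)]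
  ring

theorem cov_smul_tensor {g : Metric3} {l m : ℕ} {ξ : Tensor l m} (hξ : TSm 1 ξ) (c : ℝ) :
    cov g (c • ξ) = c • cov g ξ := by
  funext y a b
  simp only [cov_eq_der, der_smul _ _ c hξ, Pi.smul_apply]

theorem Z_n (ht : t ∈ Set.Ico 0 T) {b : ℝ} (hb : 0 < b) (hab : a t = b ^ 3) (A : Fin 3) (y : S3) :
    Z A (S.n t) y = b ^ 4 * Z A (rescale a S t).N y := by
  have hN1 : Sm 1 (rescale a S t).N := ((ck_N ha hT hS).sm ht).of_le (by norm_num)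
  have h1 : S.n t = fun y => 1 + b ^ 4 * (rescale a S t).N y := funext (n_eq ha hT hS ht hb hab)
  rw [h1, Z_add _ y (Sm.const 1) ((Sm.const _).mul hN1), Z_const, Z_const_mul _ y _ hN1, zero_add]

theorem hess_n (ht : t ∈ Set.Ico 0 T) {b : ℝ} (hb : 0 < b) (hab : a t = b ^ 3) :
    hess (S.g t) (S.n t) = b ^ 4 • hess (rescale a S t).G (rescale a S t).N := by
  have hN : Sm 18 (rescale a S t).N := (ck_N ha hT hS).sm ht
  have e : grad (S.n t) = b ^ 4 • grad (rescale a S t).N :=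
    funext fun y => funext fun i => funext fun j => Z_n ha hT hS ht hb hab (j 0) y
  rw [hess, hess, cov_rescale ha hT hS ht, e, cov_smul_tensor ha hT hS]
  exact TSm.grad (hN.of_le (by norm_num))

theorem nφ_eq (ht : t ∈ Set.Ico 0 T) {b : ℝ} (hb : 0 < b) (hab : a t = b ^ 3) (y : S3) :
    S.nφ t y = (b ^ 3)⁻¹ * ((rescale a S t).Φ y + sqt) := by
  have : (rescale a S t).Φ y = b ^ 3 * S.nφ t y - sqt := by rw [← hab]; rfl
  rw [this]
  field_simp
  ring

/-- The derivative of the factor a^{-2/3} cancels the contribution of the trace of k up to n − 1, so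
the background expansion enters only multiplied by N. -/
theorem metric_eq_rescale (ht : t ∈ Set.Ioo 0 T) {b : ℝ} (hb : 0 < b) (hab : a t = b ^ 3) :
    (rescale a S t).Gt
      = (-2 * (b ^ 3)⁻¹) • lowMul (lowT (rescale a S t).G) (rescale a S t).K
    + (-2 * b) • smulT (ofScalar (rescale a S t).N) (lowMul (lowT (rescale a S t).G) (rescale a S t).K)
    + (2 / 3 * b * deriv a t) • smulT (ofScalar (rescale a S t).N) (lowT (rescale a S t).G) := by
  have ht' : t ∈ Set.Ico 0 T := ⟨ht.1.le, ht.2⟩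
  funext y i' j'
  rw [vec0_eq i', ← vec2_eta j']
  generalize j' 0 = i
  generalize j' 1 = j
  have h1 : HasDerivAt (fun s => a s ^ (-2 / 3 : ℝ) * S.g s y i j) _ t :=
    ((ha.hasDerivAt (ha.mem hT ht')).rpow_const (p := -2 / 3)
      (Or.inl (ha.pos t (ha.mem hT ht')).ne')).mul ((hS.g_reg i j).ck.hasDerivAt (r := 17) ht y)
  refine Eq.trans (dt_eq (f := fun s x => a s ^ (-2 / 3 : ℝ) * S.g s x i j) ht.1 h1) ?_
  rw [hS.evol_g t ht' y i j, n_eq ha hT hS ht' hb hab]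
  have hK : ∀ c, (rescale a S t).K y ![c] ![j]
      = b ^ 3 * S.k t y c j + deriv a t / 3 * (1 : Matrix (Fin 3) (Fin 3) ℝ) c j := fun c => by
    rw [rescale_K_eq ha hT hS ht', hab]
  have hG : ∀ i c, (rescale a S t).G y i c = (b ^ 2)⁻¹ * S.g t y i c := fun i c => by
    show a t ^ (-2 / 3 : ℝ) * S.g t y i c = _
    rw [hab, cube_rpow_neg_two_thirds hb]
  have hs : lowMul (lowT (rescale a S t).G) (rescale a S t).K y ![] ![i, j]
      = b * ∑ c, S.g t y i c * S.k t y c j + deriv a t / 3 * (b ^ 2)⁻¹ * S.g t y i j := by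
    have : lowMul (lowT (rescale a S t).G) (rescale a S t).K y ![] ![i, j]
        = ∑ c, (rescale a S t).G y i c * (rescale a S t).K y ![c] ![j] := rfl
    rw [this]
    simp only [hK, hG, mul_add, Finset.sum_add_distrib]
    congr 1
    · rw [Finset.mul_sum]
      refine Finset.sum_congr rfl fun c _ => ?_
      field_simp
    · simp [Matrix.one_apply]
      ring
  have hl : lowT (rescale a S t).G y ![] ![i, j] = (b ^ 2)⁻¹ * S.g t y i j := hG i j
  simp only [Pi.add_apply, Pi.smul_apply, smul_eq_mul, smulT, hs, hl, ofScalar, hab,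
    cube_rpow_neg_two_thirds hb, cube_rpow_neg_five_thirds hb]
  field_simp
  ring

/-- The multiples of the identity come from a''/3 = −(2/9) b and from the trace of k multiplied by n
− 1. They drop out of the energy, where they are paired with a trace-free tensor. -/
theorem sec_eq_rescale (ht : t ∈ Set.Ioo 0 T) {b : ℝ} (hb : 0 < b) (hab : a t = b ^ 3)
    {X : Rescaled} (hX : X = rescale a S t) :
    dtT (fun s => (rescale a S s).K) t
      = (-(deriv a t * b)) • smulT (ofScalar X.N) X.K + (-b ^ 5) • sharp2 X.G (hess X.G X.N)
    + b • ricSharp X.G + b ^ 5 • smulT (ofScalar X.N) (ricSharp X.G)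
    + (-b) • upMul (invT X.G) (tens X.Ψ X.Ψ)
    + (-b ^ 5) • upMul (invT X.G) (smulT (ofScalar X.N) (tens X.Ψ X.Ψ))
    + smulT (ofScalar fun y => (1 / 3) * (b * deriv a t ^ 2) * X.N y + -(2 / 9) * b) idTen := by
  have ht' : t ∈ Set.Ico 0 T := ⟨ht.1.le, ht.2⟩
  funext y i' j'
  rw [← vec1_eta i', ← vec1_eta j']
  generalize i' 0 = i
  generalize j' 0 = j
  have h0 := (ha.pos t (ha.mem hT ht')).ne'
  have h1 : HasDerivAt (fun s => a s * S.k s y i j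
      + deriv a s / 3 * (1 : Matrix (Fin 3) (Fin 3) ℝ) i j) _ t :=
    ((ha.hasDerivAt (ha.mem hT ht')).mul ((hS.k_reg i j).ck.hasDerivAt (r := 16) ht y)).add
      (((ha.ode t (ha.mem hT ht')).div_const 3).mul_const _)
  -- The gauge condition holds only for times in [0, T), so the closed formula for K replaces its
  -- definition on a neighbourhood of t.
  have h2 := h1.congr_of_eventuallyEq (f₁ := fun s => (rescale a S s).K y ![i] ![j]) (by
    filter_upwards [Ioo_mem_nhds ht.1 ht.2] with s hs
    exact rescale_K_eq ha hT hS ⟨hs.1.le, hs.2⟩ y i j)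
  refine Eq.trans (dt_eq (f := fun s x => (rescale a S s).K x ![i] ![j]) ht.1 h2) ?_
  rw [hS.evol_k t ht' y i j, hess_n ha hT hS ht' hb hab, hS.cmc t ht' y]
  simp only [inv_rescale ha hT hS ht' hb hab, ← ric_rescale ha hT hS ht', n_eq ha hT hS ht' hb hab]
  have hK := rescale_K_eq ha hT hS ht' y i j
  rw [← hX] at hK ⊢
  have e1 : sharp2 X.G (hess X.G X.N) y ![i] ![j]
      = ∑ c, (X.G y)⁻¹ i c * hess X.G X.N y ![] ![c, j] := rfl
  have e2 : ricSharp X.G y ![i] ![j] = ∑ c, (X.G y)⁻¹ i c * ric X.G y c j := rfl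
  have e3 : upMul (invT X.G) (tens X.Ψ X.Ψ) y ![i] ![j]
      = ∑ c, (X.G y)⁻¹ i c * Z c (S.φ t) y * Z j (S.φ t) y := by
    rw [hX]
    exact Finset.sum_congr rfl fun c _ => (mul_assoc _ _ _).symm
  have e4 : upMul (invT X.G) (smulT (ofScalar X.N) (tens X.Ψ X.Ψ)) y ![i] ![j]
      = X.N y * upMul (invT X.G) (tens X.Ψ X.Ψ) y ![i] ![j] := by
    simp only [upMul, smulT, ofScalar, Finset.mul_sum]
    exact Finset.sum_congr rfl fun c _ => by ring
  simp only [Pi.add_apply, Pi.smul_apply, smul_eq_mul, smulT, ofScalar, e4]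
  have e5 : idTen y ![i] ![j] = (1 : Matrix (Fin 3) (Fin 3) ℝ) i j := rfl
  rw [e1, e2, e3, e5]
  simp only [mul_assoc, mul_left_comm _ (b ^ 4), ← Finset.mul_sum]
  have hk : S.k t y i j = (b ^ 3)⁻¹ * (X.K y ![i] ![j]
      - deriv a t / 3 * (1 : Matrix (Fin 3) (Fin 3) ℝ) i j) := by
    rw [hK, hab]
    field_simp
    ring
  rw [hk, hubble, hab, cube_rpow_one_third hb]
  generalize (1 : Matrix (Fin 3) (Fin 3) ℝ) i j = D
  generalize ∑ c, (X.G y)⁻¹ i c * (Z c (S.φ t) y * Z j (S.φ t) y) = Q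
  field_simp
  ring

theorem time_eq_rescale (ht : t ∈ Set.Ioo 0 T) {b : ℝ} (hb : 0 < b) (hab : a t = b ^ 3)
    {X : Rescaled} (hX : X = rescale a S t) :
    ofScalar (dt (fun s => (rescale a S s).Φ) t) = b • ofScalar (div01 X.G X.Ψ)
    + b ^ 5 • smulT (ofScalar X.N) (ofScalar (div01 X.G X.Ψ))
    + (-(sqt * deriv a t * b)) • ofScalar X.N
    + (-(deriv a t * b)) • smulT (ofScalar X.N) (ofScalar X.Φ)
    + b ^ 5 • pairing (grad X.N) (upVec (invT X.G) X.Ψ) := by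
  have ht' : t ∈ Set.Ico 0 T := ⟨ht.1.le, ht.2⟩
  funext y i' j'
  have h1 : HasDerivAt (fun s => a s * S.nφ s y - Real.sqrt (2 / 3)) _ t :=
    ((ha.hasDerivAt (ha.mem hT ht')).mul ((ck_nφ ha hT hS).hasDerivAt (r := 16) ht y)).sub_const _
  refine Eq.trans (dt_eq (f := fun s x => (rescale a S s).Φ x) ht.1 h1) ?_
  have hw := hS.wave t ht' y
  have e1 : lapS (S.g t) (S.φ t) y = (b ^ 2)⁻¹ * div01 X.G X.Ψ y := by
    simp only [lapS, hess, ← cov_rescale ha hT hS ht', inv_rescale ha hT hS ht' hb hab, ← hX,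
      mul_assoc, ← Finset.mul_sum, div01]
    rw [hX]
    rfl
  have e2 : ∑ i, ∑ j, (S.g t y)⁻¹ i j * Z i (S.n t) y * Z j (S.φ t) y
      = b ^ 2 * pairing (grad X.N) (upVec (invT X.G) X.Ψ) y i' j' := by
    simp only [inv_rescale ha hT hS ht' hb hab, Z_n ha hT hS ht' hb hab, ← hX, pairing, upVec,
      Finset.mul_sum]
    refine Finset.sum_congr rfl fun i _ => Finset.sum_congr rfl fun j _ => ?_
    have : X.Ψ y ![] ![j] = Z j (S.φ t) y := by rw [hX]; rfl
    simp only [this, grad, invT, Matrix.cons_val_zero, Matrix.cons_val_one]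
    field_simp
  have hn := hS.n_pos t ht' y
  have h2 : dt S.nφ t y = S.n t y * ((b ^ 2)⁻¹ * div01 X.G X.Ψ y) - S.n t y * hubble a t * S.nφ t y
      + b ^ 2 * pairing (grad X.N) (upVec (invT X.G) X.Ψ) y i' j' := by
    rw [e1, e2] at hw
    field_simp at hw ⊢
    linear_combination (-1 : ℝ) * hw
  rw [h2, nφ_eq ha hT hS ht' hb hab, n_eq ha hT hS ht' hb hab, hubble, hab, ← hX]
  simp only [Pi.add_apply, Pi.smul_apply, smul_eq_mul, smulT, ofScalar]
  field_simp
  ring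

theorem space_eq_rescale (ht : t ∈ Set.Ioo 0 T) {b : ℝ} (hb : 0 < b) (hab : a t = b ^ 3)
    {X : Rescaled} (hX : X = rescale a S t) :
    dtT (fun s => (rescale a S s).Ψ) t
      = (b ^ 3)⁻¹ • grad X.Φ + b • smulT (ofScalar X.N) (grad X.Φ)
    + b • smulT (ofScalar X.Φ) (grad X.N) + (sqt * b) • grad X.N := by
  have ht' : t ∈ Set.Ico 0 T := ⟨ht.1.le, ht.2⟩
  funext y i' j'
  have hφ : Ck 2 T S.φ := hS.φ_reg.ck.of_le (by norm_num)
  have h1 : dtT (fun s => (rescale a S s).Ψ) t y i' j' = Z (j' 0) (dt S.φ t) y :=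
    dt_Z hφ ht' (j' 0) y
  have h2 : dt S.φ t = fun y => (1 + b ^ 4 * X.N y) * ((b ^ 3)⁻¹ * (X.Φ y + sqt)) := by
    funext y
    have hn := (hS.n_pos t ht' y).ne'
    have h3 : dt S.φ t y = S.n t y * S.nφ t y := by rw [Fields.nφ, mul_inv_cancel_left₀ hn]
    rw [h3, nφ_eq ha hT hS ht' hb hab, n_eq ha hT hS ht' hb hab, ← hX]
  have hN : Sm 1 X.N := by rw [hX]; exact ((ck_N ha hT hS).sm ht').of_le (by norm_num)
  have hΦ : Sm 1 X.Φ := by rw [hX]; exact ((ck_Φ ha hT hS).sm ht').of_le (by norm_num)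
  rw [h1, h2, Z_mul _ y ((Sm.const 1).add ((Sm.const _).mul hN))
    ((Sm.const _).mul (hΦ.add (Sm.const _))), Z_add _ y (Sm.const 1) ((Sm.const _).mul hN), Z_const,
    Z_const_mul _ y _ hN, Z_const_mul _ y _ (hΦ.add (Sm.const _)), Z_add _ y hΦ (Sm.const _), Z_const]
  simp only [Pi.add_apply, Pi.smul_apply, smul_eq_mul, smulT, ofScalar, grad]
  field_simp
  ring

theorem mom_down_rescale (ht : t ∈ Set.Ico 0 T) {X : Rescaled} (hX : X = rescale a S t) :
    div11 X.G X.K = (-sqt) • X.Ψ + (-1 : ℝ) • smulT (ofScalar X.Φ) X.Ψ := by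
  funext y i' j'
  rw [vec0_eq i', ← vec1_eta j']
  generalize j' 0 = j
  have hk : TSm 1 (S.kHat t) := ((tck_kHat ha hT hS).of_le (q := 1) (by norm_num)).sm ht
  have hK : X.K = a t • S.kHat t := by rw [hX]; rfl
  have h1 : div11 X.G X.K y ![] ![j] = a t * div11 (S.g t) (S.kHat t) y ![] ![j] := by
    have hc : cov X.G X.K = a t • cov (S.g t) (S.kHat t) := by
      rw [hK, hX, cov_rescale ha hT hS ht, cov_smul_tensor ha hT hS hk]
    simp only [div11, hc, Pi.smul_apply, smul_eq_mul, Finset.mul_sum]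
  have hΨ : X.Ψ y ![] ![j] = Z j (S.φ t) y := by rw [hX]; rfl
  have hΦ : X.Φ y = a t * S.nφ t y - sqt := by rw [hX]; rfl
  rw [h1, hS.momentum t ht y j]
  simp only [Pi.add_apply, Pi.smul_apply, smul_eq_mul, smulT, ofScalar, hΨ, hΦ]
  ring

/-- With both indices raised K is symmetric, and so is its covariant derivative in these indices,
because the inverse metric is parallel. Hence this divergence is the lower one with its index
raised. -/
theorem mom_up_rescale (ht : t ∈ Set.Ico 0 T) {X : Rescaled} (hX : X = rescale a S t) :
    div11Sharp X.G X.K = (-sqt) • upVec (invT X.G) X.Ψ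
    + (-1 : ℝ) • smulT (ofScalar X.Φ) (upVec (invT X.G) X.Ψ) := by
  have hG : MetricSm 1 X.G := by rw [hX]; exact ((metricCk_rescale ha hT hS).sm ht).of_le (by norm_num)
  have hK : TSm 1 X.K := by rw [hX]; exact ((tck_K ha hT hS).sm ht).of_le (by norm_num)
  have hsym : ∀ y i j, mulUp X.K (invT X.G) y ![i, j] ![] = mulUp X.K (invT X.G) y ![j, i] ![] := by
    intro y i j
    have h1 := rescale_symm ha hT hS ht y
    rw [← hX] at h1
    have h2 : (m11 (X.K y) * (X.G y)⁻¹).IsSymm := by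
      have h3 : m11 (X.K y) * (X.G y)⁻¹ = (X.G y)⁻¹ * (X.G y * m11 (X.K y)) * (X.G y)⁻¹ := by
        rw [← Matrix.mul_assoc, hG.inv_mul, Matrix.one_mul]
      rw [h3, Matrix.IsSymm, Matrix.transpose_mul, Matrix.transpose_mul, h1.eq, (hG.inv_symm y).eq]
      simp only [Matrix.mul_assoc]
    exact h2.apply j i
  have hup : ∀ c y i j, ∑ d, (X.G y)⁻¹ d j * der c (chrMat X.G c) X.K y ![i] ![d]
      = der c (chrMat X.G c) (mulUp X.K (invT X.G)) y ![i, j] ![] := by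
    intro c y i j
    rw [isNatural_mulUp.leibniz _ _ hK hG.invT]
    simp only [Pi.add_apply, mulUp, der_invT (r := 0) hG, mul_zero, Finset.sum_const_zero, add_zero]
    exact Finset.sum_congr rfl fun d _ => mul_comm _ _
  have hdsym : ∀ c y i j, der c (chrMat X.G c) (mulUp X.K (invT X.G)) y ![i, j] ![]
      = der c (chrMat X.G c) (mulUp X.K (invT X.G)) y ![j, i] ![] := by
    intro c y i j
    have e : (fun z => mulUp X.K (invT X.G) z ![i, j] ![])
        = fun z => mulUp X.K (invT X.G) z ![j, i] ![] := funext fun z => hsym z i j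
    rw [der_20, der_20, e]
    simp only [hsym y _ i, hsym y j _]
    ring
  have hd := mom_down_rescale ha hT hS ht hX
  funext y i' j'
  rw [vec0_eq j', ← vec1_eta i']
  generalize i' 0 = i
  have h1 : div11Sharp X.G X.K y ![i] ![] = ∑ d, (X.G y)⁻¹ i d * div11 X.G X.K y ![] ![d] := by
    have e1 : div11Sharp X.G X.K y ![i] ![]
        = ∑ c, ∑ d, (X.G y)⁻¹ c d * der c (chrMat X.G c) X.K y ![i] ![d] := rfl
    have e2 : ∀ d, div11 X.G X.K y ![] ![d] = ∑ c, der c (chrMat X.G c) X.K y ![c] ![d] :=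
      fun d => rfl
    rw [e1]
    simp only [e2, Finset.mul_sum]
    conv_rhs => rw [Finset.sum_comm]
    refine Finset.sum_congr rfl fun c _ => ?_
    have e3 := hup c y i c
    rw [hdsym, ← hup] at e3
    rw [show ∑ d, (X.G y)⁻¹ c d * der c (chrMat X.G c) X.K y ![i] ![d]
      = ∑ d, (X.G y)⁻¹ d c * der c (chrMat X.G c) X.K y ![i] ![d] from
      Finset.sum_congr rfl fun d _ => by rw [hG.inv_symm_apply], e3]
    exact Finset.sum_congr rfl fun d _ => by rw [hG.inv_symm_apply]
  rw [h1, hd]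
  simp only [Pi.add_apply, Pi.smul_apply, smul_eq_mul, smulT, ofScalar, upVec, invT,
    Matrix.cons_val_zero, Matrix.cons_val_one, Finset.mul_sum, ← Finset.sum_add_distrib]
  exact Finset.sum_congr rfl fun d _ => by ring

theorem normSq_K (ht : t ∈ Set.Ico 0 T) {X : Rescaled} (hX : X = rescale a S t) (y : S3) :
    normSq X.G X.K y = ∑ i, ∑ j, X.K y ![i] ![j] * X.K y ![j] ![i] := by
  have hG : MetricSm 1 X.G := by rw [hX]; exact ((metricCk_rescale ha hT hS).sm ht).of_le (by norm_num)
  refine ipm_self_of_symm (hG.mul_inv y) (hG.inv_symm y) ?_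
  rw [hX]
  exact rescale_symm ha hT hS ht y

/-- The terms of order zero add up to (2/3)(1 − b⁴ − a'²), which vanishes by `friedmann`; the
constant 2/3 is the square of the background value √(2/3) of the scalar field. Everything left is at
least linear in the perturbation. -/
theorem lapse_eq_rescale (ht : t ∈ Set.Ico 0 T) {b : ℝ} (hb : 0 < b) (hab : a t = b ^ 3)
    {X : Rescaled} (hX : X = rescale a S t) :
    b ^ 4 • ofScalar (lapS X.G X.N) = (deriv a t ^ 2 / 3 + 2 / 3) • ofScalar X.N
    + (2 * sqt * (b ^ 4)⁻¹) • ofScalar X.Φ + (b ^ 4)⁻¹ • trMul X.K X.K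
    + (b ^ 4)⁻¹ • smulT (ofScalar X.Φ) (ofScalar X.Φ)
    + smulT (ofScalar (normSq X.G X.K)) (ofScalar X.N)
    + (2 * sqt) • smulT (ofScalar X.Φ) (ofScalar X.N)
    + smulT (ofScalar fun y => X.Φ y ^ 2) (ofScalar X.N) := by
  funext y i' j'
  have h0 := (ha.pos t (ha.mem hT ht)).ne'
  have hl := hS.lapse t ht y
  have e1 : lapS (S.g t) (S.n t) y = b ^ 2 * lapS X.G X.N y := by
    simp only [lapS, hess_n ha hT hS ht hb hab, inv_rescale ha hT hS ht hb hab, ← hX,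
      Pi.smul_apply, smul_eq_mul, Finset.mul_sum]
    refine Finset.sum_congr rfl fun i _ => Finset.sum_congr rfl fun j _ => ?_
    field_simp
  have e2 : deriv (hubble a) t = -(2 / 3) * (b ^ 2)⁻¹ - deriv a t ^ 2 * (b ^ 6)⁻¹ := by
    have h1 : HasDerivAt (hubble a) _ t :=
      (ha.ode t (ha.mem hT ht)).div (ha.hasDerivAt (ha.mem hT ht)) h0
    rw [h1.deriv, hab, cube_rpow_one_third hb]
    field_simp
  have e3 : ∑ i, ∑ j, S.kHat t y ![i] ![j] * S.kHat t y ![j] ![i]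
      = (b ^ 6)⁻¹ * ∑ i, ∑ j, X.K y ![i] ![j] * X.K y ![j] ![i] := by
    have hK : ∀ i j, X.K y ![i] ![j] = b ^ 3 * S.kHat t y ![i] ![j] := fun i j => by
      rw [hX, ← hab]; rfl
    simp only [hK, Finset.mul_sum]
    refine Finset.sum_congr rfl fun i _ => Finset.sum_congr rfl fun j _ => ?_
    field_simp
  have e4 : trMul X.K X.K y i' j' = ∑ i, ∑ j, X.K y ![i] ![j] * X.K y ![j] ![i] := rfl
  have hf := ha.friedmann (ha.mem hT ht)
  rw [hab, cube_rpow_four_thirds hb] at hf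
  rw [e1, e2, e3, nφ_eq ha hT hS ht hb hab, n_eq ha hT hS ht hb hab, hubble, hab, ← hX] at hl
  simp only [Pi.add_apply, Pi.smul_apply, smul_eq_mul, smulT, ofScalar, e4, normSq_K ha hT hS ht hX]
  generalize ∑ i, ∑ j, X.K y ![i] ![j] * X.K y ![j] ![i] = k2 at hl ⊢
  have hs := sqt_sq
  have hl2 : b ^ 8 * lapS X.G X.N y = -(2 / 3) * b ^ 4 - deriv a t ^ 2
      + (1 + b ^ 4 * X.N y) * (k2 + deriv a t ^ 2 / 3 + (X.Φ y + sqt) ^ 2) := by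
    field_simp at hl ⊢
    linear_combination hl
  have hb4 : b ^ 4 ≠ 0 := by positivity
  apply mul_left_cancel₀ hb4
  have : b ^ 4 * (b ^ 4 * lapS X.G X.N y) = b ^ 8 * lapS X.G X.N y := by ring
  rw [this, hl2]
  field_simp
  linear_combination (-2 : ℝ) * hf + 3 * (1 + b ^ 4 * X.N y) * hs

theorem sliceEqs (ht : t ∈ Set.Ioo 0 T) :
    SliceEqs (a t ^ (1 / 3 : ℝ)) (rescale a S t) (dtT (fun s => (rescale a S s).K) t)
      (dt (fun s => (rescale a S s).Φ) t) (dtT (fun s => (rescale a S s).Ψ) t) := by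
  have ht' : t ∈ Set.Ico 0 T := ⟨ht.1.le, ht.2⟩
  have hb := ha.root_pos hT ht'
  have hab := ha.root_cube hT ht'
  refine
  { b_pos := hb
    b_le := ha.root_le hT ht'
    α_eq := hab
    friedmann := ?_
    α'_nonpos := ha.deriv_nonpos ⟨ht'.1, ht'.2.trans_le hT⟩
    met := (metricCk_rescale ha hT hS).sm ht'
    K_sm := (tck_K ha hT hS).sm ht'
    N_sm := (ck_N ha hT hS).sm ht'
    Φ_sm := (ck_Φ ha hT hS).sm ht'
    Ψ_sm := (tck_Ψ ha hT hS).sm ht'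
    tr := rescale_tr ha hT hS ht'
    symm := rescale_symm ha hT hS ht'
    metric_eq := metric_eq_rescale ha hT hS ht hb hab
    sec_eq := sec_eq_rescale ha hT hS ht hb hab rfl
    time_eq := time_eq_rescale ha hT hS ht hb hab rfl
    space_eq := space_eq_rescale ha hT hS ht hb hab rfl
    mom_down := mom_down_rescale ha hT hS ht' rfl
    mom_up := mom_up_rescale ha hT hS ht' rfl
    lapse_eq := lapse_eq_rescale ha hT hS ht' hb hab rfl }
  have hf := ha.friedmann (ha.mem hT ht')
  rwa [← cube_rpow_four_thirds hb, ← hab]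

end slice

/-! ## The commuted equations -/

section sum3

variable {I : List (Fin 3)} {F F' : List (Fin 3) → List (Fin 3) → List (Fin 3) → ℝ}

theorem sum3_add : sum3 I (fun I₁ I₂ I₃ => F I₁ I₂ I₃ + F' I₁ I₂ I₃) = sum3 I F + sum3 I F' := by
  simp only [sum3, sum2_add]

theorem sum3_eq_left : sum3 I F
    = F I [] [] + sum3 I fun I₁ I₂ I₃ => if I₁.length < I.length then F I₁ I₂ I₃ else 0 := by
  rw [sum3, sum2_eq_left, sum2_nil, sum3]
  congr 1
  refine sum2_congr fun I₁ J _ => ?_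
  split_ifs <;> simp

theorem sum3_eq_right : sum3 I F
    = F [] [] I + sum3 I fun I₁ I₂ I₃ => if I₃.length < I.length then F I₁ I₂ I₃ else 0 := by
  have h1 : sum3 I (fun I₁ I₂ I₃ => if I₃.length < I.length then 0 else F I₁ I₂ I₃) = F [] [] I := by
    rw [← sum2_full_right (I := I) (F := fun I₁ J => F I₁ [] J), sum3]
    refine sum2_congr fun I₁ J hl => ?_
    split_ifs with h
    · refine (sum2_congr (F' := fun _ _ => 0) fun I₂ I₃ hl' => ?_).trans sum2_zero
      rw [if_pos (by omega)]
    · rw [← sum2_full_right (I := J) (F := fun I₂ I₃ => F I₁ I₂ I₃)]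
      refine sum2_congr fun I₂ I₃ hl' => ?_
      rw [show J.length = I.length by omega]
  rw [← h1, ← sum3_add]
  congr 1
  funext I₁ I₂ I₃
  split_ifs <;> simp

end sum3

theorem cov_add {g : Metric3} {l m : ℕ} {ξ η : Tensor l m} (hξ : TSm 1 ξ) (hη : TSm 1 η) :
    cov g (ξ + η) = cov g ξ + cov g η := by
  funext y a b
  simp only [cov_eq_der, der_add _ _ hξ hη, Pi.add_apply]

theorem cov_smul {g : Metric3} {l m : ℕ} {ξ : Tensor l m} (c : ℝ) (hξ : TSm 1 ξ) :
    cov g (c • ξ) = c • cov g ξ := by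
  funext y a b
  simp only [cov_eq_der, der_smul _ _ c hξ, Pi.smul_apply]

theorem ZI_zero (I : List (Fin 3)) : ZI I (fun _ => 0) = fun _ => 0 := by
  induction I with
  | nil => rfl
  | cons A I ih => rw [ZI_cons, ih]; funext y; exact Z_const A y 0

theorem der_idTen (A : Fin 3) (Γ : S3 → Matrix (Fin 3) (Fin 3) ℝ) : der A Γ idTen = 0 := by
  funext y a b
  rw [← vec1_eta a, ← vec1_eta b, der_11]
  have e : ∀ i j x, idTen x ![i] ![j] = (1 : Matrix (Fin 3) (Fin 3) ℝ) i j := fun _ _ _ => rfl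
  simp only [e, Z_const, Matrix.one_apply]
  simp

theorem TSm.idTen {r : ℕ} : TSm r idTen := fun _ _ => Sm.const _

/-- Every derivation kills the identity endomorphism, so a pure trace term stays a pure trace term
after commutation. -/
theorem lieI_smulT_idTen (I : List (Fin 3)) {f : S3 → ℝ} (hf : Sm I.length f) :
    lieI I (smulT (ofScalar f) idTen) = smulT (ofScalar (ZI I f)) idTen := by
  induction I with
  | nil => rfl
  | cons A I ih =>
    rw [lieI_cons, ih (hf.of_le (by simp)), lie_eq_der,
      isNatural_smulT.leibniz _ _ (TSm.ofScalar (Sm.ZI (hf.of_le (by simp; omega)))) TSm.idTen,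
      der_idTen, ← lie_eq_der, lie_ofScalar, ZI_cons]
    funext y a b
    simp [smulT]

section geometry

variable {r : ℕ} {G : Metric3}

theorem MetricSm.lapS (h : MetricSm (r + 1) G) {f : S3 → ℝ} (hf : Sm (r + 2) f) :
    Sm r (lapS G f) := by
  refine Sm.sum fun c _ => Sm.sum fun d _ => ?_
  exact (((h.of_le (Nat.le_succ r)).invT ![c, d] ![])).mul (h.cov (TSm.grad hf) _ _)

theorem MetricSm.div01 (h : MetricSm (r + 1) G) {ψ : Tensor 0 1} (hψ : TSm (r + 1) ψ) :
    Sm r (div01 G ψ) := by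
  refine Sm.sum fun c _ => Sm.sum fun d _ => ?_
  exact (((h.of_le (Nat.le_succ r)).invT ![c, d] ![])).mul (h.cov hψ _ _)

theorem MetricSm.sharp2 (h : MetricSm r G) {ξ : Tensor 0 2} (hξ : TSm r ξ) :
    TSm r (sharp2 G ξ) := fun a b => Sm.sum fun c _ => (h.invT ![a 0, c] ![]).mul (hξ _ _)

theorem MetricSm.hess (h : MetricSm (r + 1) G) {f : S3 → ℝ} (hf : Sm (r + 2) f) :
    TSm r (hess G f) := h.cov (TSm.grad hf)

theorem MetricCk.ricSharp {T : ℝ} {G : ℝ → Metric3} (h : MetricCk (r + 2) T G) :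
    TCk r T fun t => ricSharp (G t) := by
  have hi := (h.of_le (q := r) (by omega)).inv
  have h1 := h.of_le (q := r + 1) (by omega)
  have hc : ∀ m, TCk r T fun t => BigCrunch.cov (G t) (BigCrunch.cov (G t) (coframe m)) := fun m =>
    h1.cov (h.cov (ξ := fun _ => coframe m) fun a b => Ck.const _)
  refine fun a b => Ck.sum fun c _ => (hi _ _).mul (Ck.sum fun d _ => Ck.sum fun e _ =>
    (hi _ _).mul (Ck.sum fun m _ => ((h.of_le (q := r) (by omega)).smooth _ _).mul
      ((hc m _ _).sub (hc m _ _))))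

theorem MetricSm.ricSharp (h : MetricSm (r + 2) G) : TSm r (ricSharp G) := h.ck.ricSharp

end geometry

theorem sharp2_sub {G : Metric3} (ξ η : Tensor 0 2) :
    sharp2 G (ξ - η) = sharp2 G ξ - sharp2 G η := by
  funext y a b
  simp only [sharp2, Pi.sub_apply, mul_sub, Finset.sum_sub_distrib]

/-! ### Commuted constraint, scalar field and lapse equations -/

namespace SliceEqs

variable {b : ℝ} {X : Rescaled} {Kt : Tensor 1 1} {Φt : S3 → ℝ} {Ψt : Tensor 0 1}
  (E : SliceEqs b X Kt Φt Ψt) {I : List (Fin 3)} (hI : I.length ≤ 16)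
include E hI

theorem K_lie : TSm 1 (lieI I X.K) := TSm.lieI (E.K_sm.of_le (by omega))

theorem G_lie : TSm 2 (lieI I (lowT X.G)) := TSm.lieI ((E.met.lowT).of_le (by omega))

theorem N_lie : Sm 2 (ZI I X.N) := Sm.ZI (E.N_sm.of_le (by omega))

theorem Φ_lie : Sm 1 (ZI I X.Φ) := Sm.ZI (E.Φ_sm.of_le (by omega))

theorem Ψ_lie : TSm 1 (lieI I X.Ψ) := TSm.lieI (E.Ψ_sm.of_le (by omega))

/-- With mixed indices the trace does not involve the metric, so Lie derivatives preserve
trace-freeness although they do not preserve G. -/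
theorem tr_lie (y : S3) : ∑ c, lieI I X.K y ![c] ![c] = 0 := by
  have h1 := lieI_tr11 (I := I) (E.K_sm.of_le (by omega))
  have h2 : tr11 X.K = fun _ => 0 := funext E.tr
  rw [h2, ZI_zero] at h1
  exact congrFun h1 y

theorem smulT_N_lie {l m : ℕ} {ξ : Tensor l m} (hξ : TSm I.length ξ) (y : S3) (p : Fin l → Fin 3)
    (q : Fin m → Fin 3) : lieI I (smulT (ofScalar X.N) ξ) y p q
      = sum2 I fun I₁ I₂ => ZI I₁ X.N y * lieI I₂ ξ y p q := by
  rw [isNatural_smulT.lieI (TSm.ofScalar (E.N_sm.of_le (by omega))) hξ]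
  simp only [smulT, lieI_ofScalar]
  rfl

theorem smulT_Φ_lie {l m : ℕ} {ξ : Tensor l m} (hξ : TSm I.length ξ) (y : S3) (p : Fin l → Fin 3)
    (q : Fin m → Fin 3) : lieI I (smulT (ofScalar X.Φ) ξ) y p q
      = sum2 I fun I₁ I₂ => ZI I₁ X.Φ y * lieI I₂ ξ y p q := by
  rw [isNatural_smulT.lieI (TSm.ofScalar (E.Φ_sm.of_le (by omega))) hξ]
  simp only [smulT, lieI_ofScalar]
  rfl

theorem upVec_lie (y : S3) (i : Fin 3) : lieI I (upVec (invT X.G) X.Ψ) y ![i] ![]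
    = sum2 I fun I₁ I₂ => ∑ c, lieI I₁ (invT X.G) y ![i, c] ![] * lieI I₂ X.Ψ y ![] ![c] := by
  rw [isNatural_upVec.lieI (E.met.invT.of_le (by omega)) (E.Ψ_sm.of_le (by omega))]
  rfl

/-- The constraint keeps the divergence of L^I K at the level of L^I Ψ; this prevents a loss of
derivatives when the curvature terms are integrated by parts. -/
theorem div_lie (y : S3) (p : Fin 0 → Fin 3) (q : Fin 1 → Fin 3) :
    div11 X.G (lieI I X.K) y p q = -sqt * lieI I X.Ψ y p q + X.momBorderDown I y p q := by
  have h1 : TSm I.length X.Ψ := E.Ψ_sm.of_le (by omega)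
  have h2 : TSm I.length (smulT (ofScalar X.Φ) X.Ψ) :=
    isNatural_smulT.sm (TSm.ofScalar (E.Φ_sm.of_le (by omega))) h1
  have h3 : lieI I (div11 X.G X.K) y p q
      = -sqt * lieI I X.Ψ y p q - sum2 I fun I₁ I₂ => ZI I₁ X.Φ y * lieI I₂ X.Ψ y p q := by
    rw [E.mom_down, lieI_add (h1.smul _) (h2.smul _), lieI_smul _ h1, lieI_smul _ h2]
    simp only [Pi.add_apply, Pi.smul_apply, smul_eq_mul, E.smulT_Φ_lie hI h1]
    ring
  rw [Rescaled.momBorderDown, h3]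
  ring

theorem divSharp_lie (y : S3) (i : Fin 3) :
    div11Sharp X.G (lieI I X.K) y ![i] ![]
      = -sqt * sharp1 X.G (lieI I X.Ψ) y ![i] ![] + X.momBorderUp I y ![i] ![] := by
  have h1 : TSm I.length (upVec (invT X.G) X.Ψ) :=
    isNatural_upVec.sm (E.met.invT.of_le (by omega)) (E.Ψ_sm.of_le (by omega))
  have h2 : TSm I.length (smulT (ofScalar X.Φ) (upVec (invT X.G) X.Ψ)) :=
    isNatural_smulT.sm (TSm.ofScalar (E.Φ_sm.of_le (by omega))) h1
  have h4 : lieI I (smulT (ofScalar X.Φ) (upVec (invT X.G) X.Ψ)) y ![i] ![]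
      = sum3 I fun I₁ I₂ I₃ =>
        ZI I₁ X.Φ y * ∑ c, lieI I₂ (invT X.G) y ![i, c] ![] * lieI I₃ X.Ψ y ![] ![c] := by
    rw [E.smulT_Φ_lie hI h1, sum3]
    refine sum2_congr fun I₁ J hl => ?_
    rw [E.upVec_lie (by omega), sum2_mul_left]
  have h5 : lieI I (upVec (invT X.G) X.Ψ) y ![i] ![] = sharp1 X.G (lieI I X.Ψ) y ![i] ![]
      + sum2 I fun I₁ I₂ => if I₂.length < I.length then
        ∑ c, lieI I₁ (invT X.G) y ![i, c] ![] * lieI I₂ X.Ψ y ![] ![c] else 0 := by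
    rw [E.upVec_lie hI, sum2_eq_right]
    rfl
  have h3 : lieI I (div11Sharp X.G X.K) y ![i] ![]
      = -sqt * lieI I (upVec (invT X.G) X.Ψ) y ![i] ![]
        - lieI I (smulT (ofScalar X.Φ) (upVec (invT X.G) X.Ψ)) y ![i] ![] := by
    rw [E.mom_up, lieI_add (h1.smul _) (h2.smul _), lieI_smul _ h1, lieI_smul _ h2]
    simp only [Pi.add_apply, Pi.smul_apply, smul_eq_mul]
    ring
  rw [Rescaled.momBorderUp, h3, h4, h5]
  simp only [Matrix.cons_val_zero, sqt]
  ring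

/-- In the Leibniz expansion the coefficient 1 + b⁴N of the top order gradient is the lapse n
itself, kept intact as the weight of the later divergence. All splittings with fewer derivatives on
Φ or N go into `spaceJunk`. -/
theorem space_lie (y : S3) (p : Fin 0 → Fin 3) (q : Fin 1 → Fin 3) :
    lieI I Ψt y p q = (b ^ 3)⁻¹ * (1 + b ^ 4 * X.N y) * grad (ZI I X.Φ) y p q
      + sqt * b * grad (ZI I X.N) y p q + b * (X.spaceBorder I y p q + X.spaceJunk I y p q) := by
  have h1 : TSm I.length (grad X.Φ) := TSm.grad (E.Φ_sm.of_le (by omega))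
  have h2 : TSm I.length (grad X.N) := TSm.grad (E.N_sm.of_le (by omega))
  have h3 : TSm I.length (smulT (ofScalar X.N) (grad X.Φ)) :=
    isNatural_smulT.sm (TSm.ofScalar (E.N_sm.of_le (by omega))) h1
  have h4 : TSm I.length (smulT (ofScalar X.Φ) (grad X.N)) :=
    isNatural_smulT.sm (TSm.ofScalar (E.Φ_sm.of_le (by omega))) h2
  have hb := E.b_pos.ne'
  rw [E.space_eq, lieI_add (((h1.smul _).add (h3.smul _)).add (h4.smul _)) (h2.smul _),
    lieI_add ((h1.smul _).add (h3.smul _)) (h4.smul _), lieI_add (h1.smul _) (h3.smul _),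
    lieI_smul _ h1, lieI_smul _ h2, lieI_smul _ h3, lieI_smul _ h4]
  simp only [Pi.add_apply, Pi.smul_apply, smul_eq_mul, Rescaled.spaceBorder, Rescaled.spaceJunk]
  rw [← lieI_grad (E.Φ_sm.of_le (by omega)), ← lieI_grad (E.N_sm.of_le (by omega))]
  have e3 : smulT (ofScalar X.N) (grad X.Φ) = fun x i j => X.N x * grad X.Φ x i j := rfl
  have e4 : smulT (ofScalar X.Φ) (grad X.N) = fun x i j => X.Φ x * grad X.N x i j := rfl
  rw [e3, e4]
  field_simp
  ring

theorem time_lie (y : S3) :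
    ZI I Φt y = b * (1 + b ^ 4 * X.N y) * div01 X.G (lieI I X.Ψ) y
      - sqt * X.α' * b * ZI I X.N y + b * (X.timeBorder I y + X.timeJunk I y) := by
  have hdiv : TSm I.length (ofScalar (div01 X.G X.Ψ)) :=
    TSm.ofScalar ((E.met.of_le (by omega)).div01 (E.Ψ_sm.of_le (by omega)))
  have hN : TSm I.length (ofScalar X.N) := TSm.ofScalar (E.N_sm.of_le (by omega))
  have hΦ : TSm I.length (ofScalar X.Φ) := TSm.ofScalar (E.Φ_sm.of_le (by omega))
  have h2 := isNatural_smulT.sm hN hdiv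
  have h4 := isNatural_smulT.sm hN hΦ
  have hu : TSm I.length (upVec (invT X.G) X.Ψ) :=
    isNatural_upVec.sm (E.met.invT.of_le (by omega)) (E.Ψ_sm.of_le (by omega))
  have hg : TSm I.length (grad X.N) := TSm.grad (E.N_sm.of_le (by omega))
  have h5 := isNatural_pairing.sm hg hu
  rw [ZI_eq_lieI, E.time_eq,
    lieI_add ((((hdiv.smul _).add (h2.smul _)).add (hN.smul _)).add (h4.smul _)) (h5.smul _),
    lieI_add (((hdiv.smul _).add (h2.smul _)).add (hN.smul _)) (h4.smul _),
    lieI_add ((hdiv.smul _).add (h2.smul _)) (hN.smul _), lieI_add (hdiv.smul _) (h2.smul _),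
    lieI_smul _ hdiv, lieI_smul _ h2, lieI_smul _ hN, lieI_smul _ h4, lieI_smul _ h5]
  simp only [Pi.add_apply, Pi.smul_apply, smul_eq_mul]
  have e2 : lieI I (smulT (ofScalar X.N) (ofScalar (div01 X.G X.Ψ))) y ![] ![]
      = ZI I (fun x => X.N x * div01 X.G X.Ψ x) y :=
    (ZI_eq_lieI I (fun x => X.N x * div01 X.G X.Ψ x) y).symm
  have e4 : lieI I (smulT (ofScalar X.N) (ofScalar X.Φ)) y ![] ![] = ZI I X.N y * X.Φ y
      + sum2 I fun I₁ I₂ => if I₁.length < I.length then ZI I₁ X.N y * ZI I₂ X.Φ y else 0 := by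
    rw [E.smulT_N_lie hI hΦ, sum2_eq_left]
    simp only [← ZI_eq_lieI]
    rfl
  have e5 : lieI I (pairing (grad X.N) (upVec (invT X.G) X.Ψ)) y ![] ![]
      = sum3 I fun I₁ I₂ I₃ => ∑ c, ∑ d, Z c (ZI I₁ X.N) y * lieI I₂ (invT X.G) y ![c, d] ![]
        * lieI I₃ X.Ψ y ![] ![d] := by
    rw [isNatural_pairing.lieI hg hu, sum3]
    refine sum2_congr fun I₁ J hl => ?_
    rw [lieI_grad (E.N_sm.of_le (by omega))]
    simp only [pairing, sum2_finset_sum]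
    refine Finset.sum_congr rfl fun c _ => ?_
    rw [E.upVec_lie (by omega), ← sum2_mul_left, ← sum2_finset_sum]
    refine sum2_congr fun I₂ I₃ _ => ?_
    rw [Finset.mul_sum]
    exact Finset.sum_congr rfl fun d _ => by simp only [grad, Matrix.cons_val_zero]; ring
  rw [e2, e4, e5, ← ZI_eq_lieI, ← ZI_eq_lieI, Rescaled.timeBorder, Rescaled.timeJunk, E.α_eq,
    cube_rpow_four_thirds E.b_pos]
  ring

/-- The zeroth order coefficient is a positive background mass a'²/3 + 2/3 plus a correction that is
small pointwise. The linear source in Z^I Φ is the one that later cancels against the equation for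
Φ. -/
theorem lapse_lie (y : S3) :
    b ^ 4 * lapS X.G (ZI I X.N) y = (X.α' ^ 2 / 3 + 2 / 3) * ZI I X.N y
      + (normSq X.G X.K y + 2 * sqt * X.Φ y + X.Φ y ^ 2) * ZI I X.N y
      + 2 * sqt * (b ^ 4)⁻¹ * ZI I X.Φ y + (b ^ 4)⁻¹ * X.lapseBorder I y + X.lapseJunk I y := by
  have hN : TSm I.length (ofScalar X.N) := TSm.ofScalar (E.N_sm.of_le (by omega))
  have hΦ : TSm I.length (ofScalar X.Φ) := TSm.ofScalar (E.Φ_sm.of_le (by omega))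
  have hK : TSm I.length X.K := E.K_sm.of_le (by omega)
  have hl : TSm I.length (ofScalar (lapS X.G X.N)) :=
    TSm.ofScalar ((E.met.of_le (by omega)).lapS (E.N_sm.of_le (by omega)))
  have h3 := isNatural_trMul.sm hK hK
  have h4 := isNatural_smulT.sm hΦ hΦ
  have h6 := isNatural_smulT.sm hΦ hN
  have hk2 : normSq X.G X.K = fun y => trMul X.K X.K y ![] ![] := by
    funext y
    exact ipm_self_of_symm (E.met.mul_inv y) (E.met.inv_symm y) (E.symm y)
  have h5 : TSm I.length (smulT (ofScalar (normSq X.G X.K)) (ofScalar X.N)) := by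
    rw [hk2]
    exact isNatural_smulT.sm (TSm.ofScalar (h3 ![] ![])) hN
  have h7 : TSm I.length (smulT (ofScalar fun y => X.Φ y ^ 2) (ofScalar X.N)) := by
    refine isNatural_smulT.sm (TSm.ofScalar ?_) hN
    simp only [sq]
    exact (E.Φ_sm.of_le (by omega)).mul (E.Φ_sm.of_le (by omega))
  have key := congrFun (congrFun (congrFun (congrArg (lieI I) E.lapse_eq) y) ![]) ![]
  rw [lieI_smul _ hl,
    lieI_add ((((((hN.smul _).add (hΦ.smul _)).add (h3.smul _)).add (h4.smul _)).add h5).add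
      (h6.smul _)) h7,
    lieI_add (((((hN.smul _).add (hΦ.smul _)).add (h3.smul _)).add (h4.smul _)).add h5) (h6.smul _),
    lieI_add ((((hN.smul _).add (hΦ.smul _)).add (h3.smul _)).add (h4.smul _)) h5,
    lieI_add (((hN.smul _).add (hΦ.smul _)).add (h3.smul _)) (h4.smul _),
    lieI_add ((hN.smul _).add (hΦ.smul _)) (h3.smul _), lieI_add (hN.smul _) (hΦ.smul _),
    lieI_smul _ hN, lieI_smul _ hΦ, lieI_smul _ h3, lieI_smul _ h4, lieI_smul _ h6] at key
  simp only [Pi.add_apply, Pi.smul_apply, smul_eq_mul] at key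
  have e3 : lieI I (trMul X.K X.K) y ![] ![]
      = sum2 I fun I₁ I₂ => ∑ c, ∑ d, lieI I₁ X.K y ![c] ![d] * lieI I₂ X.K y ![d] ![c] := by
    rw [isNatural_trMul.lieI hK hK]
    rfl
  have e4 : lieI I (smulT (ofScalar X.Φ) (ofScalar X.Φ)) y ![] ![]
      = sum2 I fun I₁ I₂ => ZI I₁ X.Φ y * ZI I₂ X.Φ y := by
    rw [E.smulT_Φ_lie hI hΦ]
    simp only [← ZI_eq_lieI]
  have e5 : lieI I (smulT (ofScalar (normSq X.G X.K)) (ofScalar X.N)) y ![] ![]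
      = ZI I (fun x => normSq X.G X.K x * X.N x) y :=
    (ZI_eq_lieI I (fun x => normSq X.G X.K x * X.N x) y).symm
  have e6 : lieI I (smulT (ofScalar X.Φ) (ofScalar X.N)) y ![] ![]
      = ZI I (fun x => X.Φ x * X.N x) y :=
    (ZI_eq_lieI I (fun x => X.Φ x * X.N x) y).symm
  have e7 : lieI I (smulT (ofScalar fun y => X.Φ y ^ 2) (ofScalar X.N)) y ![] ![]
      = ZI I (fun x => X.Φ x ^ 2 * X.N x) y :=
    (ZI_eq_lieI I (fun x => X.Φ x ^ 2 * X.N x) y).symm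
  rw [e3, e4, e5, e6, e7, ← ZI_eq_lieI, ← ZI_eq_lieI, ← ZI_eq_lieI] at key
  rw [Rescaled.lapseBorder, Rescaled.lapseJunk, E.α_eq, cube_rpow_four_thirds E.b_pos]
  have hs : Real.sqrt (2 / 3) = sqt := rfl
  rw [hs]
  linear_combination key

end SliceEqs

/-! ## The time derivative of the connection -/

section connection

variable {T t : ℝ} {G : ℝ → Metric3} (hG : MetricCk 2 T G) (ht : t ∈ Set.Ioo 0 T)
include ht

theorem Ck.hasDerivAt_Z {f : ℝ → S3 → ℝ} (hf : Ck 2 T f) (A : Fin 3) (y : S3) :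
    HasDerivAt (fun s => BigCrunch.Z A (f s) y) (BigCrunch.Z A (BigCrunch.dt f t) y) t := by
  have h3 := (hf.Z (r := 1) A).hasDerivAt (r := 0) ht y
  rwa [dt_Z hf ⟨ht.1.le, ht.2⟩ A y] at h3

include hG

/-- The derivative of a connection is a tensor: differentiating G⁻¹ and the Koszul formula
separately gives noncovariant terms, which recombine into covariant derivatives of h = ∂_t G. -/
theorem hasDerivAt_chr {X : Rescaled} (h1 : X.G = G t) (h2 : X.Gt = dtT (fun s => lowT (G s)) t)
    (y : S3) (A D B : Fin 3) :
    HasDerivAt (fun s => chr (G s) y A D B) (X.chrDt y A D B) t := by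
  have ht' : t ∈ Set.Ico 0 T := ⟨ht.1.le, ht.2⟩
  have hm : MetricSm 2 (G t) := hG.sm ht'
  set h : Fin 3 → Fin 3 → S3 → ℝ := fun i j => dt (fun s x => G s x i j) t with hdef
  have hd : ∀ i j, HasDerivAt (fun s => G s y i j) (h i j y) t := fun i j =>
    ((hG.smooth i j).of_le (q := 1) (by norm_num)).hasDerivAt (r := 0) ht y
  have hdZ : ∀ A i j, HasDerivAt (fun s => Z A (fun x => G s x i j) y) (Z A (h i j) y) t :=
    fun A i j => Ck.hasDerivAt_Z ht (hG.smooth i j) A y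
  have hsym : ∀ i j, h i j = h j i := fun i j => by
    funext x
    refine (dt_eq ht.1 ?_ : dt (fun s x => G s x i j) t x = _)
    refine HasDerivAt.congr_of_eventuallyEq
      (((hG.smooth j i).of_le (q := 1) (by norm_num)).hasDerivAt (r := 0) ht x) ?_
    filter_upwards [Ioo_mem_nhds ht.1 ht.2] with s hs
    exact ((hG.pos s ⟨hs.1.le, hs.2⟩ x).posSemidef.isSymm.apply j i)
  set L : Fin 3 → ℝ := fun C => (1 / 2) * (Z A (h B C) y + Z B (h A C) y - Z C (h A B) y)
    + (1 / 3) * ∑ D, (eps A B D * h C D y - eps B C D * h A D y - eps A C D * h B D y) with hL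
  have hlow : ∀ C, HasDerivAt (fun s => chrLow (G s) y A C B) (L C) t := fun C =>
    ((((hdZ A B C).fun_add (hdZ B A C)).fun_sub (hdZ C A B)).const_mul (1 / 2)).fun_add
      ((HasDerivAt.fun_sum fun D _ => (((hd C D).const_mul _).fun_sub ((hd A D).const_mul _)).fun_sub
        ((hd B D).const_mul _)).const_mul (1 / 3))
  set H : Matrix (Fin 3) (Fin 3) ℝ := Matrix.of fun i j => h i j y with hH
  have hinv : ∀ i j, HasDerivAt (fun s => (G s y)⁻¹ i j)
      ((-((G t y)⁻¹ * H * (G t y)⁻¹)) i j) t := fun i j =>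
    hasDerivAt_matrix_inv (M := fun s => G s y) (M' := H) (fun i j => hd i j) (by
      filter_upwards [Ioo_mem_nhds ht.1 ht.2] with s hs
      exact (hG.pos s ⟨hs.1.le, hs.2⟩ y).det_pos.ne') i j
  have hchr : HasDerivAt (fun s => chr (G s) y A D B) _ t :=
    HasDerivAt.fun_sum fun C (_ : C ∈ Finset.univ) => (hinv C D).fun_mul (hlow C)
  refine hchr.congr_deriv ?_
  rw [Finset.sum_add_distrib]
  have e1 : ∑ C, (-((G t y)⁻¹ * H * (G t y)⁻¹)) C D * chrLow (G t) y A C B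
      = -∑ e, (G t y)⁻¹ D e * ∑ F, h F e y * chr (G t) y A F B := by
    have e3 : ∀ C, ((G t y)⁻¹ * H * (G t y)⁻¹) C D
        = ∑ e, ∑ F, (G t y)⁻¹ C F * h F e y * (G t y)⁻¹ D e := fun C => by
      simp only [Matrix.mul_apply, Finset.sum_mul]
      refine Finset.sum_congr rfl fun e _ => Finset.sum_congr rfl fun F _ => ?_
      rw [hm.inv_symm_apply y D e]
      rfl
    simp only [Matrix.neg_apply, neg_mul, Finset.sum_neg_distrib, e3, Finset.sum_mul, chr_eq,
      Finset.mul_sum]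
    congr 1
    rw [Finset.sum_comm]
    refine Finset.sum_congr rfl fun e _ => ?_
    rw [Finset.sum_comm]
    refine Finset.sum_congr rfl fun F _ => Finset.sum_congr rfl fun C _ => ?_
    ring
  rw [e1, Rescaled.chrDt, h1, Finset.mul_sum, ← Finset.sum_neg_distrib, ← Finset.sum_add_distrib]
  refine Finset.sum_congr rfl fun e _ => ?_
  have hc : ∀ c i j, cov (G t) X.Gt y ![] ![c, i, j]
      = Z c (h i j) y - ∑ D, chr (G t) y c D i * h D j y - ∑ D, chr (G t) y c D j * h i D y := by
    intro c i j
    rw [cov_cons, der_02, h2]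
    rfl
  -- The covariant derivatives of h contain the connection coefficients in several index orders.
  -- Vanishing torsion exchanges them, and the structure constants it creates match those of the
  -- Koszul formula.
  have ht1 : ∀ A B D, chr (G t) y B D A = chr (G t) y A D B - (2 / 3) * eps A B D := fun A B D => by
    linarith [chr_torsion (r := 1) hm A B D y]
  rw [hc, hc, hc, hm.inv_symm_apply y e D]
  have hL2 : L e = (1 / 2) * (Z A (h B e) y + Z B (h A e) y - Z e (h A B) y)
    + (1 / 3) * ∑ D, (eps A B D * h e D y - eps B e D * h A D y - eps A e D * h B D y) := rfl
  have key : (∑ F, chr (G t) y B F A * h F e y) = ∑ F, chr (G t) y A F B * h F e y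
      - ∑ F, (2 / 3) * eps A B F * h e F y := by
    rw [← Finset.sum_sub_distrib]
    refine Finset.sum_congr rfl fun F _ => ?_
    rw [ht1 A B F, hsym F e]
    ring
  have key2 : (∑ F, chr (G t) y e F A * h F B y) = ∑ F, chr (G t) y A F e * h B F y
      - ∑ F, (2 / 3) * eps A e F * h B F y := by
    rw [← Finset.sum_sub_distrib]
    refine Finset.sum_congr rfl fun F _ => ?_
    rw [ht1 A e F, hsym F B]
    ring
  have key3 : (∑ F, chr (G t) y e F B * h A F y) = ∑ F, chr (G t) y B F e * h A F y
      - ∑ F, (2 / 3) * eps B e F * h A F y := by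
    rw [← Finset.sum_sub_distrib]
    refine Finset.sum_congr rfl fun F _ => ?_
    rw [ht1 B e F]
    ring
  have key4 : ∑ F, h F e y * chr (G t) y A F B = ∑ F, chr (G t) y A F B * h F e y :=
    Finset.sum_congr rfl fun F _ => mul_comm _ _
  rw [key, key2, key3, key4, hL2]
  simp only [Finset.sum_sub_distrib, mul_assoc, ← Finset.mul_sum]
  ring

/-- Product rule in the connection coefficients and in ξ; with ξ = L^I G it supplies the evolution
of ∇L^I G, including the commutator of ∂_t with ∇. -/
theorem hasDerivAt_cov {ξ : ℝ → Tensor 0 2} (hξ : TCk 2 T ξ) {X : Rescaled} (h1 : X.G = G t)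
    (h2 : X.Gt = dtT (fun s => lowT (G s)) t) (y : S3) (a : Fin 0 → Fin 3) (b : Fin 3 → Fin 3) :
    HasDerivAt (fun s => cov (G s) (ξ s) y a b)
      (cov X.G (dtT ξ t) y a b + X.commDt (ξ t) y a b) t := by
  rw [vec0_eq a, ← vec3_eta b]
  generalize b 0 = c
  generalize b 1 = i
  generalize b 2 = j
  have hd : ∀ i j, HasDerivAt (fun s => ξ s y ![] ![i, j]) (dtT ξ t y ![] ![i, j]) t := fun i j =>
    ((hξ _ _).of_le (q := 1) (by norm_num)).hasDerivAt (r := 0) ht y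
  have hZ := Ck.hasDerivAt_Z ht (hξ ![] ![i, j]) c y
  have hch := fun A D B => hasDerivAt_chr hG ht h1 h2 y A D B
  have hs : HasDerivAt (fun s => Z c (fun x => ξ s x ![] ![i, j]) y
      - ∑ D, chr (G s) y c D i * ξ s y ![] ![D, j] - ∑ D, chr (G s) y c D j * ξ s y ![] ![i, D]) _ t :=
    (hZ.fun_sub (HasDerivAt.fun_sum fun D (_ : D ∈ Finset.univ) => (hch c D i).fun_mul (hd D j))).fun_sub
      (HasDerivAt.fun_sum fun D (_ : D ∈ Finset.univ) => (hch c D j).fun_mul (hd i D))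
  have e : (fun s => cov (G s) (ξ s) y ![] ![c, i, j]) = fun s => Z c (fun x => ξ s x ![] ![i, j]) y
      - ∑ D, chr (G s) y c D i * ξ s y ![] ![D, j] - ∑ D, chr (G s) y c D j * ξ s y ![] ![i, D] := by
    funext s
    rw [cov_cons, der_02]
    rfl
  rw [e]
  refine hs.congr_deriv ?_
  rw [cov_cons, der_02, h1, Rescaled.commDt]
  have e2 : Z c (fun z => dtT ξ t z ![] ![i, j]) y = Z c (dt (fun s x => ξ s x ![] ![i, j]) t) y := rfl
  rw [e2]
  simp only [chrMat, Finset.sum_add_distrib, Matrix.cons_val_zero, Matrix.cons_val_one]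
  simp only [Matrix.cons_val]
  ring

end connection

/-! ### Commuted equations for the metric gradient and the second fundamental form -/

namespace SliceEqs

variable {b : ℝ} {X : Rescaled} {Kt : Tensor 1 1} {Φt : S3 → ℝ} {Ψt : Tensor 0 1}
  (E : SliceEqs b X Kt Φt Ψt) {I : List (Fin 3)} (hI : I.length ≤ 16)
include E hI

theorem lowMul_lie (y : S3) (i j : Fin 3) : lieI I (lowMul (lowT X.G) X.K) y ![] ![i, j]
    = sum2 I fun I₁ I₂ => ∑ d, lieI I₁ (lowT X.G) y ![] ![i, d] * lieI I₂ X.K y ![d] ![j] := by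
  rw [isNatural_lowMul.lieI (E.met.lowT.of_le (by omega)) (E.K_sm.of_le (by omega))]
  rfl

theorem lowMul_sm : TSm I.length (lowMul (lowT X.G) X.K) :=
  isNatural_lowMul.sm (E.met.lowT.of_le (by omega)) (E.K_sm.of_le (by omega))

theorem lowMul_lie_sm : TSm 1 (lieI I (lowMul (lowT X.G) X.K)) :=
  TSm.lieI (isNatural_lowMul.sm (E.met.lowT.of_le (by omega)) (E.K_sm.of_le (by omega)))

theorem cov_lowMul_lie (y : S3) (c i j : Fin 3) :
    cov X.G (lieI I (lowMul (lowT X.G) X.K)) y ![] ![c, i, j]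
      = sum2 I fun I₁ I₂ =>
        (∑ d, cov X.G (lieI I₁ (lowT X.G)) y ![] ![c, i, d] * lieI I₂ X.K y ![d] ![j])
        + ∑ d, lieI I₁ (lowT X.G) y ![] ![i, d] * cov X.G (lieI I₂ X.K) y ![d] ![c, j] := by
  have hs : ∀ I₁ I₂ : List (Fin 3), I₁.length + I₂.length = I.length →
      TSm 1 (lowMul (lieI I₁ (lowT X.G)) (lieI I₂ X.K)) := fun I₁ I₂ hl =>
    isNatural_lowMul.sm ((E.G_lie (by omega)).of_le (by norm_num)) (E.K_lie (by omega))
  rw [isNatural_lowMul.lieI (E.met.lowT.of_le (by omega)) (E.K_sm.of_le (by omega)), cov_cons,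
    der_sum2 (H := fun I₁ I₂ => lowMul (lieI I₁ (lowT X.G)) (lieI I₂ X.K)) c _ hs]
  refine sum2_congr fun I₁ I₂ hl => ?_
  rw [isNatural_lowMul.leibniz c _ ((E.G_lie (by omega)).of_le (by norm_num)) (E.K_lie (by omega))]
  rfl

theorem cov_smul_lowMul_lie (y : S3) (c i j : Fin 3) :
    cov X.G (lieI I (smulT (ofScalar X.N) (lowMul (lowT X.G) X.K))) y ![] ![c, i, j]
      = sum3 I fun I₁ I₂ I₃ =>
        (Z c (ZI I₁ X.N) y * ∑ d, lieI I₂ (lowT X.G) y ![] ![i, d] * lieI I₃ X.K y ![d] ![j])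
        + (ZI I₁ X.N y
          * ∑ d, cov X.G (lieI I₂ (lowT X.G)) y ![] ![c, i, d] * lieI I₃ X.K y ![d] ![j])
        + ZI I₁ X.N y
          * ∑ d, lieI I₂ (lowT X.G) y ![] ![i, d] * cov X.G (lieI I₃ X.K) y ![d] ![c, j] := by
  have hN : ∀ J : List (Fin 3), J.length ≤ I.length → TSm 1 (ofScalar (ZI J X.N)) := fun J hl =>
    TSm.ofScalar ((E.N_lie (by omega)).of_le (by norm_num))
  rw [isNatural_smulT.lieI (TSm.ofScalar (E.N_sm.of_le (by omega))) (E.lowMul_sm hI)]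
  simp only [lieI_ofScalar]
  rw [cov_cons, der_sum2 (H := fun I₁ J => smulT (ofScalar (ZI I₁ X.N))
    (lieI J (lowMul (lowT X.G) X.K))) c _ fun I₁ J hl =>
      isNatural_smulT.sm (hN I₁ (by omega)) (E.lowMul_lie_sm (by omega)), sum3]
  refine sum2_congr fun I₁ J hl => ?_
  rw [isNatural_smulT.leibniz c _ (hN I₁ (by omega)) (E.lowMul_lie_sm (by omega))]
  simp only [Pi.add_apply, smulT, der_00]
  rw [E.lowMul_lie (by omega), ← cov_cons, E.cov_lowMul_lie (by omega), ← sum2_mul_left,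
    ← sum2_mul_left, ← sum2_add]
  refine sum2_congr fun I₂ I₃ _ => ?_
  simp only [ofScalar]
  rw [mul_add, add_assoc]

theorem cov_smul_met_lie (y : S3) (c i j : Fin 3) :
    cov X.G (lieI I (smulT (ofScalar X.N) (lowT X.G))) y ![] ![c, i, j]
      = sum2 I fun I₁ I₂ => Z c (ZI I₁ X.N) y * lieI I₂ (lowT X.G) y ![] ![i, j]
        + ZI I₁ X.N y * cov X.G (lieI I₂ (lowT X.G)) y ![] ![c, i, j] := by
  have hN : ∀ J : List (Fin 3), J.length ≤ I.length → TSm 1 (ofScalar (ZI J X.N)) := fun J hl =>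
    TSm.ofScalar ((E.N_lie (by omega)).of_le (by norm_num))
  have hG : ∀ J : List (Fin 3), J.length ≤ I.length → TSm 1 (lieI J (lowT X.G)) := fun J hl =>
    (E.G_lie (by omega)).of_le (by norm_num)
  rw [isNatural_smulT.lieI (TSm.ofScalar (E.N_sm.of_le (by omega))) (E.met.lowT.of_le (by omega))]
  simp only [lieI_ofScalar]
  rw [cov_cons, der_sum2 (H := fun I₁ J => smulT (ofScalar (ZI I₁ X.N)) (lieI J (lowT X.G))) c _
    fun I₁ J hl => isNatural_smulT.sm (hN I₁ (by omega)) (hG J (by omega))]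
  refine sum2_congr fun I₁ J hl => ?_
  rw [isNatural_smulT.leibniz c _ (hN I₁ (by omega)) (hG J (by omega))]
  simp only [Pi.add_apply, smulT, der_00, ofScalar]
  rfl

theorem metric_lie (y : S3) (p : Fin 0 → Fin 3) (q : Fin 3 → Fin 3) :
    cov X.G (lieI I X.Gt) y p q + X.commDt (lieI I (lowT X.G)) y p q
      = -2 * (b ^ 3)⁻¹ * (1 + b ^ 4 * X.N y) * lowTens (X.G y) (cov X.G (lieI I X.K) y) p q
        + 2 / 3 * b * X.α' * vecMet (X.G y) (grad (ZI I X.N) y) p q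
        + (b ^ 3)⁻¹ * X.gradMetBorder I y p q + b * X.gradMetJunk I y p q := by
  rw [vec0_eq p, ← vec3_eta q]
  generalize q 0 = c
  generalize q 1 = i
  generalize q 2 = j
  have h1 := E.lowMul_sm hI
  have hN : TSm I.length (ofScalar X.N) := TSm.ofScalar (E.N_sm.of_le (by omega))
  have h2 := isNatural_smulT.sm hN h1
  have hG : TSm I.length (lowT X.G) := E.met.lowT.of_le (by omega)
  have h3 := isNatural_smulT.sm hN hG
  have hN1 : TSm (1 + I.length) (ofScalar X.N) := TSm.ofScalar (E.N_sm.of_le (by omega))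
  have hG1 : TSm (1 + I.length) (lowT X.G) := E.met.lowT.of_le (by omega)
  have hK1 : TSm (1 + I.length) X.K := E.K_sm.of_le (by omega)
  have h1s : TSm 1 (lieI I (lowMul (lowT X.G) X.K)) := E.lowMul_lie_sm hI
  have h2s : TSm 1 (lieI I (smulT (ofScalar X.N) (lowMul (lowT X.G) X.K))) :=
    TSm.lieI (isNatural_smulT.sm hN1 (isNatural_lowMul.sm hG1 hK1))
  have h3s : TSm 1 (lieI I (smulT (ofScalar X.N) (lowT X.G))) :=
    TSm.lieI (isNatural_smulT.sm hN1 hG1)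
  rw [E.metric_eq, lieI_add ((h1.smul _).add (h2.smul _)) (h3.smul _),
    lieI_add (h1.smul _) (h2.smul _), lieI_smul _ h1, lieI_smul _ h2, lieI_smul _ h3,
    cov_add ((h1s.smul _).add (h2s.smul _)) (h3s.smul _), cov_add (h1s.smul _) (h2s.smul _),
    cov_smul _ h1s, cov_smul _ h2s, cov_smul _ h3s]
  simp only [Pi.add_apply, Pi.smul_apply, smul_eq_mul]
  rw [E.cov_lowMul_lie hI, E.cov_smul_lowMul_lie hI, E.cov_smul_met_lie hI]
  -- Four splittings are peeled off. Those with all of I on K give the principal term with the full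
  -- lapse as coefficient; those with all of I on N give the ∇Z^I N term with the metric and the
  -- first borderline term.
  have k1 := sum2_eq_right (I := I) (F := fun I₁ I₂ =>
    ∑ d, lieI I₁ (lowT X.G) y ![] ![i, d] * cov X.G (lieI I₂ X.K) y ![d] ![c, j])
  have k2 := sum2_eq_left (I := I) (F := fun I₁ I₂ =>
    Z c (ZI I₁ X.N) y * lieI I₂ (lowT X.G) y ![] ![i, j])
  have k3 := sum3_eq_left (I := I) (F := fun I₁ I₂ I₃ =>
    Z c (ZI I₁ X.N) y * ∑ d, lieI I₂ (lowT X.G) y ![] ![i, d] * lieI I₃ X.K y ![d] ![j])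
  have k4 := sum3_eq_right (I := I) (F := fun I₁ I₂ I₃ =>
    ZI I₁ X.N y * ∑ d, lieI I₂ (lowT X.G) y ![] ![i, d] * cov X.G (lieI I₃ X.K) y ![d] ![c, j])
  have l1 : lowTens (X.G y) (cov X.G (lieI I X.K) y) ![] ![c, i, j]
      = ∑ d, lieI [] (lowT X.G) y ![] ![i, d] * cov X.G (lieI I X.K) y ![d] ![c, j] := rfl
  have l2 : vecMet (X.G y) (grad (ZI I X.N) y) ![] ![c, i, j]
      = Z c (ZI I X.N) y * lieI [] (lowT X.G) y ![] ![i, j] := rfl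
  have l3 : ∑ d, lieI [] (lowT X.G) y ![] ![i, d] * lieI [] X.K y ![d] ![j]
      = ∑ d, X.G y i d * X.K y ![d] ![j] := rfl
  have l4 : ZI [] X.N y = X.N y := rfl
  simp only [sum2_add, sum3_add]
  rw [k1, k2, k3, k4, Rescaled.gradMetBorder, Rescaled.gradMetJunk, l1, l2, l3, l4, E.α_eq,
    cube_rpow_four_thirds E.b_pos]
  simp only [sum2_add, sum3_add, Matrix.cons_val_zero, Matrix.cons_val_one, Matrix.cons_val]
  have hb := E.b_pos.ne'
  field_simp
  ring

theorem upMul_lie {ξ : Tensor 0 2} (hξ : TSm I.length ξ) (y : S3) (p q : Fin 1 → Fin 3) :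
    lieI I (upMul (invT X.G) ξ) y p q = sum2 I fun I₁ J =>
      ∑ c, lieI I₁ (invT X.G) y ![p 0, c] ![] * lieI J ξ y ![] ![c, q 0] := by
  rw [isNatural_upMul.lieI (E.met.invT.of_le (by omega)) hξ]
  rfl

theorem tens_lie (y : S3) (c j : Fin 3) : lieI I (tens X.Ψ X.Ψ) y ![] ![c, j]
    = sum2 I fun I₁ I₂ => lieI I₁ X.Ψ y ![] ![c] * lieI I₂ X.Ψ y ![] ![j] := by
  rw [isNatural_tens.lieI (E.Ψ_sm.of_le (by omega)) (E.Ψ_sm.of_le (by omega))]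
  rfl

theorem tens_sm : TSm I.length (tens X.Ψ X.Ψ) :=
  isNatural_tens.sm (E.Ψ_sm.of_le (by omega)) (E.Ψ_sm.of_le (by omega))

/-- The pure trace part is recorded only through an unspecified number c at the given point, because
pairing with the trace-free L^I K annihilates it. -/
theorem sec_lie (y : S3) :
    ∃ c : ℝ, ∀ p q, lieI I Kt y p q = b * (1 + b ^ 4 * X.N y) *
        (-(1 / 2) * sharp2 X.G (lap X.G (lieI I (lowT X.G))) y p q
        - (1 / 2) * sharp2 X.G (hess X.G (trG X.G (lieI I (lowT X.G)))) y p q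
        + (1 / 2) * sharp2 X.G (cov X.G (div02 X.G (lieI I (lowT X.G)))) y p q
        + (1 / 2) * cov X.G (sharp1 X.G (div02 X.G (lieI I (lowT X.G)))) y p q
        + X.ricError I y p q)
      - b ^ 5 * sharp2 X.G (hess X.G (ZI I X.N)) y p q
      + b * (X.secBorder I y p q + X.secJunk I y p q) + c * idT p q := by
  set f₀ : S3 → ℝ := fun y => (1 / 3) * (b * X.α' ^ 2) * X.N y + -(2 / 9) * b with hf
  refine ⟨ZI I f₀ y, fun p q => ?_⟩
  have hN : TSm I.length (ofScalar X.N) := TSm.ofScalar (E.N_sm.of_le (by omega))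
  have hK : TSm I.length X.K := E.K_sm.of_le (by omega)
  have h1 := isNatural_smulT.sm hN hK
  have hh : TSm I.length (hess X.G X.N) := (E.met.of_le (by omega)).hess (E.N_sm.of_le (by omega))
  have h2 : TSm I.length (sharp2 X.G (hess X.G X.N)) := (E.met.of_le (by omega)).sharp2 hh
  have h3 : TSm I.length (ricSharp X.G) := (E.met.of_le (by omega)).ricSharp
  have h4 := isNatural_smulT.sm hN h3
  have hGi : TSm I.length (invT X.G) := E.met.invT.of_le (by omega)
  have ht := E.tens_sm hI
  have h5 := isNatural_upMul.sm hGi ht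
  have hNt := isNatural_smulT.sm hN ht
  have h6 := isNatural_upMul.sm hGi hNt
  have hf0 : Sm I.length f₀ := ((Sm.const _).mul (E.N_sm.of_le (by omega))).add (Sm.const _)
  have h7 : TSm I.length (smulT (ofScalar f₀) idTen) :=
    isNatural_smulT.sm (TSm.ofScalar hf0) TSm.idTen
  rw [E.sec_eq,
    lieI_add ((((((h1.smul _).add (h2.smul _)).add (h3.smul _)).add (h4.smul _)).add (h5.smul _)).add
      (h6.smul _)) h7,
    lieI_add (((((h1.smul _).add (h2.smul _)).add (h3.smul _)).add (h4.smul _)).add (h5.smul _))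
      (h6.smul _),
    lieI_add ((((h1.smul _).add (h2.smul _)).add (h3.smul _)).add (h4.smul _)) (h5.smul _),
    lieI_add (((h1.smul _).add (h2.smul _)).add (h3.smul _)) (h4.smul _),
    lieI_add ((h1.smul _).add (h2.smul _)) (h3.smul _), lieI_add (h1.smul _) (h2.smul _),
    lieI_smul _ h1, lieI_smul _ h2, lieI_smul _ h3, lieI_smul _ h4, lieI_smul _ h5, lieI_smul _ h6,
    lieI_smulT_idTen I hf0]
  simp only [Pi.add_apply, Pi.smul_apply, smul_eq_mul]
  have e1 : lieI I (smulT (ofScalar X.N) X.K) y p q = ZI I X.N y * X.K y p q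
      + sum2 I fun I₁ I₂ => if I₁.length < I.length then ZI I₁ X.N y * lieI I₂ X.K y p q else 0 := by
    rw [E.smulT_N_lie hI hK, sum2_eq_left]
    rfl
  have e5 : lieI I (upMul (invT X.G) (tens X.Ψ X.Ψ)) y p q = sum3 I fun I₁ I₂ I₃ =>
      (∑ c, lieI I₁ (invT X.G) y ![p 0, c] ![] * lieI I₂ X.Ψ y ![] ![c]) * lieI I₃ X.Ψ y ![] q := by
    rw [E.upMul_lie hI ht, sum3]
    refine sum2_congr fun I₁ J hl => ?_
    have : ∀ c, lieI I₁ (invT X.G) y ![p 0, c] ![] * lieI J (tens X.Ψ X.Ψ) y ![] ![c, q 0]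
        = sum2 J fun I₂ I₃ => lieI I₁ (invT X.G) y ![p 0, c] ![] * lieI I₂ X.Ψ y ![] ![c]
          * lieI I₃ X.Ψ y ![] q := fun c => by
      rw [E.tens_lie (by omega), ← sum2_mul_left, vec1_eta]
      simp only [mul_assoc]
    simp only [this, ← sum2_finset_sum, Finset.sum_mul]
  have e6 : lieI I (upMul (invT X.G) (smulT (ofScalar X.N) (tens X.Ψ X.Ψ))) y p q
      = sum4 I fun I₁ I₂ I₃ I₄ =>
      (∑ c, lieI I₁ (invT X.G) y ![p 0, c] ![] * lieI I₃ X.Ψ y ![] ![c])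
        * ZI I₂ X.N y * lieI I₄ X.Ψ y ![] q := by
    rw [E.upMul_lie hI hNt, sum4]
    refine sum2_congr fun I₁ J hl => ?_
    have : ∀ c, lieI I₁ (invT X.G) y ![p 0, c] ![]
          * lieI J (smulT (ofScalar X.N) (tens X.Ψ X.Ψ)) y ![] ![c, q 0]
        = sum2 J fun I₂ J' => sum2 J' fun I₃ I₄ =>
          lieI I₁ (invT X.G) y ![p 0, c] ![] * lieI I₃ X.Ψ y ![] ![c]
          * ZI I₂ X.N y * lieI I₄ X.Ψ y ![] q := fun c => by
      rw [E.smulT_N_lie (by omega) (E.tens_sm (by omega)), ← sum2_mul_left]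
      refine sum2_congr fun I₂ J' hl' => ?_
      rw [E.tens_lie (by omega), ← sum2_mul_left, ← sum2_mul_left, vec1_eta]
      exact sum2_congr fun _ _ _ => by ring
    simp only [this, ← sum2_finset_sum, Finset.sum_mul]
    rfl
  have e4 : smulT (ofScalar X.N) (ricSharp X.G) = fun x i j => X.N x * ricSharp X.G x i j := rfl
  have e7 : smulT (ofScalar (ZI I f₀)) idTen y p q = ZI I f₀ y * idT p q := rfl
  rw [e1, e5, e6, e4, e7, Rescaled.ricError, Rescaled.secBorder, Rescaled.secJunk, sharp2_sub,
    E.α_eq, cube_rpow_four_thirds E.b_pos]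
  simp only [Pi.sub_apply]
  ring

end SliceEqs

/-! ## Pointwise energy inequalities -/

section pointwise

variable {g k : Matrix (Fin 3) (Fin 3) ℝ} (hgk : g * k = 1) (pg : g.PosSemidef) (pk : k.PosSemidef)

section weighted

variable {b β : ℝ} (hb : 0 < b) (hb1 : b ≤ 1) (hβ : 0 ≤ β) (hβb : β ^ 2 = 1 - b ^ 4)
include hb hb1 hβ hβb

theorem beta_le_one : β ≤ 1 := by nlinarith [pow_pos hb 4]

/-- Here β stands for |a'| and 0 ≤ β ≤ 1, so 1 − β ≤ 1 − β² = b⁴. A term without the factor β is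
thus a damped term plus one with four extra powers of b. -/
theorem one_sub_beta_le : 1 - β ≤ b ^ 4 := by nlinarith [pow_pos hb 4]

/-- Splitting the weight `b n` into `β b` and a lower order part. -/
theorem lapse_weight {N t U W : ℝ} (hN : b ^ 2 * |N| ≤ 1) (hU : 0 ≤ U) (hW : 0 ≤ W)
    (h1 : |t| ≤ 50 * U + W / 200) (h2 : |t| ≤ U / 2 + W / 2) :
    |b * (1 + b ^ 4 * N) * t| ≤ β * b * (50 * U + W / 200) + b ^ 3 * (U + W) := by
  have h3 : |b * (1 + b ^ 4 * N)| ≤ β * b + 2 * b ^ 3 := by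
    have e : b * (1 + b ^ 4 * N) = β * b + ((1 - β) * b + b ^ 3 * (b ^ 2 * N)) := by ring
    have h4 : |b ^ 3 * (b ^ 2 * N)| ≤ b ^ 3 := by
      rw [abs_mul, abs_of_pos (pow_pos hb 3), abs_mul, abs_of_pos (pow_pos hb 2)]
      nlinarith [pow_pos hb 3]
    have h5 : (1 - β) * b ≤ b ^ 3 := by
      have := one_sub_beta_le hb hb1 hβ hβb
      have h6 : b ^ 4 * b ≤ b ^ 3 := by
        have : b ^ 4 * b = b ^ 3 * (b * b) := by ring
        rw [this]
        nlinarith [pow_pos hb 3, mul_le_one₀ hb1 hb.le hb1]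
      nlinarith
    have h7 : 0 ≤ (1 - β) * b := mul_nonneg (by linarith [beta_le_one hb hb1 hβ hβb]) hb.le
    rw [e]
    refine (abs_add_le _ _).trans (add_le_add (le_of_eq (abs_of_nonneg (by positivity))) ?_)
    refine (abs_add_le _ _).trans ?_
    rw [abs_of_nonneg h7]
    linarith
  rw [abs_mul]
  calc _ ≤ (β * b + 2 * b ^ 3) * |t| := by gcongr
    _ = β * b * |t| + 2 * b ^ 3 * |t| := by ring
    _ ≤ β * b * (50 * U + W / 200) + 2 * b ^ 3 * (U / 2 + W / 2) := by gcongr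
    _ = _ := by ring

end weighted

-- The unequal weights put the small coefficient 1/200 on the quantity whose damping must absorb it,
-- and the large one on the quantity that is estimated elsewhere.
include pg pk in
theorem abs_ipm_le_hundred {l m : ℕ} (ξ η : Comp l m) :
    |ipm g k ξ η| ≤ 50 * ipm g k ξ ξ + ipm g k η η / 200 := by
  have := ipm_young pg pk ξ η (c := 100) (by norm_num)
  norm_num at this
  linarith

include pg pk in
theorem abs_ipm_le_half {l m : ℕ} (ξ η : Comp l m) :
    |ipm g k ξ η| ≤ ipm g k ξ ξ / 2 + ipm g k η η / 2 := by
  have := ipm_young pg pk ξ η (c := 1) (by norm_num)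
  norm_num at this
  linarith

include pg pk in
theorem abs_ipm_le_weight {l m : ℕ} (ξ η : Comp l m) {c : ℝ} (hc : 0 < c) :
    |ipm g k ξ η| ≤ c * ipm g k ξ ξ / 2 + c⁻¹ * ipm g k η η / 2 := by
  have := ipm_young pg pk ξ η hc
  linarith

variable {b β ε : ℝ} (hb : 0 < b) (hb1 : b ≤ 1) (hβ : 0 ≤ β) (hβb : β ^ 2 = 1 - b ^ 4)
  (hε : 0 < ε)

include hb hb1 hβ hβb in
/-- The weight `b⁵`, split into `β b⁵` and a lower order part. -/
theorem fifth_weight {t U V : ℝ} (hU : 0 ≤ U) (hV : 0 ≤ V)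
    (h : ∀ c : ℝ, 0 < c → |t| ≤ c * U / 2 + c⁻¹ * V / 2) :
    b ^ 5 * |t| ≤ β * b * U / 2 + β * b ^ 9 * V / 2 + b ^ 3 * U / 2 + b ^ 12 * V / 2 := by
  -- The first weight balances the damped quantities β b U and β b⁹ V; the second is for the
  -- remainder with the four extra powers of b, where both terms are of lower order.
  have h1 := h (b ^ 4)⁻¹ (by positivity)
  have h2 := h (b ^ 5)⁻¹ (by positivity)
  have h3 := one_sub_beta_le hb hb1 hβ hβb
  have h4 : b ^ 5 * |t| ≤ β * b ^ 5 * |t| + b ^ 9 * |t| := by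
    have : (1 - β) * (b ^ 5 * |t|) ≤ b ^ 4 * (b ^ 5 * |t|) := by gcongr
    linarith
  have h5 : β * b ^ 5 * |t| ≤ β * b ^ 5 * ((b ^ 4)⁻¹ * U / 2 + (b ^ 4)⁻¹⁻¹ * V / 2) := by gcongr
  have h6 : b ^ 9 * |t| ≤ b ^ 9 * ((b ^ 5)⁻¹ * U / 2 + (b ^ 5)⁻¹⁻¹ * V / 2) := by gcongr
  have h7 : β * b ^ 5 * ((b ^ 4)⁻¹ * U / 2 + (b ^ 4)⁻¹⁻¹ * V / 2)
      = β * b * U / 2 + β * b ^ 9 * V / 2 := by field_simp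
  have h8 : b ^ 9 * ((b ^ 5)⁻¹ * U / 2 + (b ^ 5)⁻¹⁻¹ * V / 2) = b ^ 4 * U / 2 + b ^ 14 * V / 2 := by
    field_simp
  have h9 : b ^ 4 * U ≤ b ^ 3 * U :=
    mul_le_mul_of_nonneg_right (pow_le_pow_of_le_one hb.le hb1 (by norm_num)) hU
  have h10 : b ^ 14 * V ≤ b ^ 12 * V :=
    mul_le_mul_of_nonneg_right (pow_le_pow_of_le_one hb.le hb1 (by norm_num)) hV
  linarith

include hb in
theorem scale_young {t U V : ℝ} (h : ∀ c : ℝ, 0 < c → |t| ≤ c * U / 2 + c⁻¹ * V / 2) {w c : ℝ}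
    (hw : 0 ≤ w) (hc : 0 < c) : w * |t| ≤ w * c * U / 2 + w * c⁻¹ * V / 2 := by
  have := mul_le_mul_of_nonneg_left (h c hc) hw
  linarith

-- The letters stand for x = L^I K, h = ∇L^I G, ψ = L^I Ψ, ν = ∇Z^I N and ν₀ = ∇n. The damping
-- −(1/3)β b|h|² comes from the weight a^{4/3}; the shares of |h|² spent in Young's inequality add
-- up to less than 1/10, so more than 1/6 survives. The terms in ψ and ν have no damping here and
-- are left with a large constant, to be absorbed by the scalar field energy.
set_option maxHeartbeats 1600000 in
include hgk pg pk hb hb1 hβ hβb hε in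
theorem metric_density_le {N : ℝ} (hN : b ^ 2 * |N| ≤ 1) (x R BK JK : Comp 1 1)
    (h Bh Jh : Comp 0 3) (ψ M₁ ν ν₀ : Comp 0 1) (M₂ : Comp 1 0) (hν₀ : ipm g k ν₀ ν₀ ≤ b ^ 2) :
    b * (ipm g k h (lowTens g (vecTens ν₀ x)) + ipm g k x (raiseTens k ν₀ (trace23 k h))
        - ipm g k x (raiseTens k ν₀ (trace12 k h)) - ipm g k x (raiseTens k (trace12 k h) ν₀))
      + b * (1 + b ^ 4 * N) * (-sqt * ipm g k ψ (trace23 k h) + 2 * sqt * ipm g k ψ (trace12 k h)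
        + ipm g k M₁ (trace23 k h) - ipm g k M₁ (trace12 k h) - ipm g k (lower1 g M₂) (trace12 k h))
      + 2 * (b * (1 + b ^ 4 * N)) * ipm g k x R
      + 2 * b ^ 5 * (-sqt * ipm g k ψ ν + ipm g k M₁ ν)
      + 2 * b * (ipm g k x BK + ipm g k x JK)
      + 1 / 2 * b ^ 4 * (2 / 3 * b * (-β) * ipm g k (trace23 k h) ν + (b ^ 3)⁻¹ * ipm g k h Bh
        + b * ipm g k h Jh)
      + 1 / 3 * b * (-β) * ipm g k h h
    ≤ -(1 / 6) * (β * b * ipm g k h h)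
      + 1000 * (β * b * ipm g k ψ ψ + β * b ^ 9 * ipm g k ν ν)
      + 1000 * (b * ipm g k M₁ M₁ + b * ipm g k M₂ M₂ + b * ipm g k Bh Bh
        + ε⁻¹ * b ^ 5 * ipm g k BK BK)
      + 1000 * (b ^ 3 * ipm g k R R + b ^ 3 * ipm g k JK JK + b ^ 7 * ipm g k Jh Jh
        + b ^ 12 * ipm g k ν ν)
      + 1000 * ((b⁻¹ + ε * (b ^ 3)⁻¹) * ipm g k x x + b ^ 3 * ipm g k h h + b ^ 3 * ipm g k ψ ψ) := by
  have hW1 := ipm_trace23_le hgk pg pk h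
  have hW2 := ipm_trace12_le hgk pg pk h
  have hM2 := ipm_lower1_self hgk pg pk M₂
  have hlow := ipm_lowTens_vecTens_self hgk pg.isSymm pk.isSymm ν₀ x
  have hr1 := ipm_raiseTens_self hgk pk.isSymm ν₀ (trace23 k h)
  have hr2 := ipm_raiseTens_self hgk pk.isSymm ν₀ (trace12 k h)
  have hr3 := ipm_raiseTens_self hgk pk.isSymm (trace12 k h) ν₀
  generalize hw1 : trace23 k h = w₁ at *
  generalize hw2 : trace12 k h = w₂ at *
  generalize hlm : lower1 g M₂ = m₂ at *
  generalize lowTens g (vecTens ν₀ x) = z at *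
  generalize raiseTens k ν₀ w₁ = z₁ at *
  generalize raiseTens k ν₀ w₂ = z₂ at *
  generalize raiseTens k w₂ ν₀ = z₃ at *
  have nn : ∀ {l m : ℕ} (ξ : Comp l m), 0 ≤ ipm g k ξ ξ := fun ξ => ipm_self_nonneg pg pk ξ
  have yg : ∀ {l m : ℕ} (ξ η : Comp l m) (c : ℝ), 0 < c →
      |ipm g k ξ η| ≤ c * ipm g k ξ ξ / 2 + c⁻¹ * ipm g k η η / 2 := fun ξ η c hc =>
    abs_ipm_le_weight pg pk ξ η hc
  have y100 : ∀ {l m : ℕ} (ξ η : Comp l m), |ipm g k ξ η| ≤ 50 * ipm g k ξ ξ + ipm g k η η / 200 :=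
    fun ξ η => abs_ipm_le_hundred pg pk ξ η
  have y1 : ∀ {l m : ℕ} (ξ η : Comp l m), |ipm g k ξ η| ≤ ipm g k ξ ξ / 2 + ipm g k η η / 2 :=
    fun ξ η => abs_ipm_le_half pg pk ξ η
  have lw : ∀ {l m : ℕ} (ξ η : Comp l m), |b * (1 + b ^ 4 * N) * ipm g k ξ η|
      ≤ β * b * (50 * ipm g k ξ ξ + ipm g k η η / 200) + b ^ 3 * (ipm g k ξ ξ + ipm g k η η) :=
    fun ξ η => lapse_weight hb hb1 hβ hβb hN (nn ξ) (nn η) (y100 ξ η) (y1 ξ η)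
  have hβ1 := beta_le_one hb hb1 hβ hβb
  have hs := sqt_nonneg
  have hs1 : sqt ≤ 1 := by nlinarith [sqt_sq]
  have hbi := inv_pos.2 hb
  have hpow : ∀ {p q : ℕ} (_ : q ≤ p) {U : ℝ} (_ : 0 ≤ U), b ^ p * U ≤ b ^ q * U :=
    fun hpq U hU => mul_le_mul_of_nonneg_right (pow_le_pow_of_le_one hb.le hb1 hpq) hU
  have hX := nn x
  have hH := nn h
  have hP := nn ψ
  have hV := nn ν
  -- the lapse gradient
  have hbX : b * ipm g k x x ≤ b⁻¹ * ipm g k x x := by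
    gcongr
    exact hb1.trans (by rwa [one_le_inv₀ hb])
  have a1 : |b * ipm g k h z| ≤ b ^ 3 * ipm g k h h / 2 + b⁻¹ * ipm g k x x / 2 := by
    rw [abs_mul, abs_of_pos hb]
    refine (scale_young hb (yg h z) hb.le (pow_pos hb 2)).trans ?_
    have : b * (b ^ 2)⁻¹ * ipm g k z z ≤ b * (b ^ 2)⁻¹ * (b ^ 2 * ipm g k x x) := by
      rw [hlow]; gcongr
    have e : b * (b ^ 2)⁻¹ * (b ^ 2 * ipm g k x x) = b * ipm g k x x := by field_simp
    linarith
  have az : ∀ z' : Comp 1 1, ipm g k z' z' ≤ b ^ 2 * (3 * ipm g k h h) →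
      |b * ipm g k x z'| ≤ b⁻¹ * ipm g k x x / 2 + 3 / 2 * (b ^ 3 * ipm g k h h) := by
    intro z' hz
    rw [abs_mul, abs_of_pos hb]
    refine (mul_le_mul_of_nonneg_left (y1 x z') hb.le).trans ?_
    have := mul_le_mul_of_nonneg_left hz hb.le
    linarith
  have a2 := az z₁ (by rw [hr1]; exact mul_le_mul hν₀ hW1 (nn _) (pow_pos hb 2).le)
  have a3 := az z₂ (by rw [hr2]; exact mul_le_mul hν₀ hW2 (nn _) (pow_pos hb 2).le)
  have a4 := az z₃ (by rw [hr3, mul_comm]; exact mul_le_mul hν₀ hW2 (nn _) (pow_pos hb 2).le)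
  -- the momentum constraint
  have wH1 : β * b * (ipm g k w₁ w₁ / 200) + b ^ 3 * ipm g k w₁ w₁
      ≤ 3 / 200 * (β * b * ipm g k h h) + 3 * (b ^ 3 * ipm g k h h) := by
    have e1 := mul_le_mul_of_nonneg_left hW1 (mul_nonneg hβ hb.le)
    have e2 := mul_le_mul_of_nonneg_left hW1 (pow_pos hb 3).le
    linarith
  have wH2 : β * b * (ipm g k w₂ w₂ / 200) + b ^ 3 * ipm g k w₂ w₂
      ≤ 3 / 200 * (β * b * ipm g k h h) + 3 * (b ^ 3 * ipm g k h h) := by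
    have e1 := mul_le_mul_of_nonneg_left hW2 (mul_nonneg hβ hb.le)
    have e2 := mul_le_mul_of_nonneg_left hW2 (pow_pos hb 3).le
    linarith
  have mM : ∀ {l m : ℕ} (ξ : Comp l m), β * b * (50 * ipm g k ξ ξ) + b ^ 3 * ipm g k ξ ξ
      ≤ 51 * (b * ipm g k ξ ξ) := by
    intro l m ξ
    have e1 : β * (b * ipm g k ξ ξ) ≤ 1 * (b * ipm g k ξ ξ) :=
      mul_le_mul_of_nonneg_right hβ1 (mul_nonneg hb.le (nn ξ))
    have e2 := hpow (p := 3) (q := 1) (by norm_num) (nn ξ)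
    linarith
  have sP : ∀ {r B : ℝ}, |r| ≤ B → |sqt * r| ≤ B := by
    intro r B hr
    rw [abs_mul, abs_of_nonneg hs]
    nlinarith [abs_nonneg r]
  have c1 := sP (lw ψ w₁)
  have c2 := sP (lw ψ w₂)
  have c3 := lw M₁ w₁
  have c4 := lw M₁ w₂
  have c5 := lw m₂ w₂
  have d1 := mM M₁
  have d2 := mM m₂
  rw [hM2] at d2 c5
  -- curvature
  have r1 : |b * (1 + b ^ 4 * N) * ipm g k x R| ≤ b⁻¹ * ipm g k x x + b ^ 3 * ipm g k R R := by
    have e1 : |b * (1 + b ^ 4 * N)| ≤ 2 * b := by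
      have e2 : |b ^ 4 * N| ≤ 1 := by
        have e3 : b ^ 4 * N = b ^ 2 * (b ^ 2 * N) := by ring
        rw [e3, abs_mul, abs_of_pos (pow_pos hb 2), abs_mul, abs_of_pos (pow_pos hb 2)]
        exact mul_le_one₀ (pow_le_one₀ hb.le hb1) (by positivity) hN
      rw [abs_mul, abs_of_pos hb]
      have := abs_add_le 1 (b ^ 4 * N)
      rw [abs_one] at this
      nlinarith
    rw [abs_mul]
    calc _ ≤ 2 * b * |ipm g k x R| := by gcongr
      _ ≤ 2 * b * (b ^ 2)⁻¹ * ipm g k x x / 2 + 2 * b * (b ^ 2)⁻¹⁻¹ * ipm g k R R / 2 :=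
        scale_young hb (yg x R) (by positivity) (by positivity)
      _ = _ := by field_simp
  -- the remaining terms
  have f1 := fifth_weight hb hb1 hβ hβb hP hV (yg ψ ν)
  have f2 := fifth_weight hb hb1 hβ hβb (nn M₁) hV (yg M₁ ν)
  have abs5 : ∀ r : ℝ, |b ^ 5 * r| = b ^ 5 * |r| := fun r => by
    rw [abs_mul, abs_of_pos (pow_pos hb 5)]
  have f1' := sP ((abs5 _).trans_le f1)
  have f2' := (abs5 _).trans_le f2
  have f3 := hpow (p := 3) (q := 1) (by norm_num) (nn M₁)
  have f4 : β * (b * ipm g k M₁ M₁) ≤ 1 * (b * ipm g k M₁ M₁) :=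
    mul_le_mul_of_nonneg_right hβ1 (mul_nonneg hb.le (nn M₁))
  -- The weight ε b⁻⁴ turns the borderline error into ε a⁻¹|x|², a Gronwall term, at the price of a
  -- factor 1/ε in front of the error itself.
  have g1 : |b * ipm g k x BK| ≤ ε * (b ^ 3)⁻¹ * ipm g k x x / 2 + ε⁻¹ * b ^ 5 * ipm g k BK BK / 2 := by
    rw [abs_mul, abs_of_pos hb]
    refine (scale_young hb (yg x BK) hb.le (c := ε * (b ^ 4)⁻¹) (by positivity)).trans (le_of_eq ?_)
    field_simp
  have g2 : |b * ipm g k x JK| ≤ b⁻¹ * ipm g k x x / 2 + b ^ 3 * ipm g k JK JK / 2 := by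
    rw [abs_mul, abs_of_pos hb]
    refine (scale_young hb (yg x JK) hb.le (c := (b ^ 2)⁻¹) (by positivity)).trans (le_of_eq ?_)
    field_simp
  have k1 : |β * b ^ 5 * ipm g k w₁ ν|
      ≤ 3 / 200 * (β * b * ipm g k h h) + 50 * (β * b ^ 9 * ipm g k ν ν) := by
    rw [abs_mul, abs_of_nonneg (by positivity)]
    refine (scale_young hb (yg w₁ ν) (w := β * b ^ 5) (by positivity) (c := (100 * b ^ 4)⁻¹)
      (by positivity)).trans ?_
    have e1 : β * b ^ 5 * (100 * b ^ 4)⁻¹ * ipm g k w₁ w₁ / 2 = β * b * ipm g k w₁ w₁ / 200 := by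
      field_simp
      try ring
    have e2 : β * b ^ 5 * (100 * b ^ 4)⁻¹⁻¹ * ipm g k ν ν / 2 = 50 * (β * b ^ 9 * ipm g k ν ν) := by
      field_simp
      try ring
    have e3 := mul_le_mul_of_nonneg_left hW1 (mul_nonneg hβ hb.le)
    rw [e1, e2]
    linarith
  -- Used with N = 0, only to split b into β b and a multiple of b³. The borderline term comes
  -- first, so that it receives the large constant and h the small one.
  have k2 := lapse_weight hb hb1 hβ hβb (N := 0) (by simp) (nn Bh) (nn h) (y100 Bh h) (y1 Bh h)
  have k2s : ipm g k Bh h = ipm g k h Bh :=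
    ker_symm (fun _ => pg.isSymm) (fun _ => pk.isSymm) _ _
  rw [k2s, mul_zero, add_zero, mul_one] at k2
  have k3 := mM Bh
  have k4 : |b ^ 5 * ipm g k h Jh| ≤ b ^ 3 * ipm g k h h / 2 + b ^ 7 * ipm g k Jh Jh / 2 := by
    rw [abs_mul, abs_of_pos (pow_pos hb 5)]
    refine (scale_young hb (yg h Jh) (pow_pos hb 5).le (c := (b ^ 2)⁻¹) (by positivity)).trans
      (le_of_eq ?_)
    field_simp
  have k5 : 1 / 2 * b ^ 4 * (2 / 3 * b * (-β) * ipm g k w₁ ν + (b ^ 3)⁻¹ * ipm g k h Bh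
      + b * ipm g k h Jh) = -(1 / 3) * (β * b ^ 5 * ipm g k w₁ ν) + 1 / 2 * (b * ipm g k h Bh)
        + 1 / 2 * (b ^ 5 * ipm g k h Jh) := by
    field_simp
  rw [k5]
  rw [abs_le] at a1 a2 a3 a4 c1 c2 c3 c4 c5 r1 f1' f2' g1 g2 k1 k2 k4
  have n1 : 0 ≤ β * b * ipm g k h h := by positivity
  have n2 : 0 ≤ β * b * ipm g k ψ ψ := by positivity
  have n3 : 0 ≤ β * b ^ 9 * ipm g k ν ν := by positivity
  have n4 : 0 ≤ b ^ 3 * ipm g k h h := by positivity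
  have n5 : 0 ≤ b ^ 3 * ipm g k ψ ψ := by positivity
  have n6 : 0 ≤ b⁻¹ * ipm g k x x := by positivity
  have n7 : 0 ≤ ε * (b ^ 3)⁻¹ * ipm g k x x := by positivity
  have n8 : 0 ≤ b ^ 12 * ipm g k ν ν := by positivity
  have n9 : 0 ≤ b * ipm g k M₁ M₁ := mul_nonneg hb.le (nn M₁)
  have n10 : 0 ≤ b * ipm g k M₂ M₂ := mul_nonneg hb.le (nn M₂)
  have n11 : 0 ≤ b * ipm g k Bh Bh := mul_nonneg hb.le (nn Bh)
  have n12 : 0 ≤ ε⁻¹ * b ^ 5 * ipm g k BK BK := by have := nn BK; positivity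
  have n13 : 0 ≤ b ^ 3 * ipm g k R R := by have := nn R; positivity
  have n14 : 0 ≤ b ^ 3 * ipm g k JK JK := by have := nn JK; positivity
  have n15 : 0 ≤ b ^ 7 * ipm g k Jh Jh := by have := nn Jh; positivity
  linarith only [a1.2, a2.2, a3.1, a4.1, c1.1, c2.2, c3.2, c4.1, c5.1, r1.2, f1'.1, f2'.2, g1.2,
    g2.2, k1.1, k2.2, k4.2, wH1, wH2, d1, d2, f3, f4, k3, n1, n2, n3, n4, n5, n6, n7, n8, n9, n10,
    n11, n12, n13, n14, n15]

-- All quantities without a Gronwall or error weight are absorbed here. Of the damping 4/3 of |ψ|²,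
-- the cross term with ν takes 1 and the borderline error 1/12; of the damping 1 of |ν|², the cross
-- term takes 2/3.
include pg pk hb hb1 hβ hβb hε in
theorem sf_density_le {q φ f B₀ J₀ Bn Jn : ℝ} (hq : |q| ≤ 1 / 3) (ψ ν ν₀ Bψ Jψ : Comp 0 1)
    (hν₀ : ipm g k ν₀ ν₀ ≤ b ^ 2) :
    -(2 * b * φ * ipm g k ν₀ ψ) - β * b ^ 9 * ipm g k ν ν
      - β * b ^ 5 * (β ^ 2 / 3 + 2 / 3 + q) * f ^ 2 - β * b * f * Bn - β * b ^ 5 * f * Jn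
      + 2 * b * φ * (B₀ + J₀) + 2 * sqt * b ^ 5 * ipm g k ψ ν
      + 2 * b ^ 5 * (ipm g k ψ Bψ + ipm g k ψ Jψ) + 4 / 3 * b * (-β) * ipm g k ψ ψ
    ≤ -(1 / 6) * (β * b * ipm g k ψ ψ + β * b ^ 9 * ipm g k ν ν + β ^ 3 * b ^ 5 * f ^ 2)
      + 1000 * ((b ^ 3)⁻¹ * Bn ^ 2 + ε⁻¹ * b ^ 5 * B₀ ^ 2 + b ^ 9 * ipm g k Bψ Bψ)
      + 1000 * (b ^ 3 * Jn ^ 2 + b ^ 3 * J₀ ^ 2 + b ^ 7 * ipm g k Jψ Jψ + b ^ 12 * ipm g k ν ν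
        + b ^ 7 * f ^ 2)
      + 1000 * ((b⁻¹ + ε * (b ^ 3)⁻¹) * φ ^ 2 + b ^ 3 * ipm g k ψ ψ) := by
  have nn : ∀ {l m : ℕ} (ξ : Comp l m), 0 ≤ ipm g k ξ ξ := fun ξ => ipm_self_nonneg pg pk ξ
  have yg : ∀ {l m : ℕ} (ξ η : Comp l m) (c : ℝ), 0 < c →
      |ipm g k ξ η| ≤ c * ipm g k ξ ξ / 2 + c⁻¹ * ipm g k η η / 2 := fun ξ η c hc =>
    abs_ipm_le_weight pg pk ξ η hc
  have yr : ∀ (u v c : ℝ), 0 < c → |u * v| ≤ c * u ^ 2 / 2 + c⁻¹ * v ^ 2 / 2 := by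
    intro u v c hc
    have e : c * u ^ 2 / 2 + c⁻¹ * v ^ 2 / 2 = c⁻¹ * ((c * u) ^ 2 + v ^ 2) / 2 := by field_simp
    have e2 : |u * v| = c⁻¹ * |(c * u) * v| := by
      rw [mul_assoc c u v, abs_mul c, abs_of_pos hc, inv_mul_cancel_left₀ hc.ne']
    rw [e, e2, mul_div_assoc]
    have := two_mul_le_add_sq (c * u) v
    have := two_mul_le_add_sq (c * u) (-v)
    refine mul_le_mul_of_nonneg_left ?_ (inv_pos.2 hc).le
    rw [abs_le]
    constructor <;> nlinarith
  have hβ1 := beta_le_one hb hb1 hβ hβb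
  have h1β := one_sub_beta_le hb hb1 hβ hβb
  have hs := sqt_nonneg
  have hs1 : sqt ≤ 1 := by nlinarith [sqt_sq]
  have hbi := inv_pos.2 hb
  have hpow : ∀ {p q : ℕ} (_ : q ≤ p) {U : ℝ} (_ : 0 ≤ U), b ^ p * U ≤ b ^ q * U :=
    fun hpq U hU => mul_le_mul_of_nonneg_right (pow_le_pow_of_le_one hb.le hb1 hpq) hU
  have hP := nn ψ
  have hV := nn ν
  have a1 : |b * φ * ipm g k ν₀ ψ| ≤ b⁻¹ * φ ^ 2 / 2 + b ^ 3 * ipm g k ψ ψ / 2 := by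
    have e1 := scale_young hb (yr φ (ipm g k ν₀ ψ)) hb.le (c := (b ^ 2)⁻¹) (by positivity)
    rw [mul_assoc, abs_mul, abs_of_pos hb]
    have e2 : b * (b ^ 2)⁻¹ * φ ^ 2 / 2 = b⁻¹ * φ ^ 2 / 2 := by field_simp
    have e3 : b * (b ^ 2)⁻¹⁻¹ * ipm g k ν₀ ψ ^ 2 / 2 = b ^ 3 * ipm g k ν₀ ψ ^ 2 / 2 := by
      field_simp
    have e4 : ipm g k ν₀ ψ ^ 2 ≤ 1 * ipm g k ψ ψ := by
      refine (ipm_sq_le pg pk ν₀ ψ).trans ?_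
      gcongr
      exact hν₀.trans (pow_le_one₀ hb.le hb1)
    have e5 := mul_le_mul_of_nonneg_left e4 (pow_pos hb 3).le
    rw [e2, e3] at e1
    linarith
  -- The bound |q| ≤ 1/3 leaves 1/3 of the background mass 2/3. The part without β² absorbs the
  -- borderline source of the lapse equation; the part with β³ is kept as dissipation.
  have a2 : β * b ^ 5 * (β ^ 2 / 3 + 2 / 3 + q) * f ^ 2
      ≥ 1 / 3 * (β ^ 3 * b ^ 5 * f ^ 2) + 1 / 3 * (β * b ^ 5 * f ^ 2) := by
    have e1 : 0 ≤ β * b ^ 5 * f ^ 2 := by positivity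
    have := mul_le_mul_of_nonneg_left (neg_abs_le q) e1
    nlinarith
  have a3 : |β * b * (f * Bn)| ≤ β * b ^ 5 * f ^ 2 / 4 + (b ^ 3)⁻¹ * Bn ^ 2 := by
    have e1 := scale_young hb (yr f Bn) (w := β * b) (by positivity) (c := b ^ 4 / 2) (by positivity)
    rw [abs_mul, abs_of_nonneg (by positivity)]
    refine e1.trans ?_
    have e2 : β * b * (b ^ 4 / 2) * f ^ 2 / 2 = β * b ^ 5 * f ^ 2 / 4 := by ring
    have e3 : β * b * (b ^ 4 / 2)⁻¹ * Bn ^ 2 / 2 = β * ((b ^ 3)⁻¹ * Bn ^ 2) := by field_simp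
    rw [e2, e3]
    have e4 : 0 ≤ (b ^ 3)⁻¹ * Bn ^ 2 := by positivity
    nlinarith
  have a4 : |β * b ^ 5 * (f * Jn)| ≤ b ^ 7 * f ^ 2 / 2 + b ^ 3 * Jn ^ 2 / 2 := by
    have e1 := scale_young hb (yr f Jn) (w := b ^ 5) (by positivity) (c := b ^ 2) (by positivity)
    have e2 : b ^ 5 * b ^ 2 * f ^ 2 / 2 = b ^ 7 * f ^ 2 / 2 := by ring
    have e3 : b ^ 5 * (b ^ 2)⁻¹ * Jn ^ 2 / 2 = b ^ 3 * Jn ^ 2 / 2 := by field_simp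
    rw [abs_mul, abs_of_nonneg (by positivity)]
    rw [e2, e3] at e1
    refine le_trans ?_ e1
    gcongr
    nlinarith [pow_pos hb 5]
  have a5 : |b * (φ * B₀)| ≤ ε * (b ^ 3)⁻¹ * φ ^ 2 / 2 + ε⁻¹ * b ^ 5 * B₀ ^ 2 / 2 := by
    rw [abs_mul, abs_of_pos hb]
    refine (scale_young hb (yr φ B₀) hb.le (c := ε * (b ^ 4)⁻¹) (by positivity)).trans (le_of_eq ?_)
    field_simp
  have a6 : |b * (φ * J₀)| ≤ b⁻¹ * φ ^ 2 / 2 + b ^ 3 * J₀ ^ 2 / 2 := by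
    rw [abs_mul, abs_of_pos hb]
    refine (scale_young hb (yr φ J₀) hb.le (c := (b ^ 2)⁻¹) (by positivity)).trans (le_of_eq ?_)
    field_simp
  have a7 : |b ^ 5 * ipm g k ψ Jψ| ≤ b ^ 3 * ipm g k ψ ψ / 2 + b ^ 7 * ipm g k Jψ Jψ / 2 := by
    rw [abs_mul, abs_of_pos (pow_pos hb 5)]
    refine (scale_young hb (yg ψ Jψ) (pow_pos hb 5).le (c := (b ^ 2)⁻¹) (by positivity)).trans
      (le_of_eq ?_)
    field_simp
  have split : ∀ t : ℝ, b ^ 5 * |t| ≤ β * b ^ 5 * |t| + b ^ 9 * |t| := fun t => by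
    have : (1 - β) * (b ^ 5 * |t|) ≤ b ^ 4 * (b ^ 5 * |t|) := by gcongr
    linarith
  have a8 : |b ^ 5 * ipm g k ψ Bψ| ≤ β * b * ipm g k ψ ψ / 24 + b ^ 3 * ipm g k ψ ψ / 2
      + 7 * (b ^ 9 * ipm g k Bψ Bψ) := by
    rw [abs_mul, abs_of_pos (pow_pos hb 5)]
    refine (split _).trans ?_
    have e1 := scale_young hb (yg ψ Bψ) (w := β * b ^ 5) (by positivity) (c := (12 * b ^ 4)⁻¹)
      (by positivity)
    have e2 := scale_young hb (yg ψ Bψ) (w := b ^ 9) (by positivity) (c := 1) (by positivity)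
    have e3 : β * b ^ 5 * (12 * b ^ 4)⁻¹ * ipm g k ψ ψ / 2 = β * b * ipm g k ψ ψ / 24 := by
      field_simp
      try ring
    have e4 : β * b ^ 5 * (12 * b ^ 4)⁻¹⁻¹ * ipm g k Bψ Bψ / 2 = 6 * (β * (b ^ 9 * ipm g k Bψ Bψ)) := by
      field_simp
      try ring
    have e5 := hpow (p := 9) (q := 3) (by norm_num) hP
    have e6 : β * (b ^ 9 * ipm g k Bψ Bψ) ≤ 1 * (b ^ 9 * ipm g k Bψ Bψ) := by
      have := nn Bψ
      gcongr
    have e7 : 0 ≤ b ^ 9 * ipm g k Bψ Bψ := by have := nn Bψ; positivity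
    rw [e3, e4] at e1
    norm_num at e2
    linarith
  have a9 : |sqt * (b ^ 5 * ipm g k ψ ν)| ≤ β * b * ipm g k ψ ψ / 2 + β * b ^ 9 * ipm g k ν ν / 3
      + b ^ 3 * ipm g k ψ ψ / 2 + b ^ 12 * ipm g k ν ν / 2 := by
    have hs0 : 0 < sqt := Real.sqrt_pos.2 (by norm_num)
    rw [abs_mul, abs_of_nonneg hs, abs_mul, abs_of_pos (pow_pos hb 5)]
    -- This weight distributes the cross term so that its double costs 1 of |ψ|² and sqt² = 2/3 of
    -- |ν|², both below the available damping.
    have e1 := scale_young hb (yg ψ ν) (w := sqt * (β * b ^ 5)) (by positivity)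
      (c := (sqt * b ^ 4)⁻¹) (by positivity)
    have e2 := scale_young hb (yg ψ ν) (w := b ^ 9) (by positivity) (c := (b ^ 5)⁻¹) (by positivity)
    have e3 : sqt * (β * b ^ 5) * (sqt * b ^ 4)⁻¹ * ipm g k ψ ψ / 2 = β * b * ipm g k ψ ψ / 2 := by
      field_simp
    have e4 : sqt * (β * b ^ 5) * (sqt * b ^ 4)⁻¹⁻¹ * ipm g k ν ν / 2
        = β * b ^ 9 * ipm g k ν ν / 3 := by
      rw [inv_inv]
      linear_combination (β * b ^ 9 * ipm g k ν ν / 2) * sqt_sq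
    have e5 : b ^ 9 * (b ^ 5)⁻¹ * ipm g k ψ ψ / 2 = b ^ 4 * ipm g k ψ ψ / 2 := by field_simp
    have e6 : b ^ 9 * (b ^ 5)⁻¹⁻¹ * ipm g k ν ν / 2 = b ^ 14 * ipm g k ν ν / 2 := by field_simp
    have e7 := hpow (p := 4) (q := 3) (by norm_num) hP
    have e8 := hpow (p := 14) (q := 12) (by norm_num) hV
    have e9 := mul_le_mul_of_nonneg_left (split (ipm g k ψ ν)) hs
    have e10 : sqt * (b ^ 9 * |ipm g k ψ ν|) ≤ 1 * (b ^ 9 * |ipm g k ψ ν|) := by gcongr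
    rw [e3, e4] at e1
    rw [e5, e6] at e2
    linarith
  rw [abs_le] at a1 a3 a4 a5 a6 a7 a8 a9
  have n1 : 0 ≤ β * b * ipm g k ψ ψ := by positivity
  have n2 : 0 ≤ β * b ^ 9 * ipm g k ν ν := by positivity
  have n3 : 0 ≤ β * b ^ 5 * f ^ 2 := by positivity
  have n4 : 0 ≤ b ^ 3 * ipm g k ψ ψ := by positivity
  have n5 : 0 ≤ b⁻¹ * φ ^ 2 := by positivity
  have n6 : 0 ≤ ε * (b ^ 3)⁻¹ * φ ^ 2 := by positivity
  have n7 : 0 ≤ b ^ 12 * ipm g k ν ν := by positivity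
  have n8 : 0 ≤ (b ^ 3)⁻¹ * Bn ^ 2 := by positivity
  have n9 : 0 ≤ b ^ 3 * Jn ^ 2 := by positivity
  have n10 : 0 ≤ b ^ 3 * J₀ ^ 2 := by positivity
  have n11 : 0 ≤ b ^ 7 * f ^ 2 := by positivity
  have n12 : 0 ≤ ε⁻¹ * b ^ 5 * B₀ ^ 2 := by positivity
  have n13 : 0 ≤ b ^ 9 * ipm g k Bψ Bψ := by have := nn Bψ; positivity
  have n14 : 0 ≤ b ^ 7 * ipm g k Jψ Jψ := by have := nn Jψ; positivity
  have n15 : 0 ≤ β ^ 3 * b ^ 5 * f ^ 2 := by positivity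
  linarith [a1.1, a3.1, a4.1, a5.2, a6.2, a7.2, a8.2, a9.2]

end pointwise

/-! ## The energy identities on a time slice -/

/-- `P^{ij} h_{ij}`. -/
def contr2 (P : Tensor 2 0) (h : Tensor 0 2) : Tensor 0 0 := fun y _ _ =>
  ∑ i, ∑ j, P y ![i, j] ![] * h y ![] ![i, j]

theorem isNatural_contr2 : IsNatural contr2 where
  smooth hξ hη _ _ := Ck.sum fun _ _ => Ck.sum fun _ _ => (hξ _ _).mul (hη _ _)
  leibniz A Γ ξ η hξ hη := by
    funext y a b
    rw [vec0_eq a, vec0_eq b]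
    simp only [Pi.add_apply, der_00]
    simp only [contr2]
    rw [Z_sum A y fun c _ => Sm.sum fun d _ => (hξ _ _).mul (hη _ _)]
    simp only [Z_sum_mul A y (fun c => hξ _ _) fun c => hη _ _]
    simp only [der_20, der_02, Fin.sum_univ_three]
    ring

section slice

variable {G : Metric3} (h : MetricSm 1 G)
include h

/-- The inverse metric is parallel, so the trace commutes with the covariant derivative. -/
theorem grad_trG {ξ : Tensor 0 2} (hξ : TSm 1 ξ) (y : S3) :
    grad (trG G ξ) y = trace23 (G y)⁻¹ (cov G ξ y) := by
  funext a b
  have h1 := congrFun (congrFun (congrFun (isNatural_contr2.leibniz (b 0) (chrMat G (b 0)) h.invT hξ)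
    y) ![]) ![]
  rw [der_00] at h1
  simp only [Pi.add_apply, contr2, der_invT (r := 0) h, zero_mul, Finset.sum_const_zero,
    zero_add] at h1
  exact h1

theorem divV_add {V W : Tensor 1 0} (hV : TSm 1 V) (hW : TSm 1 W) (y : S3) :
    divV G (V + W) y = divV G V y + divV G W y := by
  simp only [divV, der_add _ _ hV hW, Pi.add_apply, Finset.sum_add_distrib]

theorem divV_const_smul (c : ℝ) {V : Tensor 1 0} (hV : TSm 1 V) (y : S3) :
    divV G (c • V) y = c * divV G V y := by
  simp only [divV, der_smul _ _ _ hV, Pi.smul_apply, smul_eq_mul, Finset.mul_sum]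

end slice

namespace SliceEqs

variable {b : ℝ} {X : Rescaled} {Kt : Tensor 1 1} {Φt : S3 → ℝ} {Ψt : Tensor 0 1}
  (E : SliceEqs b X Kt Φt Ψt) {I : List (Fin 3)} (hI : I.length ≤ 16)
include E

theorem n_sm : Sm 1 fun y => 1 + b ^ 4 * X.N y :=
  (Sm.const 1).add ((Sm.const _).mul (E.N_sm.of_le (by norm_num)))

theorem grad_n (y : S3) : grad (fun y => 1 + b ^ 4 * X.N y) y = b ^ 4 • grad X.N y := by
  funext p q
  have hN : Sm 1 X.N := E.N_sm.of_le (by norm_num)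
  rw [grad, Z_add _ _ (Sm.const 1) ((Sm.const _).mul hN), Z_const, Z_const_mul _ _ _ hN]
  simp [grad]

include hI

/-- The field V collects five integrations by parts: the Laplacian against L^I K, the Hessian of the
trace, the two divergence terms, and the Hessian of Z^I N. The Laplacian one cancels the pairing of
∇L^I G with ∇L^I K coming from the evolution of the metric, thanks to the coefficient 1/4 in the
energy. The others leave divergences of L^I K, replaced through the momentum constraints. -/
theorem metric_identity : ∃ V : Tensor 1 0, TSm 1 V ∧ ∀ y,
    2 * ipm (X.G y) (X.G y)⁻¹ (lieI I X.K y) (lieI I Kt y)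
      + 1 / 2 * b ^ 4 * ipm (X.G y) (X.G y)⁻¹ (cov X.G (lieI I (lowT X.G)) y)
          (cov X.G (lieI I X.Gt) y + X.commDt (lieI I (lowT X.G)) y)
      + 1 / 3 * b * X.α' * ipm (X.G y) (X.G y)⁻¹ (cov X.G (lieI I (lowT X.G)) y)
          (cov X.G (lieI I (lowT X.G)) y)
    = divV X.G V y + (b * (ipm (X.G y) (X.G y)⁻¹ (cov X.G (lieI I (lowT X.G)) y)
            (lowTens (X.G y) (vecTens (b ^ 4 • grad X.N y) (lieI I X.K y)))
        + ipm (X.G y) (X.G y)⁻¹ (lieI I X.K y) (raiseTens (X.G y)⁻¹ (b ^ 4 • grad X.N y)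
            (trace23 (X.G y)⁻¹ (cov X.G (lieI I (lowT X.G)) y)))
        - ipm (X.G y) (X.G y)⁻¹ (lieI I X.K y) (raiseTens (X.G y)⁻¹ (b ^ 4 • grad X.N y)
            (trace12 (X.G y)⁻¹ (cov X.G (lieI I (lowT X.G)) y)))
        - ipm (X.G y) (X.G y)⁻¹ (lieI I X.K y) (raiseTens (X.G y)⁻¹
            (trace12 (X.G y)⁻¹ (cov X.G (lieI I (lowT X.G)) y)) (b ^ 4 • grad X.N y)))
      + b * (1 + b ^ 4 * X.N y) * (-sqt * ipm (X.G y) (X.G y)⁻¹ (lieI I X.Ψ y)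
            (trace23 (X.G y)⁻¹ (cov X.G (lieI I (lowT X.G)) y))
        + 2 * sqt * ipm (X.G y) (X.G y)⁻¹ (lieI I X.Ψ y)
            (trace12 (X.G y)⁻¹ (cov X.G (lieI I (lowT X.G)) y))
        + ipm (X.G y) (X.G y)⁻¹ (X.momBorderDown I y)
            (trace23 (X.G y)⁻¹ (cov X.G (lieI I (lowT X.G)) y))
        - ipm (X.G y) (X.G y)⁻¹ (X.momBorderDown I y)
            (trace12 (X.G y)⁻¹ (cov X.G (lieI I (lowT X.G)) y))
        - ipm (X.G y) (X.G y)⁻¹ (lower1 (X.G y) (X.momBorderUp I y))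
            (trace12 (X.G y)⁻¹ (cov X.G (lieI I (lowT X.G)) y)))
      + 2 * (b * (1 + b ^ 4 * X.N y)) * ipm (X.G y) (X.G y)⁻¹ (lieI I X.K y) (X.ricError I y)
      + 2 * b ^ 5 * (-sqt * ipm (X.G y) (X.G y)⁻¹ (lieI I X.Ψ y) (grad (ZI I X.N) y)
        + ipm (X.G y) (X.G y)⁻¹ (X.momBorderDown I y) (grad (ZI I X.N) y))
      + 2 * b * (ipm (X.G y) (X.G y)⁻¹ (lieI I X.K y) (X.secBorder I y)
        + ipm (X.G y) (X.G y)⁻¹ (lieI I X.K y) (X.secJunk I y))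
      + 1 / 2 * b ^ 4 * (2 / 3 * b * X.α' * ipm (X.G y) (X.G y)⁻¹
            (trace23 (X.G y)⁻¹ (cov X.G (lieI I (lowT X.G)) y)) (grad (ZI I X.N) y)
        + (b ^ 3)⁻¹ * ipm (X.G y) (X.G y)⁻¹ (cov X.G (lieI I (lowT X.G)) y) (X.gradMetBorder I y)
        + b * ipm (X.G y) (X.G y)⁻¹ (cov X.G (lieI I (lowT X.G)) y) (X.gradMetJunk I y))
      + 1 / 3 * b * X.α' * ipm (X.G y) (X.G y)⁻¹ (cov X.G (lieI I (lowT X.G)) y)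
          (cov X.G (lieI I (lowT X.G)) y)) := by
  set x := lieI I X.K with hx
  set ξ := lieI I (lowT X.G) with hξ
  set n : S3 → ℝ := fun y => 1 + b ^ 4 * X.N y with hn
  have hM : MetricSm 1 X.G := E.met.of_le (by norm_num)
  have sx : TSm 1 x := E.K_lie hI
  have sξ2 : TSm 2 ξ := E.G_lie hI
  have sξ : TSm 1 ξ := sξ2.of_le (by norm_num)
  have sh : TSm 1 (cov X.G ξ) := (E.met.of_le (by norm_num)).cov sξ2
  have sn : Sm 1 n := E.n_sm
  have sw2 : TSm 1 (div02 X.G ξ) := fun _ _ => Sm.sum fun c _ => Sm.sum fun d _ =>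
    (hM.invT ![c, d] ![]).mul (sh _ _)
  have sν : TSm 1 (grad (ZI I X.N)) := TSm.grad (E.N_lie hI)
  have sw1 : TSm 1 (grad (trG X.G ξ)) := TSm.grad (Sm.sum fun c _ => Sm.sum fun d _ =>
    ((E.met.of_le (by norm_num : 2 ≤ 18)).invT ![c, d] ![]).mul (sξ2 _ _))
  have sGi : TSm 1 (invT X.G) := hM.invT
  have v1 := isNatural_smulT.sm (TSm.ofScalar sn)
    (isNatural_upVec.sm sGi (isNatural_contr.sm (isNatural_mulUp.sm sx sGi) sh))
  have v2 := isNatural_smulT.sm (TSm.ofScalar sn)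
    (isNatural_mulVec.sm sx (isNatural_upVec.sm sGi sw1))
  have v3 := isNatural_smulT.sm (TSm.ofScalar sn)
    (isNatural_mulVec.sm sx (isNatural_upVec.sm sGi sw2))
  have v4 := isNatural_smulT.sm (TSm.ofScalar sn)
    (isNatural_upVec.sm sGi (isNatural_vecMul.sm sw2 sx))
  have v5 := isNatural_smulT.sm (TSm.ofScalar (Sm.const (r := 1) 1))
    (isNatural_mulVec.sm sx (isNatural_upVec.sm sGi sν))
  refine ⟨(-b) • _ + (-b) • _ + b • _ + b • _ + (-(2 * b ^ 5)) • _,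
    ((((v1.smul _).add (v2.smul _)).add (v3.smul _)).add (v4.smul _)).add (v5.smul _), fun y => ?_⟩
  rw [divV_add hM ((((v1.smul _).add (v2.smul _)).add (v3.smul _)).add (v4.smul _)) (v5.smul _),
    divV_add hM (((v1.smul _).add (v2.smul _)).add (v3.smul _)) (v4.smul _),
    divV_add hM ((v1.smul _).add (v2.smul _)) (v3.smul _), divV_add hM (v1.smul _) (v2.smul _),
    divV_const_smul hM _ v1, divV_const_smul hM _ v2, divV_const_smul hM _ v3,
    divV_const_smul hM _ v4, divV_const_smul hM _ v5, divV_contr hM sn sx sh,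
    divV_mulVec hM sn sx sw1, divV_mulVec hM sn sx sw2, divV_vecMul hM sn sx sw2,
    divV_mulVec hM (Sm.const 1) sx sν]
  have ew1 : grad (trG X.G ξ) y = trace23 (X.G y)⁻¹ (cov X.G ξ y) := grad_trG hM sξ y
  have ew2 : div02 X.G ξ y = trace12 (X.G y)⁻¹ (cov X.G ξ y) := rfl
  have eδ : div11 X.G x y = (-sqt) • lieI I X.Ψ y + X.momBorderDown I y := by
    funext p q
    exact E.div_lie hI y p q
  have g0 : grad (fun _ : S3 => (1 : ℝ)) y = (0 : ℝ) • grad (ZI I X.N) y := by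
    funext p q
    simp [grad, Z_const]
  have z0 : ipm (X.G y) (X.G y)⁻¹ (x y)
      (raiseTens (X.G y)⁻¹ (grad (fun _ : S3 => (1 : ℝ)) y) (grad (ZI I X.N) y)) = 0 := by
    rw [ipm_raiseTens (hM.mul_inv y), g0]
    simp
  have eδs : ∑ i, div11Sharp X.G x y ![i] ![] * trace12 (X.G y)⁻¹ (cov X.G ξ y) ![] ![i]
      = -sqt * ipm (X.G y) (X.G y)⁻¹ (lieI I X.Ψ y) (trace12 (X.G y)⁻¹ (cov X.G ξ y))
        + ipm (X.G y) (X.G y)⁻¹ (lower1 (X.G y) (X.momBorderUp I y))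
            (trace12 (X.G y)⁻¹ (cov X.G ξ y)) := by
    rw [ipm_lower1 (hM.mul_inv y) (hM.pos y).posSemidef (hM.pos y).inv.posSemidef, ipm_01]
    have : ∀ i, div11Sharp X.G x y ![i] ![] = -sqt * (∑ d, (X.G y)⁻¹ i d * lieI I X.Ψ y ![] ![d])
        + X.momBorderUp I y ![i] ![] := fun i => E.divSharp_lie hI y i
    simp only [this, add_mul, Finset.sum_add_distrib]
    congr 1
    simp only [Fin.sum_univ_three]
    rw [hM.inv_symm_apply y 1 0, hM.inv_symm_apply y 2 0, hM.inv_symm_apply y 2 1]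
    ring
  obtain ⟨c, hc⟩ := E.sec_lie hI y
  have eK : lieI I Kt y = (b * n y) • ((-(1 / 2) : ℝ) • sharp2 X.G (lap X.G ξ) y
      + (-(1 / 2) : ℝ) • sharp2 X.G (cov X.G (grad (trG X.G ξ))) y
      + (1 / 2 : ℝ) • sharp2 X.G (cov X.G (div02 X.G ξ)) y
      + (1 / 2 : ℝ) • cov X.G (sharp1 X.G (div02 X.G ξ)) y + X.ricError I y)
      + (-b ^ 5) • sharp2 X.G (cov X.G (grad (ZI I X.N))) y
      + b • (X.secBorder I y + X.secJunk I y) + c • idT := by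
    funext p q
    rw [hc p q]
    simp only [Pi.add_apply, Pi.smul_apply, smul_eq_mul, hn, hess]
    ring
  have eh : cov X.G (lieI I X.Gt) y + X.commDt ξ y
      = (-2 * (b ^ 3)⁻¹ * n y) • lowTens (X.G y) (cov X.G x y)
        + (2 / 3 * b * X.α') • vecMet (X.G y) (grad (ZI I X.N) y)
        + (b ^ 3)⁻¹ • X.gradMetBorder I y + b • X.gradMetJunk I y := by
    funext p q
    exact E.metric_lie hI y p q
  -- Trace-freeness of L^I K removes the unspecified multiple of the identity in `sec_lie`.
  have etr : ipm (X.G y) (X.G y)⁻¹ (x y) idT = 0 := by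
    rw [ipm_idT (hM.mul_inv y) (hM.pos y).inv.posSemidef, E.tr_lie hI y]
  have egn : grad n y = b ^ 4 • grad X.N y := E.grad_n y
  rw [z0, ew1, ew2, eδ, eδs, eK, eh, egn]
  simp only [ipm, ker_add_left, ker_add_right, ker_smul_left, ker_smul_right] at etr ⊢
  rw [etr]
  have evm : ker (fun _ => X.G y) (fun _ => (X.G y)⁻¹) (cov X.G ξ y)
      (vecMet (X.G y) (grad (ZI I X.N) y)) = ker (fun _ => X.G y) (fun _ => (X.G y)⁻¹)
        (trace23 (X.G y)⁻¹ (cov X.G ξ y)) (grad (ZI I X.N) y) :=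
    ipm_vecMet (hM.mul_inv y) (hM.inv_symm y) _ _
  rw [evm]
  have hb := E.b_pos.ne'
  field_simp
  ring

/-- Two divergences are used. The first, of n Z^I Φ times L^I Ψ, cancels the top order terms of the
wave pair. The second, of −a' b⁹ Z^I N ∇Z^I N, brings in the lapse equation multiplied by a' b⁵ Z^I
N: it creates the damping of the lapse, and its linear term in Z^I Φ cancels the term −√(2/3) a' b
Z^I N of the evolution of Φ. -/
theorem sf_identity : ∃ V : Tensor 1 0, TSm 1 V ∧ ∀ y,
    2 * ZI I X.Φ y * ZI I Φt y + 2 * b ^ 4 * ipm (X.G y) (X.G y)⁻¹ (lieI I X.Ψ y) (lieI I Ψt y)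
      + 4 / 3 * b * X.α' * ipm (X.G y) (X.G y)⁻¹ (lieI I X.Ψ y) (lieI I X.Ψ y)
    = divV X.G V y + (-(2 * b * ZI I X.Φ y
          * ipm (X.G y) (X.G y)⁻¹ (b ^ 4 • grad X.N y) (lieI I X.Ψ y))
      - (-X.α') * b ^ 9 * ipm (X.G y) (X.G y)⁻¹ (grad (ZI I X.N) y) (grad (ZI I X.N) y)
      - (-X.α') * b ^ 5 * ((-X.α') ^ 2 / 3 + 2 / 3
          + (normSq X.G X.K y + 2 * sqt * X.Φ y + X.Φ y ^ 2)) * ZI I X.N y ^ 2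
      - (-X.α') * b * ZI I X.N y * X.lapseBorder I y
      - (-X.α') * b ^ 5 * ZI I X.N y * X.lapseJunk I y
      + 2 * b * ZI I X.Φ y * (X.timeBorder I y + X.timeJunk I y)
      + 2 * sqt * b ^ 5 * ipm (X.G y) (X.G y)⁻¹ (lieI I X.Ψ y) (grad (ZI I X.N) y)
      + 2 * b ^ 5 * (ipm (X.G y) (X.G y)⁻¹ (lieI I X.Ψ y) (X.spaceBorder I y)
        + ipm (X.G y) (X.G y)⁻¹ (lieI I X.Ψ y) (X.spaceJunk I y))
      + 4 / 3 * b * (-(-X.α')) * ipm (X.G y) (X.G y)⁻¹ (lieI I X.Ψ y) (lieI I X.Ψ y)) := by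
  set ψ := lieI I X.Ψ with hψ
  set φ := ZI I X.Φ with hφ
  set f := ZI I X.N with hf
  set n : S3 → ℝ := fun y => 1 + b ^ 4 * X.N y with hn
  have hM : MetricSm 1 X.G := E.met.of_le (by norm_num)
  have sψ : TSm 1 ψ := E.Ψ_lie hI
  have sφ : Sm 1 φ := E.Φ_lie hI
  have sf : Sm 2 f := E.N_lie hI
  have sν : TSm 1 (grad f) := TSm.grad sf
  have sn : Sm 1 n := E.n_sm
  have sGi : TSm 1 (invT X.G) := hM.invT
  have v1 := isNatural_smulT.sm (TSm.ofScalar (sn.mul sφ)) (isNatural_upVec.sm sGi sψ)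
  have v2 := isNatural_smulT.sm (TSm.ofScalar (sf.of_le (q := 1) (by norm_num)))
    (isNatural_upVec.sm sGi sν)
  refine ⟨(2 * b) • _ + (-X.α' * b ^ 9) • _, (v1.smul _).add (v2.smul _), fun y => ?_⟩
  rw [divV_add hM (v1.smul _) (v2.smul _), divV_const_smul hM _ v1, divV_const_smul hM _ v2,
    divV_smul_upVec hM (sn.mul sφ) sψ, divV_smul_upVec hM (sf.of_le (q := 1) (by norm_num)) sν]
  have egn : grad n y = b ^ 4 • grad X.N y := E.grad_n y
  have eg : grad (fun y => n y * φ y) y = n y • grad φ y + φ y • (b ^ 4 • grad X.N y) := by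
    rw [← egn]
    funext p q
    simp only [grad, Pi.add_apply, Pi.smul_apply, smul_eq_mul]
    rw [Z_mul _ y sn sφ]
    ring
  have eΨ : lieI I Ψt y = ((b ^ 3)⁻¹ * n y) • grad φ y + (sqt * b) • grad f y
      + b • (X.spaceBorder I y + X.spaceJunk I y) := by
    funext p q
    exact E.space_lie hI y p q
  have eΔ : div01 X.G (grad f) y = lapS X.G f y := rfl
  have key := E.lapse_lie hI y
  have hs : ker (fun _ => X.G y) (fun _ => (X.G y)⁻¹) (grad φ y) (ψ y)
      = ker (fun _ => X.G y) (fun _ => (X.G y)⁻¹) (ψ y) (grad φ y) :=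
    ker_symm (fun _ => hM.symm y) (fun _ => hM.inv_symm y) _ _
  rw [eg, eΨ, E.time_lie hI, eΔ]
  simp only [ipm, ker_add_left, ker_add_right, ker_smul_left, ker_smul_right]
  rw [hs]
  have hb := E.b_pos.ne'
  have key2 : b ^ 8 * lapS X.G f y = b ^ 4 * (X.α' ^ 2 / 3 + 2 / 3) * f y
      + b ^ 4 * (normSq X.G X.K y + 2 * sqt * X.Φ y + X.Φ y ^ 2) * f y
      + 2 * sqt * φ y + X.lapseBorder I y + b ^ 4 * X.lapseJunk I y := by
    have := congrArg (fun r => b ^ 4 * r) key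
    field_simp at this ⊢
    linear_combination this
  have e3 : 2 * b ^ 4 * ((b ^ 3)⁻¹ * n y * ker (fun _ => X.G y) (fun _ => (X.G y)⁻¹) (ψ y) (grad φ y))
      = 2 * b * (n y * ker (fun _ => X.G y) (fun _ => (X.G y)⁻¹) (ψ y) (grad φ y)) := by
    field_simp
  simp only [hn] at *
  linear_combination e3 + (X.α' * b * f y) * key2

end SliceEqs

/-! ## The energy density and its time derivative -/

/-- Each of the l + m slots contributes the bound c times the squared norm. In a lower slot the
derivative of the inverse metric has the opposite sign, which is why both signs s are needed. -/
theorem abs_slots_le {l m : ℕ} {g k H : Matrix (Fin 3) (Fin 3) ℝ} {c : ℝ} (hgk : g * k = 1)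
    (pg : g.PosSemidef) (pk : k.PosSemidef)
    (hH : ∀ s : ℝ, |s| = 1 → (c • g + s • H).PosSemidef) (ξ : Comp l m) :
    |∑ i, ker (Function.update (fun _ => g) i H) (fun _ => k) ξ ξ
      + ∑ j, ker (fun _ => g) (Function.update (fun _ => k) j (-(k * H * k))) ξ ξ|
    ≤ (l + m) * (c * ipm g k ξ ξ) := by
  have h1 : ∀ i, |ker (Function.update (fun _ => g) i H) (fun _ => k) ξ ξ| ≤ c * ipm g k ξ ξ :=
    fun i => abs_ker_update_left_le pg pk (hH 1 (by simp)) (hH (-1) (by simp)) i ξ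
  have h2 : ∀ j, |ker (fun _ => g) (Function.update (fun _ => k) j (-(k * H * k))) ξ ξ|
      ≤ c * ipm g k ξ ξ := fun j => by
    refine abs_ker_update_right_le pg pk ?_ ?_ j ξ
    · simpa using posSemidef_inv hgk pk (hH (-1) (by simp))
    · simpa using posSemidef_inv hgk pk (hH 1 (by simp))
  refine (abs_add_le _ _).trans ?_
  rw [add_mul]
  refine add_le_add ((Finset.abs_sum_le_sum_abs _ _).trans ?_)
    ((Finset.abs_sum_le_sum_abs _ _).trans ?_)
  · exact (Finset.sum_le_sum fun i _ => h1 i).trans (by simp)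
  · exact (Finset.sum_le_sum fun i _ => h2 i).trans (by simp)

namespace Rescaled

variable (X : Rescaled)

/-- The density of the energy of order `I`. -/
def dens (κ : ℝ) (I : List (Fin 3)) (y : S3) : ℝ :=
  κ * (normSq X.G (lieI I X.K) y
      + (1 / 4) * X.α ^ (4 / 3 : ℝ) * normSq X.G (cov X.G (lieI I (lowT X.G))) y)
    + (ZI I X.Φ y ^ 2 + X.α ^ (4 / 3 : ℝ) * normSq X.G (lieI I X.Ψ) y)

/-- The density of the dissipated energy. -/
def dissDens (I : List (Fin 3)) (y : S3) : ℝ :=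
  |X.α'| * X.α ^ (1 / 3 : ℝ) * normSq X.G (cov X.G (lieI I (lowT X.G))) y
  + |X.α'| * X.α ^ (1 / 3 : ℝ) * normSq X.G (lieI I X.Ψ) y
  + |X.α'| * X.α ^ 3 * normSq X.G (grad (ZI I X.N)) y
  + |X.α'| ^ 3 * X.α ^ (5 / 3 : ℝ) * normSq X.G (ofScalar (ZI I X.N)) y

/-- The density of the borderline terms. -/
def borderDens (ε : ℝ) (I : List (Fin 3)) (y : S3) : ℝ :=
  X.α ^ (1 / 3 : ℝ) * normSq X.G (X.momBorderDown I) y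
  + X.α ^ (1 / 3 : ℝ) * normSq X.G (X.momBorderUp I) y
  + X.α ^ (1 / 3 : ℝ) * normSq X.G (X.gradMetBorder I) y
  + X.α ^ 3 * normSq X.G (X.spaceBorder I) y
  + X.α⁻¹ * normSq X.G (ofScalar (X.lapseBorder I)) y
  + (1 / ε) * X.α ^ (5 / 3 : ℝ) * normSq X.G (X.secBorder I) y
  + (1 / ε) * X.α ^ (5 / 3 : ℝ) * normSq X.G (ofScalar (X.timeBorder I)) y

/-- The density of the junk terms. -/
def junkDens (I : List (Fin 3)) (y : S3) : ℝ :=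
  X.α ^ (7 / 3 : ℝ) * normSq X.G (X.gradMetJunk I) y
  + X.α ^ (7 / 3 : ℝ) * normSq X.G (X.spaceJunk I) y
  + X.α * normSq X.G (ofScalar (X.lapseJunk I)) y
  + X.α * normSq X.G (X.ricError I) y
  + X.α * normSq X.G (X.secJunk I) y
  + X.α * normSq X.G (ofScalar (X.timeJunk I)) y
  + X.α ^ 4 * normSq X.G (grad (ZI I X.N)) y
  + X.α ^ (7 / 3 : ℝ) * normSq X.G (ofScalar (ZI I X.N)) y

/-- The density of the bound for the time derivative of the energy. -/
def boundDens (c₀ C κ ε : ℝ) (I : List (Fin 3)) (y : S3) : ℝ :=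
  -c₀ * X.dissDens I y + C * X.borderDens ε I y + C * X.junkDens I y
    + C * (X.α ^ (-1 / 3 : ℝ) + ε * X.α⁻¹) * X.dens κ I y

end Rescaled

theorem normSq_ofScalar (G : Metric3) (f : S3 → ℝ) (y : S3) : normSq G (ofScalar f) y = f y ^ 2 := by
  rw [sq]
  exact ipm_00 (ofScalar f y) (ofScalar f y)

theorem normSq_nonneg {r : ℕ} {G : Metric3} (h : MetricSm r G) {l m : ℕ} (ξ : Tensor l m) (y : S3) :
    0 ≤ normSq G ξ y := ipm_self_nonneg (h.pos y).posSemidef (h.pos y).inv.posSemidef (ξ y)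

set_option maxHeartbeats 1000000 in
/-- Adding the two density inequalities, with a small weight on the metric part. -/
theorem combine_densities {κ ε b β B C₁ qM qS x h ψ ν f2 φ2 m₁ m₂ bh bK r jK jh bn b0 bψ jn j0 jψ : ℝ}
    (hκ : 0 < κ) (hκ1 : κ * 12000 ≤ 1) (hb : 0 < b) (hβ : 0 ≤ β) (hε : 0 < ε)
    (hm : qM ≤ -(1 / 6) * (β * b * h) + 1000 * (β * b * ψ + β * b ^ 9 * ν)
      + 1000 * (b * m₁ + b * m₂ + b * bh + ε⁻¹ * b ^ 5 * bK)
      + 1000 * (b ^ 3 * r + b ^ 3 * jK + b ^ 7 * jh + b ^ 12 * ν)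
      + 1000 * ((b⁻¹ + ε * (b ^ 3)⁻¹) * x + b ^ 3 * h + b ^ 3 * ψ))
    (hs : qS ≤ -(1 / 6) * (β * b * ψ + β * b ^ 9 * ν + β ^ 3 * b ^ 5 * f2)
      + 1000 * ((b ^ 3)⁻¹ * bn + ε⁻¹ * b ^ 5 * b0 + b ^ 9 * bψ)
      + 1000 * (b ^ 3 * jn + b ^ 3 * j0 + b ^ 7 * jψ + b ^ 12 * ν + b ^ 7 * f2)
      + 1000 * ((b⁻¹ + ε * (b ^ 3)⁻¹) * φ2 + b ^ 3 * ψ))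
    (hB : B ≤ 4 * ((4 * C₁ * ε * (b ^ 3)⁻¹ + b⁻¹)
      * (κ * (x + 1 / 4 * b ^ 4 * h) + (φ2 + b ^ 4 * ψ)))) (hC₁ : 0 ≤ C₁)
    (hx : 0 ≤ x) (hh : 0 ≤ h) (hψ : 0 ≤ ψ) (hν : 0 ≤ ν) (hf2 : 0 ≤ f2) (hφ2 : 0 ≤ φ2)
    (hm₁ : 0 ≤ m₁) (hm₂ : 0 ≤ m₂) (hbh : 0 ≤ bh) (hbK : 0 ≤ bK) (hr : 0 ≤ r) (hjK : 0 ≤ jK)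
    (hjh : 0 ≤ jh) (hbn : 0 ≤ bn) (hb0 : 0 ≤ b0) (hbψ : 0 ≤ bψ) (hjn : 0 ≤ jn) (hj0 : 0 ≤ j0)
    (hjψ : 0 ≤ jψ) :
    κ * qM + qS + B ≤ -(κ / 6) * (β * b * h + β * b * ψ + β * b ^ 9 * ν + β ^ 3 * b ^ 5 * f2)
      + (8000 + 16 * C₁) * (b * m₁ + b * m₂ + b * bh + b ^ 9 * bψ + (b ^ 3)⁻¹ * bn
          + ε⁻¹ * b ^ 5 * bK + ε⁻¹ * b ^ 5 * b0)
      + (8000 + 16 * C₁) * (b ^ 7 * jh + b ^ 7 * jψ + b ^ 3 * jn + b ^ 3 * r + b ^ 3 * jK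
          + b ^ 3 * j0 + b ^ 12 * ν + b ^ 7 * f2)
      + (8000 + 16 * C₁) * (b⁻¹ + ε * (b ^ 3)⁻¹) * (κ * (x + 1 / 4 * b ^ 4 * h) + (φ2 + b ^ 4 * ψ)) := by
  have hi := inv_pos.2 hb
  have hκ2 : κ ≤ 1 := by linarith
  have hκ3 : 0 ≤ 1 - κ * 12000 := by linarith
  have hκ4 : 0 ≤ 1 - κ := by linarith
  have hk := mul_le_mul_of_nonneg_left hm hκ.le
  have eh : b ^ 3 * h = b⁻¹ * b ^ 4 * h := by field_simp
  have eψ : b ^ 3 * ψ = b⁻¹ * b ^ 4 * ψ := by field_simp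
  rw [eh, eψ] at hk
  rw [eψ] at hs
  -- Since 1000 κ ≤ 1/12, the metric part uses up at most half of the scalar dissipation 1/6, and
  -- the remaining 1/12 is still larger than κ/6.
  have small : ∀ {u : ℝ}, 0 ≤ u → κ * u ≤ u / 12000 := fun {u} hu => by
    nlinarith
  have one : ∀ {u : ℝ}, 0 ≤ u → κ * u ≤ u := fun {u} hu => by nlinarith
  have a1 : 0 ≤ β * b * ψ := by positivity
  have a2 : 0 ≤ β * b ^ 9 * ν := by positivity
  have a3 : 0 ≤ β ^ 3 * b ^ 5 * f2 := by positivity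
  have a4 : 0 ≤ b ^ 12 * ν := by positivity
  have a5 : 0 ≤ b⁻¹ * b ^ 4 * ψ := by positivity
  have a6 : 0 ≤ b * m₁ := by positivity
  have a7 : 0 ≤ b * m₂ := by positivity
  have a8 : 0 ≤ b * bh := by positivity
  have a9 : 0 ≤ ε⁻¹ * b ^ 5 * bK := by positivity
  have a10 : 0 ≤ b ^ 3 * r := by positivity
  have a11 : 0 ≤ b ^ 3 * jK := by positivity
  have a12 : 0 ≤ b ^ 7 * jh := by positivity
  have c1 : 0 ≤ b ^ 9 * bψ := by positivity
  have c2 : 0 ≤ (b ^ 3)⁻¹ * bn := by positivity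
  have c3 : 0 ≤ ε⁻¹ * b ^ 5 * b0 := by positivity
  have c4 : 0 ≤ b ^ 7 * jψ := by positivity
  have c5 : 0 ≤ b ^ 3 * jn := by positivity
  have c6 : 0 ≤ b ^ 3 * j0 := by positivity
  have c7 : 0 ≤ b ^ 7 * f2 := by positivity
  set e := κ * (x + 1 / 4 * b ^ 4 * h) + (φ2 + b ^ 4 * ψ) with he
  have he0 : 0 ≤ e := by positivity
  have q1 : 0 ≤ (b⁻¹ + ε * (b ^ 3)⁻¹) * φ2 := by positivity
  have q2 : 0 ≤ (b⁻¹ + ε * (b ^ 3)⁻¹) * (κ * x) := by positivity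
  have q3 : 0 ≤ b⁻¹ * (κ * (b ^ 4 * h)) := by positivity
  have q4 : 0 ≤ ε * (b ^ 3)⁻¹ * (κ * (b ^ 4 * h)) := by positivity
  have q5 : 0 ≤ ε * (b ^ 3)⁻¹ * (b ^ 4 * ψ) := by positivity
  have e1 : (b⁻¹ + ε * (b ^ 3)⁻¹) * e = (b⁻¹ + ε * (b ^ 3)⁻¹) * (κ * x)
      + (b⁻¹ * (κ * (b ^ 4 * h)) + ε * (b ^ 3)⁻¹ * (κ * (b ^ 4 * h))) / 4
      + (b⁻¹ + ε * (b ^ 3)⁻¹) * φ2 + b⁻¹ * b ^ 4 * ψ + ε * (b ^ 3)⁻¹ * (b ^ 4 * ψ) := by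
    rw [he]; ring
  have e2 : B ≤ 16 * C₁ * ((b⁻¹ + ε * (b ^ 3)⁻¹) * e) + 4 * ((b⁻¹ + ε * (b ^ 3)⁻¹) * e) := by
    have g1 : 0 ≤ b⁻¹ * e := by positivity
    have g2 : 0 ≤ ε * (b ^ 3)⁻¹ * e := by positivity
    have g3 := mul_nonneg hC₁ g1
    linarith
  have mono : ∀ {u : ℝ}, 0 ≤ u → 8000 * u ≤ (8000 + 16 * C₁) * u := fun {u} hu => by
    have := mul_nonneg hC₁ hu
    linarith
  have f1 := mono (add_nonneg (add_nonneg (add_nonneg (add_nonneg (add_nonneg (add_nonneg a6 a7) a8)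
    c1) c2) a9) c3)
  have f2' := mono (add_nonneg (add_nonneg (add_nonneg (add_nonneg (add_nonneg (add_nonneg (add_nonneg
    a12 c4) c5) a10) a11) c6) a4) c7)
  have s1 := small a1
  have s2 := small a2
  have s3 := small a3
  have s4 := small a4
  have s5 := small a5
  have s6 := one a6
  have s7 := one a7
  have s8 := one a8
  have s9 := one a9
  have s10 := one a10
  have s11 := one a11
  have s12 := one a12
  rw [mul_assoc (8000 + 16 * C₁) (b⁻¹ + ε * (b ^ 3)⁻¹) e]
  linarith only [hk, hs, e2, e1, f1, f2', s1, s2, s3, s4, s5, s6, s7, s8, s9, s10, s11, s12, a1, a2,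
    a3, a4, a5, a6, a7, a8, a9, a10, a11, a12, c1, c2, c3, c4, c5, c6, c7, q1, q2, q3, q4, q5]

namespace Rescaled

variable (X : Rescaled)

/-- The matrix of the time derivative of the metric. -/
def gtMat (y : S3) : Matrix (Fin 3) (Fin 3) ℝ := Matrix.of fun i j => X.Gt y ![] ![i, j]

/-- The sum of the norms obtained by replacing, in one slot at a time, the metric by its time
derivative. -/
def slots {l m : ℕ} (ξ : Tensor l m) (y : S3) : ℝ :=
  ∑ i, ker (Function.update (fun _ => X.G y) i (X.gtMat y)) (fun _ => (X.G y)⁻¹) (ξ y) (ξ y)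
    + ∑ j, ker (fun _ => X.G y)
      (Function.update (fun _ => (X.G y)⁻¹) j (-((X.G y)⁻¹ * X.gtMat y * (X.G y)⁻¹))) (ξ y) (ξ y)

/-- The time derivative of the energy density, relative to the volume form. -/
def densDeriv (b κ : ℝ) (Kt : Tensor 1 1) (Φt : S3 → ℝ) (Ψt : Tensor 0 1) (I : List (Fin 3))
    (y : S3) : ℝ :=
  κ * (2 * ipm (X.G y) (X.G y)⁻¹ (lieI I X.K y) (lieI I Kt y) + X.slots (lieI I X.K) y
      + (1 / 3 * b * X.α' * normSq X.G (cov X.G (lieI I (lowT X.G))) y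
        + 1 / 4 * b ^ 4 * (2 * ipm (X.G y) (X.G y)⁻¹ (cov X.G (lieI I (lowT X.G)) y)
          (cov X.G (lieI I X.Gt) y + X.commDt (lieI I (lowT X.G)) y)
          + X.slots (cov X.G (lieI I (lowT X.G))) y)))
    + (2 * ZI I X.Φ y * ZI I Φt y + (4 / 3 * b * X.α' * normSq X.G (lieI I X.Ψ) y
        + b ^ 4 * (2 * ipm (X.G y) (X.G y)⁻¹ (lieI I X.Ψ y) (lieI I Ψt y)
          + X.slots (lieI I X.Ψ) y)))
    + X.dens κ I y * (1 / 2 * ((X.G y)⁻¹ * X.gtMat y).trace)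

/-- Pointwise bounds for the low order variables. -/
structure LowBounds (b C₁ ε : ℝ) (y : S3) : Prop where
  N_le : b ^ 2 * |X.N y| ≤ 1
  grad_le : ipm (X.G y) (X.G y)⁻¹ (b ^ 4 • grad X.N y) (b ^ 4 • grad X.N y) ≤ b ^ 2
  q_le : |normSq X.G X.K y + 2 * sqt * X.Φ y + X.Φ y ^ 2| ≤ 1 / 3
  K_le : normSq X.G X.K y ≤ (C₁ * ε) ^ 2

end Rescaled

/-! ### Bounds for the time derivative of the metric -/

namespace SliceEqs

variable {b : ℝ} {X : Rescaled} {Kt : Tensor 1 1} {Φt : S3 → ℝ} {Ψt : Tensor 0 1}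
  (E : SliceEqs b X Kt Φt Ψt) {I : List (Fin 3)} (hI : I.length ≤ 16) {κ ε C₁ : ℝ}
include E

theorem gtMat_eq (y : S3) : X.gtMat y = (-2 * (b ^ 3)⁻¹ * (1 + b ^ 4 * X.N y)) • (X.G y * m11 (X.K y))
    + (2 / 3 * b * X.α' * X.N y) • X.G y := by
  ext i j
  have h1 : lowMul (lowT X.G) X.K y ![] ![i, j] = (X.G y * m11 (X.K y)) i j := by
    rw [Matrix.mul_apply]
    rfl
  simp only [Rescaled.gtMat, Matrix.of_apply, E.metric_eq, Pi.add_apply, Pi.smul_apply, smul_eq_mul,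
    smulT, Matrix.add_apply, Matrix.smul_apply, h1]
  have hb := E.b_pos.ne'
  simp only [ofScalar, lowT, Matrix.cons_val_zero, Matrix.cons_val_one]
  field_simp
  ring

/-- The volume form feels only the lapse perturbation: the K part of ∂_t G is trace-free. -/
theorem trace_gtMat (y : S3) : 1 / 2 * ((X.G y)⁻¹ * X.gtMat y).trace = b * X.α' * X.N y := by
  have h1 : (X.G y)⁻¹ * (X.G y * m11 (X.K y)) = m11 (X.K y) := by
    rw [← Matrix.mul_assoc, E.met.inv_mul, Matrix.one_mul]
  have h2 : (m11 (X.K y)).trace = 0 := E.tr y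
  rw [E.gtMat_eq, Matrix.mul_add, Matrix.mul_smul, Matrix.mul_smul, h1, E.met.inv_mul,
    Matrix.trace_add, Matrix.trace_smul, Matrix.trace_smul, h2, Matrix.trace_one]
  simp
  ring

theorem abs_α'_le : |X.α'| ≤ 1 := by
  rw [abs_le]
  have := E.friedmann
  have := pow_pos E.b_pos 4
  constructor <;> nlinarith

variable (hε : 0 < ε) (hC₁ : 0 ≤ C₁) {y : S3} (L : X.LowBounds b C₁ ε y)
include L

theorem b4N_le : |b ^ 4 * X.N y| ≤ 1 := by
  have hb := E.b_pos
  have e : b ^ 4 * X.N y = b ^ 2 * (b ^ 2 * X.N y) := by ring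
  rw [e, abs_mul, abs_of_pos (pow_pos hb 2), abs_mul, abs_of_pos (pow_pos hb 2)]
  exact mul_le_one₀ (pow_le_one₀ hb.le E.b_le) (by positivity) L.N_le

theorem trace_term_le : |b * X.α' * X.N y| ≤ b⁻¹ := by
  have hb := E.b_pos
  have h1 := L.N_le
  have h2 : |X.N y| ≤ (b ^ 2)⁻¹ := by
    rw [← one_div, le_div_iff₀ (by positivity), mul_comm]
    exact h1
  calc |b * X.α' * X.N y| = b * |X.α'| * |X.N y| := by rw [abs_mul, abs_mul, abs_of_pos hb]
    _ ≤ b * 1 * (b ^ 2)⁻¹ := by gcongr; exact E.abs_α'_le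
    _ = b⁻¹ := by field_simp

include hε hC₁

/-- The singular part of ∂_t G is a⁻¹K. The pointwise bound C₁ε for K, free of the loss a^{-σ},
makes its coefficient ε a⁻¹; the lapse part is controlled by b⁻¹ = a^{-1/3}. -/
theorem gtMat_posSemidef {s : ℝ} (hs : |s| = 1) :
    ((4 * C₁ * ε * (b ^ 3)⁻¹ + b⁻¹) • X.G y + s • X.gtMat y).PosSemidef := by
  have hb := E.b_pos
  rw [E.gtMat_eq]
  refine posSemidef_add_smul (E.met.mul_inv y) (E.met.pos y).posSemidef
    (E.met.pos y).inv.posSemidef (E.symm y) (b := C₁ * ε) (by positivity) L.K_le ?_ hs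
  have h1 : |-2 * (b ^ 3)⁻¹ * (1 + b ^ 4 * X.N y)| ≤ 4 * (b ^ 3)⁻¹ := by
    have h2 : |1 + b ^ 4 * X.N y| ≤ 2 := by
      have := abs_add_le 1 (b ^ 4 * X.N y)
      have := E.b4N_le L
      simp only [abs_one] at *
      linarith
    rw [abs_mul, abs_mul, abs_of_pos (a := (b ^ 3)⁻¹) (by positivity)]
    norm_num
    have : 0 < (b ^ 3)⁻¹ := by positivity
    nlinarith
  have h3 : |2 / 3 * b * X.α' * X.N y| ≤ b⁻¹ := by
    have e : 2 / 3 * b * X.α' * X.N y = 2 / 3 * (b * X.α' * X.N y) := by ring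
    rw [e, abs_mul, abs_of_pos (by norm_num)]
    have := E.trace_term_le L
    have := inv_pos.2 hb
    linarith
  have h4 : |-2 * (b ^ 3)⁻¹ * (1 + b ^ 4 * X.N y)| * (C₁ * ε) ≤ 4 * (b ^ 3)⁻¹ * (C₁ * ε) := by gcongr
  linarith

theorem abs_slots_le {l m : ℕ} (ξ : Tensor l m) :
    |X.slots ξ y| ≤ (l + m) * ((4 * C₁ * ε * (b ^ 3)⁻¹ + b⁻¹) * normSq X.G ξ y) :=
  BigCrunch.abs_slots_le (E.met.mul_inv y) (E.met.pos y).posSemidef (E.met.pos y).inv.posSemidef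
    (fun _ hs => E.gtMat_posSemidef hε hC₁ L hs) (ξ y)

end SliceEqs

/-! ### The pointwise differential inequality for the energy density -/

namespace SliceEqs

variable {b : ℝ} {X : Rescaled} {Kt : Tensor 1 1} {Φt : S3 → ℝ} {Ψt : Tensor 0 1}
  (E : SliceEqs b X Kt Φt Ψt) {I : List (Fin 3)} (hI : I.length ≤ 16) {κ ε C₁ : ℝ}
  (hκ : 0 < κ) (hκ1 : κ * 12000 ≤ 1) (hε : 0 < ε) (hC₁ : 0 ≤ C₁)
include E hI hκ hκ1 hε hC₁

/-- The two energy identities, the density inequalities with the low order bounds inserted, and the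
slot bounds are added with weight κ on the metric part. The divergence field is the same combination
of the two fields. -/
theorem densDeriv_le (L : ∀ y, X.LowBounds b C₁ ε y) : ∃ V : Tensor 1 0, TSm 1 V ∧ ∀ y,
    X.densDeriv b κ Kt Φt Ψt I y
      ≤ divV X.G V y + X.boundDens (κ / 6) (8000 + 16 * C₁) κ ε I y := by
  obtain ⟨V, hV, hVe⟩ := E.metric_identity hI
  obtain ⟨W, hW, hWe⟩ := E.sf_identity hI
  have hM : MetricSm 1 X.G := E.met.of_le (by norm_num)
  refine ⟨κ • V + W, (hV.smul κ).add hW, fun y => ?_⟩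
  rw [divV_add hM (hV.smul κ) hW, divV_const_smul hM κ hV]
  have hb := E.b_pos
  have hβ : 0 ≤ -X.α' := neg_nonneg.2 E.α'_nonpos
  have hβb : (-X.α') ^ 2 = 1 - b ^ 4 := by rw [neg_sq, E.friedmann]
  have pg := (E.met.pos y).posSemidef
  have pk := (E.met.pos y).inv.posSemidef
  have nn : ∀ {l m : ℕ} (ξ : Tensor l m), 0 ≤ normSq X.G ξ y := fun ξ => normSq_nonneg E.met ξ y
  have hm := metric_density_le (E.met.mul_inv y) pg pk hb E.b_le hβ hβb hε (L y).N_le (lieI I X.K y)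
    (X.ricError I y) (X.secBorder I y) (X.secJunk I y) (cov X.G (lieI I (lowT X.G)) y)
    (X.gradMetBorder I y) (X.gradMetJunk I y) (lieI I X.Ψ y) (X.momBorderDown I y)
    (grad (ZI I X.N) y) (b ^ 4 • grad X.N y) (X.momBorderUp I y) (L y).grad_le
  have hs := sf_density_le pg pk hb E.b_le hβ hβb hε (φ := ZI I X.Φ y) (f := ZI I X.N y)
    (B₀ := X.timeBorder I y) (J₀ := X.timeJunk I y) (Bn := X.lapseBorder I y)
    (Jn := X.lapseJunk I y) (L y).q_le (lieI I X.Ψ y) (grad (ZI I X.N) y) (b ^ 4 • grad X.N y)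
    (X.spaceBorder I y) (X.spaceJunk I y) (L y).grad_le
  have hVy := hVe y
  have hWy := hWe y
  simp only [neg_neg] at hm hs hVy hWy
  have hm' := sub_le_iff_le_add'.2 (hVy.le.trans (add_le_add le_rfl hm))
  have hs' := sub_le_iff_le_add'.2 (hWy.le.trans (add_le_add le_rfl hs))
  clear hm hs hVy hWy
  have sx := E.abs_slots_le hε hC₁ (L y) (lieI I X.K)
  have sh := E.abs_slots_le hε hC₁ (L y) (cov X.G (lieI I (lowT X.G)))
  have sψ := E.abs_slots_le hε hC₁ (L y) (lieI I X.Ψ)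
  have st := E.trace_term_le (L y)
  rw [← E.trace_gtMat y] at st
  set c := 4 * C₁ * ε * (b ^ 3)⁻¹ + b⁻¹ with hc
  have hbi : 0 < b⁻¹ := inv_pos.2 hb
  have hcb : b⁻¹ ≤ c := by
    have : 0 ≤ 4 * C₁ * ε * (b ^ 3)⁻¹ := by positivity
    linarith
  have hc0 : 0 ≤ c := hbi.le.trans hcb
  set e := κ * (normSq X.G (lieI I X.K) y
      + 1 / 4 * b ^ 4 * normSq X.G (cov X.G (lieI I (lowT X.G))) y)
    + (ZI I X.Φ y ^ 2 + b ^ 4 * normSq X.G (lieI I X.Ψ) y) with he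
  have hdens : X.dens κ I y = e := by
    rw [Rescaled.dens, E.α_eq, cube_rpow_four_thirds hb]
  have n1 := nn (lieI I X.K)
  have n2 := nn (cov X.G (lieI I (lowT X.G)))
  have n3 := nn (lieI I X.Ψ)
  have n4 := sq_nonneg (ZI I X.Φ y)
  have he0 : 0 ≤ e := by positivity
  -- The constant 4 counts the largest number of slots, three for ∇L^I G, and one more for the
  -- volume form.
  have hB : κ * X.slots (lieI I X.K) y
      + κ * (1 / 4 * b ^ 4) * X.slots (cov X.G (lieI I (lowT X.G))) y
      + b ^ 4 * X.slots (lieI I X.Ψ) y + e * (1 / 2 * ((X.G y)⁻¹ * X.gtMat y).trace)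
      ≤ 4 * (c * e) := by
    have t1 := mul_le_mul_of_nonneg_left (le_of_abs_le sx) hκ.le
    have t2 := mul_le_mul_of_nonneg_left (le_of_abs_le sh)
      (by positivity : 0 ≤ κ * (1 / 4 * b ^ 4))
    have t3 := mul_le_mul_of_nonneg_left (le_of_abs_le sψ) (pow_pos hb 4).le
    have t4 := mul_le_mul_of_nonneg_left ((le_of_abs_le st).trans hcb) he0
    norm_num at t1 t2 t3
    have p1 : 0 ≤ c * (κ * normSq X.G (lieI I X.K) y) := by positivity
    have p2 : 0 ≤ c * (κ * (b ^ 4 * normSq X.G (cov X.G (lieI I (lowT X.G))) y)) := by positivity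
    have p3 : 0 ≤ c * (b ^ 4 * normSq X.G (lieI I X.Ψ) y) := by positivity
    have p4 : 0 ≤ c * ZI I X.Φ y ^ 2 := by positivity
    have e2 : c * e = c * (κ * normSq X.G (lieI I X.K) y)
        + c * (κ * (b ^ 4 * normSq X.G (cov X.G (lieI I (lowT X.G))) y)) / 4
        + c * ZI I X.Φ y ^ 2 + c * (b ^ 4 * normSq X.G (lieI I X.Ψ) y) := by
      rw [he]; ring
    linarith only [t1, t2, t3, t4, p1, p2, p3, p4, e2]
  have key := combine_densities hκ hκ1 hb hβ hε hm' hs' hB hC₁ n1 n2 n3 (nn (grad (ZI I X.N)))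
    (sq_nonneg _) n4 (nn (X.momBorderDown I)) (nn (X.momBorderUp I)) (nn (X.gradMetBorder I))
    (nn (X.secBorder I)) (nn (X.ricError I)) (nn (X.secJunk I)) (nn (X.gradMetJunk I))
    (sq_nonneg _) (sq_nonneg _) (nn (X.spaceBorder I)) (sq_nonneg _) (sq_nonneg _)
    (nn (X.spaceJunk I))
  have hα : |X.α'| = -X.α' := abs_of_nonpos E.α'_nonpos
  have e3 : (b ^ 3) ^ 3 = b ^ 9 := by ring
  have e4 : (b ^ 3) ^ 4 = b ^ 12 := by ring
  rw [Rescaled.densDeriv, hdens, Rescaled.boundDens, hdens, Rescaled.dissDens, Rescaled.borderDens,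
    Rescaled.junkDens]
  simp only [normSq_ofScalar, E.α_eq, cube_rpow_one_third hb, cube_rpow_five_thirds hb,
    cube_rpow_seven_thirds hb, cube_rpow_neg_one_third hb, hα, e3, e4, one_div ε]
  have nsq : ∀ {l m : ℕ} (ξ : Tensor l m), normSq X.G ξ y = ipm (X.G y) (X.G y)⁻¹ (ξ y) (ξ y) :=
    fun _ => rfl
  simp only [nsq] at key he ⊢
  rw [← he] at key
  clear_value e
  linarith only [key]

end SliceEqs

/-! ## Regularity of the error terms -/

theorem Ck.ite {r : ℕ} {T : ℝ} {p : Prop} [Decidable p] {f : ℝ → S3 → ℝ} (h : Ck r T f) :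
    Ck r T fun t y => if p then f t y else 0 := by
  split_ifs
  · exact h
  · exact Ck.const 0

theorem Ck.sum3 {r : ℕ} {T : ℝ} {I : List (Fin 3)}
    {H : List (Fin 3) → List (Fin 3) → List (Fin 3) → ℝ → S3 → ℝ}
    (h : ∀ I₁ I₂ I₃, I₁.length + I₂.length + I₃.length = I.length → Ck r T (H I₁ I₂ I₃)) :
    Ck r T fun t y => BigCrunch.sum3 I fun I₁ I₂ I₃ => H I₁ I₂ I₃ t y :=
  Ck.sum2 (H := fun I₁ J t y => BigCrunch.sum2 J fun I₂ I₃ => H I₁ I₂ I₃ t y) fun I₁ J hl =>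
    Ck.sum2 (H := fun I₂ I₃ => H I₁ I₂ I₃) fun I₂ I₃ hl' => h I₁ I₂ I₃ (by omega)

section tensors

variable {r : ℕ} {T : ℝ} {G : ℝ → Metric3}

theorem MetricCk.sharp2 (h : MetricCk r T G) {ξ : ℝ → Tensor 0 2} (hξ : TCk r T ξ) :
    TCk r T fun t => sharp2 (G t) (ξ t) := fun _ _ => Ck.sum fun _ _ => (h.inv _ _).mul (hξ _ _)

theorem MetricCk.sharp1 (h : MetricCk r T G) {ξ : ℝ → Tensor 0 1} (hξ : TCk r T ξ) :
    TCk r T fun t => sharp1 (G t) (ξ t) := fun _ _ => Ck.sum fun _ _ => (h.inv _ _).mul (hξ _ _)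

theorem MetricCk.hess (h : MetricCk (r + 1) T G) {f : ℝ → S3 → ℝ} (hf : Ck (r + 2) T f) :
    TCk r T fun t => hess (G t) (f t) := h.cov (TCk.grad hf)

theorem MetricCk.lap (h : MetricCk (r + 2) T G) {l m : ℕ} {ξ : ℝ → Tensor l m}
    (hξ : TCk (r + 2) T ξ) : TCk r T fun t => lap (G t) (ξ t) := fun _ _ =>
  Ck.sum fun _ _ => Ck.sum fun _ _ => ((h.of_le (by omega)).inv _ _).mul
    ((h.of_le (q := r + 1) (by omega)).cov (h.cov hξ) _ _)

theorem MetricCk.lapS (h : MetricCk (r + 1) T G) {f : ℝ → S3 → ℝ} (hf : Ck (r + 2) T f) :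
    Ck r T fun t => lapS (G t) (f t) :=
  Ck.sum fun _ _ => Ck.sum fun _ _ => ((h.of_le (by omega)).inv _ _).mul (h.hess hf _ _)

theorem MetricCk.trG (h : MetricCk r T G) {ξ : ℝ → Tensor 0 2} (hξ : TCk r T ξ) :
    Ck r T fun t => trG (G t) (ξ t) :=
  Ck.sum fun _ _ => Ck.sum fun _ _ => (h.inv _ _).mul (hξ _ _)

theorem MetricCk.div01 (h : MetricCk (r + 1) T G) {ξ : ℝ → Tensor 0 1} (hξ : TCk (r + 1) T ξ) :
    Ck r T fun t => div01 (G t) (ξ t) :=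
  Ck.sum fun _ _ => Ck.sum fun _ _ => ((h.of_le (by omega)).inv _ _).mul (h.cov hξ _ _)

theorem MetricCk.div02 (h : MetricCk (r + 1) T G) {ξ : ℝ → Tensor 0 2} (hξ : TCk (r + 1) T ξ) :
    TCk r T fun t => div02 (G t) (ξ t) := fun _ _ =>
  Ck.sum fun _ _ => Ck.sum fun _ _ => ((h.of_le (by omega)).inv _ _).mul (h.cov hξ _ _)

theorem MetricCk.div11 (h : MetricCk (r + 1) T G) {ξ : ℝ → Tensor 1 1} (hξ : TCk (r + 1) T ξ) :
    TCk r T fun t => div11 (G t) (ξ t) := fun _ _ => Ck.sum fun _ _ => h.cov hξ _ _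

theorem MetricCk.div11Sharp (h : MetricCk (r + 1) T G) {ξ : ℝ → Tensor 1 1}
    (hξ : TCk (r + 1) T ξ) : TCk r T fun t => div11Sharp (G t) (ξ t) := fun _ _ =>
  Ck.sum fun _ _ => Ck.sum fun _ _ => ((h.of_le (by omega)).inv _ _).mul (h.cov hξ _ _)

theorem MetricCk.normSq (h : MetricCk r T G) {l m : ℕ} {ξ : ℝ → Tensor l m} (hξ : TCk r T ξ) :
    Ck r T fun t => normSq (G t) (ξ t) :=
  Ck.sum fun _ _ => Ck.sum fun _ _ => Ck.sum fun _ _ => Ck.sum fun _ _ =>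
    (((Ck.prod fun _ _ => h.smooth _ _).mul (Ck.prod fun _ _ => h.inv _ _)).mul (hξ _ _)).mul (hξ _ _)

end tensors

/-- Regularity of a family of rescaled variables. -/
structure SlabReg (T : ℝ) (X : ℝ → Rescaled) : Prop where
  α_pos : ∀ t ∈ Set.Ico 0 T, 0 < (X t).α
  α_rpow : ∀ p : ℝ, Ck 1 T fun t _ => (X t).α ^ p
  α_ck : Ck 1 T fun t _ => (X t).α
  α'_ck : Ck 1 T fun t _ => (X t).α'
  met : MetricCk 18 T fun t => (X t).G
  K : TCk 17 T fun t => (X t).K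
  N : Ck 18 T fun t => (X t).N
  Φ : Ck 17 T fun t => (X t).Φ
  Ψ : TCk 17 T fun t => (X t).Ψ
  Gt : TCk 17 T fun t => (X t).Gt

theorem slabReg_rescale {a : ℝ → ℝ} {Tc T : ℝ} (ha : IsScaleFactor a Tc) (hT : T ≤ Tc) {S : Fields}
    (hS : IsSolution a T S) : SlabReg T (rescale a S) where
  α_pos t ht := ha.pos t (ha.mem hT ht)
  α_rpow p := ha.ck_rpow hT p
  α_ck := ha.ck hT
  α'_ck := ha.ck_deriv hT
  met := metricCk_rescale ha hT hS
  K := tck_K ha hT hS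
  N := ck_N ha hT hS
  Φ := ck_Φ ha hT hS
  Ψ := tck_Ψ ha hT hS
  Gt := tck_Gt ha hT hS

namespace SlabReg

variable {T : ℝ} {X : ℝ → Rescaled} (R : SlabReg T X) {I : List (Fin 3)} (hI : I.length ≤ 16)
include R

theorem rpow (p : ℝ) : Ck 0 T fun t _ => (X t).α ^ p := (R.α_rpow p).of_le (by norm_num)

theorem α' : Ck 0 T fun t _ => (X t).α' := R.α'_ck.of_le (by norm_num)

theorem α : Ck 0 T fun t _ => (X t).α := R.α_ck.of_le (by norm_num)

theorem G₀ : MetricCk 0 T fun t => (X t).G := R.met.of_le (by norm_num)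

theorem G₁ : MetricCk 1 T fun t => (X t).G := R.met.of_le (by norm_num)

include hI

theorem K_lie : TCk 1 T fun t => lieI I (X t).K := TCk.lieI (R.K.of_le (by omega))

theorem G_lie : TCk 2 T fun t => lieI I (lowT (X t).G) := TCk.lieI ((R.met.lowT).of_le (by omega))

theorem Gi_lie : TCk 0 T fun t => lieI I (invT (X t).G) := TCk.lieI ((R.met.invT).of_le (by omega))

theorem N_lie : Ck 2 T fun t => ZI I (X t).N := Ck.ZI (R.N.of_le (by omega))

theorem Φ_lie : Ck 1 T fun t => ZI I (X t).Φ := Ck.ZI (R.Φ.of_le (by omega))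

theorem Ψ_lie : TCk 1 T fun t => lieI I (X t).Ψ := TCk.lieI (R.Ψ.of_le (by omega))

theorem K₀ : TCk 0 T fun t => lieI I (X t).K := (R.K_lie hI).of_le (by norm_num)

theorem GL₀ : TCk 0 T fun t => lieI I (lowT (X t).G) := (R.G_lie hI).of_le (by norm_num)

theorem N₀ : Ck 0 T fun t => ZI I (X t).N := (R.N_lie hI).of_le (by norm_num)

theorem Φ₀ : Ck 0 T fun t => ZI I (X t).Φ := (R.Φ_lie hI).of_le (by norm_num)

theorem Ψ₀ : TCk 0 T fun t => lieI I (X t).Ψ := (R.Ψ_lie hI).of_le (by norm_num)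

theorem ZN₀ (c : Fin 3) : Ck 0 T fun t => Z c (ZI I (X t).N) :=
  ((R.N_lie hI).Z (r := 1) c).of_le (by norm_num)

theorem covG₁ : TCk 1 T fun t => cov (X t).G (lieI I (lowT (X t).G)) :=
  (R.met.of_le (by norm_num)).cov (R.G_lie hI)

theorem covG₀ : TCk 0 T fun t => cov (X t).G (lieI I (lowT (X t).G)) :=
  (R.covG₁ hI).of_le (by norm_num)

theorem covK₀ : TCk 0 T fun t => cov (X t).G (lieI I (X t).K) := R.G₁.cov (R.K_lie hI)

/-- The derivative count is exact: the divergence of K ∈ C¹⁷ is C¹⁶, and up to 16 Lie derivatives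
leave a continuous field. The same count for the Ricci tensor of a C¹⁸ metric is made in `ric_lie`.
-/
theorem momBorderDown : TCk 0 T fun t => (X t).momBorderDown I := fun _ _ => by
  refine Ck.sub (Ck.neg (Ck.sub (TCk.lieI (ξ := fun t => div11 (X t).G (X t).K)
    (((R.met.of_le (by omega)).div11 (r := 16) R.K).of_le (by omega)) _ _)
    (R.G₁.div11 (R.K_lie hI) _ _))) ?_
  exact Ck.sum2 fun I₁ I₂ hl => (R.Φ₀ (I := I₁) (by omega)).mul (R.Ψ₀ (I := I₂) (by omega) _ _)

theorem momBorderUp : TCk 0 T fun t => (X t).momBorderUp I := fun _ _ => by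
  refine Ck.sub (Ck.sub (Ck.neg (Ck.sub (TCk.lieI (ξ := fun t => div11Sharp (X t).G (X t).K)
    (((R.met.of_le (by omega)).div11Sharp (r := 16) R.K).of_le (by omega)) _ _)
    (R.G₁.div11Sharp (R.K_lie hI) _ _))) ((Ck.const _).mul ?_)) ?_
  · exact Ck.sum2 fun I₁ I₂ hl => Ck.ite (Ck.sum fun c _ =>
      (R.Gi_lie (I := I₁) (by omega) _ _).mul (R.Ψ₀ (I := I₂) (by omega) _ _))
  · exact Ck.sum3 fun I₁ I₂ I₃ hl => (R.Φ₀ (I := I₁) (by omega)).mul (Ck.sum fun c _ =>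
      (R.Gi_lie (I := I₂) (by omega) _ _).mul (R.Ψ₀ (I := I₃) (by omega) _ _))

theorem commDt : TCk 0 T fun t => (X t).commDt (lieI I (lowT (X t).G)) := fun _ _ => by
  have hG : TCk 0 T fun t => cov (X t).G (X t).Gt := R.G₁.cov (R.Gt.of_le (by norm_num))
  have hc : ∀ c d i, Ck 0 T fun t y => (X t).chrDt y c d i := fun c d i =>
    (Ck.const _).mul (Ck.sum fun e _ => (R.G₀.inv _ _).mul (((hG _ _).add (hG _ _)).sub (hG _ _)))
  exact Ck.neg (Ck.sum fun d _ => ((hc _ _ _).mul (R.GL₀ hI _ _)).add ((hc _ _ _).mul (R.GL₀ hI _ _)))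

theorem gradMetBorder : TCk 0 T fun t => (X t).gradMetBorder I := fun _ _ => by
  refine Ck.add (Ck.sub (Ck.mul (Ck.mul ((Ck.const _).mul (R.rpow _)) (R.ZN₀ hI _))
    (Ck.sum fun d _ => (R.G₀.smooth _ _).mul ((R.K.of_le (by norm_num)) _ _)))
    ((Ck.const _).mul (Ck.sum2 fun I₁ I₂ hl => Ck.add (Ck.sum fun d _ =>
      (R.covG₀ (I := I₁) (by omega) _ _).mul (R.K₀ (I := I₂) (by omega) _ _)) (Ck.ite (Ck.sum fun d _ =>
      (R.GL₀ (I := I₁) (by omega) _ _).mul (R.covK₀ (I := I₂) (by omega) _ _))))))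
    (R.α.mul (R.commDt hI _ _))

theorem gradMetJunk : TCk 0 T fun t => (X t).gradMetJunk I := fun _ _ => by
  refine Ck.sub (Ck.mul ((Ck.const _).mul R.α') (Ck.sum2 fun I₁ I₂ hl => Ck.add (Ck.ite
    ((R.ZN₀ (I := I₁) (by omega) _).mul (R.GL₀ (I := I₂) (by omega) _ _)))
    ((R.N₀ (I := I₁) (by omega)).mul (R.covG₀ (I := I₂) (by omega) _ _))))
    ((Ck.const _).mul (Ck.sum3 fun I₁ I₂ I₃ hl => Ck.add (Ck.add (Ck.ite
      ((R.ZN₀ (I := I₁) (by omega) _).mul (Ck.sum fun d _ => (R.GL₀ (I := I₂) (by omega) _ _).mul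
        (R.K₀ (I := I₃) (by omega) _ _))))
      ((R.N₀ (I := I₁) (by omega)).mul (Ck.sum fun d _ => (R.covG₀ (I := I₂) (by omega) _ _).mul
        (R.K₀ (I := I₃) (by omega) _ _)))) (Ck.ite
      ((R.N₀ (I := I₁) (by omega)).mul (Ck.sum fun d _ => (R.GL₀ (I := I₂) (by omega) _ _).mul
        (R.covK₀ (I := I₃) (by omega) _ _))))))

theorem ric_lie : TCk 0 T fun t => lieI I (ricSharp (X t).G) :=
  TCk.lieI ((R.met.ricSharp (r := 16)).of_le (by omega))

theorem ricError : TCk 0 T fun t => (X t).ricError I := fun _ _ => by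
  have h2 : MetricCk 2 T fun t => (X t).G := R.met.of_le (by norm_num)
  have hw := h2.div02 (r := 1) (R.G_lie hI)
  exact ((((R.ric_lie hI _ _).add ((Ck.const _).mul (R.G₀.sharp2 (h2.lap (R.G_lie hI)) _ _))).add
    ((Ck.const _).mul (R.G₀.sharp2 (R.G₁.hess (h2.trG (R.G_lie hI))) _ _))).sub
    ((Ck.const _).mul (R.G₀.sharp2 (R.G₁.cov hw) _ _))).sub
    ((Ck.const _).mul (R.G₁.cov (R.G₁.sharp1 hw) _ _))

theorem secBorder : TCk 0 T fun t => (X t).secBorder I := fun _ _ =>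
  (R.α'.neg.mul (R.N₀ hI)).mul ((R.K.of_le (by norm_num)) _ _)

theorem secJunk : TCk 0 T fun t => (X t).secJunk I := fun _ _ => by
  have hh : TCk 16 T fun t => hess (X t).G (X t).N := (R.met.of_le (by norm_num)).hess R.N
  have hr : TCk 16 T fun t => ricSharp (X t).G := R.met.ricSharp
  have hN : Ck 16 T fun t => (X t).N := R.N.of_le (by norm_num)
  have hhI : TCk 0 T fun t => lieI I (hess (X t).G (X t).N) := TCk.lieI (hh.of_le (by omega))
  refine Ck.sub (Ck.sub (Ck.add (Ck.add (Ck.add (R.α'.neg.mul ?_) ((R.rpow _).mul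
    (R.G₀.sharp2 (ξ := fun t => hess (X t).G (ZI I (X t).N) - lieI I (hess (X t).G (X t).N))
      (fun a b => (R.G₁.hess (R.N_lie hI) a b).sub (hhI a b)) _ _)))
    ((R.rpow _).mul ((R.G₀.sharp2 hhI _ _).sub (TCk.lieI (ξ := fun t => sharp2 (X t).G
      (hess (X t).G (X t).N)) (((R.met.of_le (by norm_num)).sharp2 hh).of_le (by omega)) _ _))))
    ((R.rpow _).mul ((TCk.lieI (ξ := fun t x i j => (X t).N x * ricSharp (X t).G x i j)
      ((show TCk 16 T _ from fun a b => hN.mul (hr a b)).of_le (by omega)) _ _).sub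
      ((R.N.of_le (by norm_num)).mul (R.ric_lie hI _ _))))) ?_) ((R.rpow _).mul ?_)
  · exact Ck.sum2 fun I₁ I₂ hl => Ck.ite ((R.N₀ (I := I₁) (by omega)).mul
      (R.K₀ (I := I₂) (by omega) _ _))
  · exact Ck.sum3 fun I₁ I₂ I₃ hl => (Ck.sum fun c _ => (R.Gi_lie (I := I₁) (by omega) _ _).mul
      (R.Ψ₀ (I := I₂) (by omega) _ _)).mul (R.Ψ₀ (I := I₃) (by omega) _ _)
  · exact Ck.sum2 (H := fun I₁ J t y => BigCrunch.sum3 J fun I₂ I₃ I₄ => _) fun I₁ J hl =>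
      Ck.sum3 fun I₂ I₃ I₄ hl' => ((Ck.sum fun c _ => (R.Gi_lie (I := I₁) (by omega) _ _).mul
      (R.Ψ₀ (I := I₃) (by omega) _ _)).mul (R.N₀ (I := I₂) (by omega))).mul
      (R.Ψ₀ (I := I₄) (by omega) _ _)

theorem timeBorder : Ck 0 T fun t => (X t).timeBorder I :=
  (R.α'.neg.mul (R.N₀ hI)).mul (R.Φ.of_le (by norm_num))

theorem timeJunk : Ck 0 T fun t => (X t).timeJunk I := by
  have hd : Ck 16 T fun t => div01 (X t).G (X t).Ψ := (R.met.of_le (by norm_num)).div01 R.Ψ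
  have hN : Ck 16 T fun t => (X t).N := R.N.of_le (by norm_num)
  have hdI := R.G₁.div01 (R.Ψ_lie hI)
  refine Ck.add (Ck.add (Ck.add (R.α'.neg.mul ?_) (Ck.sub (Ck.ZI (hd.of_le (by omega))) hdI))
    ((R.rpow _).mul (Ck.sub (Ck.ZI ((hN.mul hd).of_le (by omega)))
      ((hN.of_le (by norm_num)).mul hdI)))) ((R.rpow _).mul ?_)
  · exact Ck.sum2 fun I₁ I₂ hl => Ck.ite ((R.N₀ (I := I₁) (by omega)).mul
      (R.Φ₀ (I := I₂) (by omega)))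
  · exact Ck.sum3 fun I₁ I₂ I₃ hl => Ck.sum fun c _ => Ck.sum fun d _ =>
      ((R.ZN₀ (I := I₁) (by omega) _).mul (R.Gi_lie (I := I₂) (by omega) _ _)).mul
      (R.Ψ₀ (I := I₃) (by omega) _ _)

theorem spaceBorder : TCk 0 T fun t => (X t).spaceBorder I := fun _ _ =>
  (R.Φ.of_le (by norm_num)).mul (R.ZN₀ hI _)

theorem spaceJunk : TCk 0 T fun t => (X t).spaceJunk I := fun _ _ => by
  have hN : Ck 16 T fun t => (X t).N := R.N.of_le (by norm_num)
  have hΦ : Ck 16 T fun t => (X t).Φ := R.Φ.of_le (by norm_num)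
  have gN : TCk 16 T fun t => grad (X t).N := TCk.grad (R.N.of_le (by norm_num))
  have gΦ : TCk 16 T fun t => grad (X t).Φ := TCk.grad R.Φ
  exact ((TCk.lieI (ξ := fun t x i j => (X t).N x * grad (X t).Φ x i j)
    ((show TCk 16 T _ from fun a b => hN.mul (gΦ a b)).of_le (by omega)) _ _).sub
    ((hN.of_le (by norm_num)).mul (TCk.lieI (gΦ.of_le (by omega)) _ _))).add
    ((TCk.lieI (ξ := fun t x i j => (X t).Φ x * grad (X t).N x i j)
    ((show TCk 16 T _ from fun a b => hΦ.mul (gN a b)).of_le (by omega)) _ _).sub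
    ((hΦ.of_le (by norm_num)).mul (TCk.lieI (gN.of_le (by omega)) _ _)))

theorem lapseBorder : Ck 0 T fun t => (X t).lapseBorder I :=
  (Ck.sum2 fun I₁ I₂ hl => Ck.sum fun c _ => Ck.sum fun d _ => (R.K₀ (I := I₁) (by omega) _ _).mul
    (R.K₀ (I := I₂) (by omega) _ _)).add
  (Ck.sum2 fun I₁ I₂ hl => (R.Φ₀ (I := I₁) (by omega)).mul (R.Φ₀ (I := I₂) (by omega)))

theorem lapseJunk : Ck 0 T fun t => (X t).lapseJunk I := by
  have hN : Ck 16 T fun t => (X t).N := R.N.of_le (by norm_num)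
  have hΦ : Ck 16 T fun t => (X t).Φ := R.Φ.of_le (by norm_num)
  have hK : Ck 16 T fun t => normSq (X t).G (X t).K :=
    (R.met.of_le (by norm_num)).normSq (R.K.of_le (by norm_num))
  have hl : Ck 16 T fun t => lapS (X t).G (X t).N := (R.met.of_le (by norm_num)).lapS R.N
  have z : ∀ {f : ℝ → S3 → ℝ}, Ck 16 T f → Ck 0 T f := fun hf => hf.of_le (by norm_num)
  have zI : ∀ {f : ℝ → S3 → ℝ}, Ck 16 T f → Ck 0 T fun t => ZI I (f t) := fun hf =>
    Ck.ZI (hf.of_le (by omega))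
  exact ((((R.rpow _).mul ((R.G₁.lapS (R.N_lie hI)).sub (zI hl))).add
    ((zI (hK.mul hN)).sub ((z hK).mul (zI hN)))).add ((Ck.const _).mul
    ((zI (hΦ.mul hN)).sub ((z hΦ).mul (zI hN))))).add
    ((zI ((hΦ.pow 2).mul hN)).sub ((z (hΦ.pow 2)).mul (zI hN)))

end SlabReg

/-! ## Integration of the density inequality -/

section integralVol

variable {G : Metric3} (hG : MetricSm 0 G) {f g : S3 → ℝ}
include hG

theorem MetricSm.sqrt_det_sm : Sm 0 fun y => Real.sqrt (G y).det := hG.ck.sqrt_det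

theorem integrable_vol (hf : Sm 0 f) : Integrable (fun y => f y * Real.sqrt (G y).det) roundVol :=
  integrable_of_continuous (hf.mul hG.sqrt_det_sm).continuous

theorem integralVol_add (hf : Sm 0 f) (hg : Sm 0 g) :
    integralVol G (fun y => f y + g y) = integralVol G f + integralVol G g := by
  simp only [integralVol, add_mul]
  exact integral_add (integrable_vol hG hf) (integrable_vol hG hg)

end integralVol

theorem integralVol_const_mul (G : Metric3) (c : ℝ) (f : S3 → ℝ) :
    integralVol G (fun y => c * f y) = c * integralVol G f := by
  simp only [integralVol, mul_assoc]
  exact integral_const_mul _ _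

namespace SlabReg

variable {T : ℝ} {X : ℝ → Rescaled} (R : SlabReg T X) {I : List (Fin 3)} (hI : I.length ≤ 16)
include R

theorem continuousOn_integralVol {f : ℝ → S3 → ℝ} (hf : Ck 0 T f) {τ : ℝ} (hτ0 : 0 ≤ τ)
    (hτ : τ < T) : ContinuousOn (fun t => integralVol (X t).G (f t)) (Set.Icc 0 τ) :=
  (hf.mul R.G₀.sqrt_det).continuousOn_integral hτ0 hτ

theorem continuousOn_l2Sq {l m : ℕ} {ξ : ℝ → Tensor l m} (hξ : TCk 0 T ξ) {τ : ℝ} (hτ0 : 0 ≤ τ)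
    (hτ : τ < T) : ContinuousOn (fun t => l2Sq (X t).G (ξ t)) (Set.Icc 0 τ) :=
  R.continuousOn_integralVol (R.G₀.normSq hξ) hτ0 hτ

theorem continuousOn_rpow (p : ℝ) {τ : ℝ} (hτ : τ < T) :
    ContinuousOn (fun t => (X t).α ^ p) (Set.Icc 0 τ) := by
  -- Any point of the sphere would do: a function of time alone is restricted to one point of the
  -- slab.
  have y : S3 := nrm 0
  exact (R.rpow p).continuousOn.comp (f := fun t : ℝ => (t, y)) (by fun_prop) fun t ht =>
    ⟨⟨ht.1, ht.2.trans_lt hτ⟩, Set.mem_univ _⟩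

theorem continuousOn_α {τ : ℝ} (hτ : τ < T) : ContinuousOn (fun t => (X t).α) (Set.Icc 0 τ) := by
  simpa using R.continuousOn_rpow 1 hτ

theorem continuousOn_α' {τ : ℝ} (hτ : τ < T) : ContinuousOn (fun t => (X t).α') (Set.Icc 0 τ) := by
  have y : S3 := nrm 0
  exact R.α'.continuousOn.comp (f := fun t : ℝ => (t, y)) (by fun_prop) fun t ht =>
    ⟨⟨ht.1, ht.2.trans_lt hτ⟩, Set.mem_univ _⟩

theorem continuousOn_inv {τ : ℝ} (hτ : τ < T) : ContinuousOn (fun t => (X t).α⁻¹) (Set.Icc 0 τ) := by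
  refine (R.continuousOn_rpow (-1) hτ).congr fun t ht => ?_
  exact (Real.rpow_neg_one _).symm

include hI

theorem dens (κ : ℝ) : Ck 1 T fun t => (X t).dens κ I := by
  have hK := R.G₁.normSq (R.K_lie hI)
  have hG := R.G₁.normSq (R.covG₁ hI)
  have hΨ := R.G₁.normSq (R.Ψ_lie hI)
  exact ((Ck.const κ).mul (hK.add (((Ck.const _).mul (R.α_rpow _)).mul hG))).add
    (((R.Φ_lie hI).pow 2).add ((R.α_rpow _).mul hΨ))

theorem ν₀ : TCk 0 T fun t => grad (ZI I (X t).N) := TCk.grad ((R.N_lie hI).of_le (by norm_num))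

theorem f₀ : TCk 0 T fun t => ofScalar (ZI I (X t).N) := fun _ _ => R.N₀ hI

theorem dissDens : Ck 0 T fun t => (X t).dissDens I := by
  -- The absolute value of a' is not differentiated anywhere, so class C⁰ is unfolded to continuity.
  have habs : ∀ (k : ℕ), Ck 0 T fun t _ => |(X t).α'| ^ k := fun k => by
    have h := R.α'
    simp only [Ck, Nat.cast_zero, WithTop.coe_zero, contDiffOn_zero] at h ⊢
    exact (h.abs).pow k
  have h1 := habs 1
  simp only [pow_one] at h1
  exact ((((h1.mul (R.rpow _)).mul (R.G₀.normSq (R.covG₀ hI))).add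
    ((h1.mul (R.rpow _)).mul (R.G₀.normSq (R.Ψ₀ hI)))).add
    ((h1.mul (R.α.pow 3)).mul (R.G₀.normSq (R.ν₀ hI)))).add
    (((habs 3).mul (R.rpow _)).mul (R.G₀.normSq (R.f₀ hI)))

theorem borderDens (ε : ℝ) : Ck 0 T fun t => (X t).borderDens ε I := by
  have hinv : Ck 0 T fun t _ => (X t).α⁻¹ := R.α.inv fun t ht _ => (R.α_pos t ht).ne'
  exact ((((((((R.rpow _).mul (R.G₀.normSq (R.momBorderDown hI))).add
    ((R.rpow _).mul (R.G₀.normSq (R.momBorderUp hI)))).add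
    ((R.rpow _).mul (R.G₀.normSq (R.gradMetBorder hI)))).add
    ((R.α.pow 3).mul (R.G₀.normSq (R.spaceBorder hI)))).add
    (hinv.mul (R.G₀.normSq (ξ := fun t => ofScalar ((X t).lapseBorder I))
      fun _ _ => R.lapseBorder hI))).add
    (((Ck.const _).mul (R.rpow _)).mul (R.G₀.normSq (R.secBorder hI)))).add
    (((Ck.const _).mul (R.rpow _)).mul (R.G₀.normSq (ξ := fun t => ofScalar ((X t).timeBorder I))
      fun _ _ => R.timeBorder hI)))

theorem junkDens : Ck 0 T fun t => (X t).junkDens I :=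
  ((((((((R.rpow _).mul (R.G₀.normSq (R.gradMetJunk hI))).add
    ((R.rpow _).mul (R.G₀.normSq (R.spaceJunk hI)))).add
    (R.α.mul (R.G₀.normSq (ξ := fun t => ofScalar ((X t).lapseJunk I))
      fun _ _ => R.lapseJunk hI))).add
    (R.α.mul (R.G₀.normSq (R.ricError hI)))).add
    (R.α.mul (R.G₀.normSq (R.secJunk hI)))).add
    (R.α.mul (R.G₀.normSq (ξ := fun t => ofScalar ((X t).timeJunk I))
      fun _ _ => R.timeJunk hI))).add
    ((R.α.pow 4).mul (R.G₀.normSq (R.ν₀ hI)))).add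
    ((R.rpow _).mul (R.G₀.normSq (R.f₀ hI)))

theorem boundDens (c₀ C κ ε : ℝ) : Ck 0 T fun t => (X t).boundDens c₀ C κ ε I := by
  have hinv : Ck 0 T fun t _ => (X t).α⁻¹ := R.α.inv fun t ht _ => (R.α_pos t ht).ne'
  exact ((((Ck.const _).mul (R.dissDens hI)).add ((Ck.const _).mul (R.borderDens hI ε))).add
    ((Ck.const _).mul (R.junkDens hI))).add (((Ck.const _).mul ((R.rpow _).add
    ((Ck.const _).mul hinv))).mul ((R.dens hI κ).of_le (by norm_num)))

end SlabReg

/-! ### The time derivative of the energy density -/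

section slab

variable {a : ℝ → ℝ} {Tc T : ℝ} (ha : IsScaleFactor a Tc) (hT : T ≤ Tc) {S : Fields}
  (hS : IsSolution a T S) {I : List (Fin 3)} (hI : I.length ≤ 16) {κ : ℝ}
include ha hT hS hI

/-- Product rule: the norms contribute the pairings with the time derivatives and the slots, the
powers of a the terms with a', and √det G half the trace of G⁻¹∂_t G. -/
theorem hasDerivAt_dens {t : ℝ} (ht : t ∈ Set.Ioo 0 T) (y : S3) :
    HasDerivAt (fun s => (rescale a S s).dens κ I y * Real.sqrt ((rescale a S s).G y).det)
      ((rescale a S t).densDeriv (a t ^ (1 / 3 : ℝ)) κ (dtT (fun s => (rescale a S s).K) t)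
        (dt (fun s => (rescale a S s).Φ) t) (dtT (fun s => (rescale a S s).Ψ) t) I y
        * Real.sqrt ((rescale a S t).G y).det) t := by
  have R := slabReg_rescale ha hT hS
  have E := sliceEqs ha hT hS ht
  have ht' : t ∈ Set.Ico 0 T := ⟨ht.1.le, ht.2⟩
  set X := rescale a S with hX
  have hGm : MetricCk 2 T fun s => (X s).G := R.met.of_le (by norm_num)
  have hg : ∀ i j, HasDerivAt (fun s => (X s).G y i j) ((X t).gtMat y i j) t := fun i j =>
    ((R.G₁.smooth i j)).hasDerivAt (r := 0) ht y
  have hdet : ∀ᶠ s in nhds t, ((X s).G y).det ≠ 0 := by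
    filter_upwards [Ioo_mem_nhds ht.1 ht.2] with s hs
    exact (R.met.pos s ⟨hs.1.le, hs.2⟩ y).det_pos.ne'
  have hk := hasDerivAt_matrix_inv hg hdet
  have hM : MetricSm 18 (X t).G := E.met
  have hx := fun p q => hasDerivAt_lieI (I := I) (R.K.of_le (by omega)) ht y p q
  have hψ := fun p q => hasDerivAt_lieI (I := I) (R.Ψ.of_le (by omega)) ht y p q
  have hG2 : TCk 2 T fun s => lieI I (lowT (X s).G) := R.G_lie hI
  have hGt : dtT (fun s => lieI I (lowT (X s).G)) t = lieI I (X t).Gt :=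
    dtT_lieI (R.met.lowT.of_le (by omega)) ht
  have hh := fun p q => hasDerivAt_cov hGm ht hG2 (X := X t) rfl rfl y p q
  rw [hGt] at hh
  have hφ : HasDerivAt (fun s => ZI I (X s).Φ y) (ZI I (dt (fun s => (X s).Φ) t) y) t := by
    have := hasDerivAt_lieI (I := I) (ξ := fun s => ofScalar (X s).Φ)
      (show TCk (I.length + 1) T _ from fun _ _ => R.Φ.of_le (by omega)) ht y ![] ![]
    simp only [ZI_eq_lieI]
    exact this
  have hα : HasDerivAt (fun s => (X s).α ^ (4 / 3 : ℝ))
      (4 / 3 * a t ^ (1 / 3 : ℝ) * (X t).α') t := by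
    have := (ha.hasDerivAt (ha.mem hT ht')).rpow_const (p := 4 / 3)
      (Or.inl (R.α_pos t ht').ne')
    refine this.congr_deriv ?_
    norm_num
    simp only [hX, rescale]
    ring
  have i1 := hasDerivAt_ipm hg hk hx (hM.symm y) (hM.inv_symm y)
  have i2 := hasDerivAt_ipm hg hk hh (hM.symm y) (hM.inv_symm y)
  have i3 := hasDerivAt_ipm hg hk hψ (hM.symm y) (hM.inv_symm y)
  have i4 := (hasDerivAt_det hg hdet.self_of_nhds).sqrt hdet.self_of_nhds
  have hd := ((i1.fun_add ((hα.const_mul (1 / 4)).fun_mul i2)).const_mul κ).fun_add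
    ((hφ.fun_pow 2).fun_add (hα.fun_mul i3))
  refine (hd.fun_mul i4).congr_deriv ?_
  have e1 : a t ^ (4 / 3 : ℝ) = (a t ^ (1 / 3 : ℝ)) ^ 4 := by
    rw [← Real.rpow_natCast, ← Real.rpow_mul (show 0 ≤ a t from (R.α_pos t ht').le)]
    norm_num
  have e2 : (X t).α = a t := rfl
  have hs := Real.mul_self_sqrt (E.met.pos y).det_pos.le
  have hs0 := (Real.sqrt_pos.2 (E.met.pos y).det_pos).ne'
  set D := Real.sqrt ((X t).G y).det with hD
  have e3 : ((X t).G y).det * (((X t).G y)⁻¹ * (X t).gtMat y).trace / (2 * D)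
      = 1 / 2 * (((X t).G y)⁻¹ * (X t).gtMat y).trace * D := by
    rw [← hs]
    field_simp
  have n1 : ∀ {l m : ℕ} (ξ : Tensor l m),
      normSq (X t).G ξ y = ipm ((X t).G y) ((X t).G y)⁻¹ (ξ y) (ξ y) := fun _ => rfl
  have c1 : (fun a b => cov (X t).G (lieI I (X t).Gt) y a b
      + (X t).commDt (lieI I (lowT (X t).G)) y a b)
      = cov (X t).G (lieI I (X t).Gt) y + (X t).commDt (lieI I (lowT (X t).G)) y := rfl
  rw [e3]
  simp only [Rescaled.densDeriv, Rescaled.dens, Rescaled.slots, n1, e2, e1, c1]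
  push_cast
  simp only [Nat.add_one_sub_one, pow_one]
  ring

end slab

/-- `f` is continuous with integral `v`. -/
structure HasVol (G : Metric3) (f : S3 → ℝ) (v : ℝ) : Prop where
  sm : Sm 0 f
  eq : integralVol G f = v

namespace HasVol

variable {G : Metric3} {f g : S3 → ℝ} {v w : ℝ}

theorem add (hG : MetricSm 0 G) (hf : HasVol G f v) (hg : HasVol G g w) :
    HasVol G (fun y => f y + g y) (v + w) :=
  ⟨hf.sm.add hg.sm, by rw [integralVol_add hG hf.sm hg.sm, hf.eq, hg.eq]⟩

theorem const_mul (hf : HasVol G f v) (c : ℝ) : HasVol G (fun y => c * f y) (c * v) :=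
  ⟨(Sm.const c).mul hf.sm, by rw [integralVol_const_mul, hf.eq]⟩

end HasVol

namespace Rescaled

/-- The integral of the density of the dissipated energy. -/
def energyDiss (X : Rescaled) (I : List (Fin 3)) : ℝ :=
  |X.α'| * X.α ^ (1 / 3 : ℝ) * l2Sq X.G (cov X.G (lieI I (lowT X.G)))
  + |X.α'| * X.α ^ (1 / 3 : ℝ) * l2Sq X.G (lieI I X.Ψ)
  + |X.α'| * X.α ^ 3 * l2Sq X.G (grad (ZI I X.N))
  + |X.α'| ^ 3 * X.α ^ (5 / 3 : ℝ) * l2Sq X.G (ofScalar (ZI I X.N))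

/-- The energy of one multi-index. -/
def energyI (X : Rescaled) (κ : ℝ) (I : List (Fin 3)) : ℝ := integralVol X.G (X.dens κ I)

end Rescaled

namespace SlabReg

variable {T : ℝ} {X : ℝ → Rescaled} (R : SlabReg T X) {I : List (Fin 3)} (hI : I.length ≤ 16)
  {t : ℝ} (ht : t ∈ Set.Ico 0 T)
include R ht

theorem metricSm₀ : MetricSm 0 (X t).G := R.G₀.sm ht

theorem hasVol_normSq {l m : ℕ} {ξ : ℝ → Tensor l m} (hξ : TCk 0 T ξ) :
    HasVol (X t).G (normSq (X t).G (ξ t)) (l2Sq (X t).G (ξ t)) :=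
  ⟨(R.G₀.normSq hξ).slice ht, rfl⟩

include hI

theorem hasVol_diss : HasVol (X t).G ((X t).dissDens I) ((X t).energyDiss I) := by
  have hG := R.metricSm₀ ht
  exact (((((R.hasVol_normSq ht (R.covG₀ hI)).const_mul _).add hG
    ((R.hasVol_normSq ht (R.Ψ₀ hI)).const_mul _)).add hG
    ((R.hasVol_normSq ht (R.ν₀ hI)).const_mul _)).add hG
    ((R.hasVol_normSq ht (R.f₀ hI)).const_mul _))

theorem hasVol_border (ε : ℝ) :
    HasVol (X t).G ((X t).borderDens ε I) ((X t).energyBorder ε I) := by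
  have hG := R.metricSm₀ ht
  exact ((((((((R.hasVol_normSq ht (R.momBorderDown hI)).const_mul _).add hG
    ((R.hasVol_normSq ht (R.momBorderUp hI)).const_mul _)).add hG
    ((R.hasVol_normSq ht (R.gradMetBorder hI)).const_mul _)).add hG
    ((R.hasVol_normSq ht (R.spaceBorder hI)).const_mul _)).add hG
    ((R.hasVol_normSq ht (ξ := fun t => ofScalar ((X t).lapseBorder I))
      fun _ _ => R.lapseBorder hI).const_mul _)).add hG
    ((R.hasVol_normSq ht (R.secBorder hI)).const_mul _)).add hG
    ((R.hasVol_normSq ht (ξ := fun t => ofScalar ((X t).timeBorder I))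
      fun _ _ => R.timeBorder hI).const_mul _))

theorem hasVol_junk : HasVol (X t).G ((X t).junkDens I) ((X t).energyJunk I) := by
  have hG := R.metricSm₀ ht
  exact (((((((((R.hasVol_normSq ht (R.gradMetJunk hI)).const_mul _).add hG
    ((R.hasVol_normSq ht (R.spaceJunk hI)).const_mul _)).add hG
    ((R.hasVol_normSq ht (ξ := fun t => ofScalar ((X t).lapseJunk I))
      fun _ _ => R.lapseJunk hI).const_mul _)).add hG
    ((R.hasVol_normSq ht (R.ricError hI)).const_mul _)).add hG
    ((R.hasVol_normSq ht (R.secJunk hI)).const_mul _)).add hG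
    ((R.hasVol_normSq ht (ξ := fun t => ofScalar ((X t).timeJunk I))
      fun _ _ => R.timeJunk hI).const_mul _)).add hG
    ((R.hasVol_normSq ht (R.ν₀ hI)).const_mul _)).add hG
    ((R.hasVol_normSq ht (R.f₀ hI)).const_mul _))

theorem hasVol_dens (κ : ℝ) : HasVol (X t).G ((X t).dens κ I) ((X t).energyI κ I) :=
  ⟨((R.dens hI κ).of_le (by norm_num) : Ck 0 T _).slice ht, rfl⟩

theorem hasVol_bound (c₀ C κ ε : ℝ) : HasVol (X t).G ((X t).boundDens c₀ C κ ε I)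
    (-c₀ * (X t).energyDiss I + C * (X t).energyBorder ε I + C * (X t).energyJunk I
      + C * ((X t).α ^ (-1 / 3 : ℝ) + ε * (X t).α⁻¹) * (X t).energyI κ I) := by
  have hG := R.metricSm₀ ht
  exact (((((R.hasVol_diss hI ht).const_mul _).add hG ((R.hasVol_border hI ht ε).const_mul _)).add
    hG ((R.hasVol_junk hI ht).const_mul _)).add hG ((R.hasVol_dens hI ht κ).const_mul _))

theorem energyI_eq (κ : ℝ) : (X t).energyI κ I
    = κ * (integralVol (X t).G fun y => normSq (X t).G (lieI I (X t).K) y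
      + (1 / 4) * (X t).α ^ (4 / 3 : ℝ) * normSq (X t).G (cov (X t).G (lieI I (lowT (X t).G))) y)
    + integralVol (X t).G fun y =>
        ZI I (X t).Φ y ^ 2 + (X t).α ^ (4 / 3 : ℝ) * normSq (X t).G (lieI I (X t).Ψ) y := by
  have hG := R.metricSm₀ ht
  have hK := R.G₁.normSq (R.K_lie hI)
  have hc := R.G₁.normSq (R.covG₁ hI)
  have hΨ := R.G₁.normSq (R.Ψ_lie hI)
  have h1 := ((hK.add (((Ck.const (1 / 4)).mul (R.α_rpow (4 / 3))).mul hc)).of_le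
    (show 0 ≤ 1 by norm_num)).slice ht
  have h2 := ((((R.Φ_lie hI).pow 2).add ((R.α_rpow (4 / 3)).mul hΨ)).of_le
    (show 0 ≤ 1 by norm_num)).slice ht
  exact (HasVol.add hG (HasVol.const_mul ⟨h1, rfl⟩ κ) ⟨h2, rfl⟩).eq

end SlabReg

theorem length_of_mem_multiIdx {p q : ℕ} {I : List (Fin 3)} (h : I ∈ multiIdx p q) :
    p ≤ I.length ∧ I.length ≤ q := by
  simp only [multiIdx, Finset.mem_biUnion, Finset.mem_Icc, Finset.mem_image] at h
  obtain ⟨N, hN, J, -, rfl⟩ := h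
  simpa using hN

theorem mem_multiIdx {p q : ℕ} {I : List (Fin 3)} (h : p ≤ I.length) (h' : I.length ≤ q) :
    I ∈ multiIdx p q := by
  simp only [multiIdx, Finset.mem_biUnion, Finset.mem_Icc, Finset.mem_image]
  exact ⟨I.length, ⟨h, h'⟩, I.get, Finset.mem_univ _, List.ofFn_get I⟩

theorem SlabReg.totalEnergy_eq {T : ℝ} {X : ℝ → Rescaled} (R : SlabReg T X) {t : ℝ}
    (ht : t ∈ Set.Ico 0 T) {M : ℕ} (hM : M ≤ 16) (κ : ℝ) :
    (X t).totalEnergy M κ = ∑ I ∈ multiIdx 1 M, (X t).energyI κ I := by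
  simp only [Rescaled.totalEnergy, Rescaled.metricEnergy, Rescaled.sfEnergy, Finset.mul_sum]
  rw [← Finset.sum_add_distrib]
  exact Finset.sum_congr rfl fun I hI =>
    (R.energyI_eq ((length_of_mem_multiIdx hI).2.trans hM) ht κ).symm

/-! ### The integrated energy inequalities -/

section slab

variable {a : ℝ → ℝ} {Tc T : ℝ} (ha : IsScaleFactor a Tc) (hT : T ≤ Tc) {S : Fields}
  (hS : IsSolution a T S) {I : List (Fin 3)} (hI : I.length ≤ 16) {κ C₁ ε : ℝ}
  (hκ : 0 < κ) (hκ1 : κ * 12000 ≤ 1) (hε : 0 < ε) (hC₁ : 0 ≤ C₁)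
  (L : ∀ t ∈ Set.Ioo 0 T, ∀ y, (rescale a S t).LowBounds (a t ^ (1 / 3 : ℝ)) C₁ ε y)
include ha hT hS hI hκ hκ1 hε hC₁ L

/-- The divergence of the pointwise bound disappears on integration over the sphere, since there is
no boundary; what remains is integrated in time. -/
theorem energyI_sub_le {τ : ℝ} (hτ : τ ∈ Set.Ico 0 T) :
    (rescale a S τ).energyI κ I - (rescale a S 0).energyI κ I
      ≤ ∫ t in 0..τ, integralVol (rescale a S t).G
        ((rescale a S t).boundDens (κ / 6) (8000 + 16 * C₁) κ ε I) := by
  have R := slabReg_rescale ha hT hS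
  have hsd : Ck 1 T fun t y => (rescale a S t).dens κ I y
      * Real.sqrt ((rescale a S t).G y).det := (R.dens hI κ).mul R.G₁.sqrt_det
  -- This form of the fundamental theorem asks for continuity on [0, τ], a derivative on the open
  -- interval and an integrable upper bound. The equations are thus needed only for t > 0.
  refine intervalIntegral.sub_le_integral_of_hasDeriv_right_of_le hτ.1
    (g := fun t => (rescale a S t).energyI κ I)
    (R.continuousOn_integralVol ((R.dens hI κ).of_le (by norm_num)) hτ.1 hτ.2)
    (fun t ht => ((hsd.hasDerivAt_integral ⟨ht.1, ht.2.trans hτ.2⟩).hasDerivWithinAt))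
    ((R.continuousOn_integralVol (R.boundDens hI _ _ _ _) hτ.1 hτ.2).integrableOn_Icc) ?_
  intro t ht
  have ht1 : t ∈ Set.Ioo 0 T := ⟨ht.1, ht.2.trans hτ.2⟩
  have ht2 : t ∈ Set.Ico 0 T := ⟨ht1.1.le, ht1.2⟩
  have E := sliceEqs ha hT hS ht1
  obtain ⟨V, hV, hVle⟩ := E.densDeriv_le hI hκ hκ1 hε hC₁ (L t ht1)
  have hG := R.metricSm₀ ht2
  have hG1 : MetricSm 1 (rescale a S t).G := E.met.of_le (by norm_num)
  have hB : Sm 0 ((rescale a S t).boundDens (κ / 6) (8000 + 16 * C₁) κ ε I) :=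
    (R.boundDens hI _ _ _ _).slice ht2
  have hD : Sm 0 (divV (rescale a S t).G V) := Ck.sum fun c _ =>
    (hV.der c (hG1.chr c)) _ _
  calc (∫ y, dt (fun t y => (rescale a S t).dens κ I y
          * Real.sqrt ((rescale a S t).G y).det) t y ∂roundVol)
      ≤ integralVol (rescale a S t).G (fun y => divV (rescale a S t).G V y
          + (rescale a S t).boundDens (κ / 6) (8000 + 16 * C₁) κ ε I y) := by
        refine integral_mono (integrable_of_continuous (Sm.continuous (hsd.dt.slice ht2)))
          (integrable_vol hG (hD.add hB)) fun y => ?_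
        refine (dt_eq (f := fun t y => (rescale a S t).dens κ I y
          * Real.sqrt ((rescale a S t).G y).det) ht1.1 (hasDerivAt_dens ha hT hS hI ht1 y)).le.trans ?_
        exact mul_le_mul_of_nonneg_right (hVle y) (Real.sqrt_nonneg _)
    _ = _ := by
        rw [integralVol_add hG hD hB, integralVol_divV hG1 hV, zero_add]

/-- The energy inequality of one multi-index. -/
theorem energyI_le {τ : ℝ} (hτ : τ ∈ Set.Ico 0 T) :
    (rescale a S τ).energyI κ I + κ / 6 * (∫ t in 0..τ, (rescale a S t).energyDiss I)
      ≤ (rescale a S 0).energyI κ I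
        + (8000 + 16 * C₁) * (∫ t in 0..τ, (rescale a S t).energyBorder ε I)
        + (8000 + 16 * C₁) * (∫ t in 0..τ, (rescale a S t).energyJunk I)
        + (8000 + 16 * C₁) * (∫ t in 0..τ, a t ^ (-1 / 3 : ℝ) * (rescale a S t).energyI κ I)
        + (8000 + 16 * C₁) * ε * (∫ t in 0..τ, (a t)⁻¹ * (rescale a S t).energyI κ I) := by
  have R := slabReg_rescale ha hT hS
  have h := energyI_sub_le ha hT hS hI hκ hκ1 hε hC₁ L hτ
  have ii : ∀ {f : ℝ → ℝ}, ContinuousOn f (Set.Icc 0 τ) →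
      IntervalIntegrable f MeasureTheory.volume 0 τ := fun hf =>
    ContinuousOn.intervalIntegrable (by rwa [Set.uIcc_of_le hτ.1])
  have hv : ∀ {f : ℝ → S3 → ℝ} {v : ℝ → ℝ}, Ck 0 T f →
      (∀ t ∈ Set.Ico 0 T, HasVol (rescale a S t).G (f t) (v t)) →
      ContinuousOn v (Set.Icc 0 τ) := fun hf hfv =>
    (R.continuousOn_integralVol hf hτ.1 hτ.2).congr fun t ht =>
      (hfv t ⟨ht.1, ht.2.trans_lt hτ.2⟩).eq.symm
  have c1 := hv (R.dissDens hI) fun t ht => R.hasVol_diss hI ht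
  have c2 := hv (R.borderDens hI ε) fun t ht => R.hasVol_border hI ht ε
  have c3 := hv (R.junkDens hI) fun t ht => R.hasVol_junk hI ht
  have c4 := hv ((R.dens hI κ).of_le (by norm_num)) fun t ht => R.hasVol_dens hI ht κ
  have c5 : ContinuousOn (fun t => a t ^ (-1 / 3 : ℝ) * (rescale a S t).energyI κ I)
      (Set.Icc 0 τ) := (R.continuousOn_rpow (-1 / 3) hτ.2).mul c4
  have c6 : ContinuousOn (fun t => (a t)⁻¹ * (rescale a S t).energyI κ I)
      (Set.Icc 0 τ) := (R.continuousOn_inv hτ.2).mul c4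
  rw [intervalIntegral.integral_congr (g := fun t =>
      -(κ / 6) * (rescale a S t).energyDiss I
      + (8000 + 16 * C₁) * (rescale a S t).energyBorder ε I
      + (8000 + 16 * C₁) * (rescale a S t).energyJunk I
      + (8000 + 16 * C₁) * (a t ^ (-1 / 3 : ℝ) * (rescale a S t).energyI κ I)
      + (8000 + 16 * C₁) * ε * ((a t)⁻¹ * (rescale a S t).energyI κ I)) (by
        intro t ht
        rw [Set.uIcc_of_le hτ.1] at ht
        refine (R.hasVol_bound hI ⟨ht.1, ht.2.trans_lt hτ.2⟩ (κ / 6) (8000 + 16 * C₁) κ ε).eq.trans ?_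
        have e : (rescale a S t).α = a t := rfl
        simp only [e]
        ring)] at h
  have i1 := (ii c1).const_mul (-(κ / 6))
  have i2 := (ii c2).const_mul (8000 + 16 * C₁)
  have i3 := (ii c3).const_mul (8000 + 16 * C₁)
  have i4 := (ii c5).const_mul (8000 + 16 * C₁)
  have i5 := (ii c6).const_mul ((8000 + 16 * C₁) * ε)
  rw [intervalIntegral.integral_add (((i1.add i2).add i3).add i4) i5,
    intervalIntegral.integral_add ((i1.add i2).add i3) i4,
    intervalIntegral.integral_add (i1.add i2) i3, intervalIntegral.integral_add i1 i2] at h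
  simp only [intervalIntegral.integral_const_mul, Pi.mul_apply] at h
  linarith only [h]

end slab

theorem Rescaled.dens_nonneg {X : Rescaled} (hG : MetricSm 0 X.G) (hα : 0 < X.α) {κ : ℝ} (hκ : 0 < κ)
    (I : List (Fin 3)) (y : S3) : 0 ≤ X.dens κ I y := by
  have h1 := normSq_nonneg hG (lieI I X.K) y
  have h2 := normSq_nonneg hG (cov X.G (lieI I (lowT X.G))) y
  have h3 := normSq_nonneg hG (lieI I X.Ψ) y
  rw [Rescaled.dens]
  positivity

theorem SlabReg.energyI_nonneg {T : ℝ} {X : ℝ → Rescaled} (R : SlabReg T X) {t : ℝ}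
    (ht : t ∈ Set.Ico 0 T) {κ : ℝ} (hκ : 0 < κ) (I : List (Fin 3)) : 0 ≤ (X t).energyI κ I :=
  integral_nonneg fun y => mul_nonneg
    (Rescaled.dens_nonneg (R.metricSm₀ ht) (R.α_pos t ht) hκ I y) (Real.sqrt_nonneg _)

/-- Each multi-index satisfies its own inequality, without coupling on the left-hand side. After
summation a factor 6/κ normalises the dissipation to coefficient 1, which fixes the final constant.
-/
theorem energy_le {a : ℝ → ℝ} {Tc T : ℝ} (ha : IsScaleFactor a Tc) (hT : T ≤ Tc) {S : Fields}
    (hS : IsSolution a T S) {M : ℕ} (hM : M ≤ 16) {κ C₁ ε : ℝ}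
    (hκ : 0 < κ) (hκ1 : κ * 12000 ≤ 1) (hε : 0 < ε) (hC₁ : 0 ≤ C₁)
    (L : ∀ t ∈ Set.Ioo 0 T, ∀ y, (rescale a S t).LowBounds (a t ^ (1 / 3 : ℝ)) C₁ ε y)
    {t : ℝ} (ht : t ∈ Set.Ico 0 T) :
    (rescale a S t).totalEnergy M κ
      + (∑ I ∈ multiIdx 1 M, ∫ s in 0..t, |deriv a s| * a s ^ (1 / 3 : ℝ)
          * l2Sq (rescale a S s).G (cov (rescale a S s).G (lieI I (lowT (rescale a S s).G))))
      + (∑ I ∈ multiIdx 1 M, ∫ s in 0..t, |deriv a s| * a s ^ (1 / 3 : ℝ)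
          * l2Sq (rescale a S s).G (lieI I (rescale a S s).Ψ))
      + (∑ I ∈ multiIdx 1 M, ∫ s in 0..t, |deriv a s| * a s ^ 3
          * l2Sq (rescale a S s).G (grad (ZI I (rescale a S s).N)))
      + (∑ I ∈ multiIdx 1 M, ∫ s in 0..t, |deriv a s| ^ 3 * a s ^ (5 / 3 : ℝ)
          * l2Sq (rescale a S s).G (ofScalar (ZI I (rescale a S s).N)))
    ≤ 6 / κ * (8000 + 16 * C₁) * (rescale a S 0).totalEnergy M κ
      + 6 / κ * (8000 + 16 * C₁) * ε
        * (∫ s in 0..t, (a s)⁻¹ * (rescale a S s).totalEnergy M κ)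
      + 6 / κ * (8000 + 16 * C₁)
        * (∫ s in 0..t, a s ^ (-1 / 3 : ℝ) * (rescale a S s).totalEnergy M κ)
      + 6 / κ * (8000 + 16 * C₁) * (∑ I ∈ multiIdx 1 M, ∫ s in 0..t,
          (rescale a S s).energyBorder ε I)
      + 6 / κ * (8000 + 16 * C₁) * (∑ I ∈ multiIdx 1 M, ∫ s in 0..t,
          (rescale a S s).energyJunk I) := by
  have R := slabReg_rescale ha hT hS
  have h0 : (0 : ℝ) ∈ Set.Ico 0 T := ⟨le_rfl, ht.1.trans_lt ht.2⟩
  have ii : ∀ {f : ℝ → ℝ}, ContinuousOn f (Set.Icc 0 t) →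
      IntervalIntegrable f MeasureTheory.volume 0 t := fun hf =>
    ContinuousOn.intervalIntegrable (by rwa [Set.uIcc_of_le ht.1])
  have hlen : ∀ I ∈ multiIdx 1 M, I.length ≤ 16 := fun I hI =>
    (length_of_mem_multiIdx hI).2.trans hM
  have cE : ∀ I ∈ multiIdx 1 M, ContinuousOn (fun s => (rescale a S s).energyI κ I)
      (Set.Icc 0 t) := fun I hI =>
    R.continuousOn_integralVol ((R.dens (hlen I hI) κ).of_le (by norm_num)) ht.1 ht.2
  have hsum : ∀ {w : ℝ → ℝ}, ContinuousOn w (Set.Icc 0 t) →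
      (∫ s in 0..t, w s * (rescale a S s).totalEnergy M κ)
        = ∑ I ∈ multiIdx 1 M, ∫ s in 0..t, w s * (rescale a S s).energyI κ I := by
    intro w hw
    rw [← intervalIntegral.integral_finsetSum
      (f := fun I s => w s * (rescale a S s).energyI κ I) fun I hI => ii (hw.mul (cE I hI))]
    refine intervalIntegral.integral_congr fun s hs => ?_
    rw [Set.uIcc_of_le ht.1] at hs
    simp only [R.totalEnergy_eq ⟨hs.1, hs.2.trans_lt ht.2⟩ hM, Finset.mul_sum]
  have hdiss : ∀ I ∈ multiIdx 1 M, (∫ s in 0..t, (rescale a S s).energyDiss I)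
      = (∫ s in 0..t, |deriv a s| * a s ^ (1 / 3 : ℝ)
          * l2Sq (rescale a S s).G (cov (rescale a S s).G (lieI I (lowT (rescale a S s).G))))
      + (∫ s in 0..t, |deriv a s| * a s ^ (1 / 3 : ℝ)
          * l2Sq (rescale a S s).G (lieI I (rescale a S s).Ψ))
      + (∫ s in 0..t, |deriv a s| * a s ^ 3
          * l2Sq (rescale a S s).G (grad (ZI I (rescale a S s).N)))
      + (∫ s in 0..t, |deriv a s| ^ 3 * a s ^ (5 / 3 : ℝ)
          * l2Sq (rescale a S s).G (ofScalar (ZI I (rescale a S s).N))) := by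
    intro I hI
    have cα' : ContinuousOn (fun s => |deriv a s|) (Set.Icc 0 t) := (R.continuousOn_α' ht.2).abs
    have cp : ∀ p : ℝ, ContinuousOn (fun s => a s ^ p) (Set.Icc 0 t) :=
      fun p => R.continuousOn_rpow p ht.2
    have cα : ContinuousOn a (Set.Icc 0 t) := R.continuousOn_α ht.2
    have i1 := ii ((cα'.mul (cp (1 / 3))).mul
      (R.continuousOn_l2Sq (R.covG₀ (hlen I hI)) ht.1 ht.2))
    have i2 := ii ((cα'.mul (cp (1 / 3))).mul
      (R.continuousOn_l2Sq (R.Ψ₀ (hlen I hI)) ht.1 ht.2))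
    have i3 := ii ((cα'.mul (cα.pow 3)).mul
      (R.continuousOn_l2Sq (R.ν₀ (hlen I hI)) ht.1 ht.2))
    have i4 := ii (((cα'.pow 3).mul (cp (5 / 3))).mul
      (R.continuousOn_l2Sq (R.f₀ (hlen I hI)) ht.1 ht.2))
    exact (intervalIntegral.integral_add ((i1.add i2).add i3) i4).trans
      (congrArg (· + _) ((intervalIntegral.integral_add (i1.add i2) i3).trans
        (congrArg (· + _) (intervalIntegral.integral_add i1 i2))))
  have hE := Finset.sum_le_sum fun I hI =>
    energyI_le ha hT hS (hlen I hI) hκ hκ1 hε hC₁ L ht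
  rw [hsum (w := fun s => (a s)⁻¹) (R.continuousOn_inv ht.2),
    hsum (w := fun s => a s ^ (-1 / 3 : ℝ)) (R.continuousOn_rpow _ ht.2),
    R.totalEnergy_eq ht hM, R.totalEnergy_eq h0 hM]
  simp only [Finset.sum_add_distrib, ← Finset.mul_sum] at hE
  rw [Finset.sum_congr rfl hdiss] at hE
  simp only [Finset.sum_add_distrib] at hE
  have n1 : 0 ≤ ∑ I ∈ multiIdx 1 M, (rescale a S t).energyI κ I :=
    Finset.sum_nonneg fun I _ => R.energyI_nonneg ht hκ I
  have n0 : 0 ≤ ∑ I ∈ multiIdx 1 M, (rescale a S 0).energyI κ I :=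
    Finset.sum_nonneg fun I _ => R.energyI_nonneg h0 hκ I
  generalize (∑ I ∈ multiIdx 1 M, (rescale a S t).energyI κ I) = e1 at *
  generalize (∑ I ∈ multiIdx 1 M, (rescale a S 0).energyI κ I) = e0 at *
  have c : 0 < 6 / κ := by positivity
  have c1 : 6 / κ * (κ / 6) = 1 := by field_simp
  have c2 : 1 ≤ 6 / κ := by
    rw [le_div_iff₀ hκ]
    linarith
  have hm := mul_le_mul_of_nonneg_left hE c.le
  simp only [mul_add, ← mul_assoc, c1, one_mul] at hm
  have n2 : e1 ≤ 6 / κ * e1 := le_mul_of_one_le_left n1 c2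
  -- The initial energy occurs with coefficient 6/κ only; this nonnegative surplus raises it to the
  -- common constant of all terms.
  have n3 : 0 ≤ 6 / κ * (7999 + 16 * C₁) * e0 := by positivity
  linarith only [hm, n2, n3]

/-! ## Pointwise bounds from the high norm -/

theorem prod_one_apply {l : ℕ} (a a' : Fin l → Fin 3) :
    ∏ i, (1 : Matrix (Fin 3) (Fin 3) ℝ) (a i) (a' i) = if a = a' then 1 else 0 := by
  split_ifs with h
  · subst h
    exact Finset.prod_eq_one fun i _ => Matrix.one_apply_eq _
  · obtain ⟨i, hi⟩ := Function.ne_iff.1 h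
    exact Finset.prod_eq_zero (Finset.mem_univ i) (Matrix.one_apply_ne hi)

theorem normSq_roundMet {l m : ℕ} (ξ : Tensor l m) (y : S3) :
    normSq roundMet ξ y = ∑ a, ∑ b, ξ y a b ^ 2 := by
  simp only [normSq, roundMet, inv_one, prod_one_apply, ite_mul, mul_ite, one_mul, zero_mul,
    mul_zero, mul_one, Finset.sum_ite_eq, Finset.mem_univ, if_true]
  refine Finset.sum_congr rfl fun a _ => ?_
  rw [Finset.sum_comm' (t' := Finset.univ) (s' := fun _ => Finset.univ) (by simp)]
  simp [sq]

theorem sq_le_normSq_roundMet {l m : ℕ} (ξ : Tensor l m) (y : S3) (a : Fin l → Fin 3)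
    (b : Fin m → Fin 3) : ξ y a b ^ 2 ≤ normSq roundMet ξ y := by
  rw [normSq_roundMet]
  exact (Finset.single_le_sum (f := fun b => ξ y a b ^ 2) (fun _ _ => sq_nonneg _)
    (Finset.mem_univ b)).trans (Finset.single_le_sum (f := fun a => ∑ b, ξ y a b ^ 2)
      (fun _ _ => Finset.sum_nonneg fun _ _ => sq_nonneg _) (Finset.mem_univ a))

theorem normSq_roundMet_nonneg {l m : ℕ} (ξ : Tensor l m) (y : S3) : 0 ≤ normSq roundMet ξ y := by
  rw [normSq_roundMet]
  positivity

/-- The components of the Lie derivatives are bounded by the supremum norm. -/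
theorem abs_lieI_le_supNorm {l m q : ℕ} {ξ : Tensor l m} (hξ : TSm q ξ) {I : List (Fin 3)}
    (hI : I.length ≤ q) (y : S3) (a : Fin l → Fin 3) (b : Fin m → Fin 3) :
    |lieI I ξ y a b| ≤ supNorm q ξ := by
  refine Real.le_sqrt_of_sq_le ?_
  rw [sq_abs]
  have hs : TSm 0 (lieI I ξ) := TSm.lieI (hξ.of_le (by omega))
  have hc : Continuous (normSq roundMet (lieI I ξ)) := by
    have e : normSq roundMet (lieI I ξ) = fun y => ∑ a, ∑ b, lieI I ξ y a b ^ 2 :=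
      funext (normSq_roundMet _)
    rw [e]
    exact continuous_finsetSum _ fun a _ => continuous_finsetSum _ fun b _ =>
      (Sm.continuous (hs a b)).pow 2
  have hb : BddAbove (Set.range (normSq roundMet (lieI I ξ))) :=
    (isCompact_range hc).bddAbove
  exact ((sq_le_normSq_roundMet _ y a b).trans (le_ciSup hb y)).trans
    (Finset.single_le_sum (f := fun I => ⨆ y, normSq roundMet (lieI I ξ) y)
      (fun _ _ => Real.iSup_nonneg fun _ => normSq_roundMet_nonneg _ _)
      (mem_multiIdx (Nat.zero_le _) hI))

/-- The regularity of the variables on one time slice. -/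
structure Rescaled.Regular (X : Rescaled) : Prop where
  α_pos : 0 < X.α
  met : MetricSm 18 X.G
  K : TSm 17 X.K
  N : Sm 18 X.N
  Φ : Sm 17 X.Φ
  Ψ : TSm 17 X.Ψ

theorem SlabReg.regular {T : ℝ} {X : ℝ → Rescaled} (R : SlabReg T X) {t : ℝ}
    (ht : t ∈ Set.Ico 0 T) : (X t).Regular where
  α_pos := R.α_pos t ht
  met := R.met.sm ht
  K := R.K.sm ht
  N := R.N.slice ht
  Φ := R.Φ.slice ht
  Ψ := R.Ψ.sm ht

theorem invT_roundMet (y : S3) (a : Fin 2 → Fin 3) (b : Fin 0 → Fin 3) :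
    invT roundMet y a b = (1 : Matrix (Fin 3) (Fin 3) ℝ) (a 0) (a 1) := by simp [invT, roundMet]

namespace Rescaled.Regular

variable {X : Rescaled} (R : X.Regular)
include R

theorem lowT_sub : TSm 18 (lowT X.G - lowT roundMet) := fun _ _ =>
  (R.met.smooth _ _).sub (Sm.const _)

theorem invT_sub : TSm 18 (invT X.G - invT roundMet) := fun a b => by
  have h : Sm 18 fun y => (X.G y)⁻¹ (a 0) (a 1) - (1 : Matrix (Fin 3) (Fin 3) ℝ) (a 0) (a 1) :=
    (R.met.ck.inv _ _).sub (Sm.const _)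
  simp only [Pi.sub_apply, invT_roundMet]
  exact h

theorem supNorm_le : supNorm 14 X.K ≤ X.highNorm ∧ supNorm 14 (lowT X.G - lowT roundMet) ≤ X.highNorm
    ∧ supNorm 14 (invT X.G - invT roundMet) ≤ X.highNorm ∧ supNorm 12 (ofScalar X.N) ≤ X.highNorm
    ∧ supNorm 14 (ofScalar X.Φ) ≤ X.highNorm ∧ supNorm 13 X.Ψ ≤ X.highNorm := by
  have h : ∀ (q : ℕ) {l m : ℕ} (ξ : Tensor l m), 0 ≤ supNorm q ξ := fun _ _ _ _ => Real.sqrt_nonneg _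
  have h' : ∀ (p q : ℕ) {l m : ℕ} (ξ : Tensor l m), 0 ≤ sobolev p q ξ :=
    fun _ _ _ _ _ => Real.sqrt_nonneg _
  have hp : ∀ p : ℝ, 0 ≤ X.α ^ p := fun p => Real.rpow_nonneg R.α_pos.le p
  have h1 := h' 0 16 X.K
  have h2 := mul_nonneg (hp (2 / 3)) (h' 17 17 (lowT X.G))
  have h3 := h' 0 16 (lowT X.G - lowT roundMet)
  have h4 := h' 0 16 (invT X.G - invT roundMet)
  have h5 : 0 ≤ ∑ L ∈ Finset.Icc (1 : ℕ) 4,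
      X.α ^ ((2 / 3 : ℝ) * (L : ℝ)) * sobolev (14 + L) (14 + L) (ofScalar X.N) :=
    Finset.sum_nonneg fun L _ => mul_nonneg (hp _) (h' _ _ _)
  have h6 := h' 0 14 (ofScalar X.N)
  have h7 := h' 0 16 (ofScalar X.Φ)
  have h8 := mul_nonneg (hp (2 / 3)) (h' 0 16 X.Ψ)
  have h9 := h' 0 15 X.Ψ
  have k1 := h 14 X.K
  have k2 := h 14 (lowT X.G - lowT roundMet)
  have k3 := h 14 (invT X.G - invT roundMet)
  have k4 := h 12 (ofScalar X.N)
  have k5 := h 14 (ofScalar X.Φ)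
  have k6 := h 13 X.Ψ
  unfold Rescaled.highNorm
  refine ⟨?_, ?_, ?_, ?_, ?_, ?_⟩ <;>
    linarith only [h1, h2, h3, h4, h5, h6, h7, h8, h9, k1, k2, k3, k4, k5, k6]

variable {I : List (Fin 3)} (hI : I.length ≤ 12) (y : S3)
include hI

/-- Order 12 is the weakest of the C^q orders in the high norm, that of N; it serves as a common
bound for all variables, and orders up to two are what is needed. -/
theorem abs_K_le (a b : Fin 1 → Fin 3) : |lieI I X.K y a b| ≤ X.highNorm :=
  (abs_lieI_le_supNorm (R.K.of_le (by norm_num)) (by omega) y a b).trans R.supNorm_le.1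

theorem abs_lowT_le (a : Fin 0 → Fin 3) (b : Fin 2 → Fin 3) :
    |lieI I (lowT X.G - lowT roundMet) y a b| ≤ X.highNorm :=
  (abs_lieI_le_supNorm (R.lowT_sub.of_le (by norm_num)) (by omega) y a b).trans R.supNorm_le.2.1

theorem abs_invT_le (a : Fin 2 → Fin 3) (b : Fin 0 → Fin 3) :
    |lieI I (invT X.G - invT roundMet) y a b| ≤ X.highNorm :=
  (abs_lieI_le_supNorm (R.invT_sub.of_le (by norm_num)) (by omega) y a b).trans R.supNorm_le.2.2.1

theorem abs_N_le (a b : Fin 0 → Fin 3) : |lieI I (ofScalar X.N) y a b| ≤ X.highNorm :=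
  (abs_lieI_le_supNorm ((TSm.ofScalar R.N).of_le (by norm_num)) hI y a b).trans
    R.supNorm_le.2.2.2.1

theorem abs_Φ_le (a b : Fin 0 → Fin 3) : |lieI I (ofScalar X.Φ) y a b| ≤ X.highNorm :=
  (abs_lieI_le_supNorm ((TSm.ofScalar R.Φ).of_le (by norm_num)) (by omega) y a b).trans
    R.supNorm_le.2.2.2.2.1

theorem abs_Ψ_le (a : Fin 0 → Fin 3) (b : Fin 1 → Fin 3) : |lieI I X.Ψ y a b| ≤ X.highNorm :=
  (abs_lieI_le_supNorm (R.Ψ.of_le (by norm_num)) (by omega) y a b).trans R.supNorm_le.2.2.2.2.2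

end Rescaled.Regular

/-! ## Functions that are close to a constant, with their frame derivatives

For families of functions, `Near e θ r f c` says that `f i - c` and its derivatives of order at most
`r` are bounded by `C e θ^p`, for some `C` and `p` that do not depend on the index `i`. -/

/-- The admissible sizes. -/
structure Scales {ι : Type*} (e θ : ι → ℝ) : Prop where
  nonneg : ∀ i, 0 ≤ e i
  le_one : ∀ i, e i ≤ 1
  one_le : ∀ i, 1 ≤ θ i

/-- The functions `f i` are close to the constant `c`, with derivatives up to order `r`. -/
def Near {ι : Type*} (e θ : ι → ℝ) : ℕ → (ι → S3 → ℝ) → ℝ → Prop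
  | 0, f, c => (∀ i, Sm 0 (f i)) ∧
      ∃ C : ℝ, ∃ p : ℕ, 0 ≤ C ∧ ∀ i y, |f i y - c| ≤ C * e i * θ i ^ p
  | r + 1, f, c => (∀ i, Sm (r + 1) (f i)) ∧ Near e θ r f c ∧
      ∀ A, Near e θ r (fun i => Z A (f i)) 0

namespace Near

variable {ι : Type*} {e θ : ι → ℝ} (H : Scales e θ) {r : ℕ} {f g : ι → S3 → ℝ} {c d : ℝ}

theorem sm (h : Near e θ r f c) (i : ι) : Sm r (f i) := by
  cases r <;> exact h.1 i

theorem of_succ (h : Near e θ (r + 1) f c) : Near e θ r f c := h.2.1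

theorem of_le {q : ℕ} (h : Near e θ r f c) (hq : q ≤ r) : Near e θ q f c := by
  induction hq with
  | refl => exact h
  | step _ ih => exact ih h.of_succ

theorem Z (h : Near e θ (r + 1) f c) (A : Fin 3) : Near e θ r (fun i => BigCrunch.Z A (f i)) 0 :=
  h.2.2 A

theorem congr (h : Near e θ r f c) (hc : c = d) : Near e θ r f d := hc ▸ h

theorem bound {C : ℝ} {p q : ℕ} {x : ℝ} {i : ι} (H : Scales e θ) (hC : 0 ≤ C) (hpq : p ≤ q)
    (h : x ≤ C * e i * θ i ^ p) : x ≤ C * e i * θ i ^ q :=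
  h.trans (mul_le_mul_of_nonneg_left (pow_le_pow_right₀ (H.one_le i) hpq)
    (mul_nonneg hC (H.nonneg i)))

include H

theorem const (c : ℝ) : Near e θ r (fun _ _ => c) c := by
  induction r generalizing c with
  | zero =>
    exact ⟨fun _ => Sm.const c, 0, 0, le_rfl, fun i y => by simp⟩
  | succ r ih =>
    refine ⟨fun _ => Sm.const c, ih c, fun A => ?_⟩
    have e1 : (fun _ : ι => BigCrunch.Z A fun _ : S3 => c) = fun _ _ => 0 :=
      funext fun _ => funext fun y => Z_const A y c
    rw [e1]
    exact ih 0

theorem add (hf : Near e θ r f c) (hg : Near e θ r g d) :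
    Near e θ r (fun i y => f i y + g i y) (c + d) := by
  induction r generalizing f g c d with
  | zero =>
    obtain ⟨sf, C, p, hC, hf⟩ := hf
    obtain ⟨sg, D, q, hD, hg⟩ := hg
    refine ⟨fun i => (sf i).add (sg i), C + D, p + q, add_nonneg hC hD, fun i y => ?_⟩
    have h1 := bound H hC (Nat.le_add_right p q) (hf i y)
    have h2 := bound H hD (Nat.le_add_left q p) (hg i y)
    have h3 := abs_add_le (f i y - c) (g i y - d)
    rw [show f i y - c + (g i y - d) = f i y + g i y - (c + d) by ring] at h3
    linarith
  | succ r ih =>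
    refine ⟨fun i => (hf.sm i).add (hg.sm i), ih hf.of_succ hg.of_succ, fun A => ?_⟩
    have e1 : (fun i => BigCrunch.Z A fun y => f i y + g i y)
        = fun i y => BigCrunch.Z A (f i) y + BigCrunch.Z A (g i) y := by
      funext i y
      exact Z_add A y ((hf.sm i).of_le (by omega)) ((hg.sm i).of_le (by omega))
    rw [e1]
    exact (ih (hf.Z A) (hg.Z A)).congr (add_zero 0)

/-- From fg − cd = (f − c)g + c(g − d). The bound on g costs only a power of θ, since e ≤ 1; so a
product stays of first order in e while the powers of θ add up. -/
theorem mul (hf : Near e θ r f c) (hg : Near e θ r g d) :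
    Near e θ r (fun i y => f i y * g i y) (c * d) := by
  induction r generalizing f g c d with
  | zero =>
    obtain ⟨sf, C, p, hC, hf⟩ := hf
    obtain ⟨sg, D, q, hD, hg⟩ := hg
    refine ⟨fun i => (sf i).mul (sg i), C * (|d| + D) + |c| * D, p + q, by positivity,
      fun i y => ?_⟩
    have h0 := H.nonneg i
    have hp : 0 ≤ θ i ^ p := pow_nonneg (zero_le_one.trans (H.one_le i)) p
    have hq : 1 ≤ θ i ^ q := one_le_pow₀ (H.one_le i)
    have h2 := bound H hD (Nat.le_add_left q p) (hg i y)
    have h4 : |g i y| ≤ (|d| + D) * θ i ^ q := by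
      have h5 := abs_add_le (g i y - d) d
      rw [sub_add_cancel] at h5
      have h6 : D * e i * θ i ^ q ≤ D * θ i ^ q := by
        have := mul_le_mul_of_nonneg_left (H.le_one i) hD
        rw [mul_one] at this
        exact mul_le_mul_of_nonneg_right this (zero_le_one.trans hq)
      have h7 : |d| ≤ |d| * θ i ^ q := le_mul_of_one_le_right (abs_nonneg d) hq
      linarith [hg i y]
    have h3 := abs_add_le ((f i y - c) * g i y) (c * (g i y - d))
    rw [show (f i y - c) * g i y + c * (g i y - d) = f i y * g i y - c * d by ring, abs_mul,
      abs_mul] at h3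
    have h8 := mul_le_mul (hf i y) h4 (abs_nonneg _) (mul_nonneg (mul_nonneg hC h0) hp)
    have h9 := mul_le_mul_of_nonneg_left h2 (abs_nonneg c)
    rw [pow_add] at h9 ⊢
    linarith
  | succ r ih =>
    refine ⟨fun i => (hf.sm i).mul (hg.sm i), ih hf.of_succ hg.of_succ, fun A => ?_⟩
    have e1 : (fun i => BigCrunch.Z A fun y => f i y * g i y)
        = fun i y => BigCrunch.Z A (f i) y * g i y + f i y * BigCrunch.Z A (g i) y := by
      funext i y
      exact Z_mul A y ((hf.sm i).of_le (by omega)) ((hg.sm i).of_le (by omega))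
    rw [e1]
    exact (add H (ih (hf.Z A) hg.of_succ) (ih hf.of_succ (hg.Z A))).congr (by ring)

theorem const_mul (k : ℝ) (hf : Near e θ r f c) : Near e θ r (fun i y => k * f i y) (k * c) :=
  mul H (const H k) hf

theorem neg (hf : Near e θ r f c) : Near e θ r (fun i y => -f i y) (-c) := by
  simpa only [neg_one_mul] using const_mul H (-1) hf

theorem sub (hf : Near e θ r f c) (hg : Near e θ r g d) :
    Near e θ r (fun i y => f i y - g i y) (c - d) := by
  simpa only [sub_eq_add_neg] using add H hf (neg H hg)

theorem sum {κ : Type*} {s : Finset κ} {F : κ → ι → S3 → ℝ} {k : κ → ℝ}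
    (h : ∀ j ∈ s, Near e θ r (F j) (k j)) :
    Near e θ r (fun i y => ∑ j ∈ s, F j i y) (∑ j ∈ s, k j) := by
  classical
  induction s using Finset.induction_on with
  | empty => simpa using const H 0
  | insert j s hj ih =>
    simp only [Finset.sum_insert hj]
    exact add H (h j (Finset.mem_insert_self j s)) (ih fun i hi => h i (Finset.mem_insert_of_mem hi))

/-- Multiplication by a bounded constant that depends on the index. -/
theorem bdd_mul {w : ι → ℝ} (hw : ∀ i, |w i| ≤ 1) (hf : Near e θ 0 f 0) :
    Near e θ 0 (fun i y => w i * f i y) 0 := by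
  obtain ⟨sf, C, p, hC, hf⟩ := hf
  refine ⟨fun i => (Sm.const (w i)).mul (sf i), C, p, hC, fun i y => ?_⟩
  have h := hf i y
  rw [sub_zero] at h ⊢
  rw [abs_mul]
  exact (mul_le_of_le_one_left (abs_nonneg _) (hw i)).trans h

/-- Common constants for a finite family. -/
theorem uniform {κ : Type*} [Fintype κ] {F : κ → ι → S3 → ℝ} (h : ∀ j, Near e θ 0 (F j) 0) :
    ∃ C : ℝ, ∃ p : ℕ, 0 ≤ C ∧ ∀ j i y, |F j i y| ≤ C * e i * θ i ^ p := by
  choose _ C p hC hF using h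
  refine ⟨∑ j, C j, ∑ j, p j, Finset.sum_nonneg fun j _ => hC j, fun j i y => ?_⟩
  have h1 := bound H (hC j) (Finset.single_le_sum (f := p) (fun _ _ => Nat.zero_le _)
    (Finset.mem_univ j)) (hF j i y)
  have h2 : C j ≤ ∑ j, C j := Finset.single_le_sum (fun j _ => hC j) (Finset.mem_univ j)
  rw [sub_zero] at h1
  refine h1.trans ?_
  rw [mul_assoc, mul_assoc]
  exact mul_le_mul_of_nonneg_right h2 (mul_nonneg (H.nonneg i)
    (pow_nonneg (zero_le_one.trans (H.one_le i)) _))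

/-- Control of the Lie derivatives is control of the frame derivatives of the components. -/
theorem of_lieI {l m : ℕ} {ξ : ι → Tensor l m} (hs : ∀ i, TSm r (ξ i))
    (h : ∀ I : List (Fin 3), I.length ≤ r → ∀ i y a b, |lieI I (ξ i) y a b| ≤ e i * θ i)
    (a : Fin l → Fin 3) (b : Fin m → Fin 3) : Near e θ r (fun i y => ξ i y a b) 0 := by
  induction r generalizing ξ a b with
  | zero =>
    refine ⟨fun i => hs i a b, 1, 1, zero_le_one, fun i y => ?_⟩
    rw [sub_zero, one_mul, pow_one]
    exact h [] le_rfl i y a b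
  | succ r ih =>
    have h1 := fun a b => ih (fun i => (hs i).of_le (Nat.le_succ r))
      (fun I hI => h I (hI.trans (Nat.le_succ r))) a b
    refine ⟨fun i => hs i a b, h1 a b, fun A => ?_⟩
    have h2 := ih (ξ := fun i => lie A (ξ i)) (fun i => TSm.lieI (I := [A]) (hs i)) (fun I hI i y a b => by
      -- The last entry of the multi-index acts first, so derivatives of L_A ξ are the derivatives
      -- of ξ with A appended at the end.
      have := h (I ++ [A]) (by simpa using hI) i y a b
      rwa [lieI, List.foldr_append] at this) a b
    have e1 : (fun i => BigCrunch.Z A fun y => ξ i y a b) = fun i y => lie A (ξ i) y a b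
        - (∑ j, ∑ D, (2 / 3) * eps A D (a j) * ξ i y (Function.update a j D) b)
        + ∑ j, ∑ D, (2 / 3) * eps A (b j) D * ξ i y a (Function.update b j D) := by
      funext i y
      rw [lie]
      ring
    rw [e1]
    refine (add H (sub H h2 (sum H fun j _ => sum H fun D _ => const_mul H _ (h1 _ _)))
      (sum H fun j _ => sum H fun D _ => const_mul H _ (h1 _ _))).congr (by simp)

end Near

/-! ## The curvature of a metric close to the round one -/

theorem sum_one_mul (i : Fin 3) (f : Fin 3 → ℝ) :
    ∑ j, (1 : Matrix (Fin 3) (Fin 3) ℝ) i j * f j = f i := by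
  simp [Matrix.one_apply]

theorem sum_mul_one (i : Fin 3) (f : Fin 3 → ℝ) :
    ∑ j, f j * (1 : Matrix (Fin 3) (Fin 3) ℝ) i j = f i := by
  simp [Matrix.one_apply]

theorem eps_cycle (A B C : Fin 3) : eps B C A = eps A B C := by
  simp only [eps]
  ring

theorem eps_swap (A B C : Fin 3) : eps A C B = -eps A B C := by
  simp only [eps]
  ring

theorem sum_eps_mul_eps (i j k l : Fin 3) : ∑ m, eps i j m * eps k l m
    = (1 : Matrix (Fin 3) (Fin 3) ℝ) i k * (1 : Matrix (Fin 3) (Fin 3) ℝ) j l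
      - (1 : Matrix (Fin 3) (Fin 3) ℝ) i l * (1 : Matrix (Fin 3) (Fin 3) ℝ) j k := by
  fin_cases i <;> fin_cases j <;> fin_cases k <;> fin_cases l <;>
    norm_num [eps, Fin.sum_univ_three, Matrix.one_apply]

section curvature

variable {ι : Type*} {e θ : ι → ℝ} (H : Scales e θ) {G : ι → Metric3}
  (hG : ∀ i j, Near e θ 2 (fun k y => G k y i j) ((1 : Matrix (Fin 3) (Fin 3) ℝ) i j))
  (hGi : ∀ i j, Near e θ 2 (fun k y => (G k y)⁻¹ i j) ((1 : Matrix (Fin 3) (Fin 3) ℝ) i j))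
include H

theorem near_cov_01 {r : ℕ} {Γ : Fin 3 → Fin 3 → Fin 3 → ℝ}
    (hΓ : ∀ A D B, Near e θ r (fun k y => chr (G k) y A D B) (Γ A D B)) {ξ : ι → Tensor 0 1}
    {c : Fin 3 → ℝ} (hξ : ∀ j, Near e θ (r + 1) (fun k y => ξ k y ![] ![j]) (c j)) (i j : Fin 3) :
    Near e θ r (fun k y => cov (G k) (ξ k) y ![] ![i, j]) (-∑ D, Γ i D j * c D) := by
  have e1 : (fun k y => cov (G k) (ξ k) y ![] ![i, j])
      = fun k y => Z i (fun x => ξ k x ![] ![j]) y - ∑ D, chr (G k) y i D j * ξ k y ![] ![D] := by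
    funext k y
    rw [cov_cons, der_01]
    rfl
  rw [e1]
  exact (Near.sub H ((hξ j).Z i) (Near.sum H fun D _ =>
    Near.mul H (hΓ i D j) (hξ D).of_succ)).congr (zero_sub _)

theorem near_cov_02 {r : ℕ} {Γ : Fin 3 → Fin 3 → Fin 3 → ℝ}
    (hΓ : ∀ A D B, Near e θ r (fun k y => chr (G k) y A D B) (Γ A D B)) {ξ : ι → Tensor 0 2}
    {c : Fin 3 → Fin 3 → ℝ}
    (hξ : ∀ j l, Near e θ (r + 1) (fun k y => ξ k y ![] ![j, l]) (c j l)) (i j l : Fin 3) :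
    Near e θ r (fun k y => cov (G k) (ξ k) y ![] ![i, j, l])
      (-∑ D, Γ i D j * c D l - ∑ D, Γ i D l * c j D) := by
  have e1 : (fun k y => cov (G k) (ξ k) y ![] ![i, j, l])
      = fun k y => Z i (fun x => ξ k x ![] ![j, l]) y - ∑ D, chr (G k) y i D j * ξ k y ![] ![D, l]
        - ∑ D, chr (G k) y i D l * ξ k y ![] ![j, D] := by
    funext k y
    rw [cov_cons, der_02]
    rfl
  rw [e1]
  exact (Near.sub H (Near.sub H ((hξ j l).Z i) (Near.sum H fun D _ =>
    Near.mul H (hΓ i D j) (hξ D l).of_succ)) (Near.sum H fun D _ =>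
    Near.mul H (hΓ i D l) (hξ j D).of_succ)).congr (by ring)

include hG

/-- For the round metric all derivatives of the components vanish and the Koszul formula reduces to
half the bracket of the frame fields, as on a group with a bi-invariant metric. -/
theorem near_chrLow (A C B : Fin 3) :
    Near e θ 1 (fun k y => chrLow (G k) y A C B) (1 / 3 * eps A B C) := by
  refine (Near.add H (Near.const_mul H (1 / 2) (Near.sub H (Near.add H ((hG B C).Z A) ((hG A C).Z B))
    ((hG A B).Z C))) (Near.const_mul H (1 / 3) (Near.sum H fun D _ => Near.sub H (Near.sub H
    (Near.const_mul H (eps A B D) (hG C D).of_succ) (Near.const_mul H (eps B C D) (hG A D).of_succ))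
    (Near.const_mul H (eps A C D) (hG B D).of_succ)))).congr ?_
  simp only [Finset.sum_sub_distrib, sum_mul_one]
  rw [eps_swap A B C, eps_cycle A B C]
  ring

include hGi

theorem near_chr (A D B : Fin 3) :
    Near e θ 1 (fun k y => chr (G k) y A D B) (1 / 3 * eps A B D) := by
  refine (Near.sum H fun C _ => Near.mul H (hGi C D).of_succ (near_chrLow H hG A C B)).congr ?_
  simp [Matrix.one_apply]

/-- The limit is the curvature tensor of constant sectional curvature 1/9, for radius 3. It follows
from the constant connection coefficients through the contraction of two ε symbols. -/
theorem near_riem (i j k l : Fin 3) : Near e θ 0 (fun q y => riem (G q) y i j k l)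
    (1 / 9 * ((1 : Matrix (Fin 3) (Fin 3) ℝ) i k * (1 : Matrix (Fin 3) (Fin 3) ℝ) j l
      - (1 : Matrix (Fin 3) (Fin 3) ℝ) i l * (1 : Matrix (Fin 3) (Fin 3) ℝ) j k)) := by
  have hΓ := near_chr H hG hGi
  have h1 : ∀ m i j, Near e θ 1 (fun q y => cov (G q) (coframe m) y ![] ![i, j])
      (-(1 / 3 * eps i j m)) := by
    intro m i j
    have hc : ∀ j, Near e θ 2 (fun (_ : ι) y => coframe m y ![] ![j])
        ((1 : Matrix (Fin 3) (Fin 3) ℝ) m j) := by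
      intro j
      have e0 : (fun (_ : ι) y => coframe m y ![] ![j])
          = fun _ _ => (1 : Matrix (Fin 3) (Fin 3) ℝ) m j := by
        funext _ y
        simp [coframe, Matrix.one_apply, eq_comm]
      rw [e0]
      exact Near.const H _
    exact (near_cov_01 H hΓ hc i j).congr (by rw [sum_mul_one])
  have h2 := fun m i j k =>
    near_cov_02 H (fun A D B => (hΓ A D B).of_succ) (h1 m) i j k
  refine (Near.sum H fun m _ => Near.mul H (hG l m).of_succ.of_succ
    (Near.sub H (h2 m i j k) (h2 m j i k))).congr ?_
  rw [sum_one_mul]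
  have e1 : ∀ a b c d : Fin 3, ∑ D, 1 / 3 * eps a b D * -(1 / 3 * eps D c d)
      = -(1 / 9) * ∑ D, eps a b D * eps c d D := by
    intro a b c d
    rw [Finset.mul_sum]
    refine Finset.sum_congr rfl fun D _ => ?_
    rw [← eps_cycle D c d]
    ring
  have e2 : ∀ a b c d : Fin 3, ∑ D, 1 / 3 * eps a b D * -(1 / 3 * eps c D d)
      = 1 / 9 * ∑ D, eps a b D * eps c d D := by
    intro a b c d
    rw [Finset.mul_sum]
    refine Finset.sum_congr rfl fun D _ => ?_
    rw [eps_swap c d D]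
    ring
  simp only [e1, e2, sum_eps_mul_eps]
  have s1 : ∀ a b : Fin 3, (1 : Matrix (Fin 3) (Fin 3) ℝ) a b = (1 : Matrix (Fin 3) (Fin 3) ℝ) b a :=
    fun a b => by simp [Matrix.one_apply, eq_comm]
  rw [s1 j i, s1 k l, s1 k j, s1 k i]
  ring

/-- The value 2/9 is the one that cancels the term −(2/9) b of the equation for K, so that the
background drops out. -/
theorem near_ricSharp (i j : Fin 3) : Near e θ 0 (fun q y => ricSharp (G q) y ![i] ![j])
    (2 / 9 * (1 : Matrix (Fin 3) (Fin 3) ℝ) i j) := by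
  have hi := fun i j => (hGi i j).of_le (Nat.zero_le 2)
  refine (Near.sum H fun c _ => Near.mul H (hi i c) (Near.sum H fun a _ => Near.sum H fun b _ =>
    Near.mul H (hi a b) (near_riem H hG hGi c a j b))).congr ?_
  simp only [sum_one_mul, Matrix.one_apply_eq]
  have e1 : ∑ a, 1 / 9 * ((1 : Matrix (Fin 3) (Fin 3) ℝ) i j * 1
      - (1 : Matrix (Fin 3) (Fin 3) ℝ) i a * (1 : Matrix (Fin 3) (Fin 3) ℝ) a j)
      = 1 / 9 * (3 * (1 : Matrix (Fin 3) (Fin 3) ℝ) i j - (1 : Matrix (Fin 3) (Fin 3) ℝ) i j) := by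
    rw [← Finset.mul_sum, Finset.sum_sub_distrib, sum_one_mul]
    simp
  rw [e1]
  ring

end curvature

/-! ## Bounds for the low order variables -/

/-- The variables on a time slice on which the high norm is at most `e θ`. -/
structure SmallSlice where
  e : ℝ
  θ : ℝ
  b : ℝ
  X : Rescaled
  e_nonneg : 0 ≤ e
  e_le : e ≤ 1
  θ_le : 1 ≤ θ
  b_pos : 0 < b
  b_le : b ≤ 1
  α'_le : |X.α'| ≤ 1
  reg : X.Regular
  small : X.highNorm ≤ e * θ

namespace SmallSlice

/-- Small slices serve as the index set of the families in `Near`. The constants obtained in this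
way are uniform over all solutions, times and values of ε and σ. -/
theorem scales : Scales SmallSlice.e SmallSlice.θ := ⟨e_nonneg, e_le, θ_le⟩

theorem b4_le (q : SmallSlice) : |-q.b ^ 4| ≤ 1 := by
  rw [abs_neg, abs_of_pos (pow_pos q.b_pos 4)]
  exact pow_le_one₀ q.b_pos.le q.b_le

theorem b4_le' (q : SmallSlice) : |q.b ^ 4| ≤ 1 := by
  rw [← abs_neg]
  exact q.b4_le

theorem neg_α'_le (q : SmallSlice) : |-q.X.α'| ≤ 1 := by
  rw [abs_neg]
  exact q.α'_le

theorem α'_sq_le (q : SmallSlice) : |q.X.α' ^ 2| ≤ 1 := by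
  rw [abs_pow]
  exact pow_le_one₀ (abs_nonneg _) q.α'_le

theorem near_G (i j : Fin 3) : Near e θ 2 (fun q y => q.X.G y i j)
    ((1 : Matrix (Fin 3) (Fin 3) ℝ) i j) := by
  have h := Near.of_lieI scales (r := 2) (fun q => q.reg.lowT_sub.of_le (by norm_num))
    (fun I hI q y a b => (q.reg.abs_lowT_le (I := I) (by omega) y a b).trans q.small) ![] ![i, j]
  have h2 := (h.add scales (Near.const scales ((1 : Matrix (Fin 3) (Fin 3) ℝ) i j))).congr (zero_add _)
  have e1 : (fun (q : SmallSlice) y => q.X.G y i j)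
      = fun q y => (lowT q.X.G - lowT roundMet) y ![] ![i, j]
        + (1 : Matrix (Fin 3) (Fin 3) ℝ) i j := by
    funext q y
    exact (sub_add_cancel _ _).symm
  rw [e1]
  exact h2

theorem near_inv (i j : Fin 3) : Near e θ 2 (fun q y => (q.X.G y)⁻¹ i j)
    ((1 : Matrix (Fin 3) (Fin 3) ℝ) i j) := by
  have h := Near.of_lieI scales (r := 2) (fun q => q.reg.invT_sub.of_le (by norm_num))
    (fun I hI q y a b => (q.reg.abs_invT_le (I := I) (by omega) y a b).trans q.small) ![i, j] ![]
  have h2 := (h.add scales (Near.const scales ((1 : Matrix (Fin 3) (Fin 3) ℝ) i j))).congr (zero_add _)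
  have e1 : (fun (q : SmallSlice) y => (q.X.G y)⁻¹ i j)
      = fun q y => (invT q.X.G - invT roundMet) y ![i, j] ![]
        + (1 : Matrix (Fin 3) (Fin 3) ℝ) i j := by
    funext q y
    simp only [Pi.sub_apply, invT_roundMet]
    exact (sub_add_cancel _ _).symm
  rw [e1]
  exact h2

theorem near_N : Near e θ 2 (fun q => q.X.N) 0 :=
  Near.of_lieI scales (r := 2) (fun q => (TSm.ofScalar q.reg.N).of_le (by norm_num))
    (fun I hI q y a b => (q.reg.abs_N_le (I := I) (by omega) y a b).trans q.small) ![] ![]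

theorem near_Φ : Near e θ 0 (fun q => q.X.Φ) 0 :=
  Near.of_lieI scales (r := 0) (fun q => (TSm.ofScalar q.reg.Φ).of_le (by norm_num))
    (fun I hI q y a b => (q.reg.abs_Φ_le (I := I) (by omega) y a b).trans q.small) ![] ![]

theorem near_K (i j : Fin 3) : Near e θ 0 (fun q y => q.X.K y ![i] ![j]) 0 :=
  Near.of_lieI scales (r := 0) (fun q => q.reg.K.of_le (by norm_num))
    (fun I hI q y a b => (q.reg.abs_K_le (I := I) (by omega) y a b).trans q.small) ![i] ![j]

theorem near_Ψ (j : Fin 3) : Near e θ 1 (fun q y => q.X.Ψ y ![] ![j]) 0 :=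
  Near.of_lieI scales (r := 1) (fun q => q.reg.Ψ.of_le (by norm_num))
    (fun I hI q y a b => (q.reg.abs_Ψ_le (I := I) (by omega) y a b).trans q.small) ![] ![j]

theorem near_grad_N (j : Fin 3) : Near e θ 1 (fun q y => grad q.X.N y ![] ![j]) 0 := near_N.Z j

theorem near_inv₀ (i j : Fin 3) : Near e θ 0 (fun q y => (q.X.G y)⁻¹ i j)
    ((1 : Matrix (Fin 3) (Fin 3) ℝ) i j) := (near_inv i j).of_le (by norm_num)

theorem near_N₀ : Near e θ 0 (fun q => q.X.N) 0 := near_N.of_le (by norm_num)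

theorem near_chr₀ (A D B : Fin 3) :
    Near e θ 0 (fun q y => chr q.X.G y A D B) (1 / 3 * eps A B D) :=
  (near_chr scales near_G near_inv A D B).of_succ

theorem near_sharp2_hess (i j : Fin 3) :
    Near e θ 0 (fun q y => sharp2 q.X.G (hess q.X.G q.X.N) y ![i] ![j]) 0 :=
  (Near.sum scales fun c _ => (near_inv₀ i c).mul scales
    (near_cov_01 scales near_chr₀ (c := fun _ => 0) near_grad_N c j)).congr (by simp)

theorem near_div01 : Near e θ 0 (fun q => div01 q.X.G q.X.Ψ) 0 :=
  (Near.sum scales fun c _ => Near.sum scales fun d _ => (near_inv₀ c d).mul scales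
    (near_cov_01 scales near_chr₀ (c := fun _ => 0) near_Ψ c d)).congr (by simp)

/-- The right-hand side of the evolution equation of `K`, divided by the cube root of `α`. -/
def secRate (i j : Fin 3) (q : SmallSlice) (y : S3) : ℝ :=
  -q.X.α' * (q.X.N y * q.X.K y ![i] ![j]) + -q.b ^ 4 * sharp2 q.X.G (hess q.X.G q.X.N) y ![i] ![j]
    + (ricSharp q.X.G y ![i] ![j] - 2 / 9 * (1 : Matrix (Fin 3) (Fin 3) ℝ) i j)
    + q.b ^ 4 * (q.X.N y * ricSharp q.X.G y ![i] ![j])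
    - upMul (invT q.X.G) (tens q.X.Ψ q.X.Ψ) y ![i] ![j]
    + -q.b ^ 4 * upMul (invT q.X.G) (smulT (ofScalar q.X.N) (tens q.X.Ψ q.X.Ψ)) y ![i] ![j]
    + q.X.α' ^ 2 * (1 / 3 * (1 : Matrix (Fin 3) (Fin 3) ℝ) i j * q.X.N y)

/-- Every term contains a small factor, except the curvature, from which the round value has been
subtracted. Hence the rate is of first order in e. -/
theorem near_secRate (i j : Fin 3) : Near e θ 0 (secRate i j) 0 := by
  have hr := near_ricSharp scales near_G near_inv i j
  have hΨ := fun j => (near_Ψ j).of_succ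
  have h1 := ((near_N₀.mul scales (near_K i j)).congr (zero_mul 0)).bdd_mul scales neg_α'_le
  have h2 := (near_sharp2_hess i j).bdd_mul scales b4_le
  have h3 := (hr.sub scales (Near.const scales (2 / 9 * (1 : Matrix (Fin 3) (Fin 3) ℝ) i j))).congr
    (sub_self _)
  have h4 := ((near_N₀.mul scales hr).congr (zero_mul _)).bdd_mul scales b4_le'
  have h5 : Near e θ 0 (fun q y => upMul (invT q.X.G) (tens q.X.Ψ q.X.Ψ) y ![i] ![j]) 0 :=
    (Near.sum scales fun c _ => (near_inv₀ i c).mul scales ((hΨ c).mul scales (hΨ j))).congr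
      (by simp)
  have h6 : Near e θ 0 (fun q y =>
      upMul (invT q.X.G) (smulT (ofScalar q.X.N) (tens q.X.Ψ q.X.Ψ)) y ![i] ![j]) 0 :=
    (Near.sum scales fun c _ => (near_inv₀ i c).mul scales
      (near_N₀.mul scales ((hΨ c).mul scales (hΨ j)))).congr (by simp)
  have h7 := ((near_N₀.const_mul scales (1 / 3 * (1 : Matrix (Fin 3) (Fin 3) ℝ) i j)).congr
    (mul_zero _)).bdd_mul scales α'_sq_le
  exact (((((((h1.add scales h2).add scales h3).add scales h4).sub scales h5).add scales
    (h6.bdd_mul scales b4_le)).add scales h7)).congr (by ring)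

/-- The right-hand side of the evolution equation of `Φ`, divided by the cube root of `α`. -/
def timeRate (q : SmallSlice) (y : S3) : ℝ :=
  div01 q.X.G q.X.Ψ y + q.b ^ 4 * (q.X.N y * div01 q.X.G q.X.Ψ y)
    + -q.X.α' * (sqt * q.X.N y) + -q.X.α' * (q.X.N y * q.X.Φ y)
    + q.b ^ 4 * pairing (grad q.X.N) (upVec (invT q.X.G) q.X.Ψ) y ![] ![]

theorem near_timeRate : Near e θ 0 timeRate 0 := by
  have h1 := near_div01
  have h2 := ((near_N₀.mul scales h1).congr (zero_mul _)).bdd_mul scales b4_le'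
  have h3 := ((near_N₀.const_mul scales sqt).congr (mul_zero _)).bdd_mul scales neg_α'_le
  have h4 := ((near_N₀.mul scales near_Φ).congr (zero_mul _)).bdd_mul scales neg_α'_le
  have h5 : Near e θ 0 (fun q y =>
      pairing (grad q.X.N) (upVec (invT q.X.G) q.X.Ψ) y ![] ![]) 0 :=
    (Near.sum scales fun c _ => (near_grad_N c).of_succ.mul scales
      (Near.sum scales fun d _ => (near_inv₀ c d).mul scales (near_Ψ d).of_succ)).congr (by simp)
  exact ((((h1.add scales h2).add scales h3).add scales h4).add scales
    (h5.bdd_mul scales b4_le')).congr (by ring)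

theorem near_grad_sq : Near e θ 0 (fun q y =>
    ipm (q.X.G y) (q.X.G y)⁻¹ (grad q.X.N y) (grad q.X.N y)) 0 := by
  have e1 : (fun (q : SmallSlice) y => ipm (q.X.G y) (q.X.G y)⁻¹ (grad q.X.N y) (grad q.X.N y))
      = fun q y => ∑ c, ∑ d, (q.X.G y)⁻¹ c d * (grad q.X.N y ![] ![c] * grad q.X.N y ![] ![d]) := by
    funext q y
    rw [ipm_01]
    simp only [mul_assoc]
  rw [e1]
  exact (Near.sum scales fun c _ => Near.sum scales fun d _ => (near_inv₀ c d).mul scales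
    ((near_grad_N c).of_succ.mul scales (near_grad_N d).of_succ)).congr (by simp)

end SmallSlice

theorem SliceEqs.sec_rate {X : Rescaled} {b : ℝ} {Kt : Tensor 1 1} {Φt : S3 → ℝ} {Ψt : Tensor 0 1}
    (E : SliceEqs b X Kt Φt Ψt) {q : SmallSlice} (hb : q.b = b) (hX : q.X = X) (y : S3)
    (i j : Fin 3) : Kt y ![i] ![j] = b * q.secRate i j y := by
  have h := congrFun (congrFun (congrFun E.sec_eq y) ![i]) ![j]
  have hid : idTen y ![i] ![j] = (1 : Matrix (Fin 3) (Fin 3) ℝ) i j := rfl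
  simp only [Pi.add_apply, Pi.smul_apply, smul_eq_mul, smulT, ofScalar, hid] at h
  rw [h]
  simp only [SmallSlice.secRate, hb, hX, smulT, ofScalar]
  ring

theorem SliceEqs.time_rate {X : Rescaled} {b : ℝ} {Kt : Tensor 1 1} {Φt : S3 → ℝ} {Ψt : Tensor 0 1}
    (E : SliceEqs b X Kt Φt Ψt) {q : SmallSlice} (hb : q.b = b) (hX : q.X = X) (y : S3) :
    Φt y = b * q.timeRate y := by
  have h := congrFun (congrFun (congrFun E.time_eq y) ![]) ![]
  simp only [Pi.add_apply, Pi.smul_apply, smul_eq_mul, smulT, ofScalar] at h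
  rw [h]
  simp only [SmallSlice.timeRate, hb, hX]
  ring

theorem Ck.abs_le_of_dt {f : ℝ → S3 → ℝ} {T : ℝ} (hf : Ck 1 T f) {y : S3} {C₀ C : ℝ}
    (h0 : |f 0 y| ≤ C₀) (hd : ∀ t ∈ Set.Ioo 0 T, |BigCrunch.dt f t y| ≤ C) {t : ℝ} (ht : t ∈ Set.Ico 0 T) :
    |f t y| ≤ C₀ + C * t := by
  have hc : ContinuousOn (fun s => f s y) (Set.Icc 0 t) :=
    hf.continuousOn.comp (f := fun s : ℝ => (s, y)) (by fun_prop) fun s hs =>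
      ⟨⟨hs.1, hs.2.trans_lt ht.2⟩, Set.mem_univ _⟩
  have hder : ∀ s ∈ interior (Set.Icc 0 t), HasDerivAt (fun s => f s y) (BigCrunch.dt f s y) s := by
    intro s hs
    rw [interior_Icc] at hs
    exact hf.hasDerivAt (r := 0) ⟨hs.1, hs.2.trans ht.2⟩ y
  have hb : ∀ s ∈ interior (Set.Icc 0 t), |BigCrunch.dt f s y| ≤ C := by
    intro s hs
    rw [interior_Icc] at hs
    exact hd s ⟨hs.1, hs.2.trans ht.2⟩
  have h1 := (convex_Icc 0 t).image_sub_le_mul_sub_of_deriv_le hc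
    (fun s hs => (hder s hs).differentiableAt.differentiableWithinAt)
    (fun s hs => (hder s hs).deriv.le.trans (le_of_abs_le (hb s hs))) 0
    (Set.left_mem_Icc.2 ht.1) t (Set.right_mem_Icc.2 ht.1) ht.1
  have h2 := (convex_Icc 0 t).image_sub_le_mul_sub_of_deriv_le hc.neg
    (fun s hs => (hder s hs).neg.differentiableAt.differentiableWithinAt)
    (fun s hs => (hder s hs).neg.deriv.le.trans ((neg_le_abs _).trans (hb s hs))) 0
    (Set.left_mem_Icc.2 ht.1) t (Set.right_mem_Icc.2 ht.1) ht.1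
  simp only [Pi.neg_apply] at h2
  rw [abs_le] at h0 ⊢
  constructor <;> linarith

/-- In the bootstrap regime, the low order variables are small. -/
theorem exists_lowBounds {a : ℝ → ℝ} {Tc : ℝ} (ha : IsScaleFactor a Tc) :
    ∃ C₁ : ℝ, 0 ≤ C₁ ∧ ∃ ε₀ : ℝ, 0 < ε₀ ∧ ∃ σ₀ : ℝ, 0 < σ₀ ∧
      ∀ (ε σ T : ℝ), 0 < ε → ε ≤ ε₀ → 0 ≤ σ → σ ≤ σ₀ → 0 < T → T ≤ Tc →
      ∀ S : Fields, IsSolution a T S → (rescale a S 0).highNorm ≤ ε ^ 2 →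
        (∀ t ∈ Set.Ico 0 T, (rescale a S t).highNorm ≤ ε * a t ^ (-σ)) →
      ∀ t ∈ Set.Ioo 0 T, ∀ y, (rescale a S t).LowBounds (a t ^ (1 / 3 : ℝ)) C₁ ε y := by
  have Hs := SmallSlice.scales
  obtain ⟨CK, p₁, hCK, hK⟩ := Near.uniform Hs fun ij : Fin 3 × Fin 3 =>
    SmallSlice.near_secRate ij.1 ij.2
  obtain ⟨CΦ, p₂, hCΦ, hΦ⟩ := Near.uniform Hs fun _ : Unit => SmallSlice.near_timeRate
  obtain ⟨CN, p₃, hCN, hN⟩ := Near.uniform Hs fun _ : Unit => SmallSlice.near_N₀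
  obtain ⟨CQ, p₄, hCQ, hQ⟩ := Near.uniform Hs fun _ : Unit => SmallSlice.near_grad_sq
  set B : ℝ := 1 + (CK + CΦ) * Tc with hB
  have hTc := ha.crunch_pos
  have hB1 : 1 ≤ B := by
    have : 0 ≤ (CK + CΦ) * Tc := by positivity
    linarith
  -- The factor 3 is the square root of the nine entries of K. The choice of ε₀ ensures at once ε ≤
  -- 1, ε·CN ≤ 1, ε·CQ ≤ 1 and 18Bε ≤ 1. The choice of σ₀ ensures 1/3 − pσ ≥ 0 for every exponent p
  -- that occurs.
  refine ⟨3 * B, by linarith, 1 / (1 + CN + CQ + 18 * B), by positivity,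
    1 / (3 * ((p₁ + p₂ + p₃ + p₄ : ℕ) + 1)), by positivity, ?_⟩
  intro ε σ T hε hε₀ hσ hσ₀ hT0 hT S hS h0 hboot
  have R := slabReg_rescale ha hT hS
  rw [le_div_iff₀ (by positivity)] at hε₀ hσ₀
  have eN : 0 ≤ ε * CN := by positivity
  have eQ : 0 ≤ ε * CQ := by positivity
  have eB : ε ≤ ε * B := le_mul_of_one_le_right hε.le hB1
  have hε1 : ε ≤ 1 := by linarith
  have mem0 : (0 : ℝ) ∈ Set.Ico 0 T := ⟨le_rfl, hT0⟩
  have key : ∀ t ∈ Set.Ioo 0 T, ∃ q : SmallSlice, q.e = ε ∧ q.b = a t ^ (1 / 3 : ℝ)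
      ∧ q.X = rescale a S t ∧ ∀ p ≤ p₁ + p₂ + p₃ + p₄, q.b * q.θ ^ p ≤ 1 := by
    intro t ht
    have ht' : t ∈ Set.Ico 0 T := ⟨ht.1.le, ht.2⟩
    have E := sliceEqs ha hT hS ht
    have hpos := ha.pos t (ha.mem hT ht')
    have hle := ha.le_one ⟨ht'.1, ht'.2.trans_le hT⟩
    -- With e = ε and θ = a^{-σ} the bootstrap hypothesis is exactly the smallness required of the
    -- slice.
    refine ⟨⟨ε, a t ^ (-σ), a t ^ (1 / 3 : ℝ), rescale a S t, hε.le, hε1,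
      Real.one_le_rpow_of_pos_of_le_one_of_nonpos hpos hle (by linarith), E.b_pos, E.b_le, ?_,
      R.regular ht', hboot t ht'⟩, rfl, rfl, rfl, fun p hp => ?_⟩
    · rw [← sq_le_one_iff_abs_le_one, E.friedmann]
      have := pow_pos E.b_pos 4
      linarith
    · simp only
      rw [← Real.rpow_natCast, ← Real.rpow_mul hpos.le, ← Real.rpow_add hpos]
      refine Real.rpow_le_one hpos.le hle ?_
      have hp' : (p : ℝ) ≤ (p₁ + p₂ + p₃ + p₄ : ℕ) := by exact_mod_cast hp
      have := mul_le_mul_of_nonneg_left hp' hσ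
      linarith
  -- One factor b absorbs the whole power of θ. This is where the loss a^{-σ} is removed.
  have gain : ∀ {t : ℝ}, t ∈ Set.Ioo 0 T → ∀ {C : ℝ} {p : ℕ} {F : SmallSlice → S3 → ℝ}, 0 ≤ C →
      p ≤ p₁ + p₂ + p₃ + p₄ → (∀ q y, |F q y| ≤ C * q.e * q.θ ^ p) →
      ∀ q : SmallSlice, q.e = ε → (∀ p ≤ p₁ + p₂ + p₃ + p₄, q.b * q.θ ^ p ≤ 1) →
      ∀ y, q.b * |F q y| ≤ C * ε := by
    intro t ht C p F hC hp hF q he hq y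
    have h1 := mul_le_mul_of_nonneg_left (hF q y) q.b_pos.le
    have h2 := mul_le_mul_of_nonneg_left (hq p hp) (mul_nonneg hC hε.le)
    rw [he] at h1
    linarith
  -- Integration in time: data of size ε² ≤ ε plus a rate of size (CK + CΦ) ε over a time at most Tc
  -- give Bε.
  have bound : ∀ {f : ℝ → S3 → ℝ} {C : ℝ}, Ck 1 T f → ∀ y, |f 0 y| ≤ (rescale a S 0).highNorm →
      0 ≤ C → C ≤ CK + CΦ → (∀ t ∈ Set.Ioo 0 T, |dt f t y| ≤ C * ε) →
      ∀ t ∈ Set.Ico 0 T, |f t y| ≤ B * ε := by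
    intro f C hf y hf0 hC0 hC hd t ht
    have h1 := hf.abs_le_of_dt (hf0.trans h0) hd ht
    have h2 : C * ε * t ≤ (CK + CΦ) * ε * Tc :=
      mul_le_mul (mul_le_mul_of_nonneg_right hC hε.le) (ht.2.le.trans hT) ht.1 (by positivity)
    have h3 : ε ^ 2 ≤ ε := by nlinarith
    rw [hB]
    linarith
  have bK : ∀ t ∈ Set.Ico 0 T, ∀ y i j, |(rescale a S t).K y ![i] ![j]| ≤ B * ε := by
    intro t ht y i j
    refine bound (f := fun s x => (rescale a S s).K x ![i] ![j]) ((R.K _ _).of_le (by norm_num)) y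
      ((R.regular mem0).abs_K_le (I := []) (by simp) y _ _) hCK (by linarith) (fun s hs => ?_) t ht
    obtain ⟨q, he, hb, hX, hq⟩ := key s hs
    have e1 := (sliceEqs ha hT hS hs).sec_rate hb hX y i j
    have e2 : dt (fun s x => (rescale a S s).K x ![i] ![j]) s y
        = dtT (fun s => (rescale a S s).K) s y ![i] ![j] := rfl
    rw [e2, e1, ← hb, abs_mul, abs_of_pos q.b_pos]
    exact gain hs hCK (by omega) (hK (i, j)) q he hq y
  have bΦ : ∀ t ∈ Set.Ico 0 T, ∀ y, |(rescale a S t).Φ y| ≤ B * ε := by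
    intro t ht y
    refine bound (f := fun s => (rescale a S s).Φ) (R.Φ.of_le (by norm_num)) y
      ((R.regular mem0).abs_Φ_le (I := []) (by simp) y ![] ![]) hCΦ (by linarith)
      (fun s hs => ?_) t ht
    obtain ⟨q, he, hb, hX, hq⟩ := key s hs
    rw [(sliceEqs ha hT hS hs).time_rate hb hX y, ← hb, abs_mul, abs_of_pos q.b_pos]
    exact gain hs hCΦ (by omega) (hΦ ()) q he hq y
  intro t ht y
  have ht' : t ∈ Set.Ico 0 T := ⟨ht.1.le, ht.2⟩
  have E := sliceEqs ha hT hS ht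
  obtain ⟨q, he, hb, hX, hq⟩ := key t ht
  have hKn : normSq (rescale a S t).G (rescale a S t).K y
      = ∑ i, ∑ j, (rescale a S t).K y ![i] ![j] * (rescale a S t).K y ![j] ![i] :=
    ipm_self_of_symm (E.met.mul_inv y) (E.met.inv_symm y) (E.symm y)
  have hK9 : normSq (rescale a S t).G (rescale a S t).K y ≤ (3 * B * ε) ^ 2 := by
    rw [hKn]
    have h1 : ∀ i j, (rescale a S t).K y ![i] ![j] * (rescale a S t).K y ![j] ![i] ≤ (B * ε) ^ 2 := by
      intro i j
      refine (le_abs_self _).trans ?_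
      rw [abs_mul, sq]
      exact mul_le_mul (bK t ht' y i j) (bK t ht' y j i) (abs_nonneg _) (by positivity)
    refine (Finset.sum_le_sum fun i _ => Finset.sum_le_sum fun j _ => h1 i j).trans (le_of_eq ?_)
    simp only [Finset.sum_const, Finset.card_univ, Fintype.card_fin, nsmul_eq_mul]
    push_cast
    ring
  -- With Bε ≤ 1/18 the three parts of q are at most 9/324, 2/18 and 1/324, whose sum stays below
  -- 1/3.
  have hbε : 18 * (B * ε) ≤ 1 := by linarith
  have hb2 : a t ^ (1 / 3 : ℝ) * a t ^ (1 / 3 : ℝ) ≤ a t ^ (1 / 3 : ℝ) :=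
    mul_le_of_le_one_left E.b_pos.le E.b_le
  refine ⟨?_, ?_, ?_, hK9⟩
  · have h1 := gain ht hCN (by omega) (hN ()) q he hq y
    rw [hb, hX] at h1
    have h2 := mul_le_mul_of_nonneg_right hb2 (abs_nonneg ((rescale a S t).N y))
    rw [sq]
    linarith
  · have h1 := gain ht hCQ (by omega) (hQ ()) q he hq y
    rw [hb, hX] at h1
    have e1 : ipm ((rescale a S t).G y) ((rescale a S t).G y)⁻¹
        ((a t ^ (1 / 3 : ℝ)) ^ 4 • grad (rescale a S t).N y)
        ((a t ^ (1 / 3 : ℝ)) ^ 4 • grad (rescale a S t).N y)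
        = (a t ^ (1 / 3 : ℝ)) ^ 8 * ipm ((rescale a S t).G y) ((rescale a S t).G y)⁻¹
          (grad (rescale a S t).N y) (grad (rescale a S t).N y) := by
      rw [ipm_01, ipm_01]
      simp only [Pi.smul_apply, smul_eq_mul, Finset.mul_sum]
      exact Finset.sum_congr rfl fun c _ => Finset.sum_congr rfl fun d _ => by ring
    rw [e1]
    set b := a t ^ (1 / 3 : ℝ)
    set Q := ipm ((rescale a S t).G y) ((rescale a S t).G y)⁻¹ (grad (rescale a S t).N y)
      (grad (rescale a S t).N y)
    have h2 : b * Q ≤ 1 :=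
      (mul_le_mul_of_nonneg_left (le_abs_self Q) E.b_pos.le).trans (by linarith)
    have h3 : b ^ 7 * (b * Q) ≤ b ^ 7 := mul_le_of_le_one_right (pow_nonneg E.b_pos.le 7) h2
    have h4 : b ^ 7 ≤ b ^ 2 := pow_le_pow_of_le_one E.b_pos.le E.b_le (by norm_num)
    linarith
  · have hΦt := bΦ t ht' y
    have n0 : 0 ≤ normSq (rescale a S t).G (rescale a S t).K y := normSq_nonneg E.met _ y
    have hs1 : sqt ≤ 1 := by
      exact Real.sqrt_le_iff.2 ⟨by norm_num, by norm_num⟩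
    set x := normSq (rescale a S t).G (rescale a S t).K y
    set φ := (rescale a S t).Φ y
    have h18 : B * ε ≤ 1 / 18 := by linarith
    have hBε : 0 ≤ B * ε := by positivity
    have h1 : (B * ε) ^ 2 ≤ 1 / 18 * (1 / 18) := by
      rw [sq]
      exact mul_le_mul h18 h18 hBε (by norm_num)
    have h2 : |sqt * φ| ≤ 1 / 18 := by
      rw [abs_mul, abs_of_nonneg sqt_nonneg]
      exact (mul_le_of_le_one_left (abs_nonneg _) hs1).trans (hΦt.trans h18)
    have h3 : φ ^ 2 ≤ (B * ε) ^ 2 := by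
      rw [← sq_abs φ]
      exact pow_le_pow_left₀ (abs_nonneg _) hΦt 2
    have h4 := sq_nonneg φ
    rw [abs_le] at h2 ⊢
    constructor <;> linarith

end BigCrunch
end

/-! ### The theorem: choice of the constants -/

theorem proposition16p1 (a : ℝ → ℝ) (Tc : ℝ) (ha : BigCrunch.IsScaleFactor a Tc)
    (M : ℕ) (hM : 1 ≤ M) (hM' : M ≤ 16) (δ : ℝ) (hδ : 0 < δ) :
    ∃ κ : ℝ, 0 < κ ∧ κ ≤ δ ∧ ∃ C : ℝ, 0 < C ∧ ∃ ε₀ : ℝ, 0 < ε₀ ∧ ∃ σ₀ : ℝ, 0 < σ₀ ∧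
      ∀ (ε σ Tboot : ℝ), 0 < ε → ε ≤ ε₀ → Real.sqrt ε ≤ σ → σ ≤ σ₀ → σ < 1 →
        0 < Tboot → Tboot ≤ Tc →
      ∀ S : BigCrunch.Fields, BigCrunch.IsSolution a Tboot S →
        (BigCrunch.rescale a S 0).highNorm ≤ ε ^ 2 →
        (∀ t ∈ Set.Ico 0 Tboot, (BigCrunch.rescale a S t).highNorm ≤ ε * a t ^ (-σ)) →
      ∀ t ∈ Set.Ico 0 Tboot,
        (BigCrunch.rescale a S t).totalEnergy M κ
          + (∑ I ∈ BigCrunch.multiIdx 1 M, ∫ s in 0..t,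
              |deriv a s| * a s ^ (1 / 3 : ℝ)
                * BigCrunch.l2Sq (BigCrunch.rescale a S s).G
                    (BigCrunch.cov (BigCrunch.rescale a S s).G
                      (BigCrunch.lieI I (BigCrunch.lowT (BigCrunch.rescale a S s).G))))
          + (∑ I ∈ BigCrunch.multiIdx 1 M, ∫ s in 0..t,
              |deriv a s| * a s ^ (1 / 3 : ℝ)
                * BigCrunch.l2Sq (BigCrunch.rescale a S s).G
                    (BigCrunch.lieI I (BigCrunch.rescale a S s).Ψ))
          + (∑ I ∈ BigCrunch.multiIdx 1 M, ∫ s in 0..t,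
              |deriv a s| * a s ^ 3
                * BigCrunch.l2Sq (BigCrunch.rescale a S s).G
                    (BigCrunch.grad (BigCrunch.ZI I (BigCrunch.rescale a S s).N)))
          + (∑ I ∈ BigCrunch.multiIdx 1 M, ∫ s in 0..t,
              |deriv a s| ^ 3 * a s ^ (5 / 3 : ℝ)
                * BigCrunch.l2Sq (BigCrunch.rescale a S s).G
                    (BigCrunch.ofScalar (BigCrunch.ZI I (BigCrunch.rescale a S s).N)))
        ≤ C * (BigCrunch.rescale a S 0).totalEnergy M κ
          + C * ε * (∫ s in 0..t, (a s)⁻¹ * (BigCrunch.rescale a S s).totalEnergy M κ)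
          + C * (∫ s in 0..t, a s ^ (-1 / 3 : ℝ) * (BigCrunch.rescale a S s).totalEnergy M κ)
          + C * (∑ I ∈ BigCrunch.multiIdx 1 M, ∫ s in 0..t,
              (BigCrunch.rescale a S s).energyBorder ε I)
          + C * (∑ I ∈ BigCrunch.multiIdx 1 M, ∫ s in 0..t,
              (BigCrunch.rescale a S s).energyJunk I) := by
  obtain ⟨C₁, hC₁, ε₀, hε₀, σ₀, hσ₀, L⟩ := BigCrunch.exists_lowBounds ha
  -- The number 12000 is what `combine_densities` asks for: twelve times the constant 1000 with
  -- which the metric part spills into the scalar dissipation.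
  have hκ : 0 < min δ (1 / 12000) := lt_min hδ (by norm_num)
  have hκ1 : min δ (1 / 12000) * 12000 ≤ 1 := by
    have := min_le_right δ (1 / 12000)
    linarith
  refine ⟨min δ (1 / 12000), hκ, min_le_left _ _, 6 / min δ (1 / 12000) * (8000 + 16 * C₁),
    by positivity, ε₀, hε₀, σ₀, hσ₀, ?_⟩
  intro ε σ T hε hε₁ hσ hσ₁ _ hT0 hT S hS h0 hboot t ht
  exact BigCrunch.energy_le ha hT hS hM' hκ hκ1 hε hC₁
    (L ε σ T hε hε₁ ((Real.sqrt_nonneg ε).trans hσ) hσ₁ hT0 hT S hS h0 hboot) ht
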